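/- **Setting.** Let $f\in C^\infty(\mathbb R)$ with $f(s)=O(s^k)$ on $[0,1]$, $k\ge 2$ an integer, and let $\Omega\subset(-\frac13,\frac13)$ be an open interval such that for each $\omega\in\Omega$ the nonlinear Dirac equation $i\partial_t\psi=D_m\psi-f(\psi^*\beta\psi)\beta\psi$, $D_m=\begin{bmatrix}1&\partial_x\\-\partial_x&-1\end{bmatrix}$, $\beta=\sigma_3$, has a solitary wave $\phi_\omega(x)e^{-i\omega t}$ with $\phi_\omega=(v,u)\in H^1(\mathbb R,\mathbb R^2)$, $v$ even, $u$ odd, and such that $\omega\mapsto\phi_\omega\in H^1$ is $C^2$. With $$\mathbf J=\begin{bmatrix}0&I_2\\-I_2&0\end{bmatrix},\quad \boldsymbol\alpha=\begin{bmatrix}0&\mathrm{Im}\,\sigma_2\\-\mathrm{Im}\,\sigma_2&0\end{bmatrix},\quad \boldsymbol\beta=\begin{bmatrix}\sigma_3&0\\0&\sigma_3\end{bmatrix},\quad \mathbf W=\begin{bmatrix}W_1&0\\0&W_0\end{bmatrix},$$ $W_0=-f(v^2-u^2)\sigma_3$, $W_1=W_0-2f'(v^2-u^2)\begin{bmatrix}v^2&-vu\\-vu&u^2\end{bmatrix}$,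 the linearization at the solitary wave is $\mathbf J\mathbf L(\omega)$, $\mathbf L=\mathbf J\boldsymbol\alpha\partial_x+\boldsymbol\beta-\omega+\mathbf W$, on $L^2(\mathbb R,\mathbb C^4)$ with domain $H^1$; and $\mathbf J\mathbf L-\lambda=-\boldsymbol\alpha(\partial_x-\mathcal M(x,\lambda,\omega))$ with $\mathcal M=\boldsymbol\alpha\mathbf J\boldsymbol\beta-\omega\boldsymbol\alpha\mathbf J-\lambda\boldsymbol\alpha+\boldsymbol\alpha\mathbf J\mathbf W$. **Jost solutions.** For $\lambda=i\Lambda$, $\Lambda\in\mathbb R$, and a choice of side $\lambda\pm0$, let $\xi_1,\xi_2$ be the boundary values at $\lambda\pm 0$ of the roots of $\xi_1^2=(\omega-i\lambda)^2-1$, $\xi_2^2=(\omega+i\lambda)^2-1$ with $\mathrm{Im}\,\xi_j>0$, and let $\Xi_j$ be the unit vector proportional, with a positive factor, to $(i\xi_1,z-1,-\xi_1,i(z-1))$, $z=\omega-i\lambda$, for $j=1$, and to $(i\xi_2,z-1,\xi_2,-i(z-1))$, $z=\omega+i\lambda$, for $j=2$ (for $z=1$: the limit from $\xi_j>0$). The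 Jost solution $\mathbf f_j$ is the solution of $(\mathbf J\mathbf L-\lambda)\mathbf f_j=0$ with $|e^{-i\xi_jx}\mathbf f_j(x)-\Xi_j|\le c\,e^{-2k\sqrt{1-\omega^2}\,x}$ for $x\ge0$, and $\mathbf g_j(x)=\boldsymbol\beta\mathbf f_j(-x)$. The Evans function is $E(\lambda,\omega)=\det[\mathbf f_1,\mathbf f_2,\mathbf g_1,\mathbf g_2]$, formed at $\lambda-0$. Write $\langle x\rangle=(1+x^2)^{1/2}$ and $\|h\|_{L^2_s}=\|\langle\cdot\rangle^sh\|_{L^2}$. For $\lambda\in i\mathbb R$, $(\mathbf J\mathbf L-(\lambda\pm0))^{-1}$ on $L^2_s$ denotes the strong limit, with values in $L^2_{-s}$, of the $L^2$ resolvents $(\mathbf J\mathbf L-(\lambda\pm\varepsilon))^{-1}$ as $\varepsilon\to0+$. **Claim.** For all $\omega\in\Omega$, $\lambda\in i\mathbb R$, both sides and $j=1,2$, the Jost solution $\mathbf f_j$ exists and is unique. Moreover: 1. Let $\omega\in\Omega$, $\lambda\in i\mathbb R$, $|\lambda|\ge1-|\omega|$, $E(\lambda,\omega)\ne0$. There are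 kernels $G^\pm(x,y,\lambda,\omega)\in\mathbb C^{4\times4}$ such that, with the Jost solutions at $\lambda\pm0$ and every invertible $\Gamma\in\mathbb C^{2\times2}$, for $x\ne y$ $$G^\pm(x,y)=\sum_{j,k}\big[\Theta(x-y)\,\mathbf f_j(x)\Gamma_{jk}\mathbf g_k(y)^*+\Theta(y-x)\,\mathbf g_j(x)\Gamma_{jk}\mathbf f_k(y)^*\big]\Delta(y)^{-1}(-\boldsymbol\alpha),$$ where $\Theta$ is the Heaviside function and $\Delta(y)=\sum_{j,k}[\mathbf f_j(y)\Gamma_{jk}\mathbf g_k(y)^*-\mathbf g_j(y)\Gamma_{jk}\mathbf f_k(y)^*]$. They satisfy $-\boldsymbol\alpha(\partial_x-\mathcal M(x,\lambda,\omega))G^\pm(x,y,\lambda,\omega)=\delta(x-y)I_4$; for every $s>3$, the points $\lambda\pm\varepsilon$ with small $\varepsilon>0$ are in the resolvent set of $\mathbf J\mathbf L$ and $(\mathbf J\mathbf L-(\lambda\pm0))^{-1}:L^2_s\to L^2_{-s}$ exists and is the integral operator with kernel $G^\pm$; and $$|G^\pm(x,y,\lambda,\omega)|\le C(\lambda,\omega)\min(\langle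 x\rangle,\langle y\rangle)\langle y\rangle,\qquad x,y\in\mathbb R,$$ where $C(\lambda,\omega)<\infty$ is locally bounded on the set of the $(\lambda,\omega)$ considered here. 2. For each $\omega\in\Omega$ there are $C(\omega),\Lambda_0(\omega)<\infty$ such that for $\Lambda\in\mathbb{R}$, $|\Lambda|\ge\Lambda_0(\omega)$, one has $|\Lambda|\ge1-|\omega|$, $E(i\Lambda,\omega)\ne0$ and $|G^\pm(x,y,i\Lambda,\omega)|\le C(\omega)$ for all $x,y\in\mathbb R$. 3. For all $\omega\in\Omega$, $s>3$ and $K>0$ such that $E(\lambda,\omega)\neq0$ for all $\lambda\in i\mathbb R$ with $1-|\omega|\le|\lambda|\le K$, there is $C_{s,K,\omega}<\infty$ with $\|(\mathbf J\mathbf L(\omega)-(\lambda\pm0))^{-1}\|_{L^2_s\to L^2_{-s}}\le C_{s,K,\omega}$ for all these $\lambda$. 4. For each $\omega\in\Omega$ there are $C_\omega,\Lambda_0<\infty$ such that for $\lambda\in i\mathbb R$, $|\lambda|\ge\Lambda_0$, $(\mathbf J\mathbf L(\omega)-(\lambda\pm0))^{-1}:L^2_1\to L^2_{-1}$ exists,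 is the integral operator with kernel $G^\pm$, and has norm at most $C_\omega$. -/

import Mathlib

open Set Filter Topology MeasureTheory Matrix
open scoped ENNReal NNReal

namespace GN

noncomputable section

/-! ### The family of solitary waves -/

/-- `φ_ω = (v ω, u ω)`, `ω ∈ Ω`, is a family of solitary wave profiles of the nonlinear Dirac
equation `i ∂_t ψ = D_m ψ - f(ψ^* β ψ) β ψ`, `D_m = [[1, ∂_x], [-∂_x, -1]]`: each `φ_ω` is
real-valued, lies in `H¹`, has an even first and an odd second component, solves
`ω φ = D_m φ - f(φ^* β φ) β φ`, and `ω ↦ φ_ω` is `C²` as a map into `H¹`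
(realised as the closed subspace of the pairs `(φ, φ')` in `L² × L²`). -/
structure IsSolitaryFamily (f : ℝ → ℝ) (Ω : Set ℝ) (v u : ℝ → ℝ → ℝ) : Prop where
  differentiable_v : ∀ ω ∈ Ω, Differentiable ℝ (v ω)
  differentiable_u : ∀ ω ∈ Ω, Differentiable ℝ (u ω)
  even_v : ∀ ω ∈ Ω, ∀ x, v ω (-x) = v ω x
  odd_u : ∀ ω ∈ Ω, ∀ x, u ω (-x) = -u ω x
  eqn_fst : ∀ ω ∈ Ω, ∀ x,
    ω * v ω x = v ω x + deriv (u ω) x - f (v ω x ^ 2 - u ω x ^ 2) * v ω x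
  eqn_snd : ∀ ω ∈ Ω, ∀ x,
    ω * u ω x = -deriv (v ω) x - u ω x + f (v ω x ^ 2 - u ω x ^ 2) * u ω x
  contDiff_H1 : ∃ Φ : ℝ → Fin 4 → Lp ℝ 2 (volume : Measure ℝ), ContDiffOn ℝ 2 Φ Ω ∧
    ∀ ω ∈ Ω, Φ ω 0 =ᵐ[volume] v ω ∧ Φ ω 1 =ᵐ[volume] u ω ∧
      Φ ω 2 =ᵐ[volume] deriv (v ω) ∧ Φ ω 3 =ᵐ[volume] deriv (u ω)

/-! ### The linearized operator `J L(ω)` -/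

/-- The matrix `J = [[0, I₂], [-I₂, 0]]`. -/
def matJ : Matrix (Fin 4) (Fin 4) ℂ :=
  !![0, 0, 1, 0; 0, 0, 0, 1; -1, 0, 0, 0; 0, -1, 0, 0]

/-- The matrix `α = [[0, Im σ₂], [-Im σ₂, 0]]`. -/
def matα : Matrix (Fin 4) (Fin 4) ℂ :=
  !![0, 0, 0, -1; 0, 0, 1, 0; 0, 1, 0, 0; -1, 0, 0, 0]

/-- The matrix `β = diag(σ₃, σ₃)`. -/
def matβ : Matrix (Fin 4) (Fin 4) ℂ :=
  !![1, 0, 0, 0; 0, -1, 0, 0; 0, 0, 1, 0; 0, 0, 0, -1]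

/-- The value of the potential `W = diag(W₁, W₀)` at a point where the profile is `(v, u)`:
`W₀ = -f(v² - u²) σ₃`, `W₁ = W₀ - 2 f'(v² - u²) [[v², -vu], [-vu, u²]]`. -/
def pot (f : ℝ → ℝ) (v u : ℝ) : Matrix (Fin 4) (Fin 4) ℂ :=
  let p : ℝ := f (v ^ 2 - u ^ 2)
  let q : ℝ := deriv f (v ^ 2 - u ^ 2)
  (!![-p - 2 * q * v ^ 2, 2 * q * (v * u), 0, 0;
      2 * q * (v * u), p - 2 * q * u ^ 2, 0, 0;
      0, 0, -p, 0;
      0, 0, 0, p] : Matrix (Fin 4) (Fin 4) ℝ).map Complex.ofReal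

/-- `W(x, ω)`. -/
def W (f : ℝ → ℝ) (v u : ℝ → ℝ → ℝ) (ω x : ℝ) : Matrix (Fin 4) (Fin 4) ℂ :=
  pot f (v ω x) (u ω x)

/-- The value at `x` of `J L(ω) ψ`, `L(ω) = J α ∂_x + β - ω + W(·, ω)`, when `ψ` has the
(weak) derivative `dψ`. -/
def JL (f : ℝ → ℝ) (v u : ℝ → ℝ → ℝ) (ω : ℝ) (ψ dψ : ℝ → Fin 4 → ℂ) (x : ℝ) : Fin 4 → ℂ :=
  matJ *ᵥ ((matJ * matα) *ᵥ dψ x + (matβ - (ω : ℂ) • (1 : Matrix (Fin 4) (Fin 4) ℂ) + W f v u ω x) *ᵥ ψ x)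

/-- The matrix `M(x, μ, ω) = α J β - ω α J - μ α + α J W(x, ω)`, for which
`J L(ω) - μ = -α (∂_x - M(x, μ, ω))`. -/
def M (f : ℝ → ℝ) (v u : ℝ → ℝ → ℝ) (ω : ℝ) (μ : ℂ) (x : ℝ) : Matrix (Fin 4) (Fin 4) ℂ :=
  matα * matJ * matβ - (ω : ℂ) • (matα * matJ) - μ • matα + matα * matJ * W f v u ω x

/-! ### The resolvent in `L²` -/

/-- `w ∈ H¹(ℝ, ℂ⁴)` with weak derivative `dw ∈ L²`. -/
def IsH1 (w dw : ℝ → Fin 4 → ℂ) : Prop :=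
  MemLp w 2 volume ∧ MemLp dw 2 volume ∧
    ∀ θ : ℝ → ℂ, ContDiff ℝ (⊤ : ℕ∞) θ → HasCompactSupport θ → ∀ i,
      ∫ x, deriv θ x * w x i = -∫ x, θ x * dw x i

/-- `w ∈ H¹` and `(J L(ω) - μ) w = h`. -/
def SolvesResolvent (f : ℝ → ℝ) (v u : ℝ → ℝ → ℝ) (ω : ℝ) (μ : ℂ) (h w : ℝ → Fin 4 → ℂ) :
    Prop :=
  ∃ dw, IsH1 w dw ∧ ∀ᵐ x, JL f v u ω w dw x - μ • w x = h x

/-- `μ` is in the resolvent set of `J L(ω)` on `L²(ℝ, ℂ⁴)` with domain `H¹`. -/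
def IsResolventPoint (f : ℝ → ℝ) (v u : ℝ → ℝ → ℝ) (ω : ℝ) (μ : ℂ) : Prop :=
  ∃ C : ℝ≥0, ∀ h : ℝ → Fin 4 → ℂ, MemLp h 2 volume →
    ∃ w, SolvesResolvent f v u ω μ h w ∧
      (∀ w', SolvesResolvent f v u ω μ h w' → w' =ᵐ[volume] w) ∧
      eLpNorm w 2 volume ≤ C * eLpNorm h 2 volume

/-- The weighted norm `‖⟨·⟩^s h‖_{L²(ℝ, ℂ⁴)}`, `⟨x⟩ = (1 + x²)^(1/2)`. -/
def wnorm (s : ℝ) (h : ℝ → Fin 4 → ℂ) : ℝ≥0∞ :=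
  (∫⁻ x, ENNReal.ofReal ((1 + x ^ 2) ^ s * ∑ i, ‖h x i‖ ^ 2)) ^ (1 / 2 : ℝ)

/-- The side of the imaginary axis from which the spectral parameter `iΛ ± 0` is approached. -/
inductive Side : Type
  | plus : Side
  | minus : Side

/-- The sign `±1` of a side. -/
def Side.sgn : Side → ℝ
  | .plus => 1
  | .minus => -1

/-- The operator `T` is the boundary value `(J L(ω) - (iΛ ± 0))⁻¹` from `L²_s` to `L²_{-s}`
(used for `s ≥ 0`): the points `iΛ ± ε`, `0 < ε < ε₀`, are in the resolvent set, and
`(J L(ω) - (iΛ ± ε))⁻¹ h` tends to `T h` in `L²_{-s}` as `ε → 0+`, for each `h ∈ L²_s`. -/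
def IsBoundaryResolvent (f : ℝ → ℝ) (v u : ℝ → ℝ → ℝ) (ω : ℝ) (σ : Side) (Λ s : ℝ)
    (T : (ℝ → Fin 4 → ℂ) → ℝ → Fin 4 → ℂ) : Prop :=
  ∃ ε₀ > 0,
    (∀ ε ∈ Ioo (0 : ℝ) ε₀, IsResolventPoint f v u ω (Complex.I * Λ + (σ.sgn * ε : ℝ))) ∧
    ∀ h : ℝ → Fin 4 → ℂ, AEStronglyMeasurable h volume → wnorm s h < ∞ →
      ∀ w : ℝ → ℝ → Fin 4 → ℂ,
        (∀ ε ∈ Ioo (0 : ℝ) ε₀,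
          SolvesResolvent f v u ω (Complex.I * Λ + (σ.sgn * ε : ℝ)) h (w ε)) →
        Tendsto (fun ε => wnorm (-s) (fun x => w ε x - T h x)) (𝓝[>] 0) (𝓝 0)

/-- The integral operator with the kernel `G`. -/
def integralOp (G : ℝ → ℝ → Matrix (Fin 4) (Fin 4) ℂ) (h : ℝ → Fin 4 → ℂ) (x : ℝ) :
    Fin 4 → ℂ :=
  ∫ y, G x y *ᵥ h y

/-! ### Jost solutions and the Evans function at `λ = iΛ`, `Λ ∈ ℝ` -/

/-- `ω - iλ = ω + Λ` (index `0`) and `ω + iλ = ω - Λ` (index `1`). -/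
def zeta (j : Fin 2) (ω Λ : ℝ) : ℝ := if j = 0 then ω + Λ else ω - Λ

/-- The boundary value at `iΛ ± 0` of the root `ξ_j` of `ξ_j² = (ω ∓ iλ)² - 1` with
`Im ξ_j > 0`. From the left (`iΛ - 0`), real `ξ_j` have the sign of `Λ`; from the right,
the opposite one. -/
def xi (σ : Side) (j : Fin 2) (ω Λ : ℝ) : ℂ :=
  if 1 ≤ |zeta j ω Λ| then
    ((-σ.sgn * Real.sign Λ * Real.sqrt (zeta j ω Λ ^ 2 - 1) : ℝ) : ℂ)
  else Complex.I * (Real.sqrt (1 - zeta j ω Λ ^ 2) : ℝ)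

/-- The normalized amplitude of the plane wave `Ξ_j e^{i ξ_j x}`, a solution for `W = 0`:
with `z = ω ∓ iλ`, `Ξ_1 ∝ (iξ, z - 1, -ξ, i(z - 1))` and `Ξ_2 ∝ (iξ, z - 1, ξ, -i(z - 1))`;
at `z = 1`, where this vector vanishes, its direction is the limit from `ξ > 0`. -/
def Xi (σ : Side) (j : Fin 2) (ω Λ : ℝ) : Fin 4 → ℂ :=
  let z := zeta j ω Λ
  let ξ : ℂ := if z = 1 then 1 else xi σ j ω Λ
  let τ : ℂ := if j = 0 then Complex.I else -Complex.I
  let c : ℝ := Real.sqrt (2 * (‖ξ‖ ^ 2 + (z - 1) ^ 2))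
  (c⁻¹ : ℂ) • ![Complex.I * ξ, (z : ℂ) - 1, τ * (Complex.I * ξ), τ * ((z : ℂ) - 1)]

/-- `h` is the Jost solution `𝐟_j(·, iΛ ± 0, ω)`: it solves `(J L(ω) - iΛ) h = 0`, i.e.
`h' = M(x, iΛ, ω) h`, and `|e^{-i ξ_j x} h(x) - Ξ_j| ≤ c e^{-2k δ_ω x}` for `x ≥ 0`, where
`δ_ω = (1 - ω²)^(1/2)`. -/
def IsJost (f : ℝ → ℝ) (k : ℕ) (v u : ℝ → ℝ → ℝ) (ω : ℝ) (σ : Side) (Λ : ℝ) (j : Fin 2)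
    (h : ℝ → Fin 4 → ℂ) : Prop :=
  (∀ x, HasDerivAt h (M f v u ω (Complex.I * Λ) x *ᵥ h x) x) ∧
  ∃ c : ℝ, ∀ x : ℝ, 0 ≤ x →
    ‖Complex.exp (-(Complex.I * xi σ j ω Λ * x)) • h x - Xi σ j ω Λ‖ ≤
      c * Real.exp (-(2 * k * Real.sqrt (1 - ω ^ 2) * x))

/-- The Jost solution `𝐟_j(·, iΛ ± 0, ω)`. -/
def jost (f : ℝ → ℝ) (k : ℕ) (v u : ℝ → ℝ → ℝ) (ω : ℝ) (σ : Side) (Λ : ℝ) (j : Fin 2) :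
    ℝ → Fin 4 → ℂ :=
  Classical.epsilon (IsJost f k v u ω σ Λ j)

/-- The `4 × 2` matrix with the columns `𝐟_1(x), 𝐟_2(x)`. -/
def jostR (f : ℝ → ℝ) (k : ℕ) (v u : ℝ → ℝ → ℝ) (ω : ℝ) (σ : Side) (Λ x : ℝ) :
    Matrix (Fin 4) (Fin 2) ℂ :=
  Matrix.of fun i j => jost f k v u ω σ Λ j x i

/-- The `4 × 2` matrix with the columns `𝐠_1(x), 𝐠_2(x)`, where `𝐠_j(x) = β 𝐟_j(-x)`. -/
def jostL (f : ℝ → ℝ) (k : ℕ) (v u : ℝ → ℝ → ℝ) (ω : ℝ) (σ : Side) (Λ x : ℝ) :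
    Matrix (Fin 4) (Fin 2) ℂ :=
  matβ * jostR f k v u ω σ Λ (-x)

/-- The Evans function `E(iΛ, ω) = det [𝐟_1, 𝐟_2, 𝐠_1, 𝐠_2]` (it does not depend on the point
`x`, taken to be `0`), formed by the boundary values at `iΛ - 0`. -/
def evans (f : ℝ → ℝ) (k : ℕ) (v u : ℝ → ℝ → ℝ) (ω Λ : ℝ) : ℂ :=
  ((Matrix.fromCols (jostR f k v u ω .minus Λ 0) (jostL f k v u ω .minus Λ 0)).submatrix id
    (finSumFinEquiv (m := 2) (n := 2)).symm).det

/-- `Δ(y) = ∑ 𝐟_j(y) Γ_{jk} 𝐠_k(y)^* - ∑ 𝐠_j(y) Γ_{jk} 𝐟_k(y)^*`. -/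
def delta (f : ℝ → ℝ) (k : ℕ) (v u : ℝ → ℝ → ℝ) (ω : ℝ) (σ : Side) (Λ : ℝ)
    (Γ : Matrix (Fin 2) (Fin 2) ℂ) (y : ℝ) : Matrix (Fin 4) (Fin 4) ℂ :=
  jostR f k v u ω σ Λ y * Γ * (jostL f k v u ω σ Λ y)ᴴ -
    jostL f k v u ω σ Λ y * Γ * (jostR f k v u ω σ Λ y)ᴴ

/-- Green's function off the diagonal,
`[Θ(x-y) ∑ 𝐟_j(x) Γ_{jk} 𝐠_k(y)^* + Θ(y-x) ∑ 𝐠_j(x) Γ_{jk} 𝐟_k(y)^*] Δ(y)⁻¹ (-α)`. -/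
def green (f : ℝ → ℝ) (k : ℕ) (v u : ℝ → ℝ → ℝ) (ω : ℝ) (σ : Side) (Λ : ℝ)
    (Γ : Matrix (Fin 2) (Fin 2) ℂ) (x y : ℝ) : Matrix (Fin 4) (Fin 4) ℂ :=
  (if y < x then jostR f k v u ω σ Λ x * Γ * (jostL f k v u ω σ Λ y)ᴴ
    else jostL f k v u ω σ Λ x * Γ * (jostR f k v u ω σ Λ y)ᴴ) *
    (delta f k v u ω σ Λ Γ y)⁻¹ * (-matα)

/-- `(J L(ω) - iΛ) G(·, y) = -α (∂_x - M(x, iΛ, ω)) G(·, y) = δ(· - y) I₄` in the sense of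
distributions, for each `y`. -/
def IsGreen (f : ℝ → ℝ) (v u : ℝ → ℝ → ℝ) (ω Λ : ℝ)
    (G : ℝ → ℝ → Matrix (Fin 4) (Fin 4) ℂ) : Prop :=
  ∀ y i j, (∀ l, LocallyIntegrable (fun x => G x y l j) volume) ∧
    ∀ θ : ℝ → ℂ, ContDiff ℝ (⊤ : ℕ∞) θ → HasCompactSupport θ →
      ∫ x, ((matα * G x y) i j * deriv θ x +
          (matα * M f v u ω (Complex.I * Λ) x * G x y) i j * θ x) =
        θ y * (1 : Matrix (Fin 4) (Fin 4) ℂ) i j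

/-- The pairs `(Λ, ω)` with `ω ∈ Ω`, `|Λ| ≥ 1 - |ω|`, `E(iΛ, ω) ≠ 0`. -/
def regularSet (f : ℝ → ℝ) (k : ℕ) (v u : ℝ → ℝ → ℝ) (Ω : Set ℝ) : Set (ℝ × ℝ) :=
  {p | p.2 ∈ Ω ∧ 1 - |p.2| ≤ |p.1| ∧ evans f k v u p.2 p.1 ≠ 0}

end

end GN

open GN

namespace GN

/-! ### Volterra equations at infinity -/

/-! The resolvent equation is a first-order system `y' = (m + P(x)) y` on the line, where `m` is the
constant matrix of the case `W = 0` and `P` decays like `e^{-2kδ|x|}`, `δ = √(1 - ω²)`. This sharp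
decay comes from a differential inequality for `uv` (`IsProfile.sq_add_sq_le`), combined with the
flatness of `f` at zero.

The matrix `m` splits into two channels, in each of which `m² = κ_j²` with `κ_j = -iξ_j`. With `|Re
μ| ≤ 1/2` the flow of `m` grows at most like `e^{3|x|/2}`, while `2kδ > 3.7` because `k ≥ 2` and
`|ω| < 1/3`. Hence the equation `Z' = (m + P)Z - Zm`, `Z → 1`, can be solved from infinity by a
Volterra argument, uniformly and continuously in the spectral parameter up to the imaginary axis
(`exists_isConjugation`). Thresholds `κ_j = 0` need no separate treatment, since only `cosh(κx)` and
`sinh(κx)/κ` occur. The Jost solutions are `Z(x) e^{xm} Ξ_j`; they are unique because a difference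
of two of them decays faster than the free flow can grow. The parity of the profile lets reflection
by `β` supply everything on the left half-line.

Let `Q₊` project onto the values at `0` of the solutions stable at `+∞`. A splitting is a projection
`P` with the range of `Q₊` and with `βPβ = 1 - P`; it exists exactly when the spans of the `𝐟_j(0)`
and of the `𝐠_j(0) = β𝐟_j(0)` are complementary, which at `λ - 0` is `E ≠ 0`. The side `λ + 0`
follows from an antilinear symmetry (`IsJostFrame.plus`). Green's function is `Φ P Ψ` above the
diagonal and `-Φ (1 - P) Ψ` below it, times `-α`, where `Ψ = Φ⁻¹`; the formula with `Γ` reduces to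
this because `P Δ = 𝐟 Γ 𝐠^*` (`IsFrameInv.mul_inv_delta`). A factor `sinh(κt)/κ` enters only at the
variable of smaller modulus: it costs `min(|x|, |y|)` near a threshold and a constant away from it
(`IsSysData.norm_kernel_le`).

A splitting at a boundary point persists at nearby parameters in the closed half-plane
(`exists_isSplitting_eventually`). Off the axis both rates are positive, so the kernel decays
exponentially and inverts `JL - μ` on `L²`. The kernels converge pointwise under a common bound,
hence in a weighted Hilbert–Schmidt norm (`IsWeightBound.tendsto`); this yields the boundary values.
Compactness gives uniformity for bounded `λ`.

For large `|Λ|` the potential is not small, but it couples two parts of the free system that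
oscillate against each other with frequency about `2|Λ|`. A normal-form correction, in effect one
integration by parts, shows that the off-diagonal block of `Z(0)` is `O(1/|Λ|)`
(`IsConjugation.norm_offDiag_le`). The spectral projection of `m`, which is exchanged with its
complement by `β`, can then be perturbed to a splitting with uniform bounds
(`exists_isSplitting_of_norm_le`). This gives both `E ≠ 0` and a uniformly bounded kernel. -/

theorem hasDerivAt_exp_exp {a L : ℝ} (ha : a ≠ 0) (hL : L ≠ 0) (x s : ℝ) :
    HasDerivAt (fun s => -(Real.exp (L * Real.exp (-a * (x + s))) / (a * L)))
      (Real.exp (-a * (x + s)) * Real.exp (L * Real.exp (-a * (x + s)))) s := by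
  have h1 : HasDerivAt (fun s => -a * (x + s)) (-a) s := by
    simpa using ((hasDerivAt_id s).const_add x).const_mul (-a)
  have h2 := ((h1.exp.const_mul L).exp.div_const (a * L)).neg
  refine h2.congr_deriv ?_
  field_simp

theorem tendsto_exp_exp {a L : ℝ} (ha : 0 < a) (x : ℝ) :
    Tendsto (fun s => -(Real.exp (L * Real.exp (-a * (x + s))) / (a * L))) atTop
      (𝓝 (-(1 / (a * L)))) := by
  have h1 : Tendsto (fun s : ℝ => -a * (x + s)) atTop atBot :=
    (tendsto_atTop_add_const_left atTop x tendsto_id).const_mul_atTop_of_neg (by linarith)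
  have h2 := (Real.tendsto_exp_atBot.comp h1).const_mul L
  have h3 := (Real.continuous_exp.tendsto _).comp h2
  simpa using (h3.div_const (a * L)).neg

theorem integrableOn_exp_exp {a L : ℝ} (ha : 0 < a) (hL : 0 < L) (x : ℝ) :
    IntegrableOn (fun s => Real.exp (-a * (x + s)) * Real.exp (L * Real.exp (-a * (x + s))))
      (Ioi 0) :=
  integrableOn_Ioi_deriv_of_nonneg' (fun s _ => hasDerivAt_exp_exp ha.ne' hL.ne' x s)
    (fun s _ => by positivity) (tendsto_exp_exp ha x)

theorem integral_exp_exp {a L : ℝ} (ha : 0 < a) (hL : 0 < L) (x : ℝ) :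
    ∫ s in Ioi 0, Real.exp (-a * (x + s)) * Real.exp (L * Real.exp (-a * (x + s))) =
      (Real.exp (L * Real.exp (-a * x)) - 1) / (a * L) := by
  rw [integral_Ioi_of_hasDerivAt_of_tendsto'
    (fun s _ => hasDerivAt_exp_exp ha.ne' hL.ne' x s) (integrableOn_exp_exp ha hL x)
    (tendsto_exp_exp ha x)]
  simp only [add_zero]
  ring

/-- With `w(x) = (2c/a) e^{-ax}` one has `w' = -2c e^{-ax}`, so the integrand is `-(e^w)'/2` and the
integral equals `(e^{w(x)} - 1)/2`. This weight makes the Volterra operator a contraction by the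
factor `1/2`, however large `c` is. -/
theorem weighted_tail_le {a c : ℝ} (ha : 0 < a) (hc : 0 < c) (x : ℝ) :
    Real.exp (-(2 * c / a * Real.exp (-a * x))) *
      ∫ s in Ioi 0, c * (Real.exp (-a * (x + s)) *
        Real.exp (2 * c / a * Real.exp (-a * (x + s)))) ≤ 1 / 2 := by
  rw [integral_const_mul, integral_exp_exp ha (by positivity)]
  have h : c * ((Real.exp (2 * c / a * Real.exp (-a * x)) - 1) / (a * (2 * c / a))) =
      (Real.exp (2 * c / a * Real.exp (-a * x)) - 1) / 2 := by field_simp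
  rw [h, Real.exp_neg]
  have := Real.exp_pos (2 * c / a * Real.exp (-a * x))
  rw [inv_mul_le_iff₀ this]
  linarith

section Volterra

variable {Par : Type*} [TopologicalSpace Par] [FirstCountableTopology Par]
  {E : Type*} [NormedAddCommGroup E] [NormedSpace ℝ E] [CompleteSpace E]

open BoundedContinuousFunction in
/-- Solutions of a Volterra equation on a half-line, continuous in a parameter. -/
theorem exists_volterra (𝒦 : Par → ℝ → ℝ → E →L[ℝ] E)
    (hcont : Continuous fun q : Par × ℝ × ℝ => 𝒦 q.1 q.2.1 q.2.2) {c a : ℝ} (ha : 0 < a)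
    (hc : 0 < c)
    (hb : ∀ p s t, 0 ≤ s → s ≤ t → ‖𝒦 p s t‖ ≤ c * Real.exp (-a * t)) (z : E) :
    ∃ Z : Par → ℝ → E, Continuous (fun q : Par × ℝ => Z q.1 q.2) ∧
      (∀ p x, ‖Z p x‖ ≤ 2 * Real.exp (2 * c / a) * ‖z‖) ∧
      ∀ p x, 0 ≤ x → Z p x = z - ∫ s in Ioi 0, 𝒦 p s (x + s) (Z p (x + s)) := by
  set w : ℝ → ℝ := fun x => 2 * c / a * Real.exp (-a * x) with hw
  have hwc : Continuous w := by fun_prop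
  have hwpos : ∀ x, 0 ≤ w x := fun x => by positivity
  have hL : 0 < 2 * c / a := by positivity
  -- The fixed point is sought as `y = e^{-w} Z` among the bounded continuous functions on `Par ×
  -- ℝ`, so that joint continuity in the parameter comes with completeness. Replacing `x` by `|x|`
  -- extends the equation to negative `x`, where only continuity and the bound are wanted.
  set g : (Par × ℝ →ᵇ E) → Par × ℝ → ℝ → E := fun y q s =>
    𝒦 q.1 s (|q.2| + s) (Real.exp (w (|q.2| + s)) • y (q.1, |q.2| + s)) with hg
  have hgb : ∀ y q s, 0 < s → ‖g y q s‖ ≤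
      c * (Real.exp (-a * (|q.2| + s)) * Real.exp (w (|q.2| + s))) * ‖y‖ := by
    intro y q s hs
    calc ‖g y q s‖ ≤ ‖𝒦 q.1 s (|q.2| + s)‖ *
          ‖Real.exp (w (|q.2| + s)) • y (q.1, |q.2| + s)‖ := ContinuousLinearMap.le_opNorm _ _
      _ ≤ c * Real.exp (-a * (|q.2| + s)) * (Real.exp (w (|q.2| + s)) * ‖y‖) := by
          rw [norm_smul, Real.norm_of_nonneg (Real.exp_pos _).le]
          gcongr
          · exact hb _ _ _ hs.le (by linarith [abs_nonneg q.2])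
          · exact y.norm_coe_le_norm _
      _ = _ := by ring
  have hgc : ∀ y, Continuous fun r : (Par × ℝ) × ℝ => g y r.1 r.2 := by
    intro y
    have h1 : Continuous fun r : (Par × ℝ) × ℝ => 𝒦 r.1.1 r.2 (|r.1.2| + r.2) :=
      hcont.comp (f := fun r : (Par × ℝ) × ℝ => (r.1.1, r.2, |r.1.2| + r.2)) (by fun_prop)
    have h2 : Continuous fun r : (Par × ℝ) × ℝ => y (r.1.1, |r.1.2| + r.2) :=
      y.continuous.comp (by fun_prop)
    exact h1.clm_apply (Continuous.smul (by fun_prop) h2)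
  have hgint : ∀ y q, IntegrableOn (g y q) (Ioi 0) := by
    intro y q
    refine Integrable.mono' (((integrableOn_exp_exp ha hL |q.2|).const_mul c).mul_const ‖y‖)
      ((hgc y).comp (Continuous.prodMk_right q)).aestronglyMeasurable ?_
    exact (ae_restrict_iff' measurableSet_Ioi).2 (ae_of_all _ fun s hs => hgb y q s hs)
  have hgle : ∀ y q, Real.exp (-w |q.2|) * ‖∫ s in Ioi 0, g y q s‖ ≤ 1 / 2 * ‖y‖ := by
    intro y q
    calc Real.exp (-w |q.2|) * ‖∫ s in Ioi 0, g y q s‖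
        ≤ Real.exp (-w |q.2|) * ∫ s in Ioi 0,
          c * (Real.exp (-a * (|q.2| + s)) * Real.exp (w (|q.2| + s))) * ‖y‖ := by
          gcongr
          refine norm_integral_le_of_norm_le
            (((integrableOn_exp_exp ha hL |q.2|).const_mul c).mul_const ‖y‖) ?_
          exact (ae_restrict_iff' measurableSet_Ioi).2 (ae_of_all _ fun s hs => hgb y q s hs)
      _ = (Real.exp (-w |q.2|) * ∫ s in Ioi 0,
          c * (Real.exp (-a * (|q.2| + s)) * Real.exp (w (|q.2| + s)))) * ‖y‖ := by
          rw [integral_mul_const]; ring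
      _ ≤ _ := by
          gcongr
          exact weighted_tail_le ha hc _
  have hIc : ∀ y, Continuous fun q => ∫ s in Ioi 0, g y q s := by
    intro y
    refine MeasureTheory.continuous_of_dominated
      (bound := fun s => c * (Real.exp (-a * (0 + s)) * Real.exp (2 * c / a)) * ‖y‖) ?_ ?_ ?_ ?_
    · exact fun q => ((hgc y).comp (Continuous.prodMk_right q)).aestronglyMeasurable
    · intro q
      refine (ae_restrict_iff' measurableSet_Ioi).2 (ae_of_all _ fun s hs => ?_)
      refine (hgb y q s hs).trans ?_
      have hs : 0 < s := hs
      have h1 : Real.exp (-a * (|q.2| + s)) ≤ Real.exp (-a * (0 + s)) :=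
        Real.exp_le_exp.2 (by nlinarith [mul_nonneg ha.le (abs_nonneg q.2)])
      have h2 : w (|q.2| + s) ≤ 2 * c / a := by
        have : Real.exp (-a * (|q.2| + s)) ≤ 1 := by
          rw [Real.exp_le_one_iff]; nlinarith [abs_nonneg q.2]
        calc w (|q.2| + s) ≤ 2 * c / a * 1 := by simp only [hw]; gcongr
          _ = _ := mul_one _
      gcongr
    · have := exp_neg_integrableOn_Ioi 0 ha
      simp only [zero_add]
      exact ((this.mul_const _).const_mul c).mul_const _
    · exact ae_of_all _ fun s => (hgc y).comp (Continuous.prodMk_left s)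
  have hewle : ∀ x, Real.exp (-w x) ≤ 1 := fun x => by
    rw [Real.exp_le_one_iff]; linarith [hwpos x]
  set T : (Par × ℝ →ᵇ E) → (Par × ℝ →ᵇ E) := fun y =>
    BoundedContinuousFunction.ofNormedAddCommGroup
      (fun q => Real.exp (-w |q.2|) • (z - ∫ s in Ioi 0, g y q s))
      (Continuous.smul (by fun_prop) (continuous_const.sub (hIc y))) (‖z‖ + 1 / 2 * ‖y‖) (by
        intro q
        rw [norm_smul, Real.norm_of_nonneg (Real.exp_pos _).le]
        calc Real.exp (-w |q.2|) * ‖z - ∫ s in Ioi 0, g y q s‖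
            ≤ Real.exp (-w |q.2|) * (‖z‖ + ‖∫ s in Ioi 0, g y q s‖) := by
              gcongr; exact norm_sub_le _ _
          _ = Real.exp (-w |q.2|) * ‖z‖ + Real.exp (-w |q.2|) * ‖∫ s in Ioi 0, g y q s‖ := by ring
          _ ≤ 1 * ‖z‖ + 1 / 2 * ‖y‖ := by
              refine add_le_add ?_ (hgle y q)
              gcongr
              exact hewle _
          _ = _ := by ring) with hT
  have hTapp : ∀ y q, T y q = Real.exp (-w |q.2|) • (z - ∫ s in Ioi 0, g y q s) := fun y q => rfl
  have hgsub : ∀ y y' q s, g y q s - g y' q s = g (y - y') q s := by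
    intro y y' q s
    simp only [hg, BoundedContinuousFunction.coe_sub, Pi.sub_apply, smul_sub, map_sub]
  have hcontr : ContractingWith (1 / 2 : ℝ≥0) T := by
    refine ⟨by norm_num, LipschitzWith.of_dist_le_mul fun y y' => ?_⟩
    rw [BoundedContinuousFunction.dist_le (by positivity)]
    intro q
    rw [hTapp, hTapp, dist_eq_norm, ← smul_sub, sub_sub_sub_cancel_left, norm_smul,
      Real.norm_of_nonneg (Real.exp_pos _).le, ← integral_sub (hgint _ _) (hgint _ _)]
    simp only [hgsub]
    have := hgle (y' - y) q
    rw [dist_comm, dist_eq_norm]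
    simpa using this
  set y := ContractingWith.fixedPoint T hcontr
  have hy : T y = y := ContractingWith.fixedPoint_isFixedPt hcontr
  have hyb : ‖y‖ ≤ 2 * ‖z‖ := by
    have : ‖y‖ ≤ ‖z‖ + 1 / 2 * ‖y‖ := by
      conv_lhs => rw [← hy]
      exact BoundedContinuousFunction.norm_ofNormedAddCommGroup_le _ (by positivity) _
    linarith
  refine ⟨fun p x => Real.exp (w |x|) • y (p, x), ?_, ?_, ?_⟩
  · exact Continuous.smul (by fun_prop) (y.continuous.comp (by fun_prop))
  · intro p x
    rw [norm_smul, Real.norm_of_nonneg (Real.exp_pos _).le]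
    have h1 : w |x| ≤ 2 * c / a := by
      have : Real.exp (-a * |x|) ≤ 1 := by
        rw [Real.exp_le_one_iff]; nlinarith [abs_nonneg x]
      calc w |x| ≤ 2 * c / a * 1 := by simp only [hw]; gcongr
        _ = _ := mul_one _
    calc Real.exp (w |x|) * ‖y (p, x)‖ ≤ Real.exp (2 * c / a) * (2 * ‖z‖) := by
          gcongr
          exact (y.norm_coe_le_norm _).trans hyb
      _ = _ := by ring
  · intro p x hx
    have h1 : y (p, x) = Real.exp (-w |x|) • (z - ∫ s in Ioi 0, g y (p, x) s) := by
      conv_lhs => rw [← hy]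
      rfl
    beta_reduce
    rw [h1, smul_smul, ← Real.exp_add, add_neg_cancel, Real.exp_zero, one_smul]
    congr 1
    refine setIntegral_congr_fun measurableSet_Ioi fun s hs => ?_
    have hs : 0 < s := hs
    simp only [hg, abs_of_nonneg hx, abs_of_nonneg (add_nonneg hx hs.le)]

end Volterra

end GN

namespace GN

/-! ### Conjugation of a perturbed linear system to the free one -/

theorem integral_Ioi_comp_const_add {E : Type*} [NormedAddCommGroup E] [NormedSpace ℝ E]
    (g : ℝ → E) (x : ℝ) : ∫ s in Ioi 0, g (x + s) = ∫ s in Ioi x, g s := by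
  have h := (measurePreserving_add_left (volume : Measure ℝ) x).setIntegral_preimage_emb
    (measurableEmbedding_addLeft x) g (Ioi x)
  simpa using h

section Conjugation

set_option linter.unusedSectionVars false

variable {A : Type*} [NormedRing A] [NormedAlgebra ℝ A] [CompleteSpace A] [NormOneClass A]

/-- `U` is the one-parameter group generated by `m`, with growth rate at most `ρ`. -/
structure IsFlowGroup (m : A) (U : ℝ → A) (K ρ : ℝ) : Prop where
  zero : U 0 = 1
  add : ∀ x y, U (x + y) = U x * U y
  deriv : ∀ x, HasDerivAt U (m * U x) x
  comm : ∀ x, m * U x = U x * m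
  bound : ∀ x, ‖U x‖ ≤ K * Real.exp (ρ * |x|)

theorem IsFlowGroup.mul_neg {m : A} {U : ℝ → A} {K ρ : ℝ} (h : IsFlowGroup m U K ρ) (x : ℝ) :
    U x * U (-x) = 1 := by rw [← h.add, add_neg_cancel, h.zero]

theorem IsFlowGroup.neg_mul {m : A} {U : ℝ → A} {K ρ : ℝ} (h : IsFlowGroup m U K ρ) (x : ℝ) :
    U (-x) * U x = 1 := by rw [← h.add, neg_add_cancel, h.zero]

theorem IsFlowGroup.continuous {m : A} {U : ℝ → A} {K ρ : ℝ} (h : IsFlowGroup m U K ρ) :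
    Continuous U := continuous_iff_continuousAt.2 fun x => (h.deriv x).continuousAt

theorem IsFlowGroup.deriv_neg {m : A} {U : ℝ → A} {K ρ : ℝ} (h : IsFlowGroup m U K ρ) (x : ℝ) :
    HasDerivAt (fun x => U (-x)) (-(U (-x) * m)) x := by
  have := (h.deriv (-x)).scomp x (hasDerivAt_neg x)
  rw [h.comm, neg_one_smul] at this
  exact this

variable {Par : Type*} [TopologicalSpace Par] [FirstCountableTopology Par]

/-- In the rotating frame `U(-x) Z U(x)` only the term `LZR` survives, and integration from infinity
gives a Volterra equation with the kernel `U(-s) L(x+s) · R(x+s) U(s)`. The conjugation by `U(s)`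
costs `e^{2ρs}`, which is why the decay rate must exceed `2ρ`. Coefficients on both sides serve a
conjugation and its inverse alike. -/
theorem exists_twisted_limit_one {K C ρ a : ℝ} (hK : 0 < K) (hC : 0 < C) (hρ : 0 ≤ ρ)
    (ha : 0 < a) {m : Par → A} {U L R : Par → ℝ → A} {γ : Par → ℝ}
    (hU : ∀ p, IsFlowGroup (m p) (U p) K ρ) (hUc : Continuous fun q : Par × ℝ => U q.1 q.2)
    (hL : Continuous fun q : Par × ℝ => L q.1 q.2)
    (hR : Continuous fun q : Par × ℝ => R q.1 q.2)
    (hγ : ∀ p, 2 * ρ + a ≤ γ p)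
    (hLR : ∀ p t, 0 ≤ t → ‖L p t‖ * ‖R p t‖ ≤ C * Real.exp (-γ p * t)) :
    ∃ Z : Par → ℝ → A, (∀ x, 0 ≤ x → Continuous fun p => Z p x) ∧ ∀ p x, 0 ≤ x →
      HasDerivAt (Z p) (m p * Z p x - Z p x * m p + L p x * Z p x * R p x) x ∧
      ‖Z p x‖ ≤ 2 * Real.exp (2 * (K ^ 2 * C) / a) ∧
      ‖Z p x - 1‖ ≤ K ^ 2 * C / a * (2 * Real.exp (2 * (K ^ 2 * C) / a)) *
        Real.exp (-γ p * x) := by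
  set c := K ^ 2 * C with hc
  set B := 2 * Real.exp (2 * c / a) with hB
  have hUU : ∀ p s, 0 ≤ s → ‖U p (-s)‖ * ‖U p s‖ ≤ K ^ 2 * Real.exp (2 * ρ * s) := by
    intro p s hs
    calc ‖U p (-s)‖ * ‖U p s‖ ≤ (K * Real.exp (ρ * |-s|)) * (K * Real.exp (ρ * |s|)) := by
          gcongr <;> exact (hU p).bound _
      _ = K ^ 2 * (Real.exp (ρ * s) * Real.exp (ρ * s)) := by
          rw [abs_neg, abs_of_nonneg hs]; ring
      _ = _ := by rw [← Real.exp_add]; ring_nf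
  have hker : ∀ p s t, 0 ≤ s → 0 ≤ t → ‖U p (-s) * L p t‖ * ‖R p t * U p s‖ ≤
      c * Real.exp (2 * ρ * s - γ p * t) := by
    intro p s t hs ht
    calc ‖U p (-s) * L p t‖ * ‖R p t * U p s‖
        ≤ (‖U p (-s)‖ * ‖L p t‖) * (‖R p t‖ * ‖U p s‖) := by
          gcongr <;> exact norm_mul_le _ _
      _ = (‖U p (-s)‖ * ‖U p s‖) * (‖L p t‖ * ‖R p t‖) := by ring
      _ ≤ (K ^ 2 * Real.exp (2 * ρ * s)) * (C * Real.exp (-γ p * t)) := by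
          exact mul_le_mul (hUU p s hs) (hLR p t ht) (by positivity) (by positivity)
      _ = c * (Real.exp (2 * ρ * s) * Real.exp (-γ p * t)) := by rw [hc]; ring
      _ = _ := by rw [← Real.exp_add]; ring_nf
  obtain ⟨Z, hZc, hZb, hZ⟩ := exists_volterra
    (fun p s t => ContinuousLinearMap.mulLeftRight ℝ A (U p (-s) * L p t) (R p t * U p s))
    (by
      have h1 : Continuous fun q : Par × ℝ × ℝ => U q.1 (-q.2.1) :=
        hUc.comp (f := fun q : Par × ℝ × ℝ => (q.1, -q.2.1)) (by fun_prop)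
      have h2 : Continuous fun q : Par × ℝ × ℝ => U q.1 q.2.1 :=
        hUc.comp (f := fun q : Par × ℝ × ℝ => (q.1, q.2.1)) (by fun_prop)
      have h3 : Continuous fun q : Par × ℝ × ℝ => L q.1 q.2.2 :=
        hL.comp (f := fun q : Par × ℝ × ℝ => (q.1, q.2.2)) (by fun_prop)
      have h4 : Continuous fun q : Par × ℝ × ℝ => R q.1 q.2.2 :=
        hR.comp (f := fun q : Par × ℝ × ℝ => (q.1, q.2.2)) (by fun_prop)
      exact ((ContinuousLinearMap.mulLeftRight ℝ A).continuous.comp (h1.mul h3)).clm_apply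
        (h4.mul h2))
    ha (c := c) (by positivity) (by
      intro p s t hs hst
      refine (ContinuousLinearMap.opNorm_mulLeftRight_apply_apply_le ℝ A _ _).trans
        ((hker p s t hs (hs.trans hst)).trans ?_)
      gcongr
      nlinarith [hγ p, mul_le_mul_of_nonneg_left hst hρ,
        mul_le_mul_of_nonneg_right (hγ p) (hs.trans hst)]) (1 : A)
  simp only [ContinuousLinearMap.mulLeftRight_apply, norm_one, mul_one] at hZ hZb
  -- The fixed point solves the equation only for `x ≥ 0`, whereas a two-sided derivative at `0` is
  -- needed for gluing by reflection. `ζ` continues it across `0` by the formula `1 - U(x) (∫_x^∞ g)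
  -- U(-x)`, which is differentiable on the whole line.
  have key : ∀ p, ∃ ζ : ℝ → A, ∀ x, 0 ≤ x → ζ x = Z p x ∧
      HasDerivAt ζ (m p * Z p x - Z p x * m p + L p x * Z p x * R p x) x ∧
      ‖Z p x - 1‖ ≤ c / a * B * Real.exp (-γ p * x) := by
    intro p
    have hZp : Continuous (Z p) := hZc.comp (f := fun x => (p, x)) (by fun_prop)
    have hLp : Continuous (L p) := hL.comp (f := fun x => (p, x)) (by fun_prop)
    have hRp : Continuous (R p) := hR.comp (f := fun x => (p, x)) (by fun_prop)
    have hUp : Continuous (U p) := (hU p).continuous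
    set g : ℝ → A := fun t => U p (-t) * L p t * Z p t * (R p t * U p t) with hg
    have hgc : Continuous g := by fun_prop
    have hint : ∀ {x : ℝ}, 0 ≤ x → ∀ s, 0 < s →
        ‖U p (-s) * L p (x + s) * Z p (x + s) * (R p (x + s) * U p s)‖ ≤
          c * B * (Real.exp (-γ p * x) * Real.exp (-a * s)) := by
      intro x hx s hs
      calc ‖U p (-s) * L p (x + s) * Z p (x + s) * (R p (x + s) * U p s)‖
          ≤ ‖U p (-s) * L p (x + s)‖ * ‖Z p (x + s)‖ * ‖R p (x + s) * U p s‖ := by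
            refine (norm_mul_le _ _).trans ?_
            gcongr
            exact norm_mul_le _ _
        _ = (‖U p (-s) * L p (x + s)‖ * ‖R p (x + s) * U p s‖) * ‖Z p (x + s)‖ := by ring
        _ ≤ (c * Real.exp (2 * ρ * s - γ p * (x + s))) * B := by
            exact mul_le_mul (hker p s (x + s) hs.le (by positivity)) (hZb _ _)
              (norm_nonneg _) (by positivity)
        _ ≤ (c * (Real.exp (-γ p * x) * Real.exp (-a * s))) * B := by
            rw [← Real.exp_add]
            have := mul_le_mul_of_nonneg_right (hγ p) hs.le
            have h2 : 2 * ρ * s - γ p * (x + s) ≤ -γ p * x + -a * s := by nlinarith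
            gcongr
        _ = _ := by ring
    have hdom : ∀ x : ℝ, IntegrableOn (fun s => c * B * (Real.exp (-γ p * x) * Real.exp (-a * s)))
        (Ioi 0) := fun x => ((exp_neg_integrableOn_Ioi 0 ha).const_mul _).const_mul _
    have hgint : IntegrableOn g (Ioi 0) := by
      refine Integrable.mono' (((exp_neg_integrableOn_Ioi 0 ha).const_mul
        (Real.exp (-γ p * 0))).const_mul (c * B)) hgc.aestronglyMeasurable ?_
      refine (ae_restrict_iff' measurableSet_Ioi).2 (ae_of_all _ fun s hs => ?_)
      simpa [hg] using hint le_rfl s hs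
    have heq : ∀ x, 0 ≤ x → Z p x = 1 - U p x * (∫ s in Ioi x, g s) * U p (-x) := by
      intro x hx
      rw [hZ p x hx, ← integral_Ioi_comp_const_add g x]
      have hgi : IntegrableOn (fun s => g (x + s)) (Ioi 0) := by
        have h := ((measurePreserving_add_left (volume : Measure ℝ) x).integrableOn_comp_preimage
          (measurableEmbedding_addLeft x) (f := g) (s := Ioi x)).2
          (hgint.mono_set (Ioi_subset_Ioi hx))
        simpa [Function.comp_def] using h
      have h := (ContinuousLinearMap.mulLeftRight ℝ A (U p x) (U p (-x))).integral_comp_comm hgi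
      simp only [ContinuousLinearMap.mulLeftRight_apply] at h
      rw [← h]
      congr 1
      refine integral_congr_ae (ae_of_all _ fun s => ?_)
      have h1 : U p (-s) = U p x * U p (-(x + s)) := by
        rw [← (hU p).add]; ring_nf
      have h2 : U p s = U p (x + s) * U p (-x) := by
        rw [← (hU p).add]; ring_nf
      beta_reduce
      rw [h1, h2]
      simp only [hg, mul_assoc]
    have hI : ∀ y, 0 ≤ y → ∫ s in Ioi y, g s = (∫ s in Ioi 0, g s) - ∫ s in (0 : ℝ)..y, g s := by
      intro y hy
      rw [← intervalIntegral.integral_Ioi_sub_Ioi hgint hy]; abel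
    set I : ℝ → A := fun y => (∫ s in Ioi 0, g s) - ∫ s in (0 : ℝ)..y, g s with hIdef
    have hId : ∀ x, HasDerivAt I (-g x) x := fun x =>
      (hgc.integral_hasStrictDerivAt 0 x).hasDerivAt.const_sub _
    have hZx : ∀ x, 0 ≤ x → 1 - U p x * I x * U p (-x) = Z p x := fun x hx => by
      rw [heq x hx, hI x hx]
    refine ⟨fun x => 1 - U p x * I x * U p (-x), fun x hx => ⟨hZx x hx, ?_, ?_⟩⟩
    · have hD := ((((hU p).deriv x).mul (hId x)).mul ((hU p).deriv_neg x)).const_sub 1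
      refine hD.congr_deriv ?_
      have h1 : U p x * g x * U p (-x) = L p x * Z p x * R p x := by
        simp only [hg]
        calc U p x * (U p (-x) * L p x * Z p x * (R p x * U p x)) * U p (-x)
            = (U p x * U p (-x)) * L p x * Z p x * R p x * (U p x * U p (-x)) := by noncomm_ring
          _ = _ := by rw [(hU p).mul_neg]; simp
      rw [← h1, ← hZx x hx]
      simp only [Pi.mul_apply]
      noncomm_ring
    · rw [hZ p x hx, sub_sub_cancel_left, norm_neg]
      refine (norm_integral_le_of_norm_le (hdom x)
        ((ae_restrict_iff' measurableSet_Ioi).2 (ae_of_all _ fun s hs => hint hx s hs))).trans ?_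
      rw [integral_const_mul, integral_const_mul]
      have : ∫ s in Ioi (0 : ℝ), Real.exp (-a * s) = 1 / a := by
        have := integral_exp_mul_Ioi (a := -a) (by linarith) 0
        rw [this]; simp [neg_div_neg_eq]
      rw [this]
      apply le_of_eq
      field_simp
  choose ζ hζ using key
  refine ⟨ζ, fun x hx => ?_, fun p x hx => ?_⟩
  · simp only [(hζ _ x hx).1]
    exact hZc.comp (f := fun p => (p, x)) (by fun_prop)
  · obtain ⟨h1, h2, h3⟩ := hζ p x hx
    rw [h1]
    exact ⟨h2, hZb p x, h3⟩

/-- The bound for the solutions of the conjugation equations. -/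
noncomputable def conjBound (K C a : ℝ) : ℝ := 2 * Real.exp (2 * (K ^ 2 * C) / a)

/-- `Z` conjugates `∂ₓ - (m + P)` on the half-line to `∂ₓ - m`, and `Y` is its inverse. -/
structure IsConjugation (m : A) (P Z Y : ℝ → A) (B D γ : ℝ) : Prop where
  deriv_Z : ∀ x, 0 ≤ x → HasDerivAt Z ((m + P x) * Z x - Z x * m) x
  deriv_Y : ∀ x, 0 ≤ x → HasDerivAt Y (m * Y x - Y x * (m + P x)) x
  mul_YZ : ∀ x, 0 ≤ x → Y x * Z x = 1
  mul_ZY : ∀ x, 0 ≤ x → Z x * Y x = 1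
  norm_Z : ∀ x, 0 ≤ x → ‖Z x‖ ≤ B
  norm_Y : ∀ x, 0 ≤ x → ‖Y x‖ ≤ B
  norm_Z_sub : ∀ x, 0 ≤ x → ‖Z x - 1‖ ≤ D * Real.exp (-γ * x)

/-- The function `U(-x) Y Z U(x)` has derivative zero, and it tends to `1` because `YZ - 1 =
O(e^{-γx})` outweighs the factor `e^{2ρx}` of the conjugation. -/
theorem mul_eq_one_of_conjugated {m : A} {U P Y Z : ℝ → A} {K ρ a B D γ : ℝ} (ha : 0 < a)
    (hU : IsFlowGroup m U K ρ) (hγ : 2 * ρ + a ≤ γ) (hK : 0 < K)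
    (hZ : ∀ x, 0 ≤ x → HasDerivAt Z ((m + P x) * Z x - Z x * m) x)
    (hY : ∀ x, 0 ≤ x → HasDerivAt Y (m * Y x - Y x * (m + P x)) x)
    (hZb : ∀ x, 0 ≤ x → ‖Z x‖ ≤ B)
    (hZ1 : ∀ x, 0 ≤ x → ‖Z x - 1‖ ≤ D * Real.exp (-γ * x))
    (hY1 : ∀ x, 0 ≤ x → ‖Y x - 1‖ ≤ D * Real.exp (-γ * x)) {x : ℝ} (hx : 0 ≤ x) :
    Y x * Z x = 1 := by
  set F : ℝ → A := fun x => U (-x) * (Y x * Z x) * U x with hF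
  have hFd : ∀ x, 0 ≤ x → HasDerivAt F 0 x := by
    intro x hx
    have h := ((hU.deriv_neg x).mul ((hY x hx).mul (hZ x hx))).mul (hU.deriv x)
    refine h.congr_deriv ?_
    simp only [Pi.mul_apply]
    noncomm_ring
  have hconst : ∀ x, 0 ≤ x → F x = F 0 := by
    intro x hx
    exact constant_of_has_deriv_right_zero
      (fun y hy => (hFd y hy.1).continuousAt.continuousWithinAt)
      (fun y hy => (hFd y hy.1).hasDerivWithinAt) x ⟨hx, le_rfl⟩
  have hlim : Tendsto (fun x => F x - 1) atTop (𝓝 0) := by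
    have hB : 0 ≤ B := (norm_nonneg _).trans (hZb 0 le_rfl)
    have hb : ∀ x, 0 ≤ x → ‖F x - 1‖ ≤ K ^ 2 * (D * B + D) * Real.exp (-a * x) := by
      intro x hx
      have h1 : F x - 1 = U (-x) * ((Y x - 1) * Z x + (Z x - 1)) * U x := by
        have := hU.neg_mul x
        simp only [hF]
        calc U (-x) * (Y x * Z x) * U x - 1 = U (-x) * (Y x * Z x) * U x - U (-x) * U x := by
              rw [this]
          _ = _ := by noncomm_ring
      have hU1 : ‖U (-x)‖ ≤ K * Real.exp (ρ * x) := by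
        simpa [abs_of_nonneg hx] using hU.bound (-x)
      have hU2 : ‖U x‖ ≤ K * Real.exp (ρ * x) := by
        simpa [abs_of_nonneg hx] using hU.bound x
      have hD : 0 ≤ D * Real.exp (-γ * x) := (norm_nonneg _).trans (hZ1 x hx)
      have hD' : 0 ≤ D := nonneg_of_mul_nonneg_left hD (Real.exp_pos _)
      have hmid : ‖(Y x - 1) * Z x + (Z x - 1)‖ ≤ (D * B + D) * Real.exp (-γ * x) := by
        calc ‖(Y x - 1) * Z x + (Z x - 1)‖ ≤ ‖Y x - 1‖ * ‖Z x‖ + ‖Z x - 1‖ :=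
              (norm_add_le _ _).trans (by gcongr; exact norm_mul_le _ _)
          _ ≤ (D * Real.exp (-γ * x)) * B + D * Real.exp (-γ * x) :=
              add_le_add (mul_le_mul (hY1 x hx) (hZb x hx) (norm_nonneg _) hD) (hZ1 x hx)
          _ = _ := by ring
      rw [h1]
      calc ‖U (-x) * ((Y x - 1) * Z x + (Z x - 1)) * U x‖
          ≤ ‖U (-x)‖ * ‖(Y x - 1) * Z x + (Z x - 1)‖ * ‖U x‖ := by
            refine (norm_mul_le _ _).trans ?_
            gcongr
            exact norm_mul_le _ _
        _ ≤ (K * Real.exp (ρ * x)) * ((D * B + D) * Real.exp (-γ * x)) *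
            (K * Real.exp (ρ * x)) := by
            gcongr
        _ = K ^ 2 * (D * B + D) * (Real.exp (ρ * x) * Real.exp (-γ * x) * Real.exp (ρ * x)) := by
            ring
        _ ≤ K ^ 2 * (D * B + D) * Real.exp (-a * x) := by
            rw [← Real.exp_add, ← Real.exp_add]
            have := mul_le_mul_of_nonneg_right hγ hx
            gcongr
            nlinarith
    refine squeeze_zero_norm' ((eventually_ge_atTop 0).mono hb) ?_
    have h1 : Tendsto (fun x : ℝ => -a * x) atTop atBot :=
      tendsto_id.const_mul_atTop_of_neg (by linarith)
    simpa using (Real.tendsto_exp_atBot.comp h1).const_mul (K ^ 2 * (D * B + D))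
  have hF0 : F 0 - 1 = 0 := by
    refine tendsto_nhds_unique (tendsto_const_nhds (x := F 0 - 1) (f := (atTop : Filter ℝ)))
      (hlim.congr' ?_)
    filter_upwards [eventually_ge_atTop 0] with x hx
    rw [hconst x hx]
  have hFx : F x = 1 := by rw [hconst x hx]; exact sub_eq_zero.1 hF0
  calc Y x * Z x = (U x * U (-x)) * (Y x * Z x) * (U x * U (-x)) := by
        rw [hU.mul_neg]; simp
    _ = U x * F x * U (-x) := by simp only [hF]; noncomm_ring
    _ = 1 := by rw [hFx, mul_one, hU.mul_neg]

/-- `Z` and `Y` are the cases `(L, R) = (P, 1)` and `(-1, P)` of the twisted equation. The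
assumption `hA` upgrades the one-sided inverse; it holds for operators on a finite-dimensional
space. -/
theorem exists_isConjugation (hA : ∀ s t : A, s * t = 1 → t * s = 1) {K C ρ a : ℝ} (hK : 0 < K)
    (hC : 0 < C) (hρ : 0 ≤ ρ) (ha : 0 < a) {m : Par → A} {U P : Par → ℝ → A} {γ : Par → ℝ}
    (hU : ∀ p, IsFlowGroup (m p) (U p) K ρ) (hUc : Continuous fun q : Par × ℝ => U q.1 q.2)
    (hP : Continuous fun q : Par × ℝ => P q.1 q.2) (hγ : ∀ p, 2 * ρ + a ≤ γ p)
    (hPb : ∀ p t, 0 ≤ t → ‖P p t‖ ≤ C * Real.exp (-γ p * t)) :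
    ∃ Z Y : Par → ℝ → A, (∀ x, 0 ≤ x → Continuous fun p => Z p x) ∧
      (∀ x, 0 ≤ x → Continuous fun p => Y p x) ∧
      ∀ p, IsConjugation (m p) (P p) (Z p) (Y p) (conjBound K C a)
        (K ^ 2 * C / a * conjBound K C a) (γ p) := by
  obtain ⟨Z, hZc, hZ⟩ := exists_twisted_limit_one hK hC hρ ha hU hUc hP
    (R := fun _ _ => (1 : A)) (by fun_prop) hγ (by simpa using hPb)
  obtain ⟨Y, hYc, hY⟩ := exists_twisted_limit_one hK hC hρ ha hU hUc
    (L := fun _ _ => (-1 : A)) (by fun_prop) hP hγ (by simpa using hPb)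
  have hZd : ∀ p x, 0 ≤ x → HasDerivAt (Z p) ((m p + P p x) * Z p x - Z p x * m p) x :=
    fun p x hx => (hZ p x hx).1.congr_deriv (by noncomm_ring)
  have hYd : ∀ p x, 0 ≤ x → HasDerivAt (Y p) (m p * Y p x - Y p x * (m p + P p x)) x :=
    fun p x hx => (hY p x hx).1.congr_deriv (by noncomm_ring)
  have hYZ : ∀ p x, 0 ≤ x → Y p x * Z p x = 1 := fun p x hx =>
    mul_eq_one_of_conjugated ha (hU p) (hγ p) hK (hZd p) (hYd p) (fun x hx => (hZ p x hx).2.1)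
      (fun x hx => (hZ p x hx).2.2) (fun x hx => (hY p x hx).2.2) hx
  exact ⟨Z, Y, hZc, hYc, fun p => ⟨hZd p, hYd p, hYZ p, fun x hx => hA _ _ (hYZ p x hx),
    fun x hx => (hZ p x hx).2.1, fun x hx => (hY p x hx).2.1, fun x hx => (hZ p x hx).2.2⟩⟩

/-- The extension of a function on the half-line by `F(-x) = b F(x) b`. -/
noncomputable def reflect (b : A) (F : ℝ → A) (x : ℝ) : A :=
  if 0 ≤ x then F x else b * F (-x) * b

theorem reflect_of_nonneg (b : A) (F : ℝ → A) {x : ℝ} (hx : 0 ≤ x) : reflect b F x = F x :=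
  if_pos hx

theorem reflect_of_nonpos {b : A} {F : ℝ → A} (h0 : b * F 0 * b = F 0) {x : ℝ} (hx : x ≤ 0) :
    reflect b F x = b * F (-x) * b := by
  rcases hx.lt_or_eq with h | rfl
  · exact if_neg (not_le.2 h)
  · simp [reflect, h0]

theorem reflect_neg {b : A} {F : ℝ → A} (hb : b * b = 1) (h0 : b * F 0 * b = F 0) (x : ℝ) :
    reflect b F (-x) = b * reflect b F x * b := by
  rcases le_total 0 x with h | h
  · rw [reflect_of_nonneg b F h, reflect_of_nonpos h0 (by linarith), neg_neg]
  · rw [reflect_of_nonpos h0 h, reflect_of_nonneg b F (by linarith : 0 ≤ -x)]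
    calc F (-x) = (b * b) * F (-x) * (b * b) := by rw [hb]; simp
      _ = _ := by noncomm_ring

/-- The two compatibility conditions at `0` match the values and the one-sided derivatives of the
two halves. -/
theorem hasDerivAt_reflect {b : A} {F F' : ℝ → A}
    (hF : ∀ x, 0 ≤ x → HasDerivAt F (F' x) x) (h0 : b * F 0 * b = F 0)
    (h0' : -(b * F' 0 * b) = F' 0) (x : ℝ) :
    HasDerivAt (reflect b F) (if 0 ≤ x then F' x else -(b * F' (-x) * b)) x := by
  have hneg : ∀ x, x ≤ 0 → HasDerivAt (fun x => b * F (-x) * b) (-(b * F' (-x) * b)) x := by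
    intro x hx
    have h1 := (hF (-x) (by linarith)).scomp x (hasDerivAt_neg x)
    refine ((h1.const_mul b).mul_const b).congr_deriv ?_
    rw [neg_one_smul]; noncomm_ring
  rcases lt_trichotomy x 0 with h | rfl | h
  · rw [if_neg (not_le.2 h)]
    refine (hneg x h.le).congr_of_eventuallyEq ?_
    filter_upwards [Iio_mem_nhds h] with y hy
    exact reflect_of_nonpos h0 (le_of_lt hy)
  · rw [if_pos le_rfl]
    have h1 : HasDerivWithinAt (reflect b F) (F' 0) (Ici 0) 0 :=
      (hF 0 le_rfl).hasDerivWithinAt.congr (fun y hy => reflect_of_nonneg b F hy)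
        (reflect_of_nonneg b F le_rfl)
    have h2 : HasDerivWithinAt (reflect b F) (F' 0) (Iic 0) 0 := by
      have := (hneg 0 le_rfl).hasDerivWithinAt (s := Iic 0)
      rw [neg_zero, h0'] at this
      exact this.congr (fun y hy => reflect_of_nonpos h0 hy) (reflect_of_nonpos h0 le_rfl)
    have h3 := h2.union h1
    rw [Iic_union_Ici] at h3
    exact hasDerivWithinAt_univ.1 h3
  · rw [if_pos h.le]
    refine (hF x h.le).congr_of_eventuallyEq ?_
    filter_upwards [Ioi_mem_nhds h] with y hy
    exact reflect_of_nonneg b F (le_of_lt hy)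

/-- `Φ` is the fundamental solution of `∂ₓ - M`, and `Ψ` its inverse; `b` intertwines the
equation with its reflection. -/
structure IsFundamental (b : A) (M Φ Ψ : ℝ → A) : Prop where
  zero : Φ 0 = 1
  deriv : ∀ x, HasDerivAt Φ (M x * Φ x) x
  deriv_inv : ∀ x, HasDerivAt Ψ (-(Ψ x * M x)) x
  mul_inv : ∀ x, Φ x * Ψ x = 1
  inv_mul : ∀ x, Ψ x * Φ x = 1
  neg : ∀ x, Φ (-x) = b * Φ x * b
  inv_neg : ∀ x, Ψ (-x) = b * Ψ x * b

theorem IsFundamental.continuous {b : A} {M Φ Ψ : ℝ → A} (h : IsFundamental b M Φ Ψ) :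
    Continuous Φ := continuous_iff_continuousAt.2 fun x => (h.deriv x).continuousAt

theorem IsFundamental.continuous_inv {b : A} {M Φ Ψ : ℝ → A} (h : IsFundamental b M Φ Ψ) :
    Continuous Ψ := continuous_iff_continuousAt.2 fun x => (h.deriv_inv x).continuousAt

/-- The parity `hM` makes the reflection `b y(-x)` of a solution again a solution. The fundamental
solution `Z U Y(0)` of the right half-line therefore determines the one on the whole line, and no
separate analysis at `-∞` is needed. -/
theorem IsConjugation.isFundamental {b m : A} {U P Z Y : ℝ → A} {K ρ B D γ : ℝ}
    (h : IsConjugation m P Z Y B D γ) (hU : IsFlowGroup m U K ρ) (hb : b * b = 1)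
    (hM : ∀ x, b * (m + P (-x)) * b = -(m + P x)) :
    IsFundamental b (fun x => m + P x) (reflect b fun x => Z x * U x * Y 0)
      (reflect b fun x => Z 0 * U (-x) * Y x) := by
  have hΦ0 : Z 0 * U 0 * Y 0 = 1 := by rw [hU.zero, mul_one, h.mul_ZY 0 le_rfl]
  have hΨ0 : Z 0 * U (-0) * Y 0 = 1 := by rw [neg_zero, hΦ0]
  have hbM : ∀ x, b * (m + P x) = -((m + P (-x)) * b) := by
    intro x
    calc b * (m + P x) = b * (m + P (- -x)) * (b * b) := by rw [hb, mul_one, neg_neg]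
      _ = (b * (m + P (- -x)) * b) * b := by noncomm_ring
      _ = _ := by rw [hM]; noncomm_ring
  have hMb : ∀ x, (m + P x) * b = -(b * (m + P (-x))) := by
    intro x; rw [hbM, neg_neg, neg_neg]
  have hΦ : ∀ x, 0 ≤ x → HasDerivAt (fun x => Z x * U x * Y 0)
      ((m + P x) * (Z x * U x * Y 0)) x := by
    intro x hx
    refine (((h.deriv_Z x hx).mul (hU.deriv x)).mul_const (Y 0)).congr_deriv ?_
    noncomm_ring
  have hΨ : ∀ x, 0 ≤ x → HasDerivAt (fun x => Z 0 * U (-x) * Y x)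
      (-(Z 0 * U (-x) * Y x * (m + P x))) x := by
    intro x hx
    refine (((hU.deriv_neg x).const_mul (Z 0)).mul (h.deriv_Y x hx)).congr_deriv ?_
    noncomm_ring
  have h0 : b * (Z 0 * U 0 * Y 0) * b = Z 0 * U 0 * Y 0 := by rw [hΦ0, mul_one, hb]
  have h0' : b * (Z 0 * U (-0) * Y 0) * b = Z 0 * U (-0) * Y 0 := by rw [hΨ0, mul_one, hb]
  have hmul : ∀ x, 0 ≤ x → (Z x * U x * Y 0) * (Z 0 * U (-x) * Y x) = 1 := by
    intro x hx
    calc (Z x * U x * Y 0) * (Z 0 * U (-x) * Y x)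
        = Z x * U x * (Y 0 * Z 0) * U (-x) * Y x := by noncomm_ring
      _ = Z x * (U x * U (-x)) * Y x := by rw [h.mul_YZ 0 le_rfl]; noncomm_ring
      _ = 1 := by rw [hU.mul_neg, mul_one, h.mul_ZY x hx]
  have hmul' : ∀ x, 0 ≤ x → (Z 0 * U (-x) * Y x) * (Z x * U x * Y 0) = 1 := by
    intro x hx
    calc (Z 0 * U (-x) * Y x) * (Z x * U x * Y 0)
        = Z 0 * U (-x) * (Y x * Z x) * U x * Y 0 := by noncomm_ring
      _ = Z 0 * (U (-x) * U x) * Y 0 := by rw [h.mul_YZ x hx]; noncomm_ring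
      _ = 1 := by rw [hU.neg_mul, mul_one, h.mul_ZY 0 le_rfl]
  have hrefl : ∀ F G : ℝ → A, (b * F 0 * b = F 0) → (b * G 0 * b = G 0) →
      (∀ x, 0 ≤ x → F x * G x = 1) → ∀ x, reflect b F x * reflect b G x = 1 := by
    intro F G hF hG hFG x
    rcases le_total 0 x with hx | hx
    · rw [reflect_of_nonneg b F hx, reflect_of_nonneg b G hx, hFG x hx]
    · rw [reflect_of_nonpos hF hx, reflect_of_nonpos hG hx]
      calc b * F (-x) * b * (b * G (-x) * b) = b * F (-x) * (b * b) * G (-x) * b := by noncomm_ring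
        _ = b * (F (-x) * G (-x)) * b := by rw [hb]; noncomm_ring
        _ = 1 := by rw [hFG (-x) (by linarith), mul_one, hb]
  refine ⟨?_, fun x => ?_, fun x => ?_, hrefl _ _ h0 h0' hmul, hrefl _ _ h0' h0 hmul',
    reflect_neg hb h0, reflect_neg hb h0'⟩
  · rw [reflect_of_nonneg b _ le_rfl, hΦ0]
  · refine (hasDerivAt_reflect hΦ h0 ?_ x).congr_deriv ?_
    · rw [hΦ0, mul_one]
      have := hM 0
      rw [neg_zero] at this
      rw [this, neg_neg]
    · split_ifs with hx
      · rw [reflect_of_nonneg b _ hx]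
      · rw [reflect_of_nonpos h0 (not_le.1 hx).le]
        calc _ = -(b * (m + P (-x))) * (Z (-x) * U (-x) * Y 0) * b := by noncomm_ring
          _ = _ := by rw [← hMb]; noncomm_ring
  · refine (hasDerivAt_reflect hΨ h0' ?_ x).congr_deriv ?_
    · have := hM 0
      rw [neg_zero] at this
      rw [hΨ0, one_mul]
      simp only [mul_neg, neg_mul]
      rw [this, neg_neg]
    · split_ifs with hx
      · rw [reflect_of_nonneg b _ hx]
      · rw [reflect_of_nonpos h0' (not_le.1 hx).le]
        have := hbM x
        calc _ = b * (Z 0 * U (- -x) * Y (-x)) * ((m + P (-x)) * b) := by noncomm_ring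
          _ = _ := by rw [← neg_eq_iff_eq_neg.2 this]; noncomm_ring

theorem hasDerivAt_clm_apply {E : Type*} [NormedAddCommGroup E] [NormedSpace ℂ E]
    {T : ℝ → E →L[ℂ] E} {T' : E →L[ℂ] E} {y : ℝ → E} {y' : E} {x : ℝ} (hT : HasDerivAt T T' x)
    (hy : HasDerivAt y y' x) : HasDerivAt (fun x => T x (y x)) (T' (y x) + T x y') x := by
  have h := ((ContinuousLinearMap.restrictScalarsL ℂ E E ℝ ℝ).hasFDerivAt.comp_hasDerivAt x hT)
  exact h.clm_apply hy

/-- Variation of constants: `Ψ y` has derivative zero. -/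
theorem IsFundamental.eq_of_hasDerivAt {E : Type*} [NormedAddCommGroup E] [NormedSpace ℂ E]
    {b : E →L[ℂ] E} {M Φ Ψ : ℝ → E →L[ℂ] E} (h : IsFundamental b M Φ Ψ) {y : ℝ → E}
    (hy : ∀ x, HasDerivAt y (M x (y x)) x) (x : ℝ) : y x = Φ x (y 0) := by
  have hd : ∀ x, HasDerivAt (fun x => Ψ x (y x)) 0 x := by
    intro x
    refine (hasDerivAt_clm_apply (h.deriv_inv x) (hy x)).congr_deriv ?_
    simp
  have hc : Ψ x (y x) = Ψ 0 (y 0) :=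
    is_const_of_deriv_eq_zero (fun x => (hd x).differentiableAt) (fun x => (hd x).deriv) x 0
  have := h.mul_inv x
  calc y x = (Φ x * Ψ x) (y x) := by rw [this]; rfl
    _ = Φ x (Ψ x (y x)) := rfl
    _ = _ := by
      have h0 := h.mul_inv 0
      rw [h.zero, one_mul] at h0
      rw [hc, h0]; rfl

end Conjugation

end GN

namespace GN

/-! ### The function `sinh(κx)/κ` -/

/-- `sinh(κx)/κ`, extended continuously to `κ = 0`. -/
noncomputable def sn (κ : ℂ) (x : ℝ) : ℂ := x * dslope Complex.sinh 0 (κ * x)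

theorem mul_sn (κ : ℂ) (x : ℝ) : κ * sn κ x = Complex.sinh (κ * x) := by
  have h := sub_smul_dslope Complex.sinh 0 (κ * x)
  rw [sub_zero, Complex.sinh_zero, sub_zero, smul_eq_mul] at h
  rw [← h, sn]; ring

theorem sn_zero_left (x : ℝ) : sn 0 x = x := by
  simp [sn, dslope_same, (Complex.hasDerivAt_sinh 0).deriv]

theorem sn_of_ne {κ : ℂ} (hκ : κ ≠ 0) (x : ℝ) : sn κ x = Complex.sinh (κ * x) / κ := by
  rw [← mul_sn, mul_div_cancel_left₀ _ hκ]

theorem sn_zero_right (κ : ℂ) : sn κ 0 = 0 := by simp [sn]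

theorem sn_neg (κ : ℂ) (x : ℝ) : sn κ (-x) = -sn κ x := by
  rcases eq_or_ne κ 0 with rfl | h
  · simp [sn_zero_left]
  · simp [sn_of_ne h, Complex.sinh_neg, neg_div]

theorem continuous_sn : Continuous fun q : ℂ × ℝ => sn q.1 q.2 := by
  have h : Continuous (dslope Complex.sinh 0) := by
    rw [← continuousOn_univ, continuousOn_dslope univ_mem]
    exact ⟨Complex.continuous_sinh.continuousOn, (Complex.hasDerivAt_sinh 0).differentiableAt⟩
  unfold sn
  fun_prop

theorem hasDerivAt_cosh_mul (κ : ℂ) (x : ℝ) :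
    HasDerivAt (fun x : ℝ => Complex.cosh (κ * x)) (κ ^ 2 * sn κ x) x := by
  have h1 : HasDerivAt (fun x : ℝ => κ * (x : ℂ)) κ x := by
    simpa using (Complex.ofRealCLM.hasDerivAt (x := x)).const_mul κ
  refine ((Complex.hasDerivAt_cosh (κ * x)).comp x h1).congr_deriv ?_
  rw [← mul_sn]; ring

theorem hasDerivAt_sn (κ : ℂ) (x : ℝ) : HasDerivAt (sn κ) (Complex.cosh (κ * x)) x := by
  rcases eq_or_ne κ 0 with rfl | h
  · have : sn 0 = fun x : ℝ => (x : ℂ) := funext sn_zero_left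
    rw [this]
    refine (Complex.ofRealCLM.hasDerivAt (x := x)).congr_deriv ?_
    simp
  · have h1 : HasDerivAt (fun x : ℝ => κ * (x : ℂ)) κ x := by
      simpa using (Complex.ofRealCLM.hasDerivAt (x := x)).const_mul κ
    have : sn κ = fun x : ℝ => Complex.sinh (κ * x) / κ := funext (sn_of_ne h)
    rw [this]
    refine (((Complex.hasDerivAt_sinh (κ * x)).comp x h1).div_const κ).congr_deriv ?_
    field_simp

theorem cosh_mul_add (κ : ℂ) (x y : ℝ) : Complex.cosh (κ * (x + y : ℝ)) =
    Complex.cosh (κ * x) * Complex.cosh (κ * y) + κ ^ 2 * (sn κ x * sn κ y) := by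
  have h := Complex.cosh_add (κ * x) (κ * y)
  rw [← mul_sn, ← mul_sn] at h
  push_cast
  rw [mul_add, h]; ring

theorem sn_add (κ : ℂ) (x y : ℝ) :
    sn κ (x + y) = sn κ x * Complex.cosh (κ * y) + Complex.cosh (κ * x) * sn κ y := by
  rcases eq_or_ne κ 0 with rfl | h
  · simp [sn_zero_left]
  · rw [sn_of_ne h, sn_of_ne h, sn_of_ne h]
    push_cast
    rw [mul_add, Complex.sinh_add]; ring

theorem norm_cosh_le (z : ℂ) : ‖Complex.cosh z‖ ≤ Real.exp |z.re| := by
  have h1 : ‖Complex.exp z‖ ≤ Real.exp |z.re| := by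
    rw [Complex.norm_exp]; gcongr; exact le_abs_self _
  have h2 : ‖Complex.exp (-z)‖ ≤ Real.exp |z.re| := by
    rw [Complex.norm_exp]; gcongr; exact neg_le_abs _
  calc ‖Complex.cosh z‖ = ‖Complex.exp z + Complex.exp (-z)‖ / 2 := by simp [Complex.cosh]
    _ ≤ (Real.exp |z.re| + Real.exp |z.re|) / 2 := by
        gcongr; exact (norm_add_le _ _).trans (by gcongr)
    _ = _ := by ring

theorem norm_sinh_le (z : ℂ) : ‖Complex.sinh z‖ ≤ Real.exp |z.re| := by
  have h1 : ‖Complex.exp z‖ ≤ Real.exp |z.re| := by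
    rw [Complex.norm_exp]; gcongr; exact le_abs_self _
  have h2 : ‖Complex.exp (-z)‖ ≤ Real.exp |z.re| := by
    rw [Complex.norm_exp]; gcongr; exact neg_le_abs _
  calc ‖Complex.sinh z‖ = ‖Complex.exp z - Complex.exp (-z)‖ / 2 := by simp [Complex.sinh]
    _ ≤ (Real.exp |z.re| + Real.exp |z.re|) / 2 := by
        gcongr; exact (norm_sub_le _ _).trans (by gcongr)
    _ = _ := by ring

/-- The bound used away from the thresholds: there is no polynomial growth, but the constant
degenerates as `κ → 0`. -/
theorem norm_sn_le_div {κ : ℂ} (hκ : κ ≠ 0) (x : ℝ) :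
    ‖sn κ x‖ ≤ 1 / ‖κ‖ * Real.exp |κ.re * x| := by
  rw [sn_of_ne hκ, norm_div, div_eq_inv_mul, one_div]
  gcongr
  simpa using norm_sinh_le (κ * x)

/-- The mean value inequality for a primitive of `cosh(κx)`. It is uniform as `κ → 0`, at the cost
of the factor `|x|`; this factor is the source of the growth of Green's function at the thresholds.
-/
theorem norm_sn_le (κ : ℂ) (x : ℝ) : ‖sn κ x‖ ≤ |x| * Real.exp |κ.re * x| := by
  wlog hx : 0 ≤ x generalizing x
  · simpa [sn_neg] using this (-x) (by linarith)
  have h := norm_image_sub_le_of_norm_deriv_le_segment' (f := sn κ)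
    (f' := fun y => Complex.cosh (κ * y)) (C := Real.exp |κ.re * x|) (a := 0) (b := x)
    (fun y _ => (hasDerivAt_sn κ y).hasDerivWithinAt) (fun y hy => by
      refine (norm_cosh_le _).trans ?_
      have : (κ * y).re = κ.re * y := by simp
      rw [this, abs_mul, abs_mul, abs_of_nonneg hy.1, abs_of_nonneg hx]
      gcongr
      exact hy.2.le) x ⟨hx, le_rfl⟩
  rw [sn_zero_right, sub_zero, sub_zero] at h
  rw [abs_of_nonneg hx]
  linarith

/-! ### The group generated by a matrix with two channels -/

section Channel

variable {A : Type*} [NormedRing A] [NormedAlgebra ℂ A]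

/-- `pr` are complementary projections commuting with `m`, and `m² = κ_j²` in the channel `j`. -/
structure IsChanneled (m : A) (pr : Fin 2 → A) (κ : Fin 2 → ℂ) : Prop where
  sum : pr 0 + pr 1 = 1
  idem : ∀ j, pr j * pr j = pr j
  orth : ∀ i j, i ≠ j → pr i * pr j = 0
  comm : ∀ j, m * pr j = pr j * m
  sq : ∀ j, pr j * (m * m) = κ j ^ 2 • pr j

/-- `e^{xm}`, when `m` has two channels. -/
noncomputable def chanFlow (m : A) (pr : Fin 2 → A) (κ : Fin 2 → ℂ) (x : ℝ) : A :=
  ∑ j, (Complex.cosh (κ j * x) • pr j + sn (κ j) x • (pr j * m))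

theorem IsChanneled.mul_chanFlow {m : A} {pr : Fin 2 → A} {κ : Fin 2 → ℂ}
    (h : IsChanneled m pr κ) (j : Fin 2) (x : ℝ) : pr j * chanFlow m pr κ x =
      Complex.cosh (κ j * x) • pr j + sn (κ j) x • (pr j * m) := by
  have h1 : ∀ i, i ≠ j → pr j * (Complex.cosh (κ i * x) • pr i + sn (κ i) x • (pr i * m)) = 0 := by
    intro i hi
    rw [mul_add, mul_smul_comm, mul_smul_comm, ← mul_assoc, h.orth j i hi.symm]; simp
  rw [chanFlow, Finset.mul_sum, Finset.sum_eq_single j (fun i _ hi => h1 i hi) (by simp), mul_add,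
    mul_smul_comm, mul_smul_comm, ← mul_assoc, h.idem]

theorem IsChanneled.chanFlow_add {m : A} {pr : Fin 2 → A} {κ : Fin 2 → ℂ}
    (h : IsChanneled m pr κ) (x y : ℝ) :
    chanFlow m pr κ (x + y) = chanFlow m pr κ x * chanFlow m pr κ y := by
  have h1 : ∀ j, (Complex.cosh (κ j * x) • pr j + sn (κ j) x • (pr j * m)) * chanFlow m pr κ y =
      Complex.cosh (κ j * (x + y : ℝ)) • pr j + sn (κ j) (x + y) • (pr j * m) := by
    intro j
    have e1 : pr j * m = m * pr j := (h.comm j).symm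
    have e2 : (pr j * m) * chanFlow m pr κ y =
        Complex.cosh (κ j * y) • (pr j * m) + (κ j ^ 2 * sn (κ j) y) • pr j := by
      rw [e1, mul_assoc, h.mul_chanFlow, mul_add, mul_smul_comm, mul_smul_comm, ← e1,
        ← mul_assoc, ← e1, mul_assoc, h.sq, smul_smul, mul_comm (sn _ _)]
    rw [add_mul, smul_mul_assoc, smul_mul_assoc, h.mul_chanFlow, e2, cosh_mul_add, sn_add]
    module
  conv_rhs => rw [chanFlow, Finset.sum_mul]
  exact (Finset.sum_congr rfl fun j _ => h1 j).symm

theorem IsChanneled.comm_chanFlow {m : A} {pr : Fin 2 → A} {κ : Fin 2 → ℂ}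
    (h : IsChanneled m pr κ) (x : ℝ) : m * chanFlow m pr κ x = chanFlow m pr κ x * m := by
  simp only [chanFlow, Finset.mul_sum, Finset.sum_mul, mul_add, add_mul, mul_smul_comm,
    smul_mul_assoc, ← mul_assoc, h.comm]

theorem hasDerivAt_complex_smul {E : Type*} [NormedAddCommGroup E] [NormedSpace ℂ E] {f : ℝ → ℂ}
    {f' : ℂ} {x : ℝ} (hf : HasDerivAt f f' x) (a : E) :
    HasDerivAt (fun x => f x • a) (f' • a) x := by
  have := ((ContinuousLinearMap.toSpanSingleton ℂ a).restrictScalars ℝ).hasFDerivAt.comp_hasDerivAt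
    x hf
  refine this.congr_deriv ?_
  simp

theorem IsChanneled.isFlowGroup {m : A} {pr : Fin 2 → A} {κ : Fin 2 → ℂ} (h : IsChanneled m pr κ)
    {K ρ : ℝ} (hb : ∀ x, ‖chanFlow m pr κ x‖ ≤ K * Real.exp (ρ * |x|)) :
    IsFlowGroup m (chanFlow m pr κ) K ρ where
  zero := by simp [chanFlow, sn_zero_right, h.sum]
  add := h.chanFlow_add
  comm := h.comm_chanFlow
  bound := hb
  deriv x := by
    have h1 : ∀ j ∈ (Finset.univ : Finset (Fin 2)), HasDerivAt
        (fun x : ℝ => Complex.cosh (κ j * x) • pr j + sn (κ j) x • (pr j * m))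
        ((κ j ^ 2 * sn (κ j) x) • pr j + Complex.cosh (κ j * x) • (pr j * m)) x := fun j _ =>
      (hasDerivAt_complex_smul (hasDerivAt_cosh_mul _ _) _).add
        (hasDerivAt_complex_smul (hasDerivAt_sn _ _) _)
    refine (HasDerivAt.fun_sum h1).congr_deriv ?_
    rw [h.comm_chanFlow, chanFlow, Finset.sum_mul]
    refine Finset.sum_congr rfl fun j _ => ?_
    rw [add_mul, smul_mul_assoc, smul_mul_assoc, mul_assoc, h.sq, smul_smul,
      mul_comm (sn (κ j) x)]
    abel

theorem norm_chanFlow_le (m : A) (pr : Fin 2 → A) (κ : Fin 2 → ℂ) (x : ℝ) {a b : ℝ}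
    (hc : ∀ j, ‖Complex.cosh (κ j * x)‖ ≤ a) (hs : ∀ j, ‖sn (κ j) x‖ ≤ b) :
    ‖chanFlow m pr κ x‖ ≤ (a + b * ‖m‖) * (‖pr 0‖ + ‖pr 1‖) := by
  have h1 : ∀ j, ‖Complex.cosh (κ j * x) • pr j + sn (κ j) x • (pr j * m)‖ ≤
      (a + b * ‖m‖) * ‖pr j‖ := by
    intro j
    have hb : 0 ≤ b := (norm_nonneg _).trans (hs j)
    calc _ ≤ ‖Complex.cosh (κ j * x)‖ * ‖pr j‖ + ‖sn (κ j) x‖ * ‖pr j * m‖ := by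
          rw [← norm_smul, ← norm_smul]; exact norm_add_le _ _
      _ ≤ a * ‖pr j‖ + b * (‖pr j‖ * ‖m‖) := by
          gcongr
          · exact hc j
          · exact hs j
          · exact norm_mul_le _ _
      _ = _ := by ring
  rw [chanFlow, Fin.sum_univ_two, mul_add]
  exact (norm_add_le _ _).trans (add_le_add (h1 0) (h1 1))

/-- `cosh(κx)` and `sinh(κx)/κ` are entire in `κ`, so `κ_j = 0` is not exceptional, although a
diagonalization of `m` would break down there. -/
theorem continuous_chanFlow {Par : Type*} [TopologicalSpace Par] {m : Par → A} {pr : Fin 2 → A}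
    {κ : Par → Fin 2 → ℂ} (hm : Continuous m) (hκ : Continuous κ) :
    Continuous fun q : Par × ℝ => chanFlow (m q.1) pr (κ q.1) q.2 := by
  unfold chanFlow
  refine continuous_finsetSum _ fun j _ => ?_
  have h1 : Continuous fun q : Par × ℝ => sn (κ q.1 j) q.2 :=
    continuous_sn.comp (f := fun q : Par × ℝ => (κ q.1 j, q.2)) (by fun_prop)
  have h2 : Continuous fun q : Par × ℝ => Complex.cosh (κ q.1 j * q.2) :=
    Complex.continuous_cosh.comp (by fun_prop)
  exact (h2.smul continuous_const).add (h1.smul (by fun_prop))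

/-- `Q` is the projection onto the decaying directions of a matrix with two channels. -/
structure IsStableProj (m : A) (pr : Fin 2 → A) (κ : Fin 2 → ℂ) (Q : A) : Prop where
  idem : Q * Q = Q
  comm : ∀ j, Q * pr j = pr j * Q
  left : ∀ j, pr j * (m * Q) = -(κ j • (pr j * Q))
  right : ∀ j, pr j * ((1 - Q) * m) = κ j • (pr j * (1 - Q))

theorem cosh_sub_mul_sn (κ : ℂ) (x : ℝ) :
    Complex.cosh (κ * x) - κ * sn κ x = Complex.exp (-(κ * x)) := by
  rw [mul_sn, Complex.cosh_sub_sinh]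

theorem cosh_add_mul_sn (κ : ℂ) (x : ℝ) :
    Complex.cosh (κ * x) + κ * sn κ x = Complex.exp (κ * x) := by
  rw [mul_sn, Complex.cosh_add_sinh]

/-- On the range of `Q` the two terms combine through `cosh(κx) - κ · sinh(κx)/κ = e^{-κx}`. Pure
exponentials remain, so the stable part has no linear growth even at a threshold. -/
theorem IsStableProj.chanFlow_mul {m Q : A} {pr : Fin 2 → A} {κ : Fin 2 → ℂ}
    (h : IsStableProj m pr κ Q) (x : ℝ) :
    chanFlow m pr κ x * Q = ∑ j, Complex.exp (-(κ j * x)) • (pr j * Q) := by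
  rw [chanFlow, Finset.sum_mul]
  refine Finset.sum_congr rfl fun j _ => ?_
  rw [add_mul, smul_mul_assoc, smul_mul_assoc, mul_assoc, h.left, ← cosh_sub_mul_sn]
  module

theorem IsStableProj.mul_chanFlow {m Q : A} {pr : Fin 2 → A} {κ : Fin 2 → ℂ}
    (h : IsStableProj m pr κ Q) (x : ℝ) :
    (1 - Q) * chanFlow m pr κ x = ∑ j, Complex.exp (κ j * x) • (pr j * (1 - Q)) := by
  rw [chanFlow, Finset.mul_sum]
  refine Finset.sum_congr rfl fun j _ => ?_
  have h1 : (1 - Q) * pr j = pr j * (1 - Q) := by rw [sub_mul, mul_sub, h.comm]; simp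
  rw [mul_add, mul_smul_comm, mul_smul_comm, ← mul_assoc, h1, mul_assoc, h.right,
    ← cosh_add_mul_sn]
  module

end Channel

end GN

namespace GN

/-! ### Matrices as operators -/

/-- The operators on `ℂ⁴`. -/
abbrev Op := (Fin 4 → ℂ) →L[ℂ] (Fin 4 → ℂ)

/-- The operator of a matrix. -/
noncomputable def op : Matrix (Fin 4) (Fin 4) ℂ →ₐ[ℂ] Op :=
  (Module.End.toContinuousLinearMap (𝕜 := ℂ) (Fin 4 → ℂ)).toAlgHom.comp
    (Matrix.toLinAlgEquiv' (R := ℂ) (n := Fin 4)).toAlgHom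

theorem op_apply (m : Matrix (Fin 4) (Fin 4) ℂ) (y : Fin 4 → ℂ) : op m y = m *ᵥ y := rfl

theorem norm_op_le (m : Matrix (Fin 4) (Fin 4) ℂ) : ‖op m‖ ≤ ∑ i, ∑ j, ‖m i j‖ := by
  refine ContinuousLinearMap.opNorm_le_bound _ (by positivity) fun y => ?_
  rw [op_apply]
  refine (pi_norm_le_iff_of_nonneg (by positivity)).2 fun i => ?_
  calc ‖(m *ᵥ y) i‖ ≤ ∑ j, ‖m i j * y j‖ := by
        rw [Matrix.mulVec, dotProduct]; exact norm_sum_le _ _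
    _ ≤ ∑ j, ‖m i j‖ * ‖y‖ := by
        refine Finset.sum_le_sum fun j _ => ?_
        rw [norm_mul]
        gcongr
        exact norm_le_pi_norm y j
    _ = (∑ j, ‖m i j‖) * ‖y‖ := by rw [Finset.sum_mul]
    _ ≤ _ := by
        refine mul_le_mul_of_nonneg_right ?_ (norm_nonneg _)
        exact Finset.single_le_sum (f := fun i => ∑ j, ‖m i j‖)
          (fun i _ => Finset.sum_nonneg fun j _ => norm_nonneg _) (Finset.mem_univ i)

theorem norm_entry_le (m : Matrix (Fin 4) (Fin 4) ℂ) (i j : Fin 4) : ‖m i j‖ ≤ ‖op m‖ := by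
  have h1 : (op m (Pi.single j 1)) i = m i j := by rw [op_apply]; simp
  calc ‖m i j‖ = ‖(op m (Pi.single j 1)) i‖ := by rw [h1]
    _ ≤ ‖op m (Pi.single j 1)‖ := norm_le_pi_norm _ i
    _ ≤ ‖op m‖ * ‖(Pi.single j 1 : Fin 4 → ℂ)‖ := ContinuousLinearMap.le_opNorm _ _
    _ = ‖op m‖ := by rw [Pi.norm_single]; simp

theorem continuous_op {X : Type*} [TopologicalSpace X] {m : X → Matrix (Fin 4) (Fin 4) ℂ}
    (h : ∀ i j, Continuous fun x => m x i j) : Continuous fun x => op (m x) := by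
  have h1 : Continuous (op : Matrix (Fin 4) (Fin 4) ℂ → Op) :=
    op.toLinearMap.continuous_of_finiteDimensional
  exact h1.comp (continuous_matrix h)

theorem op_injective : Function.Injective op := by
  intro m n h
  ext i j
  have := congrArg (fun T : Op => T (Pi.single j 1) i) h
  simpa [op_apply] using this

theorem op_mul_eq_one {s t : Op} (h : s * t = 1) : t * s = 1 := by
  have h1 : (s : (Fin 4 → ℂ) →ₗ[ℂ] (Fin 4 → ℂ)) ∘ₗ (t : (Fin 4 → ℂ) →ₗ[ℂ] (Fin 4 → ℂ)) =
      LinearMap.id := LinearMap.ext fun y => congrArg (fun T : Op => T y) h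
  have h2 := (LinearMap.comp_eq_id_comm _ _).1 h1
  exact ContinuousLinearMap.ext fun y =>
    congrArg (fun T : (Fin 4 → ℂ) →ₗ[ℂ] (Fin 4 → ℂ) => T y) h2

/-! ### The free system -/

/-- `ζ = ω ∓ iμ` in the two channels. -/
noncomputable def zc (j : Fin 2) (μ : ℂ) (ω : ℝ) : ℂ :=
  if j = 0 then ω - Complex.I * μ else ω + Complex.I * μ

theorem zc_boundary (j : Fin 2) (ω Λ : ℝ) : zc j (Complex.I * Λ) ω = zeta j ω Λ := by
  have : Complex.I * (Complex.I * (Λ : ℂ)) = -Λ := by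
    rw [← mul_assoc, Complex.I_mul_I]; ring
  fin_cases j <;> simp [zc, zeta, this]
  ring

/-- The matrix of the system for `W = 0`. -/
noncomputable def freeM (μ : ℂ) (ω : ℝ) : Matrix (Fin 4) (Fin 4) ℂ :=
  matα * matJ * matβ - (ω : ℂ) • (matα * matJ) - μ • matα

/-- The projections onto the two channels. -/
noncomputable def chan (j : Fin 2) : Matrix (Fin 4) (Fin 4) ℂ :=
  if j = 0 then (1 / 2 : ℂ) • (1 - Complex.I • matJ) else (1 / 2 : ℂ) • (1 + Complex.I • matJ)

/-- `diag(σ₁, σ₁)`. -/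
def matX : Matrix (Fin 4) (Fin 4) ℂ :=
  !![0, 1, 0, 0; 1, 0, 0, 0; 0, 0, 0, 1; 0, 0, 1, 0]

/-- The projection of the channel onto the decaying direction. -/
noncomputable def chanQ (z κ : ℂ) : Matrix (Fin 4) (Fin 4) ℂ :=
  (1 / 2 : ℂ) • (1 + z • matβ + κ • matX)

/-- `diag(s, s)`, `s = Im σ₂`. -/
def matS : Matrix (Fin 4) (Fin 4) ℂ :=
  !![0, -1, 0, 0; 1, 0, 0, 0; 0, 0, 0, -1; 0, 0, 1, 0]

theorem matJ_mul_matJ : matJ * matJ = -1 := by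
  ext i j; fin_cases i <;> fin_cases j <;>
    simp [matJ, Matrix.mul_apply, Fin.sum_univ_four]

theorem matα_mul_matα : matα * matα = 1 := by
  ext i j; fin_cases i <;> fin_cases j <;>
    simp [matα, Matrix.mul_apply, Fin.sum_univ_four]

theorem matβ_mul_matβ : matβ * matβ = 1 := by
  ext i j; fin_cases i <;> fin_cases j <;>
    simp [matβ, Matrix.mul_apply, Fin.sum_univ_four]

theorem matX_mul_matX : matX * matX = 1 := by
  ext i j; fin_cases i <;> fin_cases j <;>
    simp [matX, Matrix.mul_apply, Fin.sum_univ_four]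

theorem matS_mul_matS : matS * matS = -1 := by
  ext i j; fin_cases i <;> fin_cases j <;>
    simp [matS, Matrix.mul_apply, Fin.sum_univ_four]

theorem matα_mul_matJ : matα * matJ = -matS := by
  ext i j; fin_cases i <;> fin_cases j <;>
    simp [matα, matJ, matS, Matrix.mul_apply, Fin.sum_univ_four]

theorem matα_eq : matα = matJ * matS := by
  ext i j; fin_cases i <;> fin_cases j <;>
    simp [matα, matJ, matS, Matrix.mul_apply, Fin.sum_univ_four]

theorem matS_mul_matJ : matS * matJ = matJ * matS := by
  ext i j; fin_cases i <;> fin_cases j <;>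
    simp [matJ, matS, Matrix.mul_apply, Fin.sum_univ_four]

theorem matβ_mul_matJ : matβ * matJ = matJ * matβ := by
  ext i j; fin_cases i <;> fin_cases j <;>
    simp [matβ, matJ, Matrix.mul_apply, Fin.sum_univ_four]

theorem matX_mul_matJ : matX * matJ = matJ * matX := by
  ext i j; fin_cases i <;> fin_cases j <;>
    simp [matJ, matX, Matrix.mul_apply, Fin.sum_univ_four]

theorem matS_mul_matβ : matS * matβ = matX := by
  ext i j; fin_cases i <;> fin_cases j <;>
    simp [matβ, matX, matS, Matrix.mul_apply, Fin.sum_univ_four]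

theorem matβ_mul_matS : matβ * matS = -matX := by
  ext i j; fin_cases i <;> fin_cases j <;>
    simp [matβ, matX, matS, Matrix.mul_apply, Fin.sum_univ_four]

theorem matS_mul_matX : matS * matX = -matβ := by
  ext i j; fin_cases i <;> fin_cases j <;>
    simp [matβ, matX, matS, Matrix.mul_apply, Fin.sum_univ_four]

theorem matX_mul_matS : matX * matS = matβ := by
  ext i j; fin_cases i <;> fin_cases j <;>
    simp [matβ, matX, matS, Matrix.mul_apply, Fin.sum_univ_four]

theorem matX_mul_matβ : matX * matβ = matS := by
  ext i j; fin_cases i <;> fin_cases j <;>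
    simp [matβ, matX, matS, Matrix.mul_apply, Fin.sum_univ_four]

theorem matβ_mul_matX : matβ * matX = -matS := by
  ext i j; fin_cases i <;> fin_cases j <;>
    simp [matβ, matX, matS, Matrix.mul_apply, Fin.sum_univ_four]

theorem chan_mul_matJ (j : Fin 2) : chan j * matJ =
    (if j = 0 then Complex.I else -Complex.I) • chan j := by
  fin_cases j
  · simp only [chan, Fin.zero_eta, if_true, sub_mul, smul_mul_assoc, matJ_mul_matJ, one_mul]
    match_scalars <;> ring_nf
    norm_num
  · simp only [chan, Fin.mk_one, one_ne_zero, if_false, add_mul, smul_mul_assoc, matJ_mul_matJ,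
      one_mul]
    match_scalars <;> ring_nf
    norm_num

theorem comm_chan {B : Matrix (Fin 4) (Fin 4) ℂ} (h : B * matJ = matJ * B) (j : Fin 2) :
    B * chan j = chan j * B := by
  fin_cases j <;> simp [chan, mul_add, add_mul, mul_sub, sub_mul, h]

theorem chan_sum : chan 0 + chan 1 = 1 := by
  simp only [chan, if_true, one_ne_zero, if_false]
  module

theorem chan_idem (j : Fin 2) : chan j * chan j = chan j := by
  have h := chan_mul_matJ j
  fin_cases j
  · simp only [Fin.zero_eta, if_true] at h ⊢
    conv_lhs => rhs; simp only [chan, if_true]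
    rw [mul_smul_comm, mul_sub, mul_one, mul_smul_comm, h, smul_smul, Complex.I_mul_I]
    module
  · simp only [Fin.mk_one, one_ne_zero, if_false] at h ⊢
    conv_lhs => rhs; simp only [chan, one_ne_zero, if_false]
    rw [mul_smul_comm, mul_add, mul_one, mul_smul_comm, h, smul_smul, mul_neg, Complex.I_mul_I]
    module

theorem chan_orth (i j : Fin 2) (h : i ≠ j) : chan i * chan j = 0 := by
  have h1 : chan j = 1 - chan i := by
    rw [← chan_sum]
    fin_cases i <;> fin_cases j <;> simp_all
  rw [h1, mul_sub, mul_one, chan_idem, sub_self]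

/-- In the channel `j` the free system is `∂ₓ + X - ζ_j S`. -/
theorem chan_mul_freeM (j : Fin 2) (μ : ℂ) (ω : ℝ) :
    chan j * freeM μ ω = chan j * (zc j μ ω • matS - matX) := by
  have h1 : freeM μ ω = -matX + (ω : ℂ) • matS - μ • (matJ * matS) := by
    rw [freeM, matα_mul_matJ, ← matα_eq, neg_mul, matS_mul_matβ]
    module
  have h := chan_mul_matJ j
  rw [h1, mul_sub, mul_smul_comm, ← mul_assoc, h, mul_add, mul_sub]
  fin_cases j <;> simp [zc, smul_smul] <;> module

theorem freeM_comm_matJ (μ : ℂ) (ω : ℝ) : freeM μ ω * matJ = matJ * freeM μ ω := by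
  have h1 : freeM μ ω = -matX + (ω : ℂ) • matS - μ • (matJ * matS) := by
    rw [freeM, matα_mul_matJ, ← matα_eq, neg_mul, matS_mul_matβ]
    module
  rw [h1]
  simp only [sub_mul, add_mul, mul_sub, mul_add, neg_mul, mul_neg, smul_mul_assoc, mul_smul_comm,
    matX_mul_matJ, matS_mul_matJ, mul_assoc]

theorem chan_mul_freeM_mul (j : Fin 2) (μ : ℂ) (ω : ℝ) (B : Matrix (Fin 4) (Fin 4) ℂ) :
    chan j * (freeM μ ω * B) = chan j * ((zc j μ ω • matS - matX) * B) := by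
  rw [← mul_assoc, chan_mul_freeM, mul_assoc]

theorem channelM_comm_matJ (z : ℂ) :
    (z • matS - matX) * matJ = matJ * (z • matS - matX) := by
  simp only [sub_mul, mul_sub, smul_mul_assoc, mul_smul_comm, matX_mul_matJ, matS_mul_matJ]

/-- `matS` and `matX` anticommute with squares `-1` and `1`, so the square of any combination of
them is a scalar. -/
theorem channelM_sq (z : ℂ) : (z • matS - matX) * (z • matS - matX) =
    (1 - z ^ 2) • (1 : Matrix (Fin 4) (Fin 4) ℂ) := by
  simp only [sub_mul, mul_sub, smul_mul_assoc, mul_smul_comm, matX_mul_matX, matS_mul_matS,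
    matX_mul_matS, matS_mul_matX]
  module

theorem freeM_isChanneled {μ : ℂ} {ω : ℝ} {κ : Fin 2 → ℂ}
    (hκ : ∀ j, κ j ^ 2 = 1 - zc j μ ω ^ 2) :
    IsChanneled (op (freeM μ ω)) (fun j => op (chan j)) κ where
  sum := by rw [← map_add, chan_sum, map_one]
  idem j := by rw [← map_mul, chan_idem]
  orth i j h := by rw [← map_mul, chan_orth i j h, map_zero]
  comm j := by rw [← map_mul, ← map_mul, comm_chan (freeM_comm_matJ μ ω)]
  sq j := by
    rw [← map_mul, ← map_mul, ← map_smul, chan_mul_freeM_mul,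
      show chan j * ((zc j μ ω • matS - matX) * freeM μ ω) =
        (zc j μ ω • matS - matX) * (chan j * freeM μ ω) by
        rw [← mul_assoc, ← mul_assoc, comm_chan (channelM_comm_matJ _)], chan_mul_freeM,
      ← mul_assoc, comm_chan (channelM_comm_matJ _), mul_assoc, channelM_sq, hκ, mul_smul_comm,
      mul_one]

theorem chanQ_comm_matJ (z κ : ℂ) : chanQ z κ * matJ = matJ * chanQ z κ := by
  simp only [chanQ, smul_mul_assoc, mul_smul_comm, add_mul, mul_add, matX_mul_matJ,
    matβ_mul_matJ, one_mul, mul_one]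

theorem chanQ_idem {z κ : ℂ} (h : κ ^ 2 = 1 - z ^ 2) : chanQ z κ * chanQ z κ = chanQ z κ := by
  simp only [chanQ, smul_mul_assoc, mul_smul_comm, add_mul, mul_add, matX_mul_matX,
    matβ_mul_matβ, matX_mul_matβ, matβ_mul_matX, one_mul, mul_one, smul_add, smul_smul]
  have h' : 1 / 2 * κ * (1 / 2 * κ) = 1 / 4 * (1 - z * z) := by linear_combination h / 4
  rw [h']
  module

theorem channelM_mul_chanQ {z κ : ℂ} (h : κ ^ 2 = 1 - z ^ 2) :
    (z • matS - matX) * chanQ z κ = -(κ • chanQ z κ) := by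
  simp only [chanQ, smul_mul_assoc, mul_smul_comm, sub_mul, mul_add, matX_mul_matX,
    matX_mul_matβ, matS_mul_matβ, matS_mul_matX, mul_one, smul_add, smul_smul, smul_sub]
  have h' : κ * (1 / 2 * κ) = 1 / 2 - z * (1 / 2) * z := by linear_combination h / 2
  rw [h']
  module

theorem one_sub_chanQ_mul_channelM {z κ : ℂ} (h : κ ^ 2 = 1 - z ^ 2) :
    (1 - chanQ z κ) * (z • matS - matX) = κ • (1 - chanQ z κ) := by
  have e : (1 : Matrix (Fin 4) (Fin 4) ℂ) - chanQ z κ = chanQ (-z) (-κ) := by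
    simp only [chanQ]; module
  rw [e]
  simp only [chanQ, smul_mul_assoc, mul_smul_comm, mul_sub, add_mul, matX_mul_matX,
    matX_mul_matS, matβ_mul_matS, matβ_mul_matX, one_mul, smul_add, smul_smul]
  have h' : κ * (1 / 2 * -κ) = -(1 / 2) + z * (1 / 2) * z := by linear_combination -h / 2
  rw [h']
  module

/-- The projection onto the decaying directions of the free system. -/
noncomputable def stab (μ : ℂ) (ω : ℝ) (κ : Fin 2 → ℂ) : Matrix (Fin 4) (Fin 4) ℂ :=
  ∑ j, chan j * chanQ (zc j μ ω) (κ j)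

theorem chan_mul_stab (μ : ℂ) (ω : ℝ) (κ : Fin 2 → ℂ) (j : Fin 2) :
    chan j * stab μ ω κ = chan j * chanQ (zc j μ ω) (κ j) := by
  rw [stab, Finset.mul_sum, Finset.sum_eq_single j, ← mul_assoc, chan_idem]
  · intro i _ hi
    rw [← mul_assoc, chan_orth j i hi.symm, zero_mul]
  · simp

theorem stab_comm_chan (μ : ℂ) (ω : ℝ) (κ : Fin 2 → ℂ) (j : Fin 2) :
    stab μ ω κ * chan j = chan j * stab μ ω κ := by
  refine comm_chan ?_ j
  rw [stab, Finset.sum_mul, Finset.mul_sum]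
  refine Finset.sum_congr rfl fun i _ => ?_
  rw [mul_assoc, chanQ_comm_matJ, ← mul_assoc, ← comm_chan rfl, mul_assoc]

theorem eq_of_chan_mul {B C : Matrix (Fin 4) (Fin 4) ℂ} (h : ∀ j, chan j * B = chan j * C) :
    B = C := by
  rw [← one_mul B, ← one_mul C, ← chan_sum, add_mul, add_mul, h 0, h 1]

/-- The projection `(1 + zβ + κX)/2` is polynomial in `z` and `κ`, hence continuous through `κ = 0`,
where the spectral projection with its factor `κ⁻¹` blows up. The price is that it does not commute
with `m` in general: its range is invariant, while its kernel need not be. -/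
theorem stab_isStableProj {μ : ℂ} {ω : ℝ} {κ : Fin 2 → ℂ}
    (hκ : ∀ j, κ j ^ 2 = 1 - zc j μ ω ^ 2) :
    IsStableProj (op (freeM μ ω)) (fun j => op (chan j)) κ (op (stab μ ω κ)) where
  idem := by
    rw [← map_mul]
    congr 1
    refine eq_of_chan_mul fun j => ?_
    rw [← mul_assoc, chan_mul_stab, ← comm_chan (chanQ_comm_matJ _ _), mul_assoc, chan_mul_stab,
      ← mul_assoc, comm_chan (chanQ_comm_matJ _ _), mul_assoc, chanQ_idem (hκ j)]
  comm j := by rw [← map_mul, ← map_mul, stab_comm_chan]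
  left j := by
    rw [← map_mul, ← map_mul, ← map_mul, ← map_smul, ← map_neg, chan_mul_freeM_mul,
      ← mul_assoc, ← comm_chan (channelM_comm_matJ _), mul_assoc, chan_mul_stab,
      ← mul_assoc, comm_chan (channelM_comm_matJ _), mul_assoc, channelM_mul_chanQ (hκ j)]
    simp
  right j := by
    rw [← map_one op, ← map_sub, ← map_mul, ← map_mul, ← map_mul, ← map_smul]
    congr 1
    have h1 : chan j * (1 - stab μ ω κ) = chan j * (1 - chanQ (zc j μ ω) (κ j)) := by
      rw [mul_sub, mul_sub, chan_mul_stab]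
    have h2 : (1 - chanQ (zc j μ ω) (κ j)) * matJ = matJ * (1 - chanQ (zc j μ ω) (κ j)) := by
      rw [sub_mul, mul_sub, chanQ_comm_matJ]; simp
    rw [← mul_assoc, h1, ← comm_chan h2, mul_assoc, chan_mul_freeM, ← mul_assoc, comm_chan h2,
      mul_assoc, one_sub_chanQ_mul_channelM (hκ j), mul_smul_comm]

end GN

namespace GN

/-! ### The rates `κ_j = -i ξ_j` -/

/-- The square root of `1 - z²` with non-negative real part in the closed upper half-plane. -/
noncomputable def kup (z : ℂ) : ℂ :=
  (-Complex.I * (1 + z)) ^ (2⁻¹ : ℂ) * (Complex.I * (1 - z)) ^ (2⁻¹ : ℂ)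

theorem cpow_half_sq (w : ℂ) : (w ^ (2⁻¹ : ℂ)) ^ 2 = w := by
  exact Complex.cpow_nat_inv_pow w two_ne_zero

theorem kup_sq (z : ℂ) : kup z ^ 2 = 1 - z ^ 2 := by
  rw [kup, mul_pow, cpow_half_sq, cpow_half_sq]
  linear_combination (-(1 - z ^ 2)) * Complex.I_sq

theorem sq_im_cpow_half (w : ℂ) :
    (w ^ (2⁻¹ : ℂ)).im ^ 2 = (w ^ (2⁻¹ : ℂ)).re ^ 2 - w.re := by
  have h := congrArg Complex.re (cpow_half_sq w)
  rw [sq, Complex.mul_re] at h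
  linarith

theorem re_cpow_half_nonneg (w : ℂ) : 0 ≤ (w ^ (2⁻¹ : ℂ)).re := by
  rw [Complex.cpow_inv_two_re]; positivity

/-- Both numbers under the roots have real part `Im z ≥ 0`. Their principal roots therefore lie in
the sector `|Im| ≤ Re`, and a product of two elements of this sector has non-negative real part. -/
theorem re_kup_nonneg {z : ℂ} (hz : 0 ≤ z.im) : 0 ≤ (kup z).re := by
  set p := (-Complex.I * (1 + z)) ^ (2⁻¹ : ℂ) with hp
  set q := (Complex.I * (1 - z)) ^ (2⁻¹ : ℂ) with hq
  have h1 : p.im ^ 2 ≤ p.re ^ 2 := by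
    have := sq_im_cpow_half (-Complex.I * (1 + z))
    rw [show (-Complex.I * (1 + z)).re = z.im by simp, ← hp] at this
    linarith
  have h2 : q.im ^ 2 ≤ q.re ^ 2 := by
    have := sq_im_cpow_half (Complex.I * (1 - z))
    rw [show (Complex.I * (1 - z)).re = z.im by simp, ← hq] at this
    linarith
  have h3 : |p.im| ≤ p.re := abs_le_of_sq_le_sq h1 (re_cpow_half_nonneg _)
  have h4 : |q.im| ≤ q.re := abs_le_of_sq_le_sq h2 (re_cpow_half_nonneg _)
  have h5 : p.im * q.im ≤ p.re * q.re := by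
    calc p.im * q.im ≤ |p.im * q.im| := le_abs_self _
      _ = |p.im| * |q.im| := abs_mul _ _
      _ ≤ _ := mul_le_mul h3 h4 (abs_nonneg _) (re_cpow_half_nonneg _)
  change 0 ≤ (p * q).re
  rw [Complex.mul_re]; linarith

theorem re_kup_pos {z : ℂ} (hz : 0 < z.im) : 0 < (kup z).re := by
  set p := (-Complex.I * (1 + z)) ^ (2⁻¹ : ℂ) with hp
  set q := (Complex.I * (1 - z)) ^ (2⁻¹ : ℂ) with hq
  have h1 : p.im ^ 2 < p.re ^ 2 := by
    have := sq_im_cpow_half (-Complex.I * (1 + z))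
    rw [show (-Complex.I * (1 + z)).re = z.im by simp, ← hp] at this
    linarith
  have h2 : q.im ^ 2 < q.re ^ 2 := by
    have := sq_im_cpow_half (Complex.I * (1 - z))
    rw [show (Complex.I * (1 - z)).re = z.im by simp, ← hq] at this
    linarith
  have h3 : |p.im| < p.re := abs_lt_of_sq_lt_sq h1 (re_cpow_half_nonneg _)
  have h4 : |q.im| < q.re := abs_lt_of_sq_lt_sq h2 (re_cpow_half_nonneg _)
  have h5 : p.im * q.im < p.re * q.re := by
    calc p.im * q.im ≤ |p.im * q.im| := le_abs_self _
      _ = |p.im| * |q.im| := abs_mul _ _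
      _ < _ := mul_lt_mul'' h3 h4 (abs_nonneg _) (abs_nonneg _)
  change 0 < (p * q).re
  rw [Complex.mul_re]; linarith

/-- The closed right half-plane meets the cut of the principal root only at `0`, where a power with
positive exponent is still continuous. The root of the product `1 - z²` would meet the cut at every
real `z` with `|z| > 1`, that is, on the continuous spectrum. -/
theorem continuousAt_kup {z : ℂ} (hz : 0 ≤ z.im) : ContinuousAt kup z := by
  have h1 : ContinuousAt (fun w : ℂ => w ^ (2⁻¹ : ℂ)) (-Complex.I * (1 + z)) :=
    Complex.continuousAt_cpow_const_of_re_pos (Or.inl (by simp [hz])) (by norm_num)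
  have h2 : ContinuousAt (fun w : ℂ => w ^ (2⁻¹ : ℂ)) (Complex.I * (1 - z)) :=
    Complex.continuousAt_cpow_const_of_re_pos (Or.inl (by simp [hz])) (by norm_num)
  exact (h1.comp (f := fun z => -Complex.I * (1 + z)) (by fun_prop)).mul
    (h2.comp (f := fun z => Complex.I * (1 - z)) (by fun_prop))

theorem cpow_half_I_mul_of_nonneg {t : ℝ} (ht : 0 ≤ t) :
    (Complex.I * (t : ℂ)) ^ (2⁻¹ : ℂ) = √(t / 2) * (1 + Complex.I) := by
  apply Complex.ext
  · rw [Complex.cpow_inv_two_re]; simp [abs_of_nonneg ht]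
  · rw [Complex.cpow_inv_two_im_eq_sqrt (by simpa using ht)]; simp [abs_of_nonneg ht]

theorem cpow_half_neg_I_mul_of_nonneg {t : ℝ} (ht : 0 ≤ t) :
    (-Complex.I * (t : ℂ)) ^ (2⁻¹ : ℂ) = √(t / 2) * (1 - Complex.I) := by
  rcases ht.eq_or_lt with rfl | h
  · simp
  apply Complex.ext
  · rw [Complex.cpow_inv_two_re]; simp [abs_of_nonneg ht]
  · rw [Complex.cpow_inv_two_im_eq_neg_sqrt (by simpa using h)]; simp [abs_of_nonneg ht]

theorem kup_of_abs_le {t : ℝ} (ht : |t| ≤ 1) : kup t = √(1 - t ^ 2) := by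
  obtain ⟨h1, h2⟩ := abs_le.1 ht
  have e1 := cpow_half_neg_I_mul_of_nonneg (t := 1 + t) (by linarith)
  have e2 := cpow_half_I_mul_of_nonneg (t := 1 - t) (by linarith)
  push_cast at e1 e2
  have h3 : √(1 - t ^ 2) = 2 * (√((1 + t) / 2) * √((1 - t) / 2)) := by
    rw [← Real.sqrt_mul (by linarith), show 1 - t ^ 2 = 2 ^ 2 * ((1 + t) / 2 * ((1 - t) / 2)) by
      ring, Real.sqrt_mul (by norm_num), Real.sqrt_sq (by norm_num)]
  rw [kup, e1, e2, h3]
  push_cast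
  linear_combination (-(√((1 + t) / 2) : ℂ) * √((1 - t) / 2)) * Complex.I_sq

theorem kup_of_one_le {t : ℝ} (ht : 1 ≤ t) : kup t = -Complex.I * √(t ^ 2 - 1) := by
  have e1 := cpow_half_neg_I_mul_of_nonneg (t := 1 + t) (by linarith)
  have e2 := cpow_half_neg_I_mul_of_nonneg (t := t - 1) (by linarith)
  push_cast at e1 e2
  have h3 : √(t ^ 2 - 1) = 2 * (√((1 + t) / 2) * √((t - 1) / 2)) := by
    rw [← Real.sqrt_mul (by linarith), show t ^ 2 - 1 = 2 ^ 2 * ((1 + t) / 2 * ((t - 1) / 2)) by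
      ring, Real.sqrt_mul (by norm_num), Real.sqrt_sq (by norm_num)]
  rw [kup, e1, show Complex.I * (1 - (t : ℂ)) = -Complex.I * (t - 1) by ring, e2, h3]
  push_cast
  linear_combination ((√((1 + t) / 2) : ℂ) * √((t - 1) / 2)) * Complex.I_sq

theorem kup_of_le_neg_one {t : ℝ} (ht : t ≤ -1) : kup t = Complex.I * √(t ^ 2 - 1) := by
  have e1 := cpow_half_I_mul_of_nonneg (t := -(1 + t)) (by linarith)
  have e2 := cpow_half_I_mul_of_nonneg (t := 1 - t) (by linarith)
  push_cast at e1 e2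
  have h3 : √(t ^ 2 - 1) = 2 * (√(-(1 + t) / 2) * √((1 - t) / 2)) := by
    rw [← Real.sqrt_mul (by linarith), show t ^ 2 - 1 = 2 ^ 2 * (-(1 + t) / 2 * ((1 - t) / 2)) by
      ring, Real.sqrt_mul (by norm_num), Real.sqrt_sq (by norm_num)]
  rw [kup, e2, show -Complex.I * (1 + (t : ℂ)) = Complex.I * -(1 + t) by ring, e1, h3]
  push_cast
  linear_combination ((√(-(1 + t) / 2) : ℂ) * √((1 - t) / 2)) * Complex.I_sq

/-- If `|Re κ| > 9/8`, then `(Re κ)² - 1 > 1/4 ≥ (Im z)²`, so the real part of the equation gives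
`|Im κ| > |Re z|`. This contradicts `Re κ · Im κ = -Re z · Im z`. -/
theorem abs_re_le_of_sq {κ z : ℂ} (h : κ ^ 2 = 1 - z ^ 2) (hz : |z.im| ≤ 1 / 2) :
    |κ.re| ≤ 9 / 8 := by
  have h1 := congrArg Complex.re h
  have h2 := congrArg Complex.im h
  simp only [sq, Complex.mul_re, Complex.mul_im, Complex.sub_re, Complex.sub_im, Complex.one_re,
    Complex.one_im] at h1 h2
  have h3 : z.im ^ 2 ≤ 1 / 4 := by
    have := sq_le_sq' (abs_le.1 hz).1 (abs_le.1 hz).2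
    linarith
  have h4 : κ.re * κ.im = -(z.re * z.im) := by linarith
  have h5 : (κ.re * κ.im) ^ 2 = (z.re * z.im) ^ 2 := by rw [h4]; ring
  refine abs_le_of_sq_le_sq ?_ (by norm_num)
  by_contra hc
  push Not at hc
  have h6 : κ.im ^ 2 = κ.re ^ 2 - 1 + z.re ^ 2 - z.im ^ 2 := by linarith
  have h7 : z.re ^ 2 ≤ κ.im ^ 2 := by rw [h6]; nlinarith
  have h8 : κ.re ^ 2 * κ.im ^ 2 = z.re ^ 2 * z.im ^ 2 := by
    rwa [mul_pow, mul_pow] at h5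
  have h9 : 0 < κ.im ^ 2 := by nlinarith [sq_nonneg z.re]
  nlinarith [mul_le_mul_of_nonneg_left h3 (sq_nonneg z.re)]

/-- The rate of decay `κ_j = -i ξ_j` of the channel `j`, on the given side of the axis. -/
noncomputable def kap (σ : Side) (μ : ℂ) (ω : ℝ) (j : Fin 2) : ℂ :=
  kup (((if j = 0 then -σ.sgn else σ.sgn : ℝ) : ℂ) * zc j μ ω)

theorem Side.sgn_sq (σ : Side) : σ.sgn * σ.sgn = 1 := by cases σ <;> simp [Side.sgn]

theorem Side.abs_sgn (σ : Side) : |σ.sgn| = 1 := by cases σ <;> simp [Side.sgn]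

theorem kap_sq (σ : Side) (μ : ℂ) (ω : ℝ) (j : Fin 2) :
    kap σ μ ω j ^ 2 = 1 - zc j μ ω ^ 2 := by
  rw [kap, kup_sq, mul_pow]
  have : ((if j = 0 then -σ.sgn else σ.sgn : ℝ) : ℂ) ^ 2 = 1 := by
    rw [← Complex.ofReal_pow]
    split_ifs <;> simp [sq, σ.sgn_sq]
  rw [this, one_mul]

theorem im_side_zc (σ : Side) (μ : ℂ) (ω : ℝ) (j : Fin 2) :
    (((if j = 0 then -σ.sgn else σ.sgn : ℝ) : ℂ) * zc j μ ω).im = σ.sgn * μ.re := by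
  fin_cases j <;> simp [zc]

theorem re_kap_nonneg {σ : Side} {μ : ℂ} (h : 0 ≤ σ.sgn * μ.re) (ω : ℝ) (j : Fin 2) :
    0 ≤ (kap σ μ ω j).re := re_kup_nonneg (by rwa [im_side_zc])

theorem re_kap_pos {σ : Side} {μ : ℂ} (h : 0 < σ.sgn * μ.re) (ω : ℝ) (j : Fin 2) :
    0 < (kap σ μ ω j).re := re_kup_pos (by rwa [im_side_zc])

theorem abs_re_kap_le (σ : Side) {μ : ℂ} (hμ : |μ.re| ≤ 1 / 2) (ω : ℝ) (j : Fin 2) :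
    |(kap σ μ ω j).re| ≤ 9 / 8 := by
  refine abs_re_le_of_sq (kap_sq σ μ ω j) ?_
  fin_cases j <;> simpa [zc] using hμ

theorem continuousAt_kap {σ : Side} {q : ℂ × ℝ} (h : 0 ≤ σ.sgn * q.1.re) :
    ContinuousAt (fun q : ℂ × ℝ => kap σ q.1 q.2) q := by
  refine continuousAt_pi.2 fun j => ?_
  have h1 : Continuous fun q : ℂ × ℝ => zc j q.1 q.2 := by
    unfold zc; split_ifs <;> fun_prop
  exact (continuousAt_kup (by rwa [im_side_zc])).comp
    (f := fun q : ℂ × ℝ => ((if j = 0 then -σ.sgn else σ.sgn : ℝ) : ℂ) * zc j q.1 q.2)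
    (by fun_prop)

/-- The sign `e` is chosen so that an approach from the side `σ` becomes an approach from the upper
half-plane. Wherever `|ζ_j| ≥ 1`, the bound `|ω| < 1` forces the sign of `ζ_j` to be that of `Λ` for
`j = 0` and of `-Λ` for `j = 1`; this is how the sign of `Λ` in `xi` arises. -/
theorem kap_boundary (σ : Side) {ω : ℝ} (hω : |ω| < 1) (Λ : ℝ) (j : Fin 2) :
    kap σ (Complex.I * Λ) ω j = -(Complex.I * xi σ j ω Λ) := by
  obtain ⟨h1, h2⟩ := abs_lt.1 hω
  set e : ℝ := if j = 0 then -σ.sgn else σ.sgn with he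
  have hz := zc_boundary j ω Λ
  have hej : (j = 0 ∧ e = -σ.sgn ∧ zeta j ω Λ = ω + Λ) ∨
      (j = 1 ∧ e = σ.sgn ∧ zeta j ω Λ = ω - Λ) := by
    fin_cases j
    · exact Or.inl ⟨rfl, rfl, rfl⟩
    · exact Or.inr ⟨rfl, rfl, rfl⟩
  have hk : kap σ (Complex.I * Λ) ω j = kup ((e * zeta j ω Λ : ℝ) : ℂ) := by
    rw [kap, hz]; push_cast; rfl
  have he2 : e * e = 1 := by rw [he]; split_ifs <;> simp [σ.sgn_sq]
  have hsq : (e * zeta j ω Λ) ^ 2 = zeta j ω Λ ^ 2 := by rw [mul_pow, sq e, he2, one_mul]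
  have habs : |e * zeta j ω Λ| = |zeta j ω Λ| := by
    rw [abs_mul]
    have : |e| = 1 := by rw [he]; split_ifs <;> simp [σ.abs_sgn]
    rw [this, one_mul]
  rw [hk, xi]
  split_ifs with h
  · have hs : (e * zeta j ω Λ ≤ -1 ∧ -σ.sgn * Real.sign Λ = -1) ∨
        (1 ≤ e * zeta j ω Λ ∧ -σ.sgn * Real.sign Λ = 1) := by
      have hσ : σ.sgn = 1 ∨ σ.sgn = -1 := by cases σ <;> simp [Side.sgn]
      rcases lt_trichotomy Λ 0 with hΛ | hΛ | hΛ
      · rw [Real.sign_of_neg hΛ]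
        rcases hej with ⟨-, h3, h4⟩ | ⟨-, h3, h4⟩ <;> rw [h4] at h ⊢ <;> rw [h3] <;>
          rcases hσ with h5 | h5 <;> rw [h5] <;> rcases le_abs.1 h with h' | h' <;>
          first
            | (exfalso; linarith)
            | (left; constructor <;> linarith)
            | (right; constructor <;> linarith)
      · exfalso
        rcases hej with ⟨-, h3, h4⟩ | ⟨-, h3, h4⟩ <;> rw [h4, hΛ] at h <;>
          rcases le_abs.1 h with h' | h' <;> linarith
      · rw [Real.sign_of_pos hΛ]
        rcases hej with ⟨-, h3, h4⟩ | ⟨-, h3, h4⟩ <;> rw [h4] at h ⊢ <;> rw [h3] <;>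
          rcases hσ with h5 | h5 <;> rw [h5] <;> rcases le_abs.1 h with h' | h' <;>
          first
            | (exfalso; linarith)
            | (left; constructor <;> linarith)
            | (right; constructor <;> linarith)
    rcases hs with ⟨h3, h4⟩ | ⟨h3, h4⟩
    · rw [kup_of_le_neg_one h3, h4, hsq]; push_cast; ring
    · rw [kup_of_one_le h3, h4, hsq]; push_cast; ring
  · rw [kup_of_abs_le (by rw [habs]; exact (not_le.1 h).le), hsq]
    linear_combination (√(1 - zeta j ω Λ ^ 2) : ℂ) * Complex.I_sq

/-! ### Plane waves -/

/-- The factor `±i` by which `J` acts in a channel. -/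
noncomputable def tau (j : Fin 2) : ℂ := if j = 0 then Complex.I else -Complex.I

theorem tau_mul_self (j : Fin 2) : tau j * tau j = -1 := by
  fin_cases j <;> simp [tau]

/-- The vector of the channel `j` with the components `a`, `b`. -/
noncomputable def chanVec (j : Fin 2) (a b : ℂ) : Fin 4 → ℂ := ![a, b, tau j * a, tau j * b]

theorem smul_chanVec (c : ℂ) (j : Fin 2) (a b : ℂ) :
    c • chanVec j a b = chanVec j (c * a) (c * b) := by
  ext i; fin_cases i <;> simp [chanVec] <;> ring

theorem chan_mulVec (j : Fin 2) (y : Fin 4 → ℂ) : chan j *ᵥ y =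
    chanVec j ((y 0 - tau j * y 2) / 2) ((y 1 - tau j * y 3) / 2) := by
  ext i
  fin_cases j <;> fin_cases i <;>
    simp [chan, chanVec, tau, matJ, Matrix.mulVec, dotProduct, Fin.sum_univ_four,
      Matrix.one_apply] <;> ring_nf <;> simp <;> ring

theorem chan_mulVec_chanVec (j : Fin 2) (a b : ℂ) : chan j *ᵥ chanVec j a b = chanVec j a b := by
  rw [chan_mulVec]
  have h := tau_mul_self j
  congr 1 <;> simp [chanVec]
  · linear_combination (-a / 2) * h
  · linear_combination (-b / 2) * h

theorem chanQ_mulVec_chanVec (j : Fin 2) (z κ a b : ℂ) : chanQ z κ *ᵥ chanVec j a b =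
    chanVec j (((1 + z) * a + κ * b) / 2) ((κ * a + (1 - z) * b) / 2) := by
  ext i
  fin_cases i <;> simp [chanQ, chanVec, matβ, matX, Matrix.mulVec, dotProduct, Fin.sum_univ_four,
      Matrix.one_apply] <;> ring

theorem Xi_eq (σ : Side) (j : Fin 2) (ω Λ : ℝ) : ∃ c : ℂ, c ≠ 0 ∧ Xi σ j ω Λ = c •
    chanVec j (Complex.I * (if zeta j ω Λ = 1 then 1 else xi σ j ω Λ)) ((zeta j ω Λ : ℂ) - 1) := by
  refine ⟨((Real.sqrt (2 * (‖(if zeta j ω Λ = 1 then 1 else xi σ j ω Λ : ℂ)‖ ^ 2 +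
    (zeta j ω Λ - 1) ^ 2)) : ℂ))⁻¹, inv_ne_zero (Complex.ofReal_ne_zero.2
      (Real.sqrt_ne_zero'.2 ?_)), rfl⟩
  split_ifs with h
  · simp; positivity
  · have : 0 < (zeta j ω Λ - 1) ^ 2 := by
      have := sub_ne_zero.2 h
      positivity
    positivity

theorem Xi_ne_zero (σ : Side) (j : Fin 2) (ω Λ : ℝ) : Xi σ j ω Λ ≠ 0 := by
  obtain ⟨c, hc, h⟩ := Xi_eq σ j ω Λ
  rw [h]
  refine smul_ne_zero hc fun h0 => ?_
  split_ifs at h0 with hz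
  · have := congrFun h0 0
    simp [chanVec] at this
  · have := congrFun h0 1
    simp [chanVec] at this
    exact hz (by exact_mod_cast sub_eq_zero.1 this)

theorem chan_mulVec_Xi (σ : Side) (j : Fin 2) (ω Λ : ℝ) : chan j *ᵥ Xi σ j ω Λ = Xi σ j ω Λ := by
  obtain ⟨c, hc, h⟩ := Xi_eq σ j ω Λ
  rw [h, Matrix.mulVec_smul, chan_mulVec_chanVec]

theorem chanQ_mulVec_Xi {σ : Side} {j : Fin 2} {ω Λ : ℝ} {κ : ℂ}
    (hκ : κ = -(Complex.I * xi σ j ω Λ)) (hκ2 : κ ^ 2 = 1 - (zeta j ω Λ : ℂ) ^ 2) :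
    chanQ (zeta j ω Λ) κ *ᵥ Xi σ j ω Λ = Xi σ j ω Λ := by
  obtain ⟨c, hc, h⟩ := Xi_eq σ j ω Λ
  rw [h, Matrix.mulVec_smul, chanQ_mulVec_chanVec]
  congr 1
  split_ifs with hz
  · rw [hz] at hκ2 ⊢
    have : κ = 0 := by simpa using hκ2
    rw [this]; congr 1 <;> push_cast <;> ring
  · rw [show Complex.I * xi σ j ω Λ = -κ by rw [hκ]; ring]
    congr 1
    · ring
    · linear_combination (-1 / 2) * hκ2

/-- With `chanQ_mulVec_Xi` this identifies the range of the projection in a channel as the line of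
`Ξ_j`. At `ζ = 1` one has `κ = 0`, and the range is the direction that `Xi` prescribes as a limit.
-/
theorem exists_smul_Xi {σ : Side} {j : Fin 2} {ω Λ : ℝ} {κ : ℂ}
    (hκ : κ = -(Complex.I * xi σ j ω Λ)) (hκ2 : κ ^ 2 = 1 - (zeta j ω Λ : ℂ) ^ 2) (a b : ℂ) :
    ∃ c : ℂ, chanQ (zeta j ω Λ) κ *ᵥ chanVec j a b = c • Xi σ j ω Λ := by
  obtain ⟨c, hc, h⟩ := Xi_eq σ j ω Λ
  suffices ∃ d : ℂ, chanQ (zeta j ω Λ) κ *ᵥ chanVec j a b = d • chanVec j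
      (Complex.I * (if zeta j ω Λ = 1 then 1 else xi σ j ω Λ)) ((zeta j ω Λ : ℂ) - 1) by
    obtain ⟨d, hd⟩ := this
    exact ⟨d * c⁻¹, by rw [hd, h, smul_smul, mul_assoc, inv_mul_cancel₀ hc, mul_one]⟩
  simp only [chanQ_mulVec_chanVec, smul_chanVec]
  split_ifs with hz
  · rw [hz] at hκ2 ⊢
    have : κ = 0 := by simpa using hκ2
    refine ⟨-Complex.I * a, ?_⟩
    rw [this]
    congr 1
    · push_cast; linear_combination a * Complex.I_sq
    · simp
  · rw [show Complex.I * xi σ j ω Λ = -κ by rw [hκ]; ring]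
    have hz' : 1 - (zeta j ω Λ : ℂ) ≠ 0 := fun h0 => hz (by exact_mod_cast (sub_eq_zero.1 h0).symm)
    refine ⟨-(κ * a / (1 - zeta j ω Λ) + b) / 2, ?_⟩
    congr 1
    · field_simp
      linear_combination (-a) * hκ2
    · field_simp
      ring

end GN

namespace GN

/-! ### The nonlinearity near zero -/

/-- Induction on the order, by the mean value inequality with the bound for the derivative. -/
theorem exists_abs_le_of_iteratedDeriv_eq_zero (n : ℕ) :
    ∀ f : ℝ → ℝ, ContDiff ℝ (⊤ : ℕ∞) f → (∀ l < n, iteratedDeriv l f 0 = 0) →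
      ∀ R : ℝ, ∃ C, 0 ≤ C ∧ ∀ s, |s| ≤ R → |f s| ≤ C * |s| ^ n := by
  induction n with
  | zero =>
    intro f hf _ R
    obtain ⟨C, hC⟩ := (isCompact_Icc (a := -R) (b := R)).exists_bound_of_continuousOn
      hf.continuous.continuousOn
    refine ⟨|C|, abs_nonneg C, fun s hs => ?_⟩
    have := hC s (abs_le.1 hs)
    rw [pow_zero, mul_one]
    exact this.trans (le_abs_self C)
  | succ n ih =>
    intro f hf h0 R
    have hd : Differentiable ℝ f := hf.differentiable (by simp)
    obtain ⟨C, hC0, hC⟩ := ih (deriv f) (((contDiff_infty_iff_deriv).1 hf).2)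
      (fun l hl => by
        rw [← iteratedDeriv_succ']
        exact h0 (l + 1) (by omega)) R
    refine ⟨C, hC0, fun s hs => ?_⟩
    have hf0 : f 0 = 0 := by simpa using h0 0 (by omega)
    have := (convex_Icc (-|s|) |s|).norm_image_sub_le_of_norm_deriv_le (f := f)
      (C := C * |s| ^ n) (fun x _ => hd x)
      (fun x hx => by
        have hx' : |x| ≤ |s| := abs_le.2 hx
        refine (hC x (hx'.trans hs)).trans ?_
        gcongr)
      (x := 0) (y := s) ⟨by simp, abs_nonneg s⟩ ⟨neg_abs_le s, le_abs_self s⟩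
    rw [hf0, sub_zero, sub_zero, Real.norm_eq_abs, Real.norm_eq_abs] at this
    rw [pow_succ, ← mul_assoc]
    exact this

/-- If all lower Taylor coefficients vanish, then `f(s) - A s^l = O(s^{l+1})`, where `A` is the
coefficient of order `l`. Division of the assumed bound by `s^l` and `s → 0+` force `A = 0`. -/
theorem iteratedDeriv_eq_zero_of_abs_le {f : ℝ → ℝ} (hf : ContDiff ℝ (⊤ : ℕ∞) f) {k : ℕ} {c : ℝ}
    (hfk : ∀ s ∈ Icc (0 : ℝ) 1, |f s| ≤ c * s ^ k) (l : ℕ) (hl : l < k) :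
    iteratedDeriv l f 0 = 0 := by
  induction l using Nat.strong_induction_on with
  | _ l ih =>
    set A : ℝ := iteratedDeriv l f 0 / l.factorial with hA
    have hpow : ContDiff ℝ (⊤ : ℕ∞) fun x : ℝ => x ^ l := contDiff_id.pow l
    have hg : ContDiff ℝ (⊤ : ℕ∞) fun x : ℝ => f x - A * x ^ l :=
      hf.sub (contDiff_const.mul hpow)
    obtain ⟨C, hC0, hC⟩ := exists_abs_le_of_iteratedDeriv_eq_zero (l + 1) _ hg
      (fun i hi => by
        have e : iteratedDeriv i (fun x : ℝ => f x - A * x ^ l) 0 =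
            iteratedDeriv i f 0 - A * iteratedDeriv i (fun x : ℝ => x ^ l) 0 := by
          rw [← iteratedDeriv_const_mul_field]
          exact iteratedDeriv_fun_sub (hf.of_le (by exact_mod_cast le_top)).contDiffAt
            ((contDiff_const.mul hpow).of_le (by exact_mod_cast le_top)).contDiffAt
        rw [e, iteratedDeriv_fun_pow_zero]
        by_cases h : i = l
        · subst h
          have : (i.factorial : ℝ) ≠ 0 := by positivity
          simp only [if_true, hA]
          field_simp
          ring
        · rw [if_neg h, ih i (by omega) (by omega)]
          simp) 1
    have hA0 : ∀ s ∈ Ioc (0 : ℝ) 1, |A| ≤ (C + |c|) * s := by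
      intro s hs
      have h1 := hC s (by rw [abs_of_pos hs.1]; exact hs.2)
      have h2 := hfk s ⟨hs.1.le, hs.2⟩
      have h3 : c * s ^ k ≤ |c| * s ^ (l + 1) :=
        mul_le_mul (le_abs_self c) (pow_le_pow_of_le_one hs.1.le hs.2 hl)
          (pow_nonneg hs.1.le _) (abs_nonneg c)
      rw [abs_of_pos hs.1] at h1
      have h4 : |A * s ^ l| ≤ (C + |c|) * s ^ (l + 1) := by
        have : |A * s ^ l| ≤ |f s| + |f s - A * s ^ l| := by
          have := abs_sub_abs_le_abs_sub (A * s ^ l) (f s)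
          rw [abs_sub_comm (A * s ^ l)] at this
          linarith
        linarith
      have hp : 0 < s ^ l := pow_pos hs.1 l
      rw [abs_mul, abs_of_pos hp, pow_succ, mul_comm (s ^ l), ← mul_assoc] at h4
      exact le_of_mul_le_mul_right h4 hp
    have hlim : Tendsto (fun s : ℝ => (C + |c|) * s) (𝓝[>] 0) (𝓝 0) := by
      have : Tendsto (fun s : ℝ => (C + |c|) * s) (𝓝 0) (𝓝 ((C + |c|) * 0)) :=
        (continuous_const.mul continuous_id).tendsto 0
      rw [mul_zero] at this
      exact this.mono_left nhdsWithin_le_nhds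
    have : |A| ≤ 0 := ge_of_tendsto hlim
      (by
        filter_upwards [Ioc_mem_nhdsGT (show (0 : ℝ) < 1 by norm_num)] with s hs using hA0 s hs)
    have hA1 : A = 0 := abs_nonpos_iff.1 this
    have : (l.factorial : ℝ) ≠ 0 := by positivity
    rw [hA, div_eq_zero_iff] at hA1
    exact hA1.resolve_right this

/-- Smoothness turns the one-sided flatness into a two-sided one and passes it on to `f'`. Both
gains are needed, since `v² - u²` may be negative and `W` contains `f'`. -/
theorem exists_abs_le_mul_pow {f : ℝ → ℝ} (hf : ContDiff ℝ (⊤ : ℕ∞) f) {k : ℕ}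
    (hfk : ∃ c : ℝ, ∀ s ∈ Icc (0 : ℝ) 1, |f s| ≤ c * s ^ k) (R : ℝ) :
    ∃ C, 0 ≤ C ∧ ∀ s, |s| ≤ R → |f s| ≤ C * |s| ^ k ∧ |deriv f s| ≤ C * |s| ^ (k - 1) := by
  obtain ⟨c, hc⟩ := hfk
  have h := iteratedDeriv_eq_zero_of_abs_le hf hc
  obtain ⟨C, hC0, hC⟩ := exists_abs_le_of_iteratedDeriv_eq_zero k f hf h R
  obtain ⟨C', hC0', hC'⟩ := exists_abs_le_of_iteratedDeriv_eq_zero (k - 1) (deriv f)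
    (((contDiff_infty_iff_deriv).1 hf).2)
    (fun l hl => by
      rw [← iteratedDeriv_succ']
      exact h (l + 1) (by omega)) R
  refine ⟨max C C', le_max_of_le_left hC0, fun s hs => ⟨(hC s hs).trans ?_, (hC' s hs).trans ?_⟩⟩
  · gcongr; exact le_max_left _ _
  · gcongr; exact le_max_right _ _

/-! ### The Sobolev inequality on the line -/

theorem integrable_mul_of_ae_eq {F G : Lp ℝ 2 (volume : Measure ℝ)} {g h : ℝ → ℝ}
    (hF : F =ᵐ[volume] g) (hG : G =ᵐ[volume] h) : Integrable (fun x => g x * h x) volume :=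
  ((memLp_congr_ae hF).1 (Lp.memLp F)).integrable_mul ((memLp_congr_ae hG).1 (Lp.memLp G))

theorem integral_sq_eq_norm_sq {F : Lp ℝ 2 (volume : Measure ℝ)} {g : ℝ → ℝ}
    (hF : F =ᵐ[volume] g) : ∫ x, g x * g x = ‖F‖ ^ 2 := by
  rw [← real_inner_self_eq_norm_sq, L2.inner_def]
  refine integral_congr_ae ?_
  filter_upwards [hF] with x hx
  rw [hx]
  simp [pow_two]

theorem tendsto_zero_of_memL2 {F F' : Lp ℝ 2 (volume : Measure ℝ)} {g : ℝ → ℝ}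
    (hg : Differentiable ℝ g) (hF : F =ᵐ[volume] g) (hF' : F' =ᵐ[volume] deriv g) :
    Tendsto g atTop (𝓝 0) := by
  have h1 : Integrable (fun x => g x * g x) volume := integrable_mul_of_ae_eq hF hF
  have h2 : Integrable (fun x => deriv g x * g x + g x * deriv g x) volume :=
    (integrable_mul_of_ae_eq hF' hF).add (integrable_mul_of_ae_eq hF hF')
  have h3 : Tendsto (fun x => g x * g x) atTop (𝓝 0) :=
    tendsto_zero_of_hasDerivAt_of_integrableOn_Ioi (a := 0)
      (fun x _ => (hg x).hasDerivAt.mul (hg x).hasDerivAt) h2.integrableOn h1.integrableOn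
  have h4 : Tendsto (fun x => Real.sqrt (g x * g x)) atTop (𝓝 (Real.sqrt 0)) :=
    (Real.continuous_sqrt.tendsto 0).comp h3
  rw [Real.sqrt_zero] at h4
  refine (tendsto_zero_iff_abs_tendsto_zero g).2 (h4.congr fun x => ?_)
  rw [Real.sqrt_mul_self_eq_abs]
  rfl

/-- `g(x)² = -∫_x^∞ 2 g g' ≤ ∫ (g² + g'²)`. -/
theorem sq_le_norm_sq_add_norm_sq {F F' : Lp ℝ 2 (volume : Measure ℝ)} {g : ℝ → ℝ}
    (hg : Differentiable ℝ g) (hF : F =ᵐ[volume] g) (hF' : F' =ᵐ[volume] deriv g) (x : ℝ) :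
    g x ^ 2 ≤ ‖F‖ ^ 2 + ‖F'‖ ^ 2 := by
  have h1 : Integrable (fun x => g x * g x) volume := integrable_mul_of_ae_eq hF hF
  have h1' : Integrable (fun x => deriv g x * deriv g x) volume := integrable_mul_of_ae_eq hF' hF'
  have h2 : Integrable (fun x => deriv g x * g x + g x * deriv g x) volume :=
    (integrable_mul_of_ae_eq hF' hF).add (integrable_mul_of_ae_eq hF hF')
  have h3 : Tendsto (fun x => g x * g x) atTop (𝓝 0) := by
    simpa using (tendsto_zero_of_memL2 hg hF hF').mul (tendsto_zero_of_memL2 hg hF hF')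
  have h4 := integral_Ioi_of_hasDerivAt_of_tendsto' (a := x)
    (fun y _ => (hg y).hasDerivAt.mul (hg y).hasDerivAt) h2.integrableOn h3
  have h5 : -∫ y in Ioi x, (deriv g y * g y + g y * deriv g y) ≤
      ∫ y in Ioi x, (g y * g y + deriv g y * deriv g y) := by
    rw [← integral_neg]
    refine integral_mono h2.integrableOn.neg (h1.add h1').integrableOn fun y => ?_
    simp only
    nlinarith [sq_nonneg (g y + deriv g y)]
  have h6 : ∫ y in Ioi x, (g y * g y + deriv g y * deriv g y) ≤
      ∫ y, (g y * g y + deriv g y * deriv g y) :=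
    setIntegral_le_integral (h1.add h1') (ae_of_all _ fun y =>
      add_nonneg (mul_self_nonneg _) (mul_self_nonneg _))
  rw [integral_add h1 h1', integral_sq_eq_norm_sq hF, integral_sq_eq_norm_sq hF'] at h6
  rw [h4] at h5
  simp only [Pi.mul_apply] at h5
  nlinarith

end GN

namespace GN

/-! ### Decay of the profile -/

/-- The decay rate `δ_ω = (1 - ω²)^(1/2)` of the profile. -/
noncomputable def dl (ω : ℝ) : ℝ := Real.sqrt (1 - ω ^ 2)

theorem dl_le_one (ω : ℝ) : dl ω ≤ 1 :=
  Real.sqrt_le_one.2 (by nlinarith [sq_nonneg ω])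

theorem dl_nonneg (ω : ℝ) : 0 ≤ dl ω := Real.sqrt_nonneg _

theorem dl_sq {ω : ℝ} (hω : |ω| < 1 / 3) : dl ω ^ 2 = 1 - ω ^ 2 := by
  have := abs_lt.1 hω
  exact Real.sq_sqrt (by nlinarith)

theorem lt_dl {ω : ℝ} (hω : |ω| < 1 / 3) : 47 / 50 < dl ω := by
  have := abs_lt.1 hω
  exact Real.lt_sqrt_of_sq_lt (by nlinarith)

theorem antitoneOn_mul_exp {a a' p p' : ℝ → ℝ} {X : ℝ}
    (ha : ∀ x, X ≤ x → HasDerivAt a (a' x) x) (hp : ∀ x, X ≤ x → HasDerivAt p (p' x) x)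
    (h : ∀ x, X ≤ x → a' x + p' x * a x ≤ 0) :
    AntitoneOn (fun x => a x * Real.exp (p x)) (Ici X) := by
  have hd : ∀ x, X ≤ x → HasDerivAt (fun x => a x * Real.exp (p x))
      (a' x * Real.exp (p x) + a x * (Real.exp (p x) * p' x)) x :=
    fun x hx => (ha x hx).mul (hp x hx).exp
  refine antitoneOn_of_deriv_nonpos (convex_Ici X)
    (fun x hx => (hd x hx).continuousAt.continuousWithinAt)
    (fun x hx => (hd x (interior_subset hx)).differentiableAt.differentiableWithinAt)
    (fun x hx => ?_)
  have hx' : X ≤ x := interior_subset hx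
  rw [(hd x hx').deriv]
  have := mul_nonpos_of_nonpos_of_nonneg (h x hx') (Real.exp_nonneg (p x))
  linarith

/-- The differential equation of a profile. -/
structure IsProfile (f : ℝ → ℝ) (ω : ℝ) (v u : ℝ → ℝ) : Prop where
  deriv_v : ∀ x, HasDerivAt v ((-(1 + ω) + f (v x ^ 2 - u x ^ 2)) * u x) x
  deriv_u : ∀ x, HasDerivAt u ((ω - 1 + f (v x ^ 2 - u x ^ 2)) * v x) x
  tendsto_v : Tendsto v atTop (𝓝 0)
  tendsto_u : Tendsto u atTop (𝓝 0)
  even_v : ∀ x, v (-x) = v x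
  odd_u : ∀ x, u (-x) = -u x

section

variable {f : ℝ → ℝ} {ω : ℝ} {v u : ℝ → ℝ}

theorem IsProfile.hasDerivAt_sub (h : IsProfile f ω v u) (x : ℝ) :
    HasDerivAt (fun x => v x ^ 2 - u x ^ 2) (-4 * ω * (u x * v x)) x := by
  have := ((h.deriv_v x).pow 2).sub ((h.deriv_u x).pow 2)
  refine this.congr_deriv ?_
  simp only [Nat.cast_ofNat]
  ring

/-- The profile equation has a first integral, whose value is zero because the profile vanishes at
infinity. -/
theorem IsProfile.energy_eq (h : IsProfile f ω v u) (hf : Continuous f) (x : ℝ) :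
    (1 - ω) * v x ^ 2 - (1 + ω) * u x ^ 2 = ∫ t in (0 : ℝ)..(v x ^ 2 - u x ^ 2), f t := by
  set F : ℝ → ℝ := fun s => ∫ t in (0 : ℝ)..s, f t with hF
  have hFd : ∀ s, HasDerivAt F (f s) s := fun s => hf.integral_hasStrictDerivAt 0 s |>.hasDerivAt
  set H : ℝ → ℝ := fun x => (1 - ω) * v x ^ 2 - (1 + ω) * u x ^ 2 - F (v x ^ 2 - u x ^ 2) with hH
  have hd : ∀ x, HasDerivAt H 0 x := by
    intro x
    have := ((((h.deriv_v x).pow 2).const_mul (1 - ω)).sub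
      (((h.deriv_u x).pow 2).const_mul (1 + ω))).sub
      ((hFd (v x ^ 2 - u x ^ 2)).comp x (h.hasDerivAt_sub x))
    refine this.congr_deriv ?_
    simp only [Nat.cast_ofNat]
    ring
  have hc : ∀ x y, H x = H y :=
    is_const_of_deriv_eq_zero (fun x => (hd x).differentiableAt) (fun x => (hd x).deriv)
  have hs : Tendsto (fun x => v x ^ 2 - u x ^ 2) atTop (𝓝 0) := by
    simpa using (h.tendsto_v.pow 2).sub (h.tendsto_u.pow 2)
  have hF0 : Tendsto (fun x => F (v x ^ 2 - u x ^ 2)) atTop (𝓝 0) := by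
    have := ((hFd 0).continuousAt.tendsto).comp hs
    rwa [show F 0 = 0 by simp [hF]] at this
  have hlim : Tendsto H atTop (𝓝 0) := by
    simpa using (((h.tendsto_v.pow 2).const_mul (1 - ω)).sub
      ((h.tendsto_u.pow 2).const_mul (1 + ω))).sub hF0
  have : H x = 0 :=
    tendsto_nhds_unique (tendsto_const_nhds.congr fun y => hc x y) hlim
  simp only [hH] at this
  linarith

/-- The product `A = uv` satisfies `A' = -N + f · (v² + u²)` with `N = (1-ω)v² + (1+ω)u²`. The
identity `N² = ((1-ω)v² - (1+ω)u²)² + (2δA)²` gives `N ≥ 2δA`. Since the first square is of higher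
order by `energy_eq`, it also gives `v² + u² ≤ 6A`. Thus `A' ≤ -2δA + 36 Cf A²`, and a crude
exponential decay of `A` makes the quadratic term integrable, so that the rate `2δ` is reached
without loss. -/
theorem IsProfile.sq_add_sq_le (h : IsProfile f ω v u) (hω : |ω| < 1 / 3) (hf : Continuous f)
    {Cf X : ℝ} (hCf : 0 ≤ Cf) (hX : 0 ≤ X) (hfb : ∀ s, |s| ≤ 1 → |f s| ≤ Cf * |s|)
    (h1 : ∀ x, X ≤ x → v x ^ 2 + u x ^ 2 ≤ 1)
    (h2 : ∀ x, X ≤ x → Cf * (v x ^ 2 + u x ^ 2) ≤ 1 / 3) {x : ℝ} (hx : X ≤ x) :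
    v x ^ 2 + u x ^ 2 ≤ 3 * Real.exp (2 * X + 27 * Cf) * Real.exp (-(2 * dl ω * x)) := by
  obtain ⟨hω1, hω2⟩ := abs_lt.1 hω
  set n : ℝ → ℝ := fun x => v x ^ 2 + u x ^ 2 with hn
  set A : ℝ → ℝ := fun x => u x * v x with hA
  set N : ℝ → ℝ := fun x => (1 - ω) * v x ^ 2 + (1 + ω) * u x ^ 2 with hN
  have hn0 : ∀ x, 0 ≤ n x := fun x => by positivity
  have hs : ∀ x, |v x ^ 2 - u x ^ 2| ≤ n x := fun x =>
    abs_le.2 ⟨by simp only [hn]; nlinarith [sq_nonneg (v x)], by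
      simp only [hn]; nlinarith [sq_nonneg (u x)]⟩
  have hfn : ∀ x, X ≤ x → |f (v x ^ 2 - u x ^ 2)| ≤ Cf * n x := fun x hx =>
    (hfb _ ((hs x).trans (h1 x hx))).trans (mul_le_mul_of_nonneg_left (hs x) hCf)
  have hAd : ∀ x, HasDerivAt A (-N x + f (v x ^ 2 - u x ^ 2) * n x) x := by
    intro x
    refine ((h.deriv_u x).mul (h.deriv_v x)).congr_deriv ?_
    simp only [hN, hn]
    ring
  have hA0 : Tendsto A atTop (𝓝 0) := by simpa using h.tendsto_u.mul h.tendsto_v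
  have hN1 : ∀ x, 2 / 3 * n x ≤ N x := fun x => by
    simp only [hN, hn]; nlinarith [sq_nonneg (v x), sq_nonneg (u x)]
  have hA1 : ∀ x, X ≤ x → -N x + f (v x ^ 2 - u x ^ 2) * n x ≤ -(1 / 3) * n x := by
    intro x hx
    have h3 := (abs_le.1 (hfn x hx)).2
    have h4 := h2 x hx
    have h5 := hN1 x
    have h6 := hn0 x
    nlinarith [mul_le_mul_of_nonneg_right (h3.trans h4) h6]
  have hAn : ∀ x, 2 * A x ≤ n x := fun x => by
    simp only [hA, hn]; nlinarith [sq_nonneg (v x - u x)]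
  have hApos : ∀ x, X ≤ x → 0 ≤ A x := by
    intro x hx
    have hanti : AntitoneOn (fun x => A x * Real.exp ((fun _ : ℝ => (0 : ℝ)) x)) (Ici X) :=
      antitoneOn_mul_exp (p' := fun _ => 0) (fun x _ => hAd x)
        (fun x _ => hasDerivAt_const x (0 : ℝ))
        (fun x hx => by nlinarith [hA1 x hx, hn0 x])
    simp only [Real.exp_zero, mul_one] at hanti
    refine le_of_tendsto hA0 ?_
    filter_upwards [eventually_ge_atTop x] with y hy
    exact hanti hx (hx.trans hy : X ≤ y) hy
  have hen : ∀ x, X ≤ x → |(1 - ω) * v x ^ 2 - (1 + ω) * u x ^ 2| ≤ Cf * n x ^ 2 := by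
    intro x hx
    rw [h.energy_eq hf]
    have := intervalIntegral.norm_integral_le_of_norm_le_const (a := 0)
      (b := v x ^ 2 - u x ^ 2) (C := Cf * n x) (f := f) (fun t ht => by
        have ht' : |t| ≤ |v x ^ 2 - u x ^ 2| := by
          have := abs_sub_left_of_mem_uIcc (uIoc_subset_uIcc ht)
          simpa using this
        have := (hfb t (ht'.trans ((hs x).trans (h1 x hx))))
        exact this.trans (mul_le_mul_of_nonneg_left (ht'.trans (hs x)) hCf))
    rw [sub_zero] at this
    refine this.trans ?_
    calc Cf * n x * |v x ^ 2 - u x ^ 2| ≤ Cf * n x * n x :=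
          mul_le_mul_of_nonneg_left (hs x) (mul_nonneg hCf (hn0 x))
      _ = Cf * n x ^ 2 := by ring
  have hNsq : ∀ x, N x ^ 2 = ((1 - ω) * v x ^ 2 - (1 + ω) * u x ^ 2) ^ 2 +
      (2 * dl ω * A x) ^ 2 := by
    intro x
    rw [mul_pow, mul_pow, dl_sq hω]
    simp only [hN, hA]
    ring
  have hd0 := dl_nonneg ω
  have hd1 := dl_le_one ω
  have hN0 : ∀ x, 0 ≤ N x := fun x => le_trans (by have := hn0 x; positivity) (hN1 x)
  have hNge : ∀ x, X ≤ x → 2 * dl ω * A x ≤ N x := by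
    intro x hx
    refine abs_le_of_sq_le_sq' ?_ (hN0 x) |>.2
    rw [hNsq x]
    nlinarith [sq_nonneg ((1 - ω) * v x ^ 2 - (1 + ω) * u x ^ 2)]
  have hnA : ∀ x, X ≤ x → n x ≤ 6 * A x := by
    intro x hx
    have hA := hApos x hx
    have h3 : N x ≤ Cf * n x ^ 2 + 2 * dl ω * A x := by
      refine abs_le_of_sq_le_sq' ?_ (by have := hn0 x; positivity) |>.2
      rw [hNsq x]
      have h4 := sq_le_sq' (abs_le.1 (hen x hx)).1 (abs_le.1 (hen x hx)).2
      have h5 : 0 ≤ Cf * n x ^ 2 * (2 * dl ω * A x) := by positivity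
      nlinarith
    have h4 := h2 x hx
    have h5 := hN1 x
    have h6 : Cf * n x ^ 2 ≤ 1 / 3 * n x := by
      rw [pow_two, ← mul_assoc]; exact mul_le_mul_of_nonneg_right h4 (hn0 x)
    have h7 : 2 * dl ω * A x ≤ 2 * A x := by nlinarith
    linarith
  -- The crude rate: `A' ≤ -(v² + u²)/3 ≤ -(2/3) A`.
  have hA2 : ∀ x, X ≤ x → A x ≤ 1 / 2 * Real.exp (-(2 / 3) * (x - X)) := by
    intro x hx
    have hanti := antitoneOn_mul_exp (a := A) (p := fun x => 2 / 3 * (x - X))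
      (p' := fun _ => 2 / 3) (X := X) (fun x _ => hAd x)
      (fun x _ => by simpa using ((hasDerivAt_id x).sub_const X).const_mul (2 / 3))
      (fun x hx => by nlinarith [hA1 x hx, hAn x, hApos x hx])
    have h3 := hanti (show X ∈ Ici X from self_mem_Ici) (show x ∈ Ici X from hx) hx
    simp only [sub_self, mul_zero, Real.exp_zero, mul_one] at h3
    have h4 : A X ≤ 1 / 2 := by linarith [hAn X, h1 X le_rfl]
    rw [show -(2 / 3) * (x - X) = -(2 / 3 * (x - X)) by ring, Real.exp_neg,
      ← div_eq_mul_inv, le_div_iff₀ (Real.exp_pos _)]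
    exact h3.trans h4
  -- One factor of `36 Cf A²` is estimated by `e^{-(2/3)(x-X)}/2`, which leaves `18 Cf
  -- e^{-(2/3)(x-X)} A`. The integrating factor contains the primitive of this coefficient, whence
  -- `27 = 18 / (2/3)`.
  have hanti := antitoneOn_mul_exp (a := A)
    (p := fun x => 2 * dl ω * x + 27 * Cf * Real.exp (-(2 / 3) * (x - X)))
    (p' := fun x => 2 * dl ω - 18 * Cf * Real.exp (-(2 / 3) * (x - X)))
    (X := X) (fun x _ => hAd x)
    (fun x _ => by
      have h3 := ((hasDerivAt_id x).sub_const X).const_mul (-(2 / 3) : ℝ)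
      have h4 := ((hasDerivAt_id x).const_mul (2 * dl ω)).add (h3.exp.const_mul (27 * Cf))
      refine h4.congr_deriv ?_
      simp only [id]
      ring)
    (fun x hx => by
      have h3 := hNge x hx
      have h4 := hApos x hx
      have h5 : f (v x ^ 2 - u x ^ 2) * n x ≤ Cf * (6 * A x) * (6 * A x) := by
        refine (le_abs_self _).trans ?_
        rw [abs_mul, abs_of_nonneg (hn0 x)]
        refine mul_le_mul ((hfn x hx).trans ?_) (hnA x hx) (hn0 x) (by positivity)
        exact mul_le_mul_of_nonneg_left (hnA x hx) hCf
      have h6 : Cf * (6 * A x) * (6 * A x) ≤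
          36 * Cf * A x * (1 / 2 * Real.exp (-(2 / 3) * (x - X))) := by
        have := mul_le_mul_of_nonneg_left (hA2 x hx) (show 0 ≤ 36 * Cf * A x by positivity)
        nlinarith
      nlinarith)
  have h3 := hanti (show X ∈ Ici X from self_mem_Ici) (show x ∈ Ici X from hx) hx
  simp only [sub_self, mul_zero, Real.exp_zero, mul_one] at h3
  have h4 : A X ≤ 1 / 2 := by linarith [hAn X, h1 X le_rfl]
  have h5 : A x * Real.exp (2 * dl ω * x) ≤ 1 / 2 * Real.exp (2 * X + 27 * Cf) := by
    calc A x * Real.exp (2 * dl ω * x)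
        ≤ A x * Real.exp (2 * dl ω * x + 27 * Cf * Real.exp (-(2 / 3) * (x - X))) := by
          refine mul_le_mul_of_nonneg_left (Real.exp_le_exp.2 ?_) (hApos x hx)
          have := Real.exp_pos (-(2 / 3) * (x - X))
          have : 0 ≤ 27 * Cf * Real.exp (-(2 / 3) * (x - X)) := by positivity
          linarith
      _ ≤ A X * Real.exp (2 * dl ω * X + 27 * Cf) := h3
      _ ≤ 1 / 2 * Real.exp (2 * X + 27 * Cf) := by
          refine mul_le_mul h4 (Real.exp_le_exp.2 ?_) (Real.exp_nonneg _) (by norm_num)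
          nlinarith
  have h6 := hnA x hx
  rw [Real.exp_neg, ← div_eq_mul_inv, le_div_iff₀ (Real.exp_pos _)]
  calc (v x ^ 2 + u x ^ 2) * Real.exp (2 * dl ω * x)
      ≤ 6 * A x * Real.exp (2 * dl ω * x) :=
        mul_le_mul_of_nonneg_right h6 (Real.exp_nonneg _)
    _ ≤ _ := by linarith

end

end GN

namespace GN

/-! ### The potential along the family -/

section

variable {f : ℝ → ℝ} {a b : ℝ} {v u : ℝ → ℝ → ℝ}

theorem IsSolitaryFamily.isProfile (hφ : IsSolitaryFamily f (Ioo a b) v u) {ω : ℝ}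
    (hω : ω ∈ Ioo a b) : IsProfile f ω (v ω) (u ω) := by
  obtain ⟨Φ, -, hΦ⟩ := hφ.contDiff_H1
  obtain ⟨h0, h1, h2, h3⟩ := hΦ ω hω
  refine ⟨fun x => ?_, fun x => ?_, tendsto_zero_of_memL2 (hφ.differentiable_v ω hω) h0 h2,
    tendsto_zero_of_memL2 (hφ.differentiable_u ω hω) h1 h3, hφ.even_v ω hω, hφ.odd_u ω hω⟩
  · refine (hφ.differentiable_v ω hω x).hasDerivAt.congr_deriv ?_
    linarith [hφ.eqn_snd ω hω x]
  · refine (hφ.differentiable_u ω hω x).hasDerivAt.congr_deriv ?_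
    linarith [hφ.eqn_fst ω hω x]

theorem abs_lt_of_mem_Ioo (ha : -(1 / 3) ≤ a) (hb : b ≤ 1 / 3) {ω : ℝ} (hω : ω ∈ Ioo a b) :
    |ω| < 1 / 3 := abs_lt.2 ⟨by linarith [hω.1], by linarith [hω.2]⟩

/-- Continuity of the family into `H¹`, with the Sobolev inequality applied to differences of
profiles, is uniform convergence. -/
theorem IsSolitaryFamily.eventually_abs_sub_le (hφ : IsSolitaryFamily f (Ioo a b) v u) {ω₀ : ℝ}
    (hω₀ : ω₀ ∈ Ioo a b) {ε : ℝ} (hε : 0 < ε) :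
    ∀ᶠ ω in 𝓝 ω₀, ω ∈ Ioo a b ∧ ∀ x, |v ω x - v ω₀ x| ≤ ε ∧ |u ω x - u ω₀ x| ≤ ε := by
  obtain ⟨Φ, hc, hΦ⟩ := hφ.contDiff_H1
  have hI : Ioo a b ∈ 𝓝 ω₀ := Ioo_mem_nhds hω₀.1 hω₀.2
  have hcont : ContinuousAt Φ ω₀ := (hc.continuousOn).continuousAt hI
  have hlim : Tendsto (fun ω => ∑ i, ‖Φ ω i - Φ ω₀ i‖ ^ 2) (𝓝 ω₀) (𝓝 0) := by
    have h : ContinuousAt (fun ω => ∑ i, ‖Φ ω i - Φ ω₀ i‖ ^ 2) ω₀ := by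
      refine tendsto_finsetSum _ fun i _ => ?_
      exact (((continuousAt_pi.1 hcont i).sub continuousAt_const).norm.pow 2)
    have := h.tendsto
    simpa using this
  filter_upwards [hI, hlim.eventually (gt_mem_nhds (pow_pos hε 2))] with ω hω hsum
  refine ⟨hω, ?_⟩
  rw [Fin.sum_univ_four] at hsum
  obtain ⟨h0, h1, h2, h3⟩ := hΦ ω hω
  obtain ⟨k0, k1, k2, k3⟩ := hΦ ω₀ hω₀
  have aux : ∀ {F F' G G' : Lp ℝ 2 (volume : Measure ℝ)} {g h : ℝ → ℝ}, Differentiable ℝ g →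
      Differentiable ℝ h → F =ᵐ[volume] g → G =ᵐ[volume] h → F' =ᵐ[volume] deriv g →
      G' =ᵐ[volume] deriv h → ‖F - G‖ ^ 2 + ‖F' - G'‖ ^ 2 < ε ^ 2 → ∀ x, |g x - h x| ≤ ε := by
    intro F F' G G' g h hg hh hF hG hF' hG' hlt x
    have e1 : (F - G : Lp ℝ 2 (volume : Measure ℝ)) =ᵐ[volume] fun x => g x - h x :=
      (Lp.coeFn_sub F G).trans (hF.sub hG)
    have e2 : (F' - G' : Lp ℝ 2 (volume : Measure ℝ)) =ᵐ[volume] deriv fun x => g x - h x := by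
      refine ((Lp.coeFn_sub F' G').trans (hF'.sub hG')).trans (ae_of_all _ fun x => ?_)
      exact (deriv_fun_sub (hg x) (hh x)).symm
    have := sq_le_norm_sq_add_norm_sq (hg.sub hh) e1 e2 x
    exact abs_le_of_sq_le_sq (this.trans hlt.le) hε.le
  have p : ∀ i, 0 ≤ ‖Φ ω i - Φ ω₀ i‖ ^ 2 := fun i => by positivity
  exact fun x => ⟨aux (hφ.differentiable_v ω hω) (hφ.differentiable_v ω₀ hω₀) h0 k0 h2 k2
      (by linarith [p 1, p 3]) x,
    aux (hφ.differentiable_u ω hω) (hφ.differentiable_u ω₀ hω₀) h1 k1 h3 k3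
      (by linarith [p 0, p 2]) x⟩

theorem continuousAt_of_uniform {g : ℝ → ℝ → ℝ} {ω₀ : ℝ}
    (h : ∀ ε > 0, ∀ᶠ ω in 𝓝 ω₀, ∀ x, |g ω x - g ω₀ x| ≤ ε) (hc : Continuous (g ω₀)) (x₀ : ℝ) :
    ContinuousAt (fun q : ℝ × ℝ => g q.1 q.2) (ω₀, x₀) := by
  rw [Metric.continuousAt_iff']
  intro ε hε
  have h1 := (Metric.continuousAt_iff'.1 (hc.continuousAt (x := x₀))) (ε / 2) (by positivity)
  rw [nhds_prod_eq]
  filter_upwards [(h (ε / 4) (by positivity)).prod_mk h1] with q hq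
  have h2 := hq.1 q.2
  have h3 := hq.2
  rw [Real.dist_eq] at h3 ⊢
  calc |g q.1 q.2 - g ω₀ x₀| = |(g q.1 q.2 - g ω₀ q.2) + (g ω₀ q.2 - g ω₀ x₀)| := by ring_nf
    _ ≤ _ := abs_add_le _ _
    _ < ε := by linarith

theorem IsSolitaryFamily.continuousAt_v (hφ : IsSolitaryFamily f (Ioo a b) v u) {ω₀ : ℝ}
    (hω₀ : ω₀ ∈ Ioo a b) (x₀ : ℝ) : ContinuousAt (fun q : ℝ × ℝ => v q.1 q.2) (ω₀, x₀) :=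
  continuousAt_of_uniform
    (fun _ hε => (hφ.eventually_abs_sub_le hω₀ hε).mono fun _ h x => (h.2 x).1)
    (hφ.differentiable_v ω₀ hω₀).continuous x₀

theorem IsSolitaryFamily.continuousAt_u (hφ : IsSolitaryFamily f (Ioo a b) v u) {ω₀ : ℝ}
    (hω₀ : ω₀ ∈ Ioo a b) (x₀ : ℝ) : ContinuousAt (fun q : ℝ × ℝ => u q.1 q.2) (ω₀, x₀) :=
  continuousAt_of_uniform
    (fun _ hε => (hφ.eventually_abs_sub_le hω₀ hε).mono fun _ h x => (h.2 x).2)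
    (hφ.differentiable_u ω₀ hω₀).continuous x₀

theorem IsProfile.exists_sq_add_sq_le {ω : ℝ} {v u : ℝ → ℝ} (h : IsProfile f ω v u) {η : ℝ}
    (hη : 0 < η) : ∃ X, 0 ≤ X ∧ ∀ x, X ≤ x → |v x| ≤ η ∧ |u x| ≤ η := by
  have h1 := (h.tendsto_v.abs).eventually (ge_mem_nhds (show |(0 : ℝ)| < η by simpa))
  have h2 := (h.tendsto_u.abs).eventually (ge_mem_nhds (show |(0 : ℝ)| < η by simpa))
  obtain ⟨X, hX⟩ := eventually_atTop.1 (h1.and h2)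
  exact ⟨max X 0, le_max_right _ _, fun x hx => hX x ((le_max_left _ _).trans hx)⟩

theorem IsProfile.exists_bound {ω : ℝ} {v u : ℝ → ℝ} (h : IsProfile f ω v u) :
    ∃ B, ∀ x, |v x| ≤ B ∧ |u x| ≤ B := by
  obtain ⟨X, hX0, hX⟩ := h.exists_sq_add_sq_le one_pos
  have hv : Continuous v := continuous_iff_continuousAt.2 fun x => (h.deriv_v x).continuousAt
  have hu : Continuous u := continuous_iff_continuousAt.2 fun x => (h.deriv_u x).continuousAt
  obtain ⟨B, hB⟩ := (isCompact_Icc (a := 0) (b := X)).exists_bound_of_continuousOn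
    (hv.prodMk hu).continuousOn
  have hpos : ∀ x, 0 ≤ x → |v x| ≤ max B 1 ∧ |u x| ≤ max B 1 := by
    intro x hx
    rcases le_total X x with h' | h'
    · exact ⟨(hX x h').1.trans (le_max_right _ _), (hX x h').2.trans (le_max_right _ _)⟩
    · have := hB x ⟨hx, h'⟩
      exact ⟨((norm_fst_le (v x, u x)).trans this).trans (le_max_left _ _),
        ((norm_snd_le (v x, u x)).trans this).trans (le_max_left _ _)⟩
  refine ⟨max B 1, fun x => ?_⟩
  rcases le_total 0 x with hx | hx
  · exact hpos x hx
  · have := hpos (-x) (by linarith)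
    rwa [h.even_v, h.odd_u, abs_neg] at this

/-- Locally uniform exponential decay of the profile with the sharp rate. -/
theorem IsSolitaryFamily.eventually_sq_add_sq_le (hφ : IsSolitaryFamily f (Ioo a b) v u)
    (ha : -(1 / 3) ≤ a) (hb : b ≤ 1 / 3) (hf : ContDiff ℝ (⊤ : ℕ∞) f) {k : ℕ} (hk : 2 ≤ k)
    (hfk : ∃ c : ℝ, ∀ s ∈ Icc (0 : ℝ) 1, |f s| ≤ c * s ^ k) {ω₀ : ℝ} (hω₀ : ω₀ ∈ Ioo a b) :
    ∃ C, 0 ≤ C ∧ ∀ᶠ ω in 𝓝 ω₀, ω ∈ Ioo a b ∧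
      ∀ x, v ω x ^ 2 + u ω x ^ 2 ≤ C * Real.exp (-(2 * dl ω * |x|)) := by
  obtain ⟨Cf, hCf, hfb⟩ := exists_abs_le_mul_pow hf hfk 1
  have hfb' : ∀ s, |s| ≤ 1 → |f s| ≤ Cf * |s| := by
    intro s hs
    refine (hfb s hs).1.trans (mul_le_mul_of_nonneg_left ?_ hCf)
    calc |s| ^ k ≤ |s| ^ 1 := pow_le_pow_of_le_one (abs_nonneg s) hs (by omega)
      _ = |s| := pow_one _
  -- Beyond the point `X` chosen for `ω₀`, profiles at distance at most `η` have components at most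
  -- `2η`, hence `v² + u² ≤ 4η`. The two entries of the minimum secure the smallness conditions `4η
  -- ≤ 1` and `4η Cf ≤ 1/3` of `sq_add_sq_le`, with one `X` for all nearby frequencies.
  set η : ℝ := min (1 / 4) (1 / (12 * (Cf + 1))) with hη
  have hη0 : 0 < η := by rw [hη]; positivity
  have hη1 : η ≤ 1 / 4 := min_le_left _ _
  have hη2 : η * (12 * (Cf + 1)) ≤ 1 := by
    rw [← le_div_iff₀ (by positivity)]
    exact min_le_right _ _
  obtain ⟨X, hX0, hX⟩ := (hφ.isProfile hω₀).exists_sq_add_sq_le hη0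
  obtain ⟨B, hB⟩ := (hφ.isProfile hω₀).exists_bound
  have hB0 : 0 ≤ B := (abs_nonneg _).trans (hB 0).1
  set C₁ : ℝ := 3 * Real.exp (2 * X + 27 * Cf)
  set C₂ : ℝ := 2 * (B + 1) ^ 2 * Real.exp (2 * X)
  have hC₁ : 0 ≤ C₁ := by positivity
  have hC₂ : 0 ≤ C₂ := by positivity
  refine ⟨max C₁ C₂, le_max_of_le_left hC₁, ?_⟩
  filter_upwards [hφ.eventually_abs_sub_le hω₀ hη0] with ω hω
  obtain ⟨hω, hd⟩ := hω
  refine ⟨hω, ?_⟩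
  have hω3 := abs_lt_of_mem_Ioo ha hb hω
  have hP := hφ.isProfile hω
  have bd : ∀ {p q c d : ℝ}, |p - q| ≤ c → |q| ≤ d → |p| ≤ d + c := by
    intro p q c d h1 h2
    calc |p| = |q + (p - q)| := by ring_nf
      _ ≤ |q| + |p - q| := abs_add_le _ _
      _ ≤ d + c := add_le_add h2 h1
  have hsmall : ∀ x, X ≤ x → v ω x ^ 2 + u ω x ^ 2 ≤ 4 * η := by
    intro x hx
    have h1 := bd (hd x).1 (hX x hx).1
    have h2 := bd (hd x).2 (hX x hx).2
    have h3 := sq_le_sq' (abs_le.1 h1).1 (abs_le.1 h1).2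
    have h4 := sq_le_sq' (abs_le.1 h2).1 (abs_le.1 h2).2
    nlinarith
  have hbig : ∀ x, v ω x ^ 2 + u ω x ^ 2 ≤ 2 * (B + 1) ^ 2 := by
    intro x
    have h1 := bd (hd x).1 (hB x).1
    have h2 := bd (hd x).2 (hB x).2
    have h3 := sq_le_sq' (abs_le.1 h1).1 (abs_le.1 h1).2
    have h4 := sq_le_sq' (abs_le.1 h2).1 (abs_le.1 h2).2
    nlinarith
  have hpos : ∀ x, 0 ≤ x →
      v ω x ^ 2 + u ω x ^ 2 ≤ max C₁ C₂ * Real.exp (-(2 * dl ω * x)) := by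
    intro x hx
    rcases le_total X x with h' | h'
    · refine (hP.sq_add_sq_le hω3 hf.continuous hCf hX0 hfb' (fun x hx => ?_) (fun x hx => ?_)
        h').trans (mul_le_mul_of_nonneg_right (le_max_left _ _) (Real.exp_nonneg _))
      · linarith [hsmall x hx]
      · have := mul_le_mul_of_nonneg_left (hsmall x hx) hCf
        nlinarith
    · refine le_trans ?_ (mul_le_mul_of_nonneg_right (le_max_right _ _) (Real.exp_nonneg _))
      have h1 : (1 : ℝ) ≤ Real.exp (2 * X) * Real.exp (-(2 * dl ω * x)) := by
        rw [← Real.exp_add]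
        refine Real.one_le_exp ?_
        have := dl_le_one ω
        nlinarith [dl_nonneg ω]
      calc v ω x ^ 2 + u ω x ^ 2 ≤ 2 * (B + 1) ^ 2 * 1 := by rw [mul_one]; exact hbig x
        _ ≤ 2 * (B + 1) ^ 2 * (Real.exp (2 * X) * Real.exp (-(2 * dl ω * x))) := by gcongr
        _ = _ := by ring
  intro x
  rcases le_total 0 x with hx | hx
  · rw [abs_of_nonneg hx]; exact hpos x hx
  · have := hpos (-x) (by linarith)
    rw [hP.even_v, hP.odd_u, neg_sq] at this
    rwa [abs_of_nonpos hx]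

/-- The perturbation `α J W` of the free system, as an operator. -/
noncomputable def potOp (f : ℝ → ℝ) (v u : ℝ → ℝ → ℝ) (ω x : ℝ) : Op :=
  op (matα * matJ * W f v u ω x)

theorem op_M (ω : ℝ) (μ : ℂ) (x : ℝ) :
    op (M f v u ω μ x) = op (freeM μ ω) + potOp f v u ω x := by
  rw [potOp, ← map_add]
  rfl

theorem pot_eq (f : ℝ → ℝ) (v u : ℝ) : pot f v u =
    !![((-f (v ^ 2 - u ^ 2) - 2 * deriv f (v ^ 2 - u ^ 2) * v ^ 2 : ℝ) : ℂ),
        ((2 * deriv f (v ^ 2 - u ^ 2) * (v * u) : ℝ) : ℂ), 0, 0;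
      ((2 * deriv f (v ^ 2 - u ^ 2) * (v * u) : ℝ) : ℂ),
        ((f (v ^ 2 - u ^ 2) - 2 * deriv f (v ^ 2 - u ^ 2) * u ^ 2 : ℝ) : ℂ), 0, 0;
      0, 0, ((-f (v ^ 2 - u ^ 2) : ℝ) : ℂ), 0;
      0, 0, 0, ((f (v ^ 2 - u ^ 2) : ℝ) : ℂ)] := by
  ext i j
  fin_cases i <;> fin_cases j <;> simp [pot]

theorem norm_pot_le {v u p q : ℝ} (hp : |f (v ^ 2 - u ^ 2)| ≤ p)
    (hq : |deriv f (v ^ 2 - u ^ 2)| ≤ q) (i j : Fin 4) :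
    ‖pot f v u i j‖ ≤ p + 2 * q * (v ^ 2 + u ^ 2) := by
  have hp0 : 0 ≤ p := (abs_nonneg _).trans hp
  have hq0 : 0 ≤ q := (abs_nonneg _).trans hq
  obtain ⟨h1, h2⟩ := abs_le.1 hp
  have h3 : ∀ w, |w| ≤ v ^ 2 + u ^ 2 →
      |2 * deriv f (v ^ 2 - u ^ 2) * w| ≤ 2 * q * (v ^ 2 + u ^ 2) := by
    intro w hw
    rw [abs_mul, abs_mul, abs_two]
    gcongr
  have hv : |v ^ 2| ≤ v ^ 2 + u ^ 2 := by rw [abs_of_nonneg (sq_nonneg v)]; nlinarith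
  have hu : |u ^ 2| ≤ v ^ 2 + u ^ 2 := by rw [abs_of_nonneg (sq_nonneg u)]; nlinarith
  have hvu : |v * u| ≤ v ^ 2 + u ^ 2 :=
    abs_le.2 ⟨by nlinarith [sq_nonneg (v + u), sq_nonneg v, sq_nonneg u],
      by nlinarith [sq_nonneg (v - u), sq_nonneg v, sq_nonneg u]⟩
  have e1 := abs_le.1 (h3 _ hv)
  have e2 := abs_le.1 (h3 _ hu)
  have e3 := abs_le.1 (h3 _ hvu)
  have e0 : 0 ≤ 2 * q * (v ^ 2 + u ^ 2) := by positivity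
  have key : ∀ r : ℝ, -(p + 2 * q * (v ^ 2 + u ^ 2)) ≤ r → r ≤ p + 2 * q * (v ^ 2 + u ^ 2) →
      ‖(r : ℂ)‖ ≤ p + 2 * q * (v ^ 2 + u ^ 2) := fun r hr hr' => by
    rw [Complex.norm_real]
    exact abs_le.2 ⟨hr, hr'⟩
  have key0 : ‖(0 : ℂ)‖ ≤ p + 2 * q * (v ^ 2 + u ^ 2) := by
    rw [norm_zero]
    positivity
  rw [pot_eq]
  fin_cases i <;> fin_cases j <;> first | exact key0 | (refine key _ ?_ ?_ <;> linarith)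

/-- Locally uniform exponential decay of the potential. -/
theorem IsSolitaryFamily.eventually_norm_potOp_le (hφ : IsSolitaryFamily f (Ioo a b) v u)
    (ha : -(1 / 3) ≤ a) (hb : b ≤ 1 / 3) (hf : ContDiff ℝ (⊤ : ℕ∞) f) {k : ℕ} (hk : 2 ≤ k)
    (hfk : ∃ c : ℝ, ∀ s ∈ Icc (0 : ℝ) 1, |f s| ≤ c * s ^ k) {ω₀ : ℝ} (hω₀ : ω₀ ∈ Ioo a b) :
    ∃ C, 0 < C ∧ ∀ᶠ ω in 𝓝 ω₀, ω ∈ Ioo a b ∧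
      ∀ x, ‖potOp f v u ω x‖ ≤ C * Real.exp (-(2 * k * dl ω * |x|)) := by
  obtain ⟨C, hC0, hC⟩ := hφ.eventually_sq_add_sq_le ha hb hf hk hfk hω₀
  obtain ⟨Cf, hCf, hfb⟩ := exists_abs_le_mul_pow hf hfk C
  refine ⟨‖op (matα * matJ)‖ * (16 * (3 * Cf * C ^ k)) + 1, by positivity, ?_⟩
  filter_upwards [hC] with ω hω
  refine ⟨hω.1, fun x => ?_⟩
  set n : ℝ := v ω x ^ 2 + u ω x ^ 2 with hn
  have hn0 : 0 ≤ n := by positivity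
  have hn1 : n ≤ C := (hω.2 x).trans (mul_le_of_le_one_right hC0 (Real.exp_le_one_iff.2 (by
    have := dl_nonneg ω; have := abs_nonneg x; simp only [neg_nonpos]; positivity)))
  have hs : |v ω x ^ 2 - u ω x ^ 2| ≤ n :=
    abs_le.2 ⟨by simp only [hn]; nlinarith [sq_nonneg (v ω x)], by
      simp only [hn]; nlinarith [sq_nonneg (u ω x)]⟩
  obtain ⟨h1, h2⟩ := hfb _ (hs.trans hn1)
  have h1' : |f (v ω x ^ 2 - u ω x ^ 2)| ≤ Cf * n ^ k := h1.trans (by gcongr)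
  have h2' : |deriv f (v ω x ^ 2 - u ω x ^ 2)| ≤ Cf * n ^ (k - 1) := h2.trans (by gcongr)
  -- The derivative `f'` is one order less flat than `f`, but it always comes with a quadratic
  -- factor in `(v, u)`. All entries are therefore `O((v² + u²)^k)`, and the potential decays at `k`
  -- times the rate of `v² + u²`.
  have hent : ∀ i j, ‖W f v u ω x i j‖ ≤ 3 * Cf * n ^ k := by
    intro i j
    refine (norm_pot_le h1' h2' i j).trans (le_of_eq ?_)
    obtain ⟨l, rfl⟩ : ∃ l, k = l + 1 := ⟨k - 1, by omega⟩
    simp only [Nat.add_sub_cancel, ← hn]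
    ring
  have hW : ‖op (W f v u ω x)‖ ≤ 16 * (3 * Cf * n ^ k) := by
    refine (norm_op_le _).trans ?_
    calc ∑ i, ∑ j, ‖W f v u ω x i j‖ ≤ ∑ _i : Fin 4, ∑ _j : Fin 4, 3 * Cf * n ^ k :=
          Finset.sum_le_sum fun i _ => Finset.sum_le_sum fun j _ => hent i j
      _ = 16 * (3 * Cf * n ^ k) := by simp; ring
  have hnk : n ^ k ≤ C ^ k * Real.exp (-(2 * k * dl ω * |x|)) := by
    have := pow_le_pow_left₀ hn0 (hω.2 x) k
    rwa [mul_pow, ← Real.exp_nat_mul,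
      show (k : ℝ) * -(2 * dl ω * |x|) = -(2 * k * dl ω * |x|) by ring] at this
  calc ‖potOp f v u ω x‖ ≤ ‖op (matα * matJ)‖ * ‖op (W f v u ω x)‖ := by
        rw [potOp, map_mul]; exact norm_mul_le _ _
    _ ≤ ‖op (matα * matJ)‖ * (16 * (3 * Cf * (C ^ k * Real.exp (-(2 * k * dl ω * |x|))))) := by
        gcongr
        exact hW.trans (by gcongr)
    _ = ‖op (matα * matJ)‖ * (16 * (3 * Cf * C ^ k)) * Real.exp (-(2 * k * dl ω * |x|)) := by
        ring
    _ ≤ _ := by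
        gcongr
        linarith

theorem continuousAt_op {T : Type*} [TopologicalSpace T] {m : T → Matrix (Fin 4) (Fin 4) ℂ}
    {t : T} (h : ∀ i j, ContinuousAt (fun t => m t i j) t) : ContinuousAt (fun t => op (m t)) t := by
  have h1 : ContinuousAt m t := continuousAt_pi.2 fun i => continuousAt_pi.2 fun j => h i j
  exact (continuous_op (m := id) fun i j =>
    (continuous_apply j).comp (continuous_apply i)).continuousAt.comp h1

theorem IsSolitaryFamily.continuousAt_potOp (hφ : IsSolitaryFamily f (Ioo a b) v u)
    (hf : ContDiff ℝ (⊤ : ℕ∞) f) {ω₀ : ℝ} (hω₀ : ω₀ ∈ Ioo a b) (x₀ : ℝ) :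
    ContinuousAt (fun q : ℝ × ℝ => potOp f v u q.1 q.2) (ω₀, x₀) := by
  have hv := hφ.continuousAt_v hω₀ x₀
  have hu := hφ.continuousAt_u hω₀ x₀
  have hs := (hv.pow 2).sub (hu.pow 2)
  have h1 : ContinuousAt (fun q : ℝ × ℝ => f (v q.1 q.2 ^ 2 - u q.1 q.2 ^ 2)) (ω₀, x₀) :=
    ContinuousAt.comp (f := fun q : ℝ × ℝ => v q.1 q.2 ^ 2 - u q.1 q.2 ^ 2)
      hf.continuous.continuousAt hs
  have h2 : ContinuousAt (fun q : ℝ × ℝ => deriv f (v q.1 q.2 ^ 2 - u q.1 q.2 ^ 2)) (ω₀, x₀) :=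
    ContinuousAt.comp (f := fun q : ℝ × ℝ => v q.1 q.2 ^ 2 - u q.1 q.2 ^ 2)
      (((contDiff_infty_iff_deriv).1 hf).2.continuous.continuousAt) hs
  have hW : ContinuousAt (fun q : ℝ × ℝ => op (W f v u q.1 q.2)) (ω₀, x₀) := by
    refine continuousAt_op fun i j => ?_
    have key : ∀ g : ℝ × ℝ → ℝ, ContinuousAt g (ω₀, x₀) →
        ContinuousAt (fun q => (g q : ℂ)) (ω₀, x₀) := fun g hg =>
      Complex.continuous_ofReal.continuousAt.comp hg
    have c1 := key _ (h1.neg.sub ((h2.const_mul 2).mul (hv.pow 2)))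
    have c2 := key _ ((h2.const_mul 2).mul (hv.mul hu))
    have c3 := key _ (h1.sub ((h2.const_mul 2).mul (hu.pow 2)))
    simp only [W, pot_eq]
    fin_cases i <;> fin_cases j <;>
      first
      | exact continuousAt_const
      | exact c1
      | exact c2
      | exact c3
      | exact key _ h1.neg
      | exact key _ h1
  simp only [potOp, map_mul (op)]
  exact continuousAt_const.mul hW

/-- The parity of the potential. -/
theorem IsProfile.op_matβ_mul {ω : ℝ} (h : IsProfile f ω (v ω) (u ω)) (μ : ℂ) (x : ℝ) :
    op matβ * (op (freeM μ ω) + potOp f v u ω (-x)) * op matβ =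
      -(op (freeM μ ω) + potOp f v u ω x) := by
  rw [potOp, potOp, ← map_add, ← map_add, ← map_mul, ← map_mul, ← map_neg]
  congr 1
  simp only [W, h.even_v, h.odd_u, freeM]
  rw [pot_eq, pot_eq]
  simp only [neg_sq, mul_neg, Complex.ofReal_neg (_ * _)]
  ext i j
  fin_cases i <;> fin_cases j <;>
    simp [matα, matJ, matβ, Matrix.mul_apply, Fin.sum_univ_four, -Complex.ofReal_sub,
      -Complex.ofReal_mul, -Complex.ofReal_pow]

end

end GN

namespace GN

/-! ### The local family of conjugations to the free system -/

/-- The free flow `e^{x M}` for `W = 0` at the spectral parameter `p = (μ, ω)`. -/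
noncomputable def flow (σ : Side) (p : ℂ × ℝ) : ℝ → Op :=
  chanFlow (op (freeM p.1 p.2)) (fun j => op (chan j)) (kap σ p.1 p.2)

theorem freeM_isChanneled_kap (σ : Side) (p : ℂ × ℝ) :
    IsChanneled (op (freeM p.1 p.2)) (fun j => op (chan j)) (kap σ p.1 p.2) :=
  freeM_isChanneled fun j => kap_sq σ p.1 p.2 j

/-- The rate `9/8` of `Re κ_j` plus `1/3`, spent on the linear factor in the bound of `sinh(κx)/κ`
through `|x| ≤ 3 e^{|x|/3}`, stays below `3/2`. The bound is thus uniform across the thresholds. -/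
theorem norm_flow_le (σ : Side) {p : ℂ × ℝ} (hp : |p.1.re| ≤ 1 / 2) (x : ℝ) :
    ‖flow σ p x‖ ≤ (1 + 3 * ‖op (freeM p.1 p.2)‖) * (‖op (chan 0)‖ + ‖op (chan 1)‖) *
      Real.exp (3 / 2 * |x|) := by
  have h1 : ∀ j, |(kap σ p.1 p.2 j).re * x| ≤ 9 / 8 * |x| := fun j => by
    rw [abs_mul]
    exact mul_le_mul_of_nonneg_right (abs_re_kap_le σ hp p.2 j) (abs_nonneg x)
  have hc : ∀ j, ‖Complex.cosh (kap σ p.1 p.2 j * x)‖ ≤ Real.exp (3 / 2 * |x|) := fun j => by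
    refine (norm_cosh_le _).trans (Real.exp_le_exp.2 ?_)
    rw [Complex.re_mul_ofReal]
    exact (h1 j).trans (by nlinarith [abs_nonneg x])
  have hs : ∀ j, ‖sn (kap σ p.1 p.2 j) x‖ ≤ 3 * Real.exp (3 / 2 * |x|) := fun j => by
    have h2 : |x| ≤ 3 * Real.exp (1 / 3 * |x|) := by
      have := Real.add_one_le_exp (1 / 3 * |x|)
      linarith
    calc ‖sn (kap σ p.1 p.2 j) x‖ ≤ |x| * Real.exp |(kap σ p.1 p.2 j).re * x| := norm_sn_le _ x
      _ ≤ 3 * Real.exp (1 / 3 * |x|) * Real.exp (9 / 8 * |x|) := by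
          gcongr
          exact h1 j
      _ = 3 * Real.exp ((1 / 3 + 9 / 8) * |x|) := by
          rw [mul_assoc, ← Real.exp_add]
          ring_nf
      _ ≤ 3 * Real.exp (3 / 2 * |x|) := by
          gcongr
          norm_num
  refine (norm_chanFlow_le _ _ _ x hc hs).trans (le_of_eq ?_)
  ring

theorem flow_isFlowGroup (σ : Side) {p : ℂ × ℝ} (hp : |p.1.re| ≤ 1 / 2) {m₀ : ℝ}
    (hm : ‖op (freeM p.1 p.2)‖ ≤ m₀) :
    IsFlowGroup (op (freeM p.1 p.2)) (flow σ p)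
      ((1 + 3 * m₀) * (‖op (chan 0)‖ + ‖op (chan 1)‖)) (3 / 2) :=
  (freeM_isChanneled_kap σ p).isFlowGroup fun x => (norm_flow_le σ hp x).trans (by gcongr)

theorem norm_freeM_le (μ : ℂ) (ω : ℝ) : ‖op (freeM μ ω)‖ ≤
    ‖op (matα * matJ * matβ)‖ + |ω| * ‖op (matα * matJ)‖ + ‖μ‖ * ‖op matα‖ := by
  rw [freeM, map_sub, map_sub, map_smul, map_smul]
  refine (norm_sub_le _ _).trans (add_le_add ((norm_sub_le _ _).trans (add_le_add le_rfl ?_)) ?_)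
  · rw [norm_smul, Complex.norm_real, Real.norm_eq_abs]
  · rw [norm_smul]

theorem continuous_freeM : Continuous fun p : ℂ × ℝ => op (freeM p.1 p.2) := by
  simp only [freeM, map_sub, map_smul]
  fun_prop

/-- The closed half-plane of the spectral parameters on the side `σ` of the imaginary axis, times
the line of the frequencies. -/
def halfSpace (σ : Side) : Set (ℂ × ℝ) := {p | 0 ≤ σ.sgn * p.1.re}

theorem boundary_mem_halfSpace (σ : Side) (Λ ω : ℝ) : (Complex.I * Λ, ω) ∈ halfSpace σ := by
  simp [halfSpace]

theorem continuousWithinAt_extend {T E : Type*} [TopologicalSpace T] [TopologicalSpace E] {S R : Set T}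
    {t : T} (hS : S ∈ 𝓝[R] t) (ht : t ∈ S) {F : S → E} (hF : Continuous F) {G : T → E}
    (hG : ∀ s : S, G s = F s) : ContinuousWithinAt G R t := by
  have : ContinuousWithinAt G S t := by
    rw [continuousWithinAt_iff_continuousAt_domRestrict _ ht]
    exact hF.continuousAt.congr (Eventually.of_forall fun s => (hG s).symm)
  exact this.mono_of_mem_nhdsWithin hS

/-- The data are continuous only on the closed half-space, so the parameter space of the Volterra
argument is the subtype `S`. The values `1` outside `S` do not affect continuity at `t₀` within `R`,
of which `S` is a relative neighbourhood. -/
theorem exists_isConjugation_on {A : Type*} [NormedRing A] [NormedAlgebra ℝ A] [CompleteSpace A]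
    [NormOneClass A] (hA : ∀ s t : A, s * t = 1 → t * s = 1) {T : Type*} [TopologicalSpace T]
    [FirstCountableTopology T] {S R : Set T} {t₀ : T} (hS : S ∈ 𝓝[R] t₀) (ht₀ : t₀ ∈ S)
    {K C ρ a : ℝ} (hK : 0 < K) (hC : 0 < C) (hρ : 0 ≤ ρ) (ha : 0 < a) {m : T → A}
    {U P : T → ℝ → A} {γ : T → ℝ} (hU : ∀ p ∈ S, IsFlowGroup (m p) (U p) K ρ)
    (hUc : Continuous fun q : S × ℝ => U q.1 q.2) (hP : Continuous fun q : S × ℝ => P q.1 q.2)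
    (hγ : ∀ p ∈ S, 2 * ρ + a ≤ γ p)
    (hPb : ∀ p ∈ S, ∀ t, 0 ≤ t → ‖P p t‖ ≤ C * Real.exp (-γ p * t)) :
    ∃ (B D : ℝ) (Z Y : T → ℝ → A), (∀ x, 0 ≤ x → ContinuousWithinAt (fun p => Z p x) R t₀) ∧
      (∀ x, 0 ≤ x → ContinuousWithinAt (fun p => Y p x) R t₀) ∧
      ∀ p ∈ S, IsConjugation (m p) (P p) (Z p) (Y p) B D (γ p) := by
  obtain ⟨Z, Y, hZ, hY, hZY⟩ := exists_isConjugation (Par := S) hA hK hC hρ ha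
    (m := fun p => m p) (U := fun p => U p) (P := fun p => P p) (γ := fun p => γ p)
    (fun p => hU p p.2) hUc hP (fun p => hγ p p.2) (fun p => hPb p p.2)
  classical
  refine ⟨conjBound K C a, K ^ 2 * C / a * conjBound K C a,
    fun p x => if h : p ∈ S then Z ⟨p, h⟩ x else 1,
    fun p x => if h : p ∈ S then Y ⟨p, h⟩ x else 1,
    fun x hx => continuousWithinAt_extend hS ht₀ (hZ x hx) fun p => by simp only [p.2, dite_true],
    fun x hx => continuousWithinAt_extend hS ht₀ (hY x hx) fun p => by simp only [p.2, dite_true],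
    fun p hp => ?_⟩
  have := hZY ⟨p, hp⟩
  simpa only [hp, dite_true] using this

theorem continuous_flow {σ : Side} {S : Set (ℂ × ℝ)} (hS : S ⊆ halfSpace σ) :
    Continuous fun q : S × ℝ => flow σ q.1 q.2 := by
  have hκ : Continuous fun p : S => kap σ p.1.1 p.1.2 := continuous_iff_continuousAt.2 fun p =>
    ContinuousAt.comp (f := (Subtype.val : S → ℂ × ℝ)) (g := fun q : ℂ × ℝ => kap σ q.1 q.2)
      (continuousAt_kap (hS p.2)) continuousAt_subtype_val
  have hm : Continuous fun p : S => op (freeM p.1.1 p.1.2) :=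
    continuous_freeM.comp continuous_subtype_val
  have h := continuous_chanFlow (pr := fun j => op (chan j)) hm hκ
  simp only [flow]
  exact h

theorem IsSolitaryFamily.exists_isConjugation {f : ℝ → ℝ} {a b : ℝ} {v u : ℝ → ℝ → ℝ}
    (hφ : IsSolitaryFamily f (Ioo a b) v u)
    (ha : -(1 / 3) ≤ a) (hb : b ≤ 1 / 3) (hf : ContDiff ℝ (⊤ : ℕ∞) f) {k : ℕ} (hk : 2 ≤ k)
    (hfk : ∃ c : ℝ, ∀ s ∈ Icc (0 : ℝ) 1, |f s| ≤ c * s ^ k) (σ : Side) (Λ : ℝ) {ω₀ : ℝ}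
    (hω₀ : ω₀ ∈ Ioo a b) :
    ∃ (B D : ℝ) (Z Y : ℂ × ℝ → ℝ → Op),
      (∀ x, 0 ≤ x → ContinuousWithinAt (fun p => Z p x) (halfSpace σ) (Complex.I * Λ, ω₀)) ∧
      (∀ x, 0 ≤ x → ContinuousWithinAt (fun p => Y p x) (halfSpace σ) (Complex.I * Λ, ω₀)) ∧
      ∀ᶠ p in 𝓝[halfSpace σ] (Complex.I * Λ, ω₀), p.2 ∈ Ioo a b ∧ |p.1.re| ≤ 1 / 2 ∧
        IsConjugation (op (freeM p.1 p.2)) (potOp f v u p.2) (Z p) (Y p) B D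
          (2 * k * dl p.2) := by
  obtain ⟨C, hC0, hC⟩ := hφ.eventually_norm_potOp_le ha hb hf hk hfk hω₀
  set p₀ : ℂ × ℝ := (Complex.I * Λ, ω₀) with hp₀
  set m₀ : ℝ := ‖op (matα * matJ * matβ)‖ + 1 * ‖op (matα * matJ)‖ + (|Λ| + 1 / 2) * ‖op matα‖
  have hm₀ : 0 ≤ m₀ := by positivity
  set S : Set (ℂ × ℝ) := {p | p ∈ halfSpace σ ∧ ‖p.1 - Complex.I * Λ‖ ≤ 1 / 2 ∧ p.2 ∈ Ioo a b ∧
    ∀ x, ‖potOp f v u p.2 x‖ ≤ C * Real.exp (-(2 * k * dl p.2 * |x|))} with hS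
  have hSmem : S ∈ 𝓝[halfSpace σ] p₀ := by
    have h1 : ∀ᶠ p : ℂ × ℝ in 𝓝 p₀, ‖p.1 - Complex.I * Λ‖ ≤ 1 / 2 := by
      have hc : ContinuousAt (fun p : ℂ × ℝ => ‖p.1 - Complex.I * Λ‖) p₀ := by fun_prop
      have h0 : ‖p₀.1 - Complex.I * Λ‖ < 1 / 2 := by simp [hp₀]
      exact hc.eventually (ge_mem_nhds h0)
    have h2 := (continuous_snd.tendsto p₀).eventually hC
    filter_upwards [nhdsWithin_le_nhds h1, nhdsWithin_le_nhds h2, self_mem_nhdsWithin]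
      with p q1 q2 q3 using ⟨q3, q1, q2⟩
  have hp₀S : p₀ ∈ S := mem_of_mem_nhdsWithin (boundary_mem_halfSpace σ Λ ω₀) hSmem
  have hre : ∀ p ∈ S, |p.1.re| ≤ 1 / 2 := by
    rintro p ⟨-, h, -⟩
    refine le_trans ?_ ((Complex.abs_re_le_norm _).trans h)
    simp
  have hm : ∀ p ∈ S, ‖op (freeM p.1 p.2)‖ ≤ m₀ := by
    rintro p ⟨-, h, hω, -⟩
    have h1 : ‖p.1‖ ≤ |Λ| + 1 / 2 := by
      calc ‖p.1‖ = ‖Complex.I * Λ + (p.1 - Complex.I * Λ)‖ := by ring_nf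
        _ ≤ ‖Complex.I * Λ‖ + ‖p.1 - Complex.I * Λ‖ := norm_add_le _ _
        _ ≤ |Λ| + 1 / 2 := by
          gcongr
          simp
    have h2 : |p.2| ≤ 1 := by linarith [abs_lt_of_mem_Ioo ha hb hω]
    exact (norm_freeM_le _ _).trans (add_le_add (add_le_add le_rfl
      (mul_le_mul_of_nonneg_right h2 (norm_nonneg _)))
      (mul_le_mul_of_nonneg_right h1 (norm_nonneg _)))
  set K : ℝ := (1 + 3 * m₀) * (‖op (chan 0)‖ + ‖op (chan 1)‖) + 1 with hK
  have hK0 : 0 < K := by positivity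
  have hU : ∀ p ∈ S, IsFlowGroup (op (freeM p.1 p.2)) (flow σ p) K (3 / 2) := fun p hp => by
    have h := flow_isFlowGroup σ (hre _ hp) (hm _ hp)
    exact ⟨h.zero, h.add, h.deriv, h.comm, fun x => (h.bound x).trans (by
      rw [hK]; gcongr; linarith)⟩
  have hP : Continuous fun q : S × ℝ => potOp f v u q.1.1.2 q.2 :=
    continuous_iff_continuousAt.2 fun q =>
      ContinuousAt.comp (f := fun q : S × ℝ => (q.1.1.2, q.2))
        (g := fun q : ℝ × ℝ => potOp f v u q.1 q.2)
        (hφ.continuousAt_potOp hf q.1.2.2.2.1 q.2) (by fun_prop)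
  have hUc : Continuous fun q : S × ℝ => flow σ q.1 q.2 := continuous_flow fun p hp => hp.1
  -- Here the decay of the potential beats twice the growth of the free flow: `2kδ ≥ 4 · 47/50 =
  -- 3.76 > 3.7`.
  have hγ : ∀ p ∈ S, 2 * (3 / 2) + 7 / 10 ≤ 2 * k * dl p.2 := fun p hp => by
    have h1 := lt_dl (abs_lt_of_mem_Ioo ha hb hp.2.2.1)
    have h2 : (2 : ℝ) ≤ k := by exact_mod_cast hk
    nlinarith
  have hPb : ∀ p ∈ S, ∀ t, 0 ≤ t → ‖potOp f v u p.2 t‖ ≤ C * Real.exp (-(2 * k * dl p.2) * t) :=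
    fun p hp t ht => by
      have := hp.2.2.2 t
      rwa [abs_of_nonneg ht, ← neg_mul] at this
  obtain ⟨B, D, Z, Y, hZ, hY, hZY⟩ := exists_isConjugation_on (fun s t => op_mul_eq_one) hSmem hp₀S
    hK0 hC0 (show (0 : ℝ) ≤ 3 / 2 by norm_num) (show (0 : ℝ) < 7 / 10 by norm_num) hU hUc hP hγ hPb
  refine ⟨B, D, Z, Y, hZ, hY, ?_⟩
  filter_upwards [hSmem] with p hp
  exact ⟨hp.2.2.1, hre p hp, hZY p hp⟩

end GN

namespace GN

/-! ### Exponential dichotomies -/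

section

set_option linter.unusedSectionVars false

variable {A : Type*} [NormedRing A] [NormedAlgebra ℂ A] [CompleteSpace A] [NormOneClass A]

theorem norm_sum_exp_smul_le {c : Fin 2 → ℂ} {g : Fin 2 → A} {e B : ℝ} (hc : ∀ j, ‖c j‖ ≤ e)
    (hg : ∀ j, ‖g j‖ ≤ B) : ‖∑ j, c j • g j‖ ≤ 2 * B * e := by
  have he : 0 ≤ e := (norm_nonneg _).trans (hc 0)
  refine (norm_sum_le _ _).trans ?_
  calc ∑ j, ‖c j • g j‖ ≤ ∑ _j : Fin 2, e * B := Finset.sum_le_sum fun j _ => by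
        rw [norm_smul]
        exact mul_le_mul (hc j) (hg j) (norm_nonneg _) he
    _ = 2 * B * e := by simp; ring

theorem norm_exp_neg_mul_le {κ : ℂ} {r x : ℝ} (h : r ≤ κ.re) (hx : 0 ≤ x) :
    ‖Complex.exp (-(κ * x))‖ ≤ Real.exp (-(r * x)) := by
  rw [Complex.norm_exp, Complex.neg_re, Complex.re_mul_ofReal]
  exact Real.exp_le_exp.2 (neg_le_neg (mul_le_mul_of_nonneg_right h hx))

/-- The constants controlling a free flow with a stable projection. -/
structure IsBoundedBy (N : ℝ) (pr : Fin 2 → A) (κ : Fin 2 → ℂ) (Q : A) (r : ℝ) :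
    Prop where
  one_le : 1 ≤ N
  norm_pr : ∀ j, ‖pr j‖ ≤ N
  norm_Q : ‖Q‖ ≤ N
  norm_one_sub_Q : ‖1 - Q‖ ≤ N
  rate_nonneg : 0 ≤ r
  rate_le : ∀ j, r ≤ (κ j).re

variable {N r : ℝ} {m Q : A} {pr : Fin 2 → A} {κ : Fin 2 → ℂ}

theorem IsBoundedBy.norm_mul_le_sq (h : IsBoundedBy N pr κ Q r) {s t : A} (hs : ‖s‖ ≤ N)
    (ht : ‖t‖ ≤ N) : ‖s * t‖ ≤ N ^ 2 := by
  have := h.one_le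
  rw [pow_two]
  exact (norm_mul_le _ _).trans (mul_le_mul hs ht (norm_nonneg _) (by linarith))

theorem IsBoundedBy.norm_chanFlow_mul_le (h : IsBoundedBy N pr κ Q r)
    (hQ : IsStableProj m pr κ Q) {x : ℝ} (hx : 0 ≤ x) :
    ‖chanFlow m pr κ x * Q‖ ≤ 2 * N ^ 2 * Real.exp (-(r * x)) := by
  rw [hQ.chanFlow_mul]
  exact norm_sum_exp_smul_le (fun j => norm_exp_neg_mul_le (h.rate_le j) hx)
    fun j => h.norm_mul_le_sq (h.norm_pr j) h.norm_Q

theorem IsBoundedBy.norm_mul_chanFlow_neg_le (h : IsBoundedBy N pr κ Q r)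
    (hQ : IsStableProj m pr κ Q) {y : ℝ} (hy : 0 ≤ y) :
    ‖(1 - Q) * chanFlow m pr κ (-y)‖ ≤ 2 * N ^ 2 * Real.exp (-(r * y)) := by
  rw [hQ.mul_chanFlow]
  refine norm_sum_exp_smul_le (fun j => ?_)
    fun j => h.norm_mul_le_sq (h.norm_pr j) h.norm_one_sub_Q
  have := norm_exp_neg_mul_le (h.rate_le j) hy
  rwa [Complex.ofReal_neg, mul_neg]

theorem IsBoundedBy.norm_pr_mul_chanFlow_le (h : IsBoundedBy N pr κ Q r)
    (hm : IsChanneled m pr κ) {x y B : ℝ} (j : Fin 2) (hxy : |x| = y)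
    (hB : ‖sn (κ j) x‖ * ‖m‖ ≤ B * Real.exp ((κ j).re * y)) :
    ‖pr j * chanFlow m pr κ x‖ ≤ N * (1 + B) * Real.exp ((κ j).re * y) := by
  have hN := h.one_le
  have hκ : 0 ≤ (κ j).re := h.rate_nonneg.trans (h.rate_le j)
  rw [hm.mul_chanFlow]
  have h1 : ‖Complex.cosh (κ j * x)‖ ≤ Real.exp ((κ j).re * y) := by
    refine (norm_cosh_le _).trans (le_of_eq ?_)
    rw [Complex.re_mul_ofReal, abs_mul, hxy, abs_of_nonneg hκ]
  calc ‖Complex.cosh (κ j * x) • pr j + sn (κ j) x • (pr j * m)‖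
      ≤ ‖Complex.cosh (κ j * x)‖ * ‖pr j‖ + ‖sn (κ j) x‖ * ‖pr j * m‖ := by
        refine (norm_add_le _ _).trans (le_of_eq ?_)
        rw [norm_smul, norm_smul]
    _ ≤ Real.exp ((κ j).re * y) * N + B * Real.exp ((κ j).re * y) * N := by
        refine add_le_add (mul_le_mul h1 (h.norm_pr j) (norm_nonneg _) (Real.exp_nonneg _)) ?_
        calc ‖sn (κ j) x‖ * ‖pr j * m‖ ≤ ‖sn (κ j) x‖ * (N * ‖m‖) := by
              gcongr
              exact (norm_mul_le _ _).trans (mul_le_mul_of_nonneg_right (h.norm_pr j)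
                (norm_nonneg _))
          _ = ‖sn (κ j) x‖ * ‖m‖ * N := by ring
          _ ≤ _ := by gcongr
    _ = _ := by ring

theorem exp_mul_exp_le {κ r s t : ℝ} (h : r ≤ κ) (hst : t ≤ s) :
    Real.exp (-(κ * s)) * Real.exp (κ * t) ≤ Real.exp (-(r * (s - t))) := by
  rw [← Real.exp_add]
  refine Real.exp_le_exp.2 ?_
  nlinarith

/-- The projection `Q` reduces the factor at the larger variable `x` to pure exponentials. Only the
factor at `y` contains `sinh(κy)/κ`, so the non-exponential loss `B` depends on the smaller variable
alone. -/
theorem IsBoundedBy.norm_chanFlow_mul_mul_le (h : IsBoundedBy N pr κ Q r)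
    (hm : IsChanneled m pr κ) (hQ : IsStableProj m pr κ Q) {x y B : ℝ} (hB0 : 0 ≤ B)
    (hy : 0 ≤ y) (hyx : y ≤ x)
    (hB : ∀ j, ‖sn (κ j) y‖ * ‖m‖ ≤ B * Real.exp ((κ j).re * y)) :
    ‖chanFlow m pr κ x * Q * chanFlow m pr κ (-y)‖ ≤
      2 * N ^ 2 * (1 + B) * Real.exp (-(r * (x - y))) := by
  have hN := h.one_le
  rw [hQ.chanFlow_mul, Finset.sum_mul]
  refine (norm_sum_le _ _).trans ?_
  have key : ∀ j, ‖Complex.exp (-(κ j * x)) • (pr j * Q) * chanFlow m pr κ (-y)‖ ≤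
      N ^ 2 * (1 + B) * Real.exp (-(r * (x - y))) := by
    intro j
    rw [smul_mul_assoc, ← hQ.comm, mul_assoc, norm_smul]
    have h1 := h.norm_pr_mul_chanFlow_le hm j (x := -y) (y := y) (B := B)
      (by rw [abs_neg, abs_of_nonneg hy]) (by rw [sn_neg, norm_neg]; exact hB j)
    have h2 := norm_exp_neg_mul_le (le_refl (κ j).re) (hy.trans hyx)
    have h3 : ‖Q * (pr j * chanFlow m pr κ (-y))‖ ≤
        N * (N * (1 + B) * Real.exp ((κ j).re * y)) :=
      (norm_mul_le _ _).trans (mul_le_mul h.norm_Q h1 (norm_nonneg _) (by linarith))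
    calc _ ≤ Real.exp (-((κ j).re * x)) * (N * (N * (1 + B) * Real.exp ((κ j).re * y))) :=
          mul_le_mul h2 h3 (norm_nonneg _) (Real.exp_nonneg _)
      _ = N ^ 2 * (1 + B) * (Real.exp (-((κ j).re * x)) * Real.exp ((κ j).re * y)) := by ring
      _ ≤ _ := by
          have := exp_mul_exp_le (h.rate_le j) hyx
          gcongr
  calc _ ≤ ∑ _j : Fin 2, N ^ 2 * (1 + B) * Real.exp (-(r * (x - y))) :=
        Finset.sum_le_sum fun j _ => key j
    _ = _ := by simp; ring

theorem IsBoundedBy.norm_chanFlow_mul_one_sub_mul_le (h : IsBoundedBy N pr κ Q r)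
    (hm : IsChanneled m pr κ) (hQ : IsStableProj m pr κ Q) {x y B : ℝ} (hB0 : 0 ≤ B)
    (hx : 0 ≤ x) (hxy : x ≤ y)
    (hB : ∀ j, ‖sn (κ j) x‖ * ‖m‖ ≤ B * Real.exp ((κ j).re * x)) :
    ‖chanFlow m pr κ x * ((1 - Q) * chanFlow m pr κ (-y))‖ ≤
      2 * N ^ 2 * (1 + B) * Real.exp (-(r * (y - x))) := by
  have hN := h.one_le
  rw [hQ.mul_chanFlow, Finset.mul_sum]
  refine (norm_sum_le _ _).trans ?_
  have key : ∀ j, ‖chanFlow m pr κ x *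
      (Complex.exp (κ j * (-y : ℝ)) • (pr j * (1 - Q)))‖ ≤
      N ^ 2 * (1 + B) * Real.exp (-(r * (y - x))) := by
    intro j
    have hc : chanFlow m pr κ x * pr j = pr j * chanFlow m pr κ x := by
      have hmj : pr j * m * pr j = pr j * (pr j * m) := by
        rw [mul_assoc, hm.comm]
      rw [hm.mul_chanFlow, chanFlow, Finset.sum_mul, Finset.sum_eq_single j]
      · rw [add_mul, smul_mul_assoc, smul_mul_assoc, hm.idem, hmj, ← mul_assoc, hm.idem]
      · intro i _ hi
        rw [add_mul, smul_mul_assoc, smul_mul_assoc, mul_assoc (pr i), hm.comm, ← mul_assoc (pr i),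
          hm.orth i j hi]
        simp
      · simp
    rw [mul_smul_comm, ← mul_assoc, hc, norm_smul]
    have h1 := h.norm_pr_mul_chanFlow_le hm j (x := x) (y := x) (B := B)
      (abs_of_nonneg hx) (hB j)
    have h2 := norm_exp_neg_mul_le (le_refl (κ j).re) (hx.trans hxy)
    have h3 : ‖pr j * chanFlow m pr κ x * (1 - Q)‖ ≤
        (N * (1 + B) * Real.exp ((κ j).re * x)) * N :=
      (norm_mul_le _ _).trans (mul_le_mul h1 h.norm_one_sub_Q (norm_nonneg _)
        ((norm_nonneg _).trans h1))
    rw [Complex.ofReal_neg, mul_neg]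
    calc _ ≤ Real.exp (-((κ j).re * y)) * ((N * (1 + B) * Real.exp ((κ j).re * x)) * N) :=
          mul_le_mul h2 h3 (norm_nonneg _) (Real.exp_nonneg _)
      _ = N ^ 2 * (1 + B) * (Real.exp (-((κ j).re * y)) * Real.exp ((κ j).re * x)) := by ring
      _ ≤ _ := by
          have := exp_mul_exp_le (h.rate_le j) hxy
          gcongr
  calc _ ≤ ∑ _j : Fin 2, N ^ 2 * (1 + B) * Real.exp (-(r * (y - x))) :=
        Finset.sum_le_sum fun j _ => key j
    _ = _ := by simp; ring

/-- `P` is a projection with the same range as the projection `Q`, and complementary to its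
reflection. -/
structure IsSplitting (b Q P : A) : Prop where
  left : Q * P = P
  right : P * Q = Q
  refl : b * P * b = 1 - P

theorem IsSplitting.idem {b Q P : A} (h : IsSplitting b Q P) : P * P = P := by
  calc P * P = P * (Q * P) := by rw [h.left]
    _ = P := by rw [← mul_assoc, h.right, h.left]

theorem IsSplitting.refl_one_sub {b Q P : A} (h : IsSplitting b Q P) (hb : b * b = 1) :
    b * (1 - P) * b = P := by
  calc b * (1 - P) * b = b * b - b * P * b := by noncomm_ring
    _ = P := by rw [hb, h.refl]; noncomm_ring

theorem IsSplitting.mul_refl {b Q P : A} (h : IsSplitting b Q P) (hb : b * b = 1) :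
    P * b = b * (1 - P) := by
  rw [← h.refl]
  calc P * b = (b * b) * P * b := by rw [hb, one_mul]
    _ = _ := by noncomm_ring

variable {Pt Z Y : ℝ → A} {b P : A} {B₀ D γ : ℝ}

theorem IsConjugation.splitting_left (h : IsConjugation m Pt Z Y B₀ D γ)
    (hP : IsSplitting b (Z 0 * Q * Y 0) P) : Q * (Y 0 * P * Z 0) = Y 0 * P * Z 0 := by
  have := h.mul_YZ 0 le_rfl
  calc Q * (Y 0 * P * Z 0) = (Y 0 * Z 0) * Q * (Y 0 * P * Z 0) := by rw [this, one_mul]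
    _ = Y 0 * ((Z 0 * Q * Y 0) * P) * Z 0 := by noncomm_ring
    _ = _ := by rw [hP.left]

theorem IsConjugation.splitting_right (h : IsConjugation m Pt Z Y B₀ D γ)
    (hP : IsSplitting b (Z 0 * Q * Y 0) P) : (Y 0 * P * Z 0) * Q = Q := by
  have := h.mul_YZ 0 le_rfl
  calc (Y 0 * P * Z 0) * Q = Y 0 * P * Z 0 * Q * (Y 0 * Z 0) := by rw [this, mul_one]
    _ = Y 0 * (P * (Z 0 * Q * Y 0)) * Z 0 := by noncomm_ring
    _ = (Y 0 * Z 0) * Q * (Y 0 * Z 0) := by rw [hP.right]; noncomm_ring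
    _ = Q := by rw [this, one_mul, mul_one]

theorem IsConjugation.mul_splitting (h : IsConjugation m Pt Z Y B₀ D γ)
    (hP : IsSplitting b (Z 0 * Q * Y 0) P) : Y 0 * P = Q * Y 0 * P := by
  calc Y 0 * P = Y 0 * (Z 0 * Q * Y 0 * P) := by rw [hP.left]
    _ = (Y 0 * Z 0) * Q * Y 0 * P := by noncomm_ring
    _ = _ := by rw [h.mul_YZ 0 le_rfl, one_mul]

theorem IsConjugation.one_sub_splitting_mul (h : IsConjugation m Pt Z Y B₀ D γ)
    (hP : IsSplitting b (Z 0 * Q * Y 0) P) : (1 - P) * Z 0 = (1 - P) * Z 0 * (1 - Q) := by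
  have h1 : (1 - P) * Z 0 * Q = 0 := by
    calc (1 - P) * Z 0 * Q = (1 - P) * Z 0 * Q * (Y 0 * Z 0) := by
          rw [h.mul_YZ 0 le_rfl, mul_one]
      _ = (Z 0 * Q * Y 0 - P * (Z 0 * Q * Y 0)) * Z 0 := by noncomm_ring
      _ = 0 := by rw [hP.right, sub_self, zero_mul]
  rw [mul_sub, mul_one, h1, sub_zero]

/-- The fundamental solution of the conjugated system. -/
noncomputable def fund (m : A) (pr : Fin 2 → A) (κ : Fin 2 → ℂ) (Z Y : ℝ → A) (b : A) : ℝ → A :=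
  reflect b fun x => Z x * chanFlow m pr κ x * Y 0

/-- The inverse of the fundamental solution. -/
noncomputable def fundInv (m : A) (pr : Fin 2 → A) (κ : Fin 2 → ℂ) (Z Y : ℝ → A) (b : A) : ℝ → A :=
  reflect b fun x => Z 0 * chanFlow m pr κ (-x) * Y x

theorem IsBoundedBy.norm_fund_mul_le (h : IsBoundedBy N pr κ Q r) (hQ : IsStableProj m pr κ Q)
    (hZ : IsConjugation m Pt Z Y N D γ) (hP : IsSplitting b (Z 0 * Q * Y 0) P) (hPN : ‖P‖ ≤ N)
    {x : ℝ} (hx : 0 ≤ x) :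
    ‖fund m pr κ Z Y b x * P‖ ≤ 2 * N ^ 5 * Real.exp (-(r * x)) := by
  have hN : 0 ≤ N := by linarith [h.one_le]
  rw [fund, reflect_of_nonneg _ _ hx, mul_assoc, hZ.mul_splitting hP]
  calc ‖Z x * chanFlow m pr κ x * (Q * Y 0 * P)‖
      = ‖Z x * (chanFlow m pr κ x * Q) * Y 0 * P‖ := by congr 1; noncomm_ring
    _ ≤ ‖Z x‖ * ‖chanFlow m pr κ x * Q‖ * ‖Y 0‖ * ‖P‖ := by
        refine (norm_mul_le _ _).trans ?_
        gcongr
        refine (norm_mul_le _ _).trans ?_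
        gcongr
        exact norm_mul_le _ _
    _ ≤ N * (2 * N ^ 2 * Real.exp (-(r * x))) * N * N := by
        have h1 := hZ.norm_Z x hx
        have h2 := hZ.norm_Y 0 le_rfl
        have h3 := h.norm_chanFlow_mul_le hQ hx
        gcongr
    _ = _ := by ring

theorem IsSplitting.norm_one_sub_le {Q : A} (h : IsSplitting b Q P) (hb : ‖b‖ ≤ N) (hP : ‖P‖ ≤ N) :
    ‖1 - P‖ ≤ N ^ 3 := by
  have hN : 0 ≤ N := (norm_nonneg _).trans hb
  rw [← h.refl]
  calc ‖b * P * b‖ ≤ ‖b‖ * ‖P‖ * ‖b‖ := norm_mul₃_le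
    _ ≤ N * N * N := by gcongr
    _ = N ^ 3 := by ring

theorem IsBoundedBy.norm_mul_fundInv_le (h : IsBoundedBy N pr κ Q r) (hQ : IsStableProj m pr κ Q)
    (hZ : IsConjugation m Pt Z Y N D γ) (hP : IsSplitting b (Z 0 * Q * Y 0) P) (hPN : ‖P‖ ≤ N)
    (hbN : ‖b‖ ≤ N) {y : ℝ} (hy : 0 ≤ y) :
    ‖(1 - P) * fundInv m pr κ Z Y b y‖ ≤ 2 * N ^ 7 * Real.exp (-(r * y)) := by
  have hN : 0 ≤ N := by linarith [h.one_le]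
  rw [fundInv, reflect_of_nonneg _ _ hy]
  calc ‖(1 - P) * (Z 0 * chanFlow m pr κ (-y) * Y y)‖
      = ‖(1 - P) * Z 0 * (chanFlow m pr κ (-y) * Y y)‖ := by congr 1; noncomm_ring
    _ = ‖(1 - P) * Z 0 * (1 - Q) * (chanFlow m pr κ (-y) * Y y)‖ := by
        rw [← hZ.one_sub_splitting_mul hP]
    _ = ‖(1 - P) * Z 0 * ((1 - Q) * chanFlow m pr κ (-y)) * Y y‖ := by congr 1; noncomm_ring
    _ ≤ ‖1 - P‖ * ‖Z 0‖ * ‖(1 - Q) * chanFlow m pr κ (-y)‖ * ‖Y y‖ := by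
        refine (norm_mul_le _ _).trans ?_
        gcongr
        refine (norm_mul_le _ _).trans ?_
        gcongr
        exact norm_mul_le _ _
    _ ≤ N ^ 3 * N * (2 * N ^ 2 * Real.exp (-(r * y))) * N := by
        have h1 := hP.norm_one_sub_le hbN hPN
        have h2 := hZ.norm_Z 0 le_rfl
        have h3 := hZ.norm_Y y hy
        have h4 := h.norm_mul_chanFlow_neg_le hQ hy
        gcongr
    _ = _ := by ring

theorem IsBoundedBy.norm_mid_le (h : IsBoundedBy N pr κ Q r) (hQ : IsStableProj m pr κ Q)
    {R : A} (hR : ‖R‖ ≤ N ^ 3) {x y s : ℝ} (hx : 0 ≤ x) (hy : 0 ≤ y) (hs : s ≤ x + y) :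
    ‖chanFlow m pr κ x * Q * R * ((1 - Q) * chanFlow m pr κ (-y))‖ ≤
      4 * N ^ 7 * Real.exp (-(r * s)) := by
  have hN : 0 ≤ N := by linarith [h.one_le]
  have h1 := h.norm_chanFlow_mul_le hQ hx
  have h2 := h.norm_mul_chanFlow_neg_le hQ hy
  calc _ ≤ ‖chanFlow m pr κ x * Q‖ * ‖R‖ * ‖(1 - Q) * chanFlow m pr κ (-y)‖ := norm_mul₃_le
    _ ≤ (2 * N ^ 2 * Real.exp (-(r * x))) * N ^ 3 * (2 * N ^ 2 * Real.exp (-(r * y))) := by gcongr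
    _ = 4 * N ^ 7 * Real.exp (-(r * (x + y))) := by
        rw [show -(r * (x + y)) = -(r * x) + -(r * y) by ring, Real.exp_add]
        ring
    _ ≤ _ := by
        have := h.rate_nonneg
        gcongr

theorem IsConjugation.norm_conj_splitting_le (hZ : IsConjugation m Pt Z Y N D γ) (hPN : ‖P‖ ≤ N) :
    ‖Y 0 * P * Z 0‖ ≤ N ^ 3 := by
  have hN : 0 ≤ N := (norm_nonneg _).trans hPN
  have h1 := hZ.norm_Z 0 le_rfl
  have h2 := hZ.norm_Y 0 le_rfl
  calc _ ≤ ‖Y 0‖ * ‖P‖ * ‖Z 0‖ := norm_mul₃_le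
    _ ≤ N * N * N := by gcongr
    _ = N ^ 3 := by ring

theorem add_le_of_one_le {N B e : ℝ} (hN : 1 ≤ N) (hB : 0 ≤ B) (he : 0 ≤ e) :
    N * (2 * N ^ 2 * (1 + B) * e + 4 * N ^ 7 * e) * N ≤ 6 * N ^ 9 * (1 + B) * e := by
  have h1 : N ^ 2 ≤ N ^ 7 := pow_le_pow_right₀ hN (by norm_num)
  have h2 : (1 : ℝ) ≤ 1 + B := by linarith
  calc N * (2 * N ^ 2 * (1 + B) * e + 4 * N ^ 7 * e) * N
      = 2 * (N ^ 2 * (1 + B)) * e * N ^ 2 + 4 * (N ^ 7 * 1) * e * N ^ 2 := by ring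
    _ ≤ 2 * (N ^ 7 * (1 + B)) * e * N ^ 2 + 4 * (N ^ 7 * (1 + B)) * e * N ^ 2 := by gcongr
    _ = _ := by ring

/-- In the coordinates of the free system the splitting becomes `R = Q + Q R (1 - Q)`, since it has
the range of `Q`. The first term is the Green's function of the half-line without reflection; the
second is a reflected wave, bounded by `e^{-r(x+y)}`. -/
theorem IsBoundedBy.norm_fund_mul_mul_le (h : IsBoundedBy N pr κ Q r) (hm : IsChanneled m pr κ)
    (hQ : IsStableProj m pr κ Q) (hZ : IsConjugation m Pt Z Y N D γ)
    (hP : IsSplitting b (Z 0 * Q * Y 0) P) (hPN : ‖P‖ ≤ N) {x y B : ℝ} (hB0 : 0 ≤ B)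
    (hy : 0 ≤ y) (hyx : y ≤ x)
    (hB : ∀ j, ‖sn (κ j) y‖ * ‖m‖ ≤ B * Real.exp ((κ j).re * y)) :
    ‖fund m pr κ Z Y b x * P * fundInv m pr κ Z Y b y‖ ≤
      6 * N ^ 9 * (1 + B) * Real.exp (-(r * (x - y))) := by
  have hN : 0 ≤ N := by linarith [h.one_le]
  have hx : 0 ≤ x := hy.trans hyx
  have e1 := hZ.splitting_left hP
  have e2 := hZ.splitting_right hP
  set R : A := Y 0 * P * Z 0 with hR
  have e3 : R = Q + Q * R * (1 - Q) := by rw [e1, mul_sub, mul_one, e2]; noncomm_ring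
  rw [fund, fundInv, reflect_of_nonneg _ _ hx, reflect_of_nonneg _ _ hy]
  have e4 : Z x * chanFlow m pr κ x * Y 0 * P * (Z 0 * chanFlow m pr κ (-y) * Y y) =
      Z x * (chanFlow m pr κ x * Q * chanFlow m pr κ (-y) +
        chanFlow m pr κ x * Q * R * ((1 - Q) * chanFlow m pr κ (-y))) * Y y := by
    calc _ = Z x * chanFlow m pr κ x * R * chanFlow m pr κ (-y) * Y y := by
          rw [hR]; noncomm_ring
      _ = Z x * chanFlow m pr κ x * (Q + Q * R * (1 - Q)) * chanFlow m pr κ (-y) * Y y := by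
          rw [← e3]
      _ = _ := by noncomm_ring
  rw [e4]
  have h1 := h.norm_chanFlow_mul_mul_le hm hQ hB0 hy hyx hB
  have h2 := h.norm_mid_le hQ (hZ.norm_conj_splitting_le hPN) hx hy
    (show x - y ≤ x + y by linarith)
  have h3 := hZ.norm_Z x hx
  have h4 := hZ.norm_Y y hy
  refine le_trans ?_ (add_le_of_one_le h.one_le hB0 (Real.exp_nonneg (-(r * (x - y)))))
  refine norm_mul₃_le.trans ?_
  gcongr
  exact (norm_add_le _ _).trans (add_le_add h1 h2)

theorem IsBoundedBy.norm_fund_mul_one_sub_mul_le (h : IsBoundedBy N pr κ Q r)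
    (hm : IsChanneled m pr κ)
    (hQ : IsStableProj m pr κ Q) (hZ : IsConjugation m Pt Z Y N D γ)
    (hP : IsSplitting b (Z 0 * Q * Y 0) P) (hPN : ‖P‖ ≤ N) {x y B : ℝ} (hB0 : 0 ≤ B)
    (hx : 0 ≤ x) (hxy : x ≤ y)
    (hB : ∀ j, ‖sn (κ j) x‖ * ‖m‖ ≤ B * Real.exp ((κ j).re * x)) :
    ‖fund m pr κ Z Y b x * (1 - P) * fundInv m pr κ Z Y b y‖ ≤
      6 * N ^ 9 * (1 + B) * Real.exp (-(r * (y - x))) := by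
  have hN : 0 ≤ N := by linarith [h.one_le]
  have hy : 0 ≤ y := hx.trans hxy
  have e0 := hZ.mul_YZ 0 le_rfl
  have e1 := hZ.splitting_left hP
  have e2 := hZ.splitting_right hP
  set R : A := Y 0 * P * Z 0 with hR
  have e3 : Y 0 * (1 - P) * Z 0 = (1 - Q) - Q * R * (1 - Q) := by
    calc Y 0 * (1 - P) * Z 0 = Y 0 * Z 0 - R := by rw [hR]; noncomm_ring
      _ = _ := by rw [e0, e1, mul_sub, mul_one, e2]; noncomm_ring
  rw [fund, fundInv, reflect_of_nonneg _ _ hx, reflect_of_nonneg _ _ hy]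
  have e4 : Z x * chanFlow m pr κ x * Y 0 * (1 - P) * (Z 0 * chanFlow m pr κ (-y) * Y y) =
      Z x * (chanFlow m pr κ x * ((1 - Q) * chanFlow m pr κ (-y)) -
        chanFlow m pr κ x * Q * R * ((1 - Q) * chanFlow m pr κ (-y))) * Y y := by
    calc _ = Z x * chanFlow m pr κ x * (Y 0 * (1 - P) * Z 0) * chanFlow m pr κ (-y) * Y y := by
          noncomm_ring
      _ = _ := by rw [e3]; noncomm_ring
  rw [e4]
  have h1 := h.norm_chanFlow_mul_one_sub_mul_le hm hQ hB0 hx hxy hB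
  have h2 := h.norm_mid_le hQ (hZ.norm_conj_splitting_le hPN) hx hy
    (show y - x ≤ x + y by linarith)
  have h3 := hZ.norm_Z x hx
  have h4 := hZ.norm_Y y hy
  refine le_trans ?_ (add_le_of_one_le h.one_le hB0 (Real.exp_nonneg (-(r * (y - x)))))
  refine norm_mul₃_le.trans ?_
  gcongr
  exact (norm_sub_le _ _).trans (add_le_add h1 h2)

/-- If both points are on the right, this is the half-line bound; if both are on the left,
reflection exchanges `P` and `1 - P`. For `y ≤ 0 ≤ x` the kernel factors through the origin as a
product of two decaying pieces, with no loss `B`. -/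
theorem IsBoundedBy.norm_stable_le (h : IsBoundedBy N pr κ Q r) (hm : IsChanneled m pr κ)
    (hQ : IsStableProj m pr κ Q) (hZ : IsConjugation m Pt Z Y N D γ)
    (hP : IsSplitting b (Z 0 * Q * Y 0) P) (hPN : ‖P‖ ≤ N) (hb : b * b = 1) (hbN : ‖b‖ ≤ N)
    {Mt : ℝ → A} (hF : IsFundamental b Mt (fund m pr κ Z Y b) (fundInv m pr κ Z Y b))
    {x y B : ℝ} (hB0 : 0 ≤ B) (hyx : y ≤ x)
    (hB : ∀ j, ‖sn (κ j) (min |x| |y|)‖ * ‖m‖ ≤ B * Real.exp ((κ j).re * min |x| |y|)) :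
    ‖fund m pr κ Z Y b x * P * fundInv m pr κ Z Y b y‖ ≤
      6 * N ^ 14 * (1 + B) * Real.exp (-(r * (x - y))) := by
  have hN1 := h.one_le
  have hN : 0 ≤ N := by linarith
  rcases le_total 0 y with hy | hy
  · rw [abs_of_nonneg hy, abs_of_nonneg (hy.trans hyx), min_eq_right hyx] at hB
    refine (h.norm_fund_mul_mul_le hm hQ hZ hP hPN hB0 hy hyx hB).trans ?_
    gcongr
    norm_num
  · rcases le_total 0 x with hx | hx
    · have e1 : fund m pr κ Z Y b x * P * fundInv m pr κ Z Y b y =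
          (fund m pr κ Z Y b x * P) * b * ((1 - P) * fundInv m pr κ Z Y b (-y)) * b := by
        have e2 := hF.inv_neg (-y)
        rw [neg_neg] at e2
        rw [e2]
        calc _ = fund m pr κ Z Y b x * (P * b) * fundInv m pr κ Z Y b (-y) * b := by noncomm_ring
          _ = fund m pr κ Z Y b x * (P * (P * b)) * fundInv m pr κ Z Y b (-y) * b := by
              rw [← mul_assoc P P b, hP.idem]
          _ = _ := by rw [hP.mul_refl hb]; noncomm_ring
      rw [e1]
      have h1 := h.norm_fund_mul_le hQ hZ hP hPN hx
      have h2 := h.norm_mul_fundInv_le hQ hZ hP hPN hbN (show 0 ≤ -y by linarith)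
      calc _ ≤ ‖fund m pr κ Z Y b x * P‖ * ‖b‖ * ‖(1 - P) * fundInv m pr κ Z Y b (-y)‖ * ‖b‖ :=
            (norm_mul_le _ _).trans (mul_le_mul_of_nonneg_right norm_mul₃_le (norm_nonneg _))
        _ ≤ (2 * N ^ 5 * Real.exp (-(r * x))) * N * (2 * N ^ 7 * Real.exp (-(r * -y))) * N := by
            gcongr
        _ = 4 * N ^ 14 * 1 * Real.exp (-(r * (x - y))) := by
            rw [show -(r * (x - y)) = -(r * x) + -(r * -y) by ring, Real.exp_add]
            ring
        _ ≤ _ := by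
            gcongr
            · norm_num
            · linarith
    · have e1 : fund m pr κ Z Y b x * P * fundInv m pr κ Z Y b y =
          b * (fund m pr κ Z Y b (-x) * (1 - P) * fundInv m pr κ Z Y b (-y)) * b := by
        have e2 := hF.inv_neg (-y)
        have e3 := hF.neg (-x)
        rw [neg_neg] at e2 e3
        rw [e2, e3, ← hP.refl]
        noncomm_ring
      rw [e1]
      rw [abs_of_nonpos hx, abs_of_nonpos hy, min_eq_left (by linarith)] at hB
      have h1 := h.norm_fund_mul_one_sub_mul_le hm hQ hZ hP hPN hB0 (show 0 ≤ -x by linarith)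
        (show -x ≤ -y by linarith) hB
      calc _ ≤ ‖b‖ * ‖fund m pr κ Z Y b (-x) * (1 - P) * fundInv m pr κ Z Y b (-y)‖ * ‖b‖ :=
            norm_mul₃_le
        _ ≤ N * (6 * N ^ 9 * (1 + B) * Real.exp (-(r * (-y - -x)))) * N := by gcongr
        _ = 6 * N ^ 11 * (1 + B) * Real.exp (-(r * (x - y))) := by
            rw [show -y - -x = x - y by ring]
            ring
        _ ≤ _ := by
            gcongr
            norm_num

/-- A splitting persists, and depends continuously on the projection it extends. -/
theorem exists_isSplitting_eventually {T : Type*} {l : Filter T}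
    {b Q₀ P₀ : A} {Q : T → A} (hb : b * b = 1) (hQ : Tendsto Q l (𝓝 Q₀))
    (hidem : ∀ᶠ p in l, Q p * Q p = Q p) (hP₀ : IsSplitting b Q₀ P₀) :
    ∃ P : T → A, Tendsto P l (𝓝 P₀) ∧ ∀ᶠ p in l, IsSplitting b (Q p) (P p) := by
  -- `S` is close to `1`, commutes with `b` and carries the range of `P₀` into that of `Q`. The
  -- conjugate `S P₀ S⁻¹` therefore inherits the reflection symmetry and has range in that of `Q`.
  set S : T → A := fun p => Q p * P₀ + b * Q p * b * (1 - P₀) with hS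
  have hS1 : Tendsto S l (𝓝 1) := by
    have h1 : Tendsto S l (𝓝 (Q₀ * P₀ + b * Q₀ * b * (1 - P₀))) :=
      (hQ.mul_const _).add (((hQ.const_mul b).mul_const b).mul_const _)
    have h2 : b * Q₀ * b * (1 - P₀) = 1 - P₀ := by
      calc b * Q₀ * b * (1 - P₀) = b * Q₀ * b * (b * P₀ * b) := by rw [hP₀.refl]
        _ = b * Q₀ * (b * b) * P₀ * b := by noncomm_ring
        _ = b * (Q₀ * P₀) * b := by rw [hb]; noncomm_ring
        _ = _ := by rw [hP₀.left, hP₀.refl]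
    rwa [hP₀.left, h2, add_sub_cancel] at h1
  have hunit : ∀ᶠ p in l, IsUnit (S p) :=
    hS1.eventually (Units.isOpen.mem_nhds (show IsUnit (1 : A) from isUnit_one))
  have hinv : Tendsto (fun p => Ring.inverse (S p)) l (𝓝 1) := by
    have := (NormedRing.inverse_continuousAt (1 : Aˣ)).tendsto
    rw [Units.val_one, Ring.inverse_one] at this
    exact this.comp hS1
  set P : T → A := fun p => S p * P₀ * Ring.inverse (S p) with hP
  have hPlim : Tendsto P l (𝓝 P₀) := by
    simpa using (hS1.mul_const P₀).mul hinv
  have hX : Tendsto (fun p => (1 - P p) * Q p) l (𝓝 0) := by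
    have := (hPlim.const_sub 1).mul hQ
    have e : (1 - P₀) * Q₀ = 0 := by rw [sub_mul, one_mul, hP₀.right, sub_self]
    rwa [e] at this
  refine ⟨P, hPlim, ?_⟩
  have hsmall : ∀ᶠ p in l, ‖(1 - P p) * Q p‖ < 1 := by
    have := hX.norm
    rw [norm_zero] at this
    exact this.eventually (gt_mem_nhds one_pos)
  filter_upwards [hunit, hidem, hsmall] with p hu hi hs
  have i1 : S p * Ring.inverse (S p) = 1 := Ring.mul_inverse_cancel _ hu
  have i2 : Ring.inverse (S p) * S p = 1 := Ring.inverse_mul_cancel _ hu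
  have e1 : S p * P₀ = Q p * P₀ := by
    simp only [hS]
    calc _ = Q p * (P₀ * P₀) + b * Q p * b * (P₀ - P₀ * P₀) := by noncomm_ring
      _ = _ := by rw [hP₀.idem]; noncomm_ring
  have e2 : b * S p = S p * b := by
    have e3 := hP₀.mul_refl hb
    have e4 : (1 - P₀) * b = b * P₀ := by
      calc (1 - P₀) * b = b - P₀ * b := by noncomm_ring
        _ = b * P₀ := by rw [e3]; noncomm_ring
    simp only [hS]
    calc _ = b * Q p * P₀ + (b * b) * Q p * b * (1 - P₀) := by noncomm_ring
      _ = b * Q p * (b * b) * P₀ + Q p * (b * (1 - P₀)) := by rw [hb]; noncomm_ring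
      _ = Q p * (P₀ * b) + b * Q p * b * ((1 - P₀) * b) := by rw [e3, e4]; noncomm_ring
      _ = _ := by noncomm_ring
  have e5 : b * Ring.inverse (S p) = Ring.inverse (S p) * b := by
    calc b * Ring.inverse (S p) = Ring.inverse (S p) * (S p * b) * Ring.inverse (S p) := by
          rw [← mul_assoc, i2, one_mul]
      _ = Ring.inverse (S p) * b * (S p * Ring.inverse (S p)) := by rw [← e2]; noncomm_ring
      _ = _ := by rw [i1, mul_one]
  have hl : Q p * P p = P p := by
    simp only [hP]
    rw [e1]
    calc _ = (Q p * Q p) * P₀ * Ring.inverse (S p) := by noncomm_ring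
      _ = _ := by rw [hi]
  have hPP : P p * P p = P p := by
    simp only [hP]
    calc _ = S p * P₀ * (Ring.inverse (S p) * S p) * P₀ * Ring.inverse (S p) := by noncomm_ring
      _ = S p * (P₀ * P₀) * Ring.inverse (S p) := by rw [i2]; noncomm_ring
      _ = _ := by rw [hP₀.idem]
  refine ⟨hl, ?_, ?_⟩
  · have hXX : (1 - P p) * Q p * ((1 - P p) * Q p) = (1 - P p) * Q p := by
      calc _ = (1 - P p) * (Q p * Q p) - (1 - P p) * (Q p * P p) * Q p := by noncomm_ring
        _ = (1 - P p) * Q p - (P p - P p * P p) * Q p := by rw [hi, hl]; noncomm_ring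
        _ = _ := by rw [hPP]; noncomm_ring
    have h0 : (1 - P p) * Q p = 0 := by
      by_contra hne
      have h1 : 0 < ‖(1 - P p) * Q p‖ := norm_pos_iff.2 hne
      have h2 := norm_mul_le ((1 - P p) * Q p) ((1 - P p) * Q p)
      rw [hXX] at h2
      nlinarith
    have : Q p - P p * Q p = 0 := by rw [← h0]; noncomm_ring
    exact (sub_eq_zero.1 this).symm
  · simp only [hP]
    calc b * (S p * P₀ * Ring.inverse (S p)) * b
        = (b * S p) * P₀ * (Ring.inverse (S p) * b) := by noncomm_ring
      _ = S p * (b * P₀ * b) * Ring.inverse (S p) := by rw [e2, ← e5]; noncomm_ring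
      _ = S p * Ring.inverse (S p) - S p * P₀ * Ring.inverse (S p) := by
          rw [hP₀.refl]; noncomm_ring
      _ = _ := by rw [i1]

end

end GN

namespace GN

/-! ### Jost solutions -/

section

variable {f : ℝ → ℝ} {v u : ℝ → ℝ → ℝ}

/-- The fundamental solution of `∂ₓ - M(x, μ, ω)`, `p = (μ, ω)`, given by a conjugation to the
free system. -/
noncomputable def sysFund (σ : Side) (p : ℂ × ℝ) (Z Y : ℝ → Op) : ℝ → Op :=
  fund (op (freeM p.1 p.2)) (fun j => op (chan j)) (kap σ p.1 p.2) Z Y (op matβ)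

/-- The inverse of `sysFund`. -/
noncomputable def sysInv (σ : Side) (p : ℂ × ℝ) (Z Y : ℝ → Op) : ℝ → Op :=
  fundInv (op (freeM p.1 p.2)) (fun j => op (chan j)) (kap σ p.1 p.2) Z Y (op matβ)

/-- The stable projection of the free system. -/
noncomputable def freeStab (σ : Side) (p : ℂ × ℝ) : Op := op (stab p.1 p.2 (kap σ p.1 p.2))

theorem freeStab_isStableProj (σ : Side) (p : ℂ × ℝ) :
    IsStableProj (op (freeM p.1 p.2)) (fun j => op (chan j)) (kap σ p.1 p.2) (freeStab σ p) :=
  stab_isStableProj fun j => kap_sq σ p.1 p.2 j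

theorem op_matβ_mul_self : op matβ * op matβ = 1 := by rw [← map_mul, matβ_mul_matβ, map_one]

/-- `Z`, `Y` conjugate the system at the parameter `p = (μ, ω)` to the free one. -/
def IsSysConj (f : ℝ → ℝ) (k : ℕ) (v u : ℝ → ℝ → ℝ) (p : ℂ × ℝ) (Z Y : ℝ → Op) (B D : ℝ) : Prop :=
  IsConjugation (op (freeM p.1 p.2)) (potOp f v u p.2) Z Y B D (2 * k * dl p.2)

theorem IsSysConj.isFundamental {k : ℕ} {σ : Side} {p : ℂ × ℝ} {Z Y : ℝ → Op} {B D : ℝ}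
    (h : IsSysConj f k v u p Z Y B D) (hp : |p.1.re| ≤ 1 / 2)
    (hP : IsProfile f p.2 (v p.2) (u p.2)) :
    IsFundamental (op matβ) (fun x => op (freeM p.1 p.2) + potOp f v u p.2 x)
      (sysFund σ p Z Y) (sysInv σ p Z Y) :=
  IsConjugation.isFundamental h (flow_isFlowGroup σ hp le_rfl) op_matβ_mul_self
    (hP.op_matβ_mul p.1)

theorem freeStab_apply_Xi (σ : Side) {ω : ℝ} (hω : |ω| < 1) (Λ : ℝ) (j : Fin 2) :
    freeStab σ (Complex.I * Λ, ω) (Xi σ j ω Λ) = Xi σ j ω Λ := by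
  have hk := kap_boundary σ hω Λ j
  have hk2 := kap_sq σ (Complex.I * Λ) ω j
  rw [zc_boundary] at hk2
  rw [freeStab, op_apply, stab, Matrix.sum_mulVec, Finset.sum_eq_single j]
  · rw [zc_boundary, ← Matrix.mulVec_mulVec, chanQ_mulVec_Xi hk hk2, chan_mulVec_Xi]
  · intro i _ hi
    rw [← comm_chan (chanQ_comm_matJ _ _), ← chan_mulVec_Xi σ j, Matrix.mulVec_mulVec, mul_assoc,
      chan_orth i j hi, mul_zero, Matrix.zero_mulVec]
  · simp

theorem exists_freeStab_apply (σ : Side) {ω : ℝ} (hω : |ω| < 1) (Λ : ℝ) (y : Fin 4 → ℂ) :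
    ∃ c : Fin 2 → ℂ, freeStab σ (Complex.I * Λ, ω) y = ∑ j, c j • Xi σ j ω Λ := by
  have h : ∀ j, ∃ c : ℂ, (chan j * chanQ (zc j (Complex.I * Λ) ω) (kap σ (Complex.I * Λ) ω j)) *ᵥ y =
      c • Xi σ j ω Λ := by
    intro j
    have hk := kap_boundary σ hω Λ j
    have hk2 := kap_sq σ (Complex.I * Λ) ω j
    rw [zc_boundary] at hk2
    rw [← comm_chan (chanQ_comm_matJ _ _), ← Matrix.mulVec_mulVec, chan_mulVec, zc_boundary]
    exact exists_smul_Xi hk hk2 _ _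
  choose c hc using h
  refine ⟨c, ?_⟩
  rw [freeStab, op_apply, stab, Matrix.sum_mulVec]
  exact Finset.sum_congr rfl fun j _ => hc j

theorem flow_apply_Xi (σ : Side) {ω : ℝ} (hω : |ω| < 1) (Λ : ℝ) (j : Fin 2) (x : ℝ) :
    flow σ (Complex.I * Λ, ω) x (Xi σ j ω Λ) =
      Complex.exp (Complex.I * xi σ j ω Λ * x) • Xi σ j ω Λ := by
  have h := (freeStab_isStableProj σ (Complex.I * Λ, ω)).chanFlow_mul x
  have h1 := congrArg (fun T : Op => T (Xi σ j ω Λ)) h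
  simp only [mul_apply_eq_comp, freeStab_apply_Xi σ hω, _root_.sum_apply,
    _root_.smul_apply, op_apply] at h1
  rw [flow, h1, Finset.sum_eq_single j]
  · rw [chan_mulVec_Xi, kap_boundary σ hω]
    congr 2
    ring
  · intro i _ hi
    rw [← chan_mulVec_Xi σ j, Matrix.mulVec_mulVec, chan_orth i j hi, Matrix.zero_mulVec, smul_zero]
  · simp

theorem hasDerivAt_apply {F : ℝ → Op} {F' : Op} {x : ℝ} (hF : HasDerivAt F F' x) (y : Fin 4 → ℂ) :
    HasDerivAt (fun x => F x y) (F' y) x := by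
  have := hasDerivAt_clm_apply hF (hasDerivAt_const x y)
  simpa using this

theorem re_xi_mul_nonpos (σ : Side) {ω : ℝ} (hω : |ω| < 1) (Λ : ℝ) (j : Fin 2) {x : ℝ}
    (hx : 0 ≤ x) : (Complex.I * xi σ j ω Λ * x).re ≤ 0 := by
  have h1 : Complex.I * xi σ j ω Λ = -kap σ (Complex.I * Λ) ω j := by
    rw [kap_boundary σ hω, neg_neg]
  rw [h1, Complex.re_mul_ofReal, Complex.neg_re]
  have := re_kap_nonneg (σ := σ) (μ := Complex.I * Λ) (by simp) ω j
  nlinarith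

section Boundary

variable {k : ℕ} {σ : Side} {ω Λ : ℝ} {Z Y : ℝ → Op} {B D : ℝ}

/-- The solution is `Z(x) e^{xm} Ξ_j = e^{iξ_j x} Z(x) Ξ_j` for `x ≥ 0`, so the required asymptotics
are the bound on `Z - 1`. -/
theorem IsSysConj.isJost (h : IsSysConj f k v u (Complex.I * Λ, ω) Z Y B D) (hω : |ω| < 1)
    (hP : IsProfile f ω (v ω) (u ω)) (j : Fin 2) :
    IsJost f k v u ω σ Λ j fun x => sysFund σ (Complex.I * Λ, ω) Z Y x (Z 0 (Xi σ j ω Λ)) := by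
  have hF := h.isFundamental (σ := σ) (by simp) hP
  refine ⟨fun x => ?_, D * ‖Xi σ j ω Λ‖, fun x hx => ?_⟩
  · have := hasDerivAt_apply (hF.deriv x) (Z 0 (Xi σ j ω Λ))
    simp only at this
    rwa [← op_M, mul_apply_eq_comp, op_apply] at this
  · have e0 : Y 0 (Z 0 (Xi σ j ω Λ)) = Xi σ j ω Λ := by
      rw [← mul_apply_eq_comp, h.mul_YZ 0 le_rfl]
      rfl
    have e1 : sysFund σ (Complex.I * Λ, ω) Z Y x (Z 0 (Xi σ j ω Λ)) =
        Complex.exp (Complex.I * xi σ j ω Λ * x) • Z x (Xi σ j ω Λ) := by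
      rw [sysFund, fund, reflect_of_nonneg _ _ hx]
      change Z x (flow σ (Complex.I * Λ, ω) x (Y 0 (Z 0 (Xi σ j ω Λ)))) = _
      rw [e0, flow_apply_Xi σ hω, map_smul]
    beta_reduce
    rw [e1, smul_smul, ← Complex.exp_add, neg_add_cancel, Complex.exp_zero, one_smul]
    have e2 : Z x (Xi σ j ω Λ) - Xi σ j ω Λ = (Z x - 1) (Xi σ j ω Λ) := rfl
    rw [e2]
    refine ((Z x - 1).le_opNorm _).trans ?_
    have := h.norm_Z_sub x hx
    rw [neg_mul] at this
    calc ‖Z x - 1‖ * ‖Xi σ j ω Λ‖ ≤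
        D * Real.exp (-(2 * k * dl ω * x)) * ‖Xi σ j ω Λ‖ := by gcongr
      _ = _ := by rw [dl]; ring

/-- Since `|e^{iξx}| ≤ 1`, the difference of two Jost solutions is `O(e^{-2kδx})`. Pulled back to
`0` by the conjugated flow, which grows at most at rate `3/2`, it is `O(e^{-x})` for every `x ≥ 0`,
hence zero. -/
theorem IsSysConj.isJost_unique (h : IsSysConj f k v u (Complex.I * Λ, ω) Z Y B D) (hk : 2 ≤ k)
    (hω : |ω| < 1 / 3) (hP : IsProfile f ω (v ω) (u ω)) {j : Fin 2} {g₁ g₂ : ℝ → Fin 4 → ℂ}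
    (h₁ : IsJost f k v u ω σ Λ j g₁) (h₂ : IsJost f k v u ω σ Λ j g₂) : g₁ = g₂ := by
  have hF := h.isFundamental (σ := σ) (by simp) hP
  obtain ⟨hd₁, c₁, hc₁⟩ := h₁
  obtain ⟨hd₂, c₂, hc₂⟩ := h₂
  set d : ℝ → Fin 4 → ℂ := fun x => g₁ x - g₂ x with hd
  have hdd : ∀ x, HasDerivAt d ((op (freeM (Complex.I * Λ) ω) + potOp f v u ω x) (d x)) x := by
    intro x
    refine ((hd₁ x).sub (hd₂ x)).congr_deriv ?_
    rw [← op_M, op_apply, Matrix.mulVec_sub]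
  have hrep := hF.eq_of_hasDerivAt hdd
  have hdn : ∀ x, 0 ≤ x → ‖d x‖ ≤ (c₁ + c₂) * Real.exp (-(2 * k * dl ω * x)) := by
    intro x hx
    have e1 : d x = Complex.exp (Complex.I * xi σ j ω Λ * x) •
        (Complex.exp (-(Complex.I * xi σ j ω Λ * x)) • d x) := by
      rw [smul_smul, ← Complex.exp_add, add_neg_cancel, Complex.exp_zero, one_smul]
    have e2 : Complex.exp (-(Complex.I * xi σ j ω Λ * x)) • d x =
        (Complex.exp (-(Complex.I * xi σ j ω Λ * x)) • g₁ x - Xi σ j ω Λ) -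
        (Complex.exp (-(Complex.I * xi σ j ω Λ * x)) • g₂ x - Xi σ j ω Λ) := by
      rw [hd, smul_sub]
      abel
    have e3 : ‖Complex.exp (Complex.I * xi σ j ω Λ * x)‖ ≤ 1 := by
      rw [Complex.norm_exp, Real.exp_le_one_iff]
      exact re_xi_mul_nonpos σ (by linarith) Λ j hx
    have e4 : ‖Complex.exp (-(Complex.I * xi σ j ω Λ * x)) • d x‖ ≤
        (c₁ + c₂) * Real.exp (-(2 * k * dl ω * x)) := by
      rw [e2, add_mul]
      exact (norm_sub_le _ _).trans (add_le_add (hc₁ x hx) (hc₂ x hx))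
    calc ‖d x‖ = ‖Complex.exp (Complex.I * xi σ j ω Λ * x)‖ *
          ‖Complex.exp (-(Complex.I * xi σ j ω Λ * x)) • d x‖ := by rw [← norm_smul, ← e1]
      _ ≤ 1 * ((c₁ + c₂) * Real.exp (-(2 * k * dl ω * x))) :=
          mul_le_mul e3 e4 (norm_nonneg _) zero_le_one
      _ = _ := one_mul _
  set K : ℝ := (1 + 3 * ‖op (freeM (Complex.I * Λ) ω)‖) * (‖op (chan 0)‖ + ‖op (chan 1)‖) with hK
  have hfl : IsFlowGroup (op (freeM (Complex.I * Λ) ω)) (flow σ (Complex.I * Λ, ω)) K (3 / 2) :=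
    flow_isFlowGroup σ (p := (Complex.I * Λ, ω)) (by simp) le_rfl
  have hY0 : ∀ x, 0 ≤ x → ‖Y 0 (d 0)‖ ≤ K * B * (c₁ + c₂) * Real.exp (-x) := by
    intro x hx
    have e1 : Y 0 (d 0) = flow σ (Complex.I * Λ, ω) (-x) (Y x (d x)) := by
      rw [hrep x, sysFund, fund, reflect_of_nonneg _ _ hx]
      change _ = flow σ (Complex.I * Λ, ω) (-x) (Y x (Z x (flow σ (Complex.I * Λ, ω) x (Y 0 (d 0)))))
      rw [← mul_apply_eq_comp (Y x), h.mul_YZ x hx, one_apply_eq_self,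
        ← mul_apply_eq_comp, ← hfl.add, neg_add_cancel, hfl.zero,
        one_apply_eq_self]
    have hK0 : 0 ≤ K := by positivity
    have hcc : 0 ≤ c₁ + c₂ := by
      have := (norm_nonneg _).trans (hdn 0 le_rfl)
      simpa using this
    have e2 := hfl.bound (-x)
    rw [abs_neg, abs_of_nonneg hx] at e2
    calc ‖Y 0 (d 0)‖ ≤ ‖flow σ (Complex.I * Λ, ω) (-x)‖ * (‖Y x‖ * ‖d x‖) := by
          rw [e1]
          refine (ContinuousLinearMap.le_opNorm _ _).trans ?_
          gcongr
          exact ContinuousLinearMap.le_opNorm _ _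
      _ ≤ (K * Real.exp (3 / 2 * x)) * (B * ((c₁ + c₂) * Real.exp (-(2 * k * dl ω * x)))) := by
          have := h.norm_Y x hx
          have := hdn x hx
          have hB : 0 ≤ B := (norm_nonneg _).trans (h.norm_Y 0 le_rfl)
          gcongr
      _ = K * B * (c₁ + c₂) * Real.exp (3 / 2 * x - 2 * k * dl ω * x) := by
          rw [sub_eq_add_neg, Real.exp_add]
          ring
      _ ≤ _ := by
          have hB : 0 ≤ B := (norm_nonneg _).trans (h.norm_Y 0 le_rfl)
          have h1 := lt_dl hω
          have h2 : (2 : ℝ) ≤ k := by exact_mod_cast hk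
          have h3 : 5 / 2 ≤ 2 * k * dl ω := by nlinarith
          gcongr
          nlinarith
  have hlim : Tendsto (fun x : ℝ => K * B * (c₁ + c₂) * Real.exp (-x)) atTop (𝓝 0) := by
    simpa using (Real.tendsto_exp_neg_atTop_nhds_zero).const_mul (K * B * (c₁ + c₂))
  have h0 : ‖Y 0 (d 0)‖ ≤ 0 := ge_of_tendsto hlim (by
    filter_upwards [eventually_ge_atTop 0] with x hx using hY0 x hx)
  have hd0 : d 0 = 0 := by
    have e : Z 0 (Y 0 (d 0)) = d 0 := by
      rw [← mul_apply_eq_comp, h.mul_ZY 0 le_rfl, one_apply_eq_self]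
    rw [← e, norm_le_zero_iff.1 h0, map_zero]
  funext x
  have := hrep x
  rw [hd0, map_zero] at this
  exact sub_eq_zero.1 this

theorem IsSysConj.jost_eq (h : IsSysConj f k v u (Complex.I * Λ, ω) Z Y B D) (hk : 2 ≤ k)
    (hω : |ω| < 1 / 3) (hP : IsProfile f ω (v ω) (u ω)) (j : Fin 2) :
    jost f k v u ω σ Λ j =
      fun x => sysFund σ (Complex.I * Λ, ω) Z Y x (Z 0 (Xi σ j ω Λ)) := by
  have h1 := h.isJost (σ := σ) (by linarith) hP j
  exact h.isJost_unique hk hω hP (Classical.epsilon_spec (p := IsJost f k v u ω σ Λ j) ⟨_, h1⟩) h1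

end Boundary

end

end GN

namespace GN

/-! ### Frames of Jost solutions -/

section

/-- The matrix of an operator. -/
noncomputable def mat (T : Op) : Matrix (Fin 4) (Fin 4) ℂ :=
  LinearMap.toMatrix' (T : (Fin 4 → ℂ) →ₗ[ℂ] (Fin 4 → ℂ))

theorem mat_mulVec (T : Op) (y : Fin 4 → ℂ) : mat T *ᵥ y = T y :=
  LinearMap.toMatrix'_mulVec _ y

theorem op_mat (T : Op) : op (mat T) = T := by
  ext1 y
  rw [op_apply, mat_mulVec]

theorem mat_op (m : Matrix (Fin 4) (Fin 4) ℂ) : mat (op m) = m := op_injective (op_mat _)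

theorem mat_mul (S T : Op) : mat (S * T) = mat S * mat T :=
  op_injective (by rw [map_mul, op_mat, op_mat, op_mat])

theorem mat_one : mat 1 = 1 := op_injective (by rw [op_mat, map_one])

theorem mat_sub (S T : Op) : mat (S - T) = mat S - mat T :=
  op_injective (by rw [map_sub, op_mat, op_mat, op_mat])

theorem norm_mat_le (T : Op) (i j : Fin 4) : ‖mat T i j‖ ≤ ‖T‖ := by
  have := norm_entry_le (mat T) i j
  rwa [op_mat] at this

/-- `L` is the inverse of the square matrix `[a, b]`. -/
structure IsFrameInv (a b : Matrix (Fin 4) (Fin 2) ℂ) (L : Matrix (Fin 2 ⊕ Fin 2) (Fin 4) ℂ) :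
    Prop where
  right : fromCols a b * L = 1
  left : L * fromCols a b = 1

variable {a b : Matrix (Fin 4) (Fin 2) ℂ} {L : Matrix (Fin 2 ⊕ Fin 2) (Fin 4) ℂ}

theorem exists_isFrameInv_iff : (∃ L, IsFrameInv a b L) ↔
    ((fromCols a b).submatrix id (finSumFinEquiv (m := 2) (n := 2)).symm).det ≠ 0 := by
  set e := (finSumFinEquiv (m := 2) (n := 2)).symm
  set S : Matrix (Fin 4) (Fin 4) ℂ := (fromCols a b).submatrix id e with hS
  have hSab : fromCols a b = S.submatrix id e.symm := by
    rw [hS, Matrix.submatrix_submatrix]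
    simp
  constructor
  · rintro ⟨L, h⟩ h0
    have h1 : S * L.submatrix e id = 1 := by
      rw [hS, Matrix.submatrix_mul_equiv, h.right]
      simp
    have := congrArg Matrix.det h1
    rw [Matrix.det_mul, h0, Matrix.det_one] at this
    simp at this
  · intro h
    have hu : IsUnit S.det := isUnit_iff_ne_zero.2 h
    refine ⟨S⁻¹.submatrix e.symm id, ?_, ?_⟩
    · rw [hSab, Matrix.submatrix_mul_equiv, Matrix.mul_nonsing_inv _ hu]
      simp
    · rw [hSab]
      have : S⁻¹.submatrix e.symm id * S.submatrix id e.symm = (S⁻¹ * S).submatrix e.symm e.symm :=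
        Matrix.submatrix_mul_equiv (S⁻¹) S e.symm (Equiv.refl _) e.symm
      rw [this, Matrix.nonsing_inv_mul _ hu]
      simp

theorem IsFrameInv.ext (h : IsFrameInv a b L) {X Y : Matrix (Fin 4) (Fin 4) ℂ}
    (ha : X * a = Y * a) (hb : X * b = Y * b) : X = Y := by
  calc X = X * fromCols a b * L := by rw [Matrix.mul_assoc, h.right, Matrix.mul_one]
    _ = Y * fromCols a b * L := by rw [Matrix.mul_fromCols, Matrix.mul_fromCols, ha, hb]
    _ = Y := by rw [Matrix.mul_assoc, h.right, Matrix.mul_one]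

/-- The projection onto the span of `a` along the span of `b`. -/
theorem IsFrameInv.exists_proj (h : IsFrameInv a b L) :
    ∃ P : Matrix (Fin 4) (Fin 4) ℂ, P * a = a ∧ P * b = 0 := by
  set P : Matrix (Fin 4) (Fin 4) ℂ := fromCols a (0 : Matrix (Fin 4) (Fin 2) ℂ) * L with hP
  have h1 : fromCols (P * a) (P * b) = fromCols a 0 := by
    rw [← Matrix.mul_fromCols, hP, Matrix.mul_assoc, h.left, Matrix.mul_one]
  exact ⟨P, (Matrix.fromCols_inj h1).1, (Matrix.fromCols_inj h1).2⟩

theorem IsFrameInv.eq_zero (h : IsFrameInv a b L) {c d : Fin 2 → ℂ} (h0 : a *ᵥ c + b *ᵥ d = 0) :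
    c = 0 ∧ d = 0 := by
  have h1 : fromCols a b *ᵥ Sum.elim c d = 0 := by rw [Matrix.fromCols_mulVec_sumElim, h0]
  have h2 : Sum.elim c d = 0 := by
    rw [← Matrix.one_mulVec (Sum.elim c d), ← h.left, ← Matrix.mulVec_mulVec, h1,
      Matrix.mulVec_zero]
  exact ⟨funext fun i => congrFun h2 (Sum.inl i), funext fun i => congrFun h2 (Sum.inr i)⟩

theorem exists_isFrameInv (h : ∀ c d : Fin 2 → ℂ, a *ᵥ c + b *ᵥ d = 0 → c = 0 ∧ d = 0) :
    ∃ L, IsFrameInv a b L := by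
  rw [exists_isFrameInv_iff]
  intro h0
  obtain ⟨w, hw, hw0⟩ := Matrix.exists_mulVec_eq_zero_iff.2 h0
  set e := (finSumFinEquiv (m := 2) (n := 2)).symm
  have h1 : fromCols a b *ᵥ (w ∘ e.symm) = 0 := by
    rw [← hw0, Matrix.submatrix_mulVec_equiv]
    rfl
  have h2 : w ∘ e.symm = Sum.elim (w ∘ e.symm ∘ Sum.inl) (w ∘ e.symm ∘ Sum.inr) := by
    ext i; cases i <;> rfl
  rw [h2, Matrix.fromCols_mulVec_sumElim] at h1
  obtain ⟨hc, hd⟩ := h _ _ h1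
  refine hw (funext fun i => ?_)
  have h3 : ∀ s, (w ∘ e.symm) s = 0 := by
    rw [h2, hc, hd]
    rintro (s | s) <;> rfl
  simpa using h3 (e i)

theorem IsFrameInv.mul (h : IsFrameInv a b L) {F F' : Matrix (Fin 4) (Fin 4) ℂ} (hF : F * F' = 1)
    (hF' : F' * F = 1) : IsFrameInv (F * a) (F * b) (L * F') where
  right := by
    rw [← Matrix.mul_fromCols]
    calc F * fromCols a b * (L * F') = F * (fromCols a b * L) * F' := by
          simp only [Matrix.mul_assoc]
      _ = 1 := by rw [h.right, Matrix.mul_one, hF]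
  left := by
    rw [← Matrix.mul_fromCols]
    calc L * F' * (F * fromCols a b) = L * (F' * F) * fromCols a b := by
          simp only [Matrix.mul_assoc]
      _ = 1 := by rw [hF', Matrix.mul_one, h.left]

/-- If `Δw = 0`, the independence of the columns of `a` and `b` makes both terms vanish separately.
Invertibility of `Γ` then gives `a^* w = b^* w = 0`, so `w` is orthogonal to a basis. -/
theorem IsFrameInv.isUnit_det (h : IsFrameInv a b L) {Γ : Matrix (Fin 2) (Fin 2) ℂ}
    (hΓ : Γ.det ≠ 0) : IsUnit (a * Γ * bᴴ - b * Γ * aᴴ).det := by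
  rw [isUnit_iff_ne_zero]
  intro h0
  obtain ⟨w, hw, hw0⟩ := Matrix.exists_mulVec_eq_zero_iff.2 h0
  have h1 : a *ᵥ (Γ *ᵥ (bᴴ *ᵥ w)) + b *ᵥ (-(Γ *ᵥ (aᴴ *ᵥ w))) = 0 := by
    rw [← hw0, Matrix.sub_mulVec, Matrix.mulVec_neg, ← sub_eq_add_neg]
    simp only [Matrix.mulVec_mulVec, Matrix.mul_assoc]
  obtain ⟨hb, ha⟩ := h.eq_zero h1
  have hΓ' : ∀ x, Γ *ᵥ x = 0 → x = 0 := fun x hx => by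
    by_contra hne
    exact hΓ (Matrix.exists_mulVec_eq_zero_iff.1 ⟨x, hne, hx⟩)
  have hb' := hΓ' _ hb
  have ha' := hΓ' _ (neg_eq_zero.1 ha)
  have h2 : (fromCols a b)ᴴ *ᵥ w = 0 := by
    rw [Matrix.conjTranspose_fromCols_eq_fromRows_conjTranspose, Matrix.fromRows_mulVec, ha', hb']
    ext i; cases i <;> rfl
  have h3 : Lᴴ * (fromCols a b)ᴴ = 1 := by
    rw [← Matrix.conjTranspose_mul, h.right, Matrix.conjTranspose_one]
  exact hw (by rw [← Matrix.one_mulVec w, ← h3, ← Matrix.mulVec_mulVec, h2, Matrix.mulVec_zero])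

/-- Because `P` fixes `a` and kills `b`, one has `P Δ = a Γ b^*`. Dividing by `Δ` removes `Γ`, which
is why Green's function does not depend on it. -/
theorem IsFrameInv.mul_inv_delta (h : IsFrameInv a b L) {Γ : Matrix (Fin 2) (Fin 2) ℂ}
    (hΓ : Γ.det ≠ 0) {P : Matrix (Fin 4) (Fin 4) ℂ} (ha : P * a = a) (hb : P * b = 0) :
    a * Γ * bᴴ * (a * Γ * bᴴ - b * Γ * aᴴ)⁻¹ = P ∧
      b * Γ * aᴴ * (a * Γ * bᴴ - b * Γ * aᴴ)⁻¹ = -(1 - P) := by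
  have hu := h.isUnit_det hΓ
  set Δ := a * Γ * bᴴ - b * Γ * aᴴ with hΔ
  have h1 : P * Δ = a * Γ * bᴴ := by
    rw [hΔ, Matrix.mul_sub]
    simp only [← Matrix.mul_assoc, ha, hb]
    simp
  have h2 : b * Γ * aᴴ = -((1 - P) * Δ) := by
    rw [Matrix.sub_mul, Matrix.one_mul, h1, hΔ]
    abel
  constructor
  · rw [← h1, Matrix.mul_assoc, Matrix.mul_nonsing_inv _ hu, Matrix.mul_one]
  · rw [h2, Matrix.neg_mul, Matrix.mul_assoc, Matrix.mul_nonsing_inv _ hu, Matrix.mul_one]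

end

section

variable {f : ℝ → ℝ} {v u : ℝ → ℝ → ℝ} {k : ℕ} {σ : Side} {ω Λ : ℝ} {Z Y : ℝ → Op} {B D : ℝ}

theorem jostR_mulVec (f : ℝ → ℝ) (k : ℕ) (v u : ℝ → ℝ → ℝ) (ω : ℝ) (σ : Side) (Λ x : ℝ)
    (c : Fin 2 → ℂ) : jostR f k v u ω σ Λ x *ᵥ c = ∑ j, c j • jost f k v u ω σ Λ j x := by
  ext i
  simp [jostR, Matrix.mulVec, dotProduct, mul_comm]

theorem matrix_ext_mulVec {n : ℕ} {a b : Matrix (Fin 4) (Fin n) ℂ} (h : ∀ c, a *ᵥ c = b *ᵥ c) :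
    a = b := Matrix.ext_of_mulVec_single fun _ => h _

/-- The Jost solutions form a frame at the origin. -/
def IsJostFrame (f : ℝ → ℝ) (k : ℕ) (v u : ℝ → ℝ → ℝ) (ω : ℝ) (σ : Side) (Λ : ℝ) : Prop :=
  ∃ L, IsFrameInv (jostR f k v u ω σ Λ 0) (matβ * jostR f k v u ω σ Λ 0) L

theorem evans_ne_zero_iff : evans f k v u ω Λ ≠ 0 ↔ IsJostFrame f k v u ω .minus Λ := by
  rw [IsJostFrame, exists_isFrameInv_iff, evans, jostL, neg_zero]

theorem IsSysConj.jostR_eq (h : IsSysConj f k v u (Complex.I * Λ, ω) Z Y B D) (hk : 2 ≤ k)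
    (hω : |ω| < 1 / 3) (hP : IsProfile f ω (v ω) (u ω)) (x : ℝ) :
    jostR f k v u ω σ Λ x =
      mat (sysFund σ (Complex.I * Λ, ω) Z Y x) * jostR f k v u ω σ Λ 0 := by
  have hF := h.isFundamental (σ := σ) (by simp) hP
  refine matrix_ext_mulVec fun c => ?_
  rw [← Matrix.mulVec_mulVec, jostR_mulVec, jostR_mulVec, mat_mulVec, map_sum]
  refine Finset.sum_congr rfl fun j _ => ?_
  rw [map_smul, h.jost_eq hk hω hP]
  simp only [hF.zero, one_apply_eq_self]

theorem IsSysConj.jostL_eq (h : IsSysConj f k v u (Complex.I * Λ, ω) Z Y B D) (hk : 2 ≤ k)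
    (hω : |ω| < 1 / 3) (hP : IsProfile f ω (v ω) (u ω)) (x : ℝ) :
    jostL f k v u ω σ Λ x =
      mat (sysFund σ (Complex.I * Λ, ω) Z Y x) * (matβ * jostR f k v u ω σ Λ 0) := by
  have hF := h.isFundamental (σ := σ) (by simp) hP
  rw [jostL, h.jostR_eq hk hω hP, hF.neg, mat_mul, mat_mul, mat_op]
  have := matβ_mul_matβ
  calc _ = (matβ * matβ) * mat (sysFund σ (Complex.I * Λ, ω) Z Y x) * matβ *
        jostR f k v u ω σ Λ 0 := by simp only [Matrix.mul_assoc]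
    _ = _ := by rw [this, Matrix.one_mul, Matrix.mul_assoc]

/-- The projection `Q₊` onto the initial values of the solutions that are stable at `+∞`. -/
noncomputable def sysStab (σ : Side) (p : ℂ × ℝ) (Z Y : ℝ → Op) : Op :=
  Z 0 * freeStab σ p * Y 0

theorem IsSysConj.sysStab_mul_jostR (h : IsSysConj f k v u (Complex.I * Λ, ω) Z Y B D) (hk : 2 ≤ k)
    (hω : |ω| < 1 / 3) (hP : IsProfile f ω (v ω) (u ω)) :
    mat (sysStab σ (Complex.I * Λ, ω) Z Y) * jostR f k v u ω σ Λ 0 = jostR f k v u ω σ Λ 0 := by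
  have hF := h.isFundamental (σ := σ) (by simp) hP
  refine matrix_ext_mulVec fun c => ?_
  rw [← Matrix.mulVec_mulVec, jostR_mulVec, mat_mulVec, map_sum]
  refine Finset.sum_congr rfl fun j _ => ?_
  rw [map_smul, h.jost_eq hk hω hP]
  simp only [hF.zero, one_apply_eq_self, sysStab, mul_apply_eq_comp]
  have e : Y 0 (Z 0 (Xi σ j ω Λ)) = Xi σ j ω Λ := by
    rw [← mul_apply_eq_comp, h.mul_YZ 0 le_rfl, one_apply_eq_self]
  rw [e, freeStab_apply_Xi σ (by linarith)]

theorem IsSysConj.exists_sysStab_eq (h : IsSysConj f k v u (Complex.I * Λ, ω) Z Y B D) (hk : 2 ≤ k)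
    (hω : |ω| < 1 / 3) (hP : IsProfile f ω (v ω) (u ω)) (y : Fin 4 → ℂ) :
    ∃ c, sysStab σ (Complex.I * Λ, ω) Z Y y = jostR f k v u ω σ Λ 0 *ᵥ c := by
  have hF := h.isFundamental (σ := σ) (by simp) hP
  obtain ⟨c, hc⟩ := exists_freeStab_apply σ (show |ω| < 1 by linarith) Λ (Y 0 y)
  refine ⟨c, ?_⟩
  rw [jostR_mulVec, sysStab, mul_apply_eq_comp, mul_apply_eq_comp, hc, map_sum]
  refine Finset.sum_congr rfl fun j _ => ?_
  rw [map_smul, h.jost_eq hk hω hP]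
  simp only [hF.zero, one_apply_eq_self]

/-- The matrix `β` exchanges the spans of the `𝐟_j(0)` and the `𝐠_j(0)`, so the projection onto the
first along the second goes to its complement under conjugation by `β`. Only here is the frame
condition turned into a projection. -/
theorem IsSysConj.exists_isSplitting (h : IsSysConj f k v u (Complex.I * Λ, ω) Z Y B D) (hk : 2 ≤ k)
    (hω : |ω| < 1 / 3) (hP : IsProfile f ω (v ω) (u ω)) (hJ : IsJostFrame f k v u ω σ Λ) :
    ∃ P, IsSplitting (op matβ) (sysStab σ (Complex.I * Λ, ω) Z Y) P := by
  obtain ⟨L, hL⟩ := hJ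
  obtain ⟨P, ha, hb⟩ := hL.exists_proj
  have hQ := h.sysStab_mul_jostR (σ := σ) hk hω hP
  refine ⟨op P, ?_, ?_, ?_⟩
  · rw [← op_mat (sysStab σ (Complex.I * Λ, ω) Z Y), ← map_mul]
    congr 1
    refine hL.ext ?_ ?_
    · rw [Matrix.mul_assoc, ha, hQ]
    · rw [Matrix.mul_assoc, hb, Matrix.mul_zero]
  · ext1 y
    obtain ⟨c, hc⟩ := h.exists_sysStab_eq (σ := σ) hk hω hP y
    rw [mul_apply_eq_comp, hc, op_apply, Matrix.mulVec_mulVec, ha]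
  · rw [← map_mul, ← map_mul, ← map_one op, ← map_sub]
    congr 1
    refine hL.ext ?_ ?_
    · rw [Matrix.mul_assoc, Matrix.mul_assoc, hb, Matrix.mul_zero, Matrix.sub_mul, ha, Matrix.one_mul, sub_self]
    · calc matβ * P * matβ * (matβ * jostR f k v u ω σ Λ 0)
          = matβ * P * (matβ * matβ) * jostR f k v u ω σ Λ 0 := by simp only [Matrix.mul_assoc]
        _ = matβ * jostR f k v u ω σ Λ 0 := by
          rw [matβ_mul_matβ, Matrix.mul_one, Matrix.mul_assoc, ha]
        _ = _ := by rw [Matrix.sub_mul, hb, Matrix.one_mul, sub_zero]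

/-- The kernel of the resolvent determined by a splitting `P` of the solutions, where `Φ` is the
fundamental solution with the inverse `Ψ`. -/
noncomputable def splitKernel (Φ Ψ : ℝ → Op) (P : Op) (x y : ℝ) : Op :=
  (if y < x then Φ x * P * Ψ y else -(Φ x * (1 - P) * Ψ y)) * op (-matα)

/-- The kernel of the resolvent at the parameter `p`. -/
noncomputable def kernel (σ : Side) (p : ℂ × ℝ) (Z Y : ℝ → Op) (P : Op) : ℝ → ℝ → Op :=
  splitKernel (sysFund σ p Z Y) (sysInv σ p Z Y) P

/-- Green's function is the kernel determined by the splitting, whatever `Γ` is. -/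
theorem IsSysConj.green_eq (h : IsSysConj f k v u (Complex.I * Λ, ω) Z Y B D) (hk : 2 ≤ k)
    (hω : |ω| < 1 / 3) (hP : IsProfile f ω (v ω) (u ω)) (hJ : IsJostFrame f k v u ω σ Λ) {P : Op}
    (hs : IsSplitting (op matβ) (sysStab σ (Complex.I * Λ, ω) Z Y) P)
    {Γ : Matrix (Fin 2) (Fin 2) ℂ} (hΓ : Γ.det ≠ 0) (x y : ℝ) :
    green f k v u ω σ Λ Γ x y = mat (kernel σ (Complex.I * Λ, ω) Z Y P x y) := by
  have hF := h.isFundamental (σ := σ) (by simp) hP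
  obtain ⟨L, hL⟩ := hJ
  have hQ := h.sysStab_mul_jostR (σ := σ) hk hω hP
  have hPQ : mat P * mat (sysStab σ (Complex.I * Λ, ω) Z Y) =
      mat (sysStab σ (Complex.I * Λ, ω) Z Y) := by rw [← mat_mul, hs.right]
  have hPa : mat P * jostR f k v u ω σ Λ 0 = jostR f k v u ω σ Λ 0 := by
    rw [← hQ, ← Matrix.mul_assoc, hPQ]
  have hPβ : mat P * matβ = matβ * (1 - mat P) := by
    have := congrArg mat (hs.mul_refl op_matβ_mul_self)
    rwa [mat_mul, mat_mul, mat_op, mat_sub, mat_one] at this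
  have hPb : mat P * (matβ * jostR f k v u ω σ Λ 0) = 0 := by
    rw [← Matrix.mul_assoc, hPβ, Matrix.mul_assoc, Matrix.sub_mul, hPa, Matrix.one_mul, sub_self, Matrix.mul_zero]
  have m1 : ∀ x, mat (sysFund σ (Complex.I * Λ, ω) Z Y x) *
      mat (sysInv σ (Complex.I * Λ, ω) Z Y x) = 1 := fun x => by
    rw [← mat_mul, hF.mul_inv, mat_one]
  have m2 : ∀ x, mat (sysInv σ (Complex.I * Λ, ω) Z Y x) *
      mat (sysFund σ (Complex.I * Λ, ω) Z Y x) = 1 := fun x => by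
    rw [← mat_mul, hF.inv_mul, mat_one]
  have hax := h.jostR_eq (σ := σ) hk hω hP x
  have hay := h.jostR_eq (σ := σ) hk hω hP y
  have hbx := h.jostL_eq (σ := σ) hk hω hP x
  have hby := h.jostL_eq (σ := σ) hk hω hP y
  have hco := m2 y
  have hoc := m1 y
  set Fx := mat (sysFund σ (Complex.I * Λ, ω) Z Y x) with hFx
  set Fy := mat (sysFund σ (Complex.I * Λ, ω) Z Y y) with hFy
  set Iy := mat (sysInv σ (Complex.I * Λ, ω) Z Y y) with hIy
  -- Transport from `y` to `x` by `Φ(x) Ψ(y)` reduces the formula to the frame at `y` alone, where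
  -- `mul_inv_delta` applies with the transported projection `Φ(y) P Ψ(y)`.
  have ra : jostR f k v u ω σ Λ x = Fx * Iy * jostR f k v u ω σ Λ y := by
    rw [hax, hay]
    calc _ = Fx * (Iy * Fy) * jostR f k v u ω σ Λ 0 := by rw [hco, Matrix.mul_one]
      _ = _ := by simp only [Matrix.mul_assoc]
  have rb : jostL f k v u ω σ Λ x = Fx * Iy * jostL f k v u ω σ Λ y := by
    rw [hbx, hby]
    calc _ = Fx * (Iy * Fy) * (matβ * jostR f k v u ω σ Λ 0) := by rw [hco, Matrix.mul_one]
      _ = _ := by simp only [Matrix.mul_assoc]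
  have hLy : IsFrameInv (jostR f k v u ω σ Λ y) (jostL f k v u ω σ Λ y) (L * Iy) := by
    rw [hay, hby]
    exact hL.mul hoc hco
  have hya : Fy * mat P * Iy * jostR f k v u ω σ Λ y = jostR f k v u ω σ Λ y := by
    rw [hay]
    calc _ = Fy * mat P * (Iy * Fy) * jostR f k v u ω σ Λ 0 := by simp only [Matrix.mul_assoc, hFy]
      _ = _ := by rw [hco, Matrix.mul_one, Matrix.mul_assoc, hPa]
  have hyb : Fy * mat P * Iy * jostL f k v u ω σ Λ y = 0 := by
    rw [hby]
    calc _ = Fy * mat P * (Iy * Fy) * (matβ * jostR f k v u ω σ Λ 0) := by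
          simp only [Matrix.mul_assoc, hFy]
      _ = _ := by rw [hco, Matrix.mul_one, Matrix.mul_assoc, hPb, Matrix.mul_zero]
  obtain ⟨g1, g2⟩ := hLy.mul_inv_delta hΓ hya hyb
  rw [green, kernel, splitKernel, delta, mat_mul, mat_op]
  congr 1
  split_ifs with hxy
  · rw [ra, mat_mul, mat_mul]
    calc _ = Fx * Iy * (jostR f k v u ω σ Λ y * Γ * (jostL f k v u ω σ Λ y)ᴴ *
          (jostR f k v u ω σ Λ y * Γ * (jostL f k v u ω σ Λ y)ᴴ -
            jostL f k v u ω σ Λ y * Γ * (jostR f k v u ω σ Λ y)ᴴ)⁻¹) := by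
          simp only [Matrix.mul_assoc]
      _ = Fx * (Iy * Fy) * mat P * Iy := by rw [g1]; simp only [Matrix.mul_assoc]
      _ = _ := by rw [hco, Matrix.mul_one]
  · have hneg : mat (-(sysFund σ (Complex.I * Λ, ω) Z Y x * (1 - P) *
        sysInv σ (Complex.I * Λ, ω) Z Y y)) = -(Fx * (1 - mat P) * Iy) := by
      rw [← zero_sub, mat_sub, mat_mul, mat_mul, mat_sub, mat_one,
        show mat 0 = 0 from op_injective (by rw [op_mat, map_zero]), zero_sub]
    rw [rb, hneg]
    calc _ = Fx * Iy * (jostL f k v u ω σ Λ y * Γ * (jostR f k v u ω σ Λ y)ᴴ *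
          (jostR f k v u ω σ Λ y * Γ * (jostL f k v u ω σ Λ y)ᴴ -
            jostL f k v u ω σ Λ y * Γ * (jostR f k v u ω σ Λ y)ᴴ)⁻¹) := by
          simp only [Matrix.mul_assoc]
      _ = -(Fx * (Iy - (Iy * Fy) * mat P * Iy)) := by
          rw [g2]
          simp only [Matrix.mul_assoc, Matrix.mul_sub, Matrix.mul_neg, Matrix.mul_one]
      _ = _ := by
          rw [hco, Matrix.one_mul]
          simp only [Matrix.mul_sub, Matrix.sub_mul, Matrix.mul_one, Matrix.mul_assoc]

end

end GN

namespace GN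

/-! ### The symmetry between the two sides of the imaginary axis -/

section

/-- The conjugation `y ↦ diag(1, 1, -1, -1) ȳ`, which exchanges the two sides of the imaginary
axis. -/
noncomputable def flip (y : Fin 4 → ℂ) : Fin 4 → ℂ :=
  ![star (y 0), star (y 1), -star (y 2), -star (y 3)]

theorem flip_add (y z : Fin 4 → ℂ) : flip (y + z) = flip y + flip z := by
  ext i; fin_cases i <;> simp [flip] <;> ring

theorem flip_sub (y z : Fin 4 → ℂ) : flip (y - z) = flip y - flip z := by
  ext i; fin_cases i <;> simp [flip] <;> ring

theorem flip_smul (c : ℂ) (y : Fin 4 → ℂ) : flip (c • y) = star c • flip y := by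
  ext i; fin_cases i <;> simp [flip]

theorem flip_flip (y : Fin 4 → ℂ) : flip (flip y) = y := by
  ext i; fin_cases i <;> simp [flip]

theorem flip_zero : flip 0 = 0 := by
  ext i; fin_cases i <;> simp [flip]

theorem norm_flip_le (y : Fin 4 → ℂ) : ‖flip y‖ ≤ ‖y‖ := by
  refine (pi_norm_le_iff_of_nonneg (norm_nonneg _)).2 fun i => ?_
  fin_cases i <;> simp [flip] <;> exact norm_le_pi_norm y _

theorem flip_mulVec {m : Matrix (Fin 4) (Fin 4) ℂ}
    (h : ∀ i j, (if i < 2 then (1 : ℂ) else -1) * star (m i j) =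
      (if j < 2 then (1 : ℂ) else -1) * m i j)
    (y : Fin 4 → ℂ) : flip (m *ᵥ y) = m *ᵥ flip y := by
  have h0 : ∀ i j, star (m i j) = (if i < 2 then (1 : ℂ) else -1) *
      ((if j < 2 then (1 : ℂ) else -1) * m i j) := by
    intro i j
    rw [← h i j, ← mul_assoc]
    split_ifs <;> simp
  ext i
  fin_cases i <;>
    simp [flip, Matrix.mulVec, dotProduct, Fin.sum_univ_four, -RCLike.star_def, h0] <;> ring

variable {f : ℝ → ℝ} {v u : ℝ → ℝ → ℝ} {k : ℕ} {ω Λ : ℝ}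

/-- On the imaginary axis the system commutes with this antilinear map. It thus permutes solutions
at the same `Λ`, while complex conjugation of `e^{iξx}` exchanges the two boundary values of `ξ`. -/
theorem flip_M (x : ℝ) (y : Fin 4 → ℂ) :
    flip (M f v u ω (Complex.I * Λ) x *ᵥ y) = M f v u ω (Complex.I * Λ) x *ᵥ flip y := by
  refine flip_mulVec (fun i j => ?_) y
  rw [M, W, pot_eq]
  fin_cases i <;> fin_cases j <;>
    simp [matα, matJ, matβ]

theorem hasDerivAt_flip {g : ℝ → Fin 4 → ℂ} {g' : Fin 4 → ℂ} {x : ℝ} (h : HasDerivAt g g' x) :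
    HasDerivAt (fun x => flip (g x)) (flip g') x := by
  rw [hasDerivAt_pi] at h ⊢
  intro i
  fin_cases i
  · exact (h 0).star
  · exact (h 1).star
  · exact (h 2).star.neg
  · exact (h 3).star.neg

theorem star_I_mul_xi (j : Fin 2) (ω Λ : ℝ) :
    star (Complex.I * xi .minus j ω Λ) = Complex.I * xi .plus j ω Λ := by
  simp only [xi]
  split_ifs with h
  · simp [Side.sgn]
  · simp [← mul_assoc]

theorem norm_xi (j : Fin 2) (ω Λ : ℝ) : ‖xi .plus j ω Λ‖ = ‖xi .minus j ω Λ‖ := by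
  have := congrArg norm (star_I_mul_xi j ω Λ)
  rw [norm_star, norm_mul, norm_mul, Complex.norm_I, one_mul, one_mul] at this
  exact this.symm

/-- The sign in the relation of the amplitudes on the two sides. -/
noncomputable def xiSign (j : Fin 2) (ω Λ : ℝ) : ℂ := if zeta j ω Λ = 1 then -1 else 1

theorem xiSign_ne_zero (j : Fin 2) (ω Λ : ℝ) : xiSign j ω Λ ≠ 0 := by
  unfold xiSign; split_ifs <;> simp

theorem norm_xiSign (j : Fin 2) (ω Λ : ℝ) : ‖xiSign j ω Λ‖ = 1 := by
  unfold xiSign; split_ifs <;> simp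

/-- At `ζ = 1` the amplitude is normalized as a limit from positive `ξ` on both sides, whereas
conjugation would send it to negative `ξ`; hence the exceptional sign. -/
theorem Xi_plus (j : Fin 2) (ω Λ : ℝ) :
    Xi .plus j ω Λ = xiSign j ω Λ • flip (Xi .minus j ω Λ) := by
  have h1 := star_I_mul_xi j ω Λ
  simp only [Xi, xiSign]
  by_cases hz : zeta j ω Λ = 1
  · simp only [hz, if_true]
    rw [flip_smul]
    ext i
    fin_cases j <;> fin_cases i <;> simp [flip]
  · simp only [hz, if_false]
    rw [flip_smul, norm_xi, one_smul]
    congr 1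
    · simp
    · ext i
      have h2 : Complex.I * xi .plus j ω Λ =
          -(Complex.I * (starRingEnd ℂ) (xi .minus j ω Λ)) := by
        rw [← h1]
        simp
      generalize xi .plus j ω Λ = p at *
      generalize xi .minus j ω Λ = q at *
      fin_cases i
      · simp [flip, h2]
      · simp [flip]
      · fin_cases j <;> simp [flip]
        · linear_combination Complex.I * h2
        · linear_combination -Complex.I * h2
      · fin_cases j <;> simp [flip]

theorem IsJost.flip_minus {j : Fin 2} {g : ℝ → Fin 4 → ℂ} (h : IsJost f k v u ω .minus Λ j g) :
    IsJost f k v u ω .plus Λ j fun x => xiSign j ω Λ • flip (g x) := by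
  obtain ⟨hd, c, hc⟩ := h
  refine ⟨fun x => ?_, c, fun x hx => ?_⟩
  · refine ((hasDerivAt_flip (hd x)).const_smul (xiSign j ω Λ)).congr_deriv ?_
    rw [flip_M, Matrix.mulVec_smul]
  · refine le_trans ?_ (hc x hx)
    have e1 : Complex.exp (-(Complex.I * xi .plus j ω Λ * x)) =
        star (Complex.exp (-(Complex.I * xi .minus j ω Λ * x))) := by
      rw [← star_I_mul_xi, RCLike.star_def, ← Complex.exp_conj]
      simp
    rw [Xi_plus, e1, smul_comm, ← flip_smul, ← smul_sub, ← flip_sub, norm_smul, norm_xiSign,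
      one_mul]
    exact norm_flip_le _

/-- The Evans function is formed on one side only. By uniqueness the Jost solutions of the other
side are images under the antilinear symmetry, up to signs, and linear independence is preserved. -/
theorem IsJostFrame.plus (h : IsJostFrame f k v u ω .minus Λ)
    (hJ : ∀ j, ∃! g, IsJost f k v u ω .minus Λ j g)
    (hJ' : ∀ j, ∃! g, IsJost f k v u ω .plus Λ j g) : IsJostFrame f k v u ω .plus Λ := by
  obtain ⟨L, hL⟩ := h
  have hj : ∀ j x, jost f k v u ω .plus Λ j x = xiSign j ω Λ • flip (jost f k v u ω .minus Λ j x) := by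
    intro j x
    have h1 : IsJost f k v u ω .minus Λ j (jost f k v u ω .minus Λ j) :=
      Classical.epsilon_spec (hJ j).exists
    have h2 : IsJost f k v u ω .plus Λ j (jost f k v u ω .plus Λ j) :=
      Classical.epsilon_spec (hJ' j).exists
    exact congrFun ((hJ' j).unique h2 h1.flip_minus) x
  have hβ : ∀ y, flip (matβ *ᵥ y) = matβ *ᵥ flip y := flip_mulVec fun i j => by
    fin_cases i <;> fin_cases j <;> simp [matβ]
  have hcol : ∀ c : Fin 2 → ℂ, flip (jostR f k v u ω .plus Λ 0 *ᵥ c) =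
      jostR f k v u ω .minus Λ 0 *ᵥ fun j => star (c j * xiSign j ω Λ) := by
    intro c
    rw [jostR_mulVec, jostR_mulVec, Fin.sum_univ_two, Fin.sum_univ_two, flip_add, hj, hj, smul_smul,
      smul_smul, flip_smul, flip_smul, flip_flip, flip_flip]
  refine exists_isFrameInv fun c d h0 => ?_
  have h1 := congrArg flip h0
  rw [flip_add, flip_zero, ← Matrix.mulVec_mulVec, hβ, hcol, hcol, Matrix.mulVec_mulVec] at h1
  obtain ⟨h2, h3⟩ := hL.eq_zero h1
  refine ⟨funext fun i => ?_, funext fun i => ?_⟩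
  · have := congrFun h2 i
    simpa [xiSign_ne_zero] using this
  · have := congrFun h3 i
    simpa [xiSign_ne_zero] using this

end

end GN

namespace GN

/-! ### The kernel as a fundamental solution -/

section

set_option linter.unusedSectionVars false

variable {E : Type*} [NormedAddCommGroup E] [NormedSpace ℂ E] [CompleteSpace E]

theorem contDiff_one_smul {θ : ℝ → ℂ} (hθ : ContDiff ℝ (⊤ : ℕ∞) θ) {F F' : ℝ → E}
    (hF : ∀ x, HasDerivAt F (F' x) x) (hF' : Continuous F') :
    ContDiff ℝ 1 (fun x => θ x • F x) ∧
      deriv (fun x => θ x • F x) = fun x => deriv θ x • F x + θ x • F' x := by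
  have hθd : Differentiable ℝ θ := hθ.differentiable (by simp)
  have hd : ∀ x, HasDerivAt (fun x => θ x • F x) (deriv θ x • F x + θ x • F' x) x := by
    intro x
    refine ((hθd x).hasDerivAt.smul (hF x)).congr_deriv ?_
    rw [add_comm]
  have hFc : Continuous F := continuous_iff_continuousAt.2 fun x => (hF x).continuousAt
  have hθ' : Continuous (deriv θ) := hθ.continuous_deriv (by simp)
  have he : deriv (fun x => θ x • F x) = fun x => deriv θ x • F x + θ x • F' x :=
    funext fun x => (hd x).deriv
  refine ⟨contDiff_one_iff_deriv.2 ⟨fun x => (hd x).differentiableAt, ?_⟩, he⟩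
  rw [he]
  have := hθ.continuous
  fun_prop

theorem integral_Ioi_test {θ : ℝ → ℂ} (hθ : ContDiff ℝ (⊤ : ℕ∞) θ) (hc : HasCompactSupport θ)
    {F F' : ℝ → E} (hF : ∀ x, HasDerivAt F (F' x) x) (hF' : Continuous F') (y : ℝ) :
    ∫ x in Ioi y, (deriv θ x • F x + θ x • F' x) = -(θ y • F y) := by
  obtain ⟨h1, h2⟩ := contDiff_one_smul hθ hF hF'
  rw [← (hc.smul_right (f' := F)).integral_Ioi_deriv_eq h1 y]
  rw [h2]

theorem integral_Iic_test {θ : ℝ → ℂ} (hθ : ContDiff ℝ (⊤ : ℕ∞) θ) (hc : HasCompactSupport θ)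
    {F F' : ℝ → E} (hF : ∀ x, HasDerivAt F (F' x) x) (hF' : Continuous F') (y : ℝ) :
    ∫ x in Iic y, (deriv θ x • F x + θ x • F' x) = θ y • F y := by
  obtain ⟨h1, h2⟩ := contDiff_one_smul hθ hF hF'
  rw [← (hc.smul_right (f' := F)).integral_Iic_deriv_eq h1 y]
  rw [h2]

theorem integrable_test {θ : ℝ → ℂ} (hθ : ContDiff ℝ (⊤ : ℕ∞) θ) (hc : HasCompactSupport θ)
    {F F' : ℝ → E} (hF : Continuous F) (hF' : Continuous F') :
    Integrable (fun x => deriv θ x • F x + θ x • F' x) volume := by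
  have hθ' : Continuous (deriv θ) := hθ.continuous_deriv (by simp)
  have := hθ.continuous
  refine Continuous.integrable_of_hasCompactSupport (by fun_prop) ?_
  exact (hc.deriv.smul_right (f' := F)).add (hc.smul_right (f' := F'))

end

section

variable {b : Op} {Mt Φ Ψ : ℝ → Op}

theorem splitKernel_of_lt (P : Op) {x y : ℝ} (h : y < x) :
    splitKernel Φ Ψ P x y = Φ x * P * Ψ y * op (-matα) := by rw [splitKernel, if_pos h]

theorem splitKernel_of_le (P : Op) {x y : ℝ} (h : x ≤ y) :
    splitKernel Φ Ψ P x y = -(Φ x * (1 - P) * Ψ y) * op (-matα) := by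
  rw [splitKernel, if_neg h.not_gt]

theorem neg_mul_mul_mul {A : Type*} [Ring A] (x q s a : A) :
    -(x * q * s) * a = x * -(q * s * a) := by noncomm_ring

theorem mul_neg_sub_mul {A : Type*} [Ring A] (x p s a : A) :
    x * -((1 - p) * s * a) - x * (p * s * a) = -(x * s) * a := by noncomm_ring

/-- On each side of the diagonal the kernel solves the homogeneous system. Its jump there is `Φ(y)
(P + (1 - P)) Ψ(y) (-α) = -α`, and integration by parts on the two half-lines picks it up. -/
theorem IsFundamental.integral_splitKernel (h : IsFundamental b Mt Φ Ψ) (hM : Continuous Mt) (P : Op)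
    {θ : ℝ → ℂ} (hθ : ContDiff ℝ (⊤ : ℕ∞) θ) (hc : HasCompactSupport θ) (y : ℝ) :
    Integrable (fun x => _root_.deriv θ x • splitKernel Φ Ψ P x y +
        θ x • (Mt x * splitKernel Φ Ψ P x y)) volume ∧
      ∫ x, (_root_.deriv θ x • splitKernel Φ Ψ P x y + θ x • (Mt x * splitKernel Φ Ψ P x y)) =
        θ y • op matα := by
  have hΦ := h.continuous
  have hd : ∀ R : Op, ∀ x, HasDerivAt (fun x => Φ x * R) (Mt x * (Φ x * R)) x := fun R x => by
    have := (h.deriv x).mul_const R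
    rwa [mul_assoc] at this
  have hd' : ∀ R : Op, Continuous fun x => Mt x * (Φ x * R) := fun R => by fun_prop
  set R₁ : Op := P * Ψ y * op (-matα) with hR₁
  set R₂ : Op := -((1 - P) * Ψ y * op (-matα)) with hR₂
  have e₁ : ∀ x, y < x → splitKernel Φ Ψ P x y = Φ x * R₁ := fun x hx => by
    rw [splitKernel_of_lt P hx, hR₁]; simp only [mul_assoc]
  have e₂ : ∀ x, x ≤ y → splitKernel Φ Ψ P x y = Φ x * R₂ := fun x hx => by
    rw [splitKernel_of_le P hx]
    exact neg_mul_mul_mul _ _ _ _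
  set g := fun x => _root_.deriv θ x • splitKernel Φ Ψ P x y + θ x • (Mt x * splitKernel Φ Ψ P x y)
    with hg
  have g₁ : EqOn g (fun x => _root_.deriv θ x • (Φ x * R₁) + θ x • (Mt x * (Φ x * R₁))) (Ioi y) :=
    fun x hx => by simp only [hg, e₁ x hx]
  have g₂ : EqOn g (fun x => _root_.deriv θ x • (Φ x * R₂) + θ x • (Mt x * (Φ x * R₂))) (Iic y) :=
    fun x hx => by simp only [hg, e₂ x hx]
  have i₁ : IntegrableOn g (Ioi y) :=
    ((integrable_test hθ hc (hΦ.mul continuous_const) (hd' R₁)).integrableOn).congr_fun g₁.symm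
      measurableSet_Ioi
  have i₂ : IntegrableOn g (Iic y) :=
    ((integrable_test hθ hc (hΦ.mul continuous_const) (hd' R₂)).integrableOn).congr_fun g₂.symm
      measurableSet_Iic
  have hi : Integrable g volume := by
    rw [← integrableOn_univ, ← Iic_union_Ioi (a := y)]
    exact i₂.union i₁
  refine ⟨hi, ?_⟩
  rw [← intervalIntegral.integral_Iic_add_Ioi i₂ i₁, setIntegral_congr_fun measurableSet_Ioi g₁,
    setIntegral_congr_fun measurableSet_Iic g₂, integral_Ioi_test hθ hc (hd R₁) (hd' R₁),
    integral_Iic_test hθ hc (hd R₂) (hd' R₂), ← sub_eq_add_neg, ← smul_sub, hR₁, hR₂]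
  congr 1
  rw [mul_neg_sub_mul, h.mul_inv, map_neg]
  exact neg_mul_neg 1 (op matα) |>.trans (one_mul _)

theorem IsFundamental.measurable_splitKernel (h : IsFundamental b Mt Φ Ψ) (P : Op) :
    StronglyMeasurable fun z : ℝ × ℝ => splitKernel Φ Ψ P z.1 z.2 := by
  have hΦ := h.continuous
  have hΨ := h.continuous_inv
  unfold splitKernel
  refine StronglyMeasurable.mul_const (StronglyMeasurable.ite
    (measurableSet_lt measurable_snd measurable_fst) ?_ ?_) _
  · exact Continuous.stronglyMeasurable (by fun_prop)
  · exact Continuous.stronglyMeasurable (by fun_prop)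

/-- A matrix entry as a functional of the operator. -/
noncomputable def entryL (i j : Fin 4) : Op →L[ℂ] ℂ :=
  (ContinuousLinearMap.proj (R := ℂ) (φ := fun _ : Fin 4 => ℂ) i).comp
    (ContinuousLinearMap.apply ℂ (Fin 4 → ℂ) (Pi.single j (1 : ℂ)))

theorem entryL_apply (i j : Fin 4) (T : Op) : entryL i j T = mat T i j := by
  rw [mat, LinearMap.toMatrix'_apply]
  rfl

theorem IsFundamental.isGreen {f : ℝ → ℝ} {v u : ℝ → ℝ → ℝ} {ω Λ : ℝ}
    (h : IsFundamental b (fun x => op (M f v u ω (Complex.I * Λ) x)) Φ Ψ)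
    (hM : Continuous fun x => op (M f v u ω (Complex.I * Λ) x)) (P : Op) :
    IsGreen f v u ω Λ fun x y => mat (splitKernel Φ Ψ P x y) := by
  intro y i j
  refine ⟨fun l => ?_, fun θ hθ hc => ?_⟩
  · have hΦ := h.continuous
    have hpiece : ∀ S : Set ℝ, MeasurableSet S → ∀ F : ℝ → Op, Continuous F →
        LocallyIntegrable (S.indicator fun x => entryL l j (F x)) volume := fun S hS F hF =>
      (Continuous.locallyIntegrable (by fun_prop)).indicator hS
    have := (hpiece (Ioi y) measurableSet_Ioi (fun x => Φ x * P * Ψ y * op (-matα))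
      (by fun_prop)).add (hpiece (Iic y) measurableSet_Iic
        (fun x => -(Φ x * (1 - P) * Ψ y) * op (-matα)) (by fun_prop))
    refine (funext fun x => ?_ : (fun x => mat (splitKernel Φ Ψ P x y) l j) = _) ▸ this
    simp only [Pi.add_apply, ← entryL_apply]
    rcases lt_or_ge y x with hx | hx
    · rw [indicator_of_mem (show x ∈ Ioi y from hx), indicator_of_notMem (by simpa using hx),
        splitKernel_of_lt P hx, add_zero]
    · rw [indicator_of_mem (show x ∈ Iic y from hx), indicator_of_notMem (by simpa using hx),
        splitKernel_of_le P hx, zero_add]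
  · obtain ⟨hi, he⟩ := h.integral_splitKernel hM P hθ hc y
    set L : Op →L[ℂ] ℂ := (ContinuousLinearMap.proj (R := ℂ) (φ := fun _ : Fin 4 => ℂ) i).comp
      ((op matα).comp (ContinuousLinearMap.apply ℂ (Fin 4 → ℂ) (Pi.single j (1 : ℂ)))) with hL
    have hLa : ∀ T, L T = mat (op matα * T) i j := fun T => by
      rw [hL, ← entryL_apply]; rfl
    have h1 := L.integral_comp_comm hi
    rw [he] at h1
    have h2 : L (θ y • op matα) = θ y * (1 : Matrix (Fin 4) (Fin 4) ℂ) i j := by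
      rw [map_smul, hLa, ← map_mul, matα_mul_matα, map_one, mat_one, smul_eq_mul]
    rw [h2] at h1
    rw [← h1]
    refine integral_congr_ae (ae_of_all _ fun x => ?_)
    beta_reduce
    rw [map_add, map_smul, map_smul, hLa, hLa, mat_mul, mat_mul, mat_mul, mat_op, mat_op,
      smul_eq_mul, smul_eq_mul, Matrix.mul_assoc]
    ring

end

end GN

namespace GN

/-! ### Weak derivatives on the line -/

theorem exists_hasCompactSupport_primitive {ψ : ℝ → ℝ} (hψ : ContDiff ℝ (⊤ : ℕ∞) ψ)
    (hc : HasCompactSupport ψ) (h0 : ∫ x, ψ x = 0) :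
    ∃ θ : ℝ → ℝ, ContDiff ℝ (⊤ : ℕ∞) θ ∧ HasCompactSupport θ ∧ deriv θ = ψ := by
  obtain ⟨R, hR⟩ := hc.isCompact.isBounded.subset_closedBall 0
  have hz : ∀ x, R < |x| → ψ x = 0 := fun x hx => by
    refine image_eq_zero_of_notMem_tsupport fun h => ?_
    have := hR h
    rw [mem_closedBall_zero_iff, Real.norm_eq_abs] at this
    linarith
  have hd : ∀ x, HasDerivAt (fun x => ∫ t in Iic x, ψ t) (ψ x) x := fun x => by
    have h1 : (fun x => ∫ t in Iic x, ψ t) = fun x => (∫ t in Iic (0 : ℝ), ψ t) + ∫ t in (0 : ℝ)..x, ψ t := by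
      funext x
      have hi := hψ.continuous.integrable_of_hasCompactSupport hc (μ := volume)
      rw [← intervalIntegral.integral_Iic_sub_Iic hi.integrableOn hi.integrableOn]
      ring
    rw [h1]
    exact (intervalIntegral.integral_hasDerivAt_right (hψ.continuous.intervalIntegrable _ _)
      hψ.continuous.aestronglyMeasurable.stronglyMeasurableAtFilter
      hψ.continuous.continuousAt).const_add _
  have he : deriv (fun x => ∫ t in Iic x, ψ t) = ψ := funext fun x => (hd x).deriv
  refine ⟨fun x => ∫ t in Iic x, ψ t, ?_, ?_, he⟩
  · rw [contDiff_infty_iff_deriv, he]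
    exact ⟨fun x => (hd x).differentiableAt, hψ⟩
  · refine HasCompactSupport.of_support_subset_isCompact (isCompact_Icc (a := -R) (b := R)) ?_
    intro x hx
    by_contra hx'
    rw [mem_Icc, not_and_or, not_le, not_le] at hx'
    refine hx ?_
    rcases hx' with h | h
    · refine setIntegral_eq_zero_of_forall_eq_zero fun t ht => hz t ?_
      have : t ≤ x := ht
      rw [lt_abs]; right; linarith
    · have h2 : ∫ t in Iic x, ψ t = ∫ t, ψ t := by
        refine setIntegral_eq_integral_of_forall_compl_eq_zero fun t ht => hz t ?_
        have : x < t := not_le.1 ht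
        rw [lt_abs]; left; linarith
      exact h2.trans h0

/-- A function with vanishing weak derivative is constant. -/
theorem exists_ae_eq_const {H : ℝ → ℝ} (hH : LocallyIntegrable H volume)
    (h : ∀ θ : ℝ → ℝ, ContDiff ℝ (⊤ : ℕ∞) θ → HasCompactSupport θ → ∫ x, deriv θ x * H x = 0) :
    ∃ c : ℝ, ∀ᵐ x, H x = c := by
  have bump : ContDiffBump (0 : ℝ) := ⟨1, 2, one_pos, one_lt_two⟩
  set ρ : ℝ → ℝ := bump.normed volume with hρ
  have hρ1 : ContDiff ℝ (⊤ : ℕ∞) ρ := bump.contDiff_normed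
  have hρ2 : HasCompactSupport ρ := bump.hasCompactSupport_normed
  have hint : ∀ η : ℝ → ℝ, ContDiff ℝ (⊤ : ℕ∞) η → HasCompactSupport η →
      Integrable (fun x => η x * H x) volume := fun η h1 h2 =>
    hH.integrable_smul_left_of_hasCompactSupport h1.continuous h2
  refine ⟨∫ x, ρ x * H x, ?_⟩
  have key := ae_eq_zero_of_integral_contDiff_smul_eq_zero (μ := volume)
    (f := fun x => H x - ∫ x, ρ x * H x) (hH.sub (locallyIntegrable_const _)) fun η h1 h2 => by
      have i1 : Integrable η volume := h1.continuous.integrable_of_hasCompactSupport h2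
      have i2 : Integrable ρ volume := hρ1.continuous.integrable_of_hasCompactSupport hρ2
      -- Every test function is a multiple of the bump `ρ` plus the derivative of a test function,
      -- and the latter is annihilated by hypothesis.
      obtain ⟨θ, t1, t2, t3⟩ := exists_hasCompactSupport_primitive
        (ψ := fun x => η x - (∫ y, η y) * ρ x) (h1.sub (contDiff_const.mul hρ1))
        (h2.sub (hρ2.mul_left (f := fun _ => ∫ y, η y))) (by
          rw [integral_sub i1 (i2.const_mul _), integral_const_mul, hρ, bump.integral_normed]
          ring)
      have := h θ t1 t2
      rw [t3] at this
      simp only [sub_mul, mul_assoc] at this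
      rw [integral_sub (hint η h1 h2) ((hint ρ hρ1 hρ2).const_mul _), integral_const_mul] at this
      simp only [smul_eq_mul, mul_sub]
      rw [integral_sub (hint η h1 h2) (i1.mul_const _), integral_mul_const]
      linarith
  filter_upwards [key] with x hx
  linarith

/-- A locally integrable function with a locally integrable weak derivative is a primitive of it. -/
theorem exists_ae_eq_add_integral {H g : ℝ → ℝ} (hH : LocallyIntegrable H volume)
    (hg : LocallyIntegrable g volume)
    (h : ∀ θ : ℝ → ℝ, ContDiff ℝ (⊤ : ℕ∞) θ → HasCompactSupport θ →
      ∫ x, deriv θ x * H x = -∫ x, θ x * g x) :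
    ∃ c : ℝ, ∀ᵐ x, H x = c + ∫ t in (0 : ℝ)..x, g t := by
  have hgi : ∀ x y, IntervalIntegrable g volume x y := fun x y =>
    intervalIntegrable_iff.2 ((hg.integrableOn_isCompact isCompact_uIcc).mono_set uIoc_subset_uIcc)
  set Z : ℝ → ℝ := fun x => ∫ t in (0 : ℝ)..x, g t with hZ
  have hZc : Continuous Z := intervalIntegral.continuous_primitive hgi 0
  obtain ⟨c, hc⟩ := exists_ae_eq_const (H := fun x => H x - Z x)
    (hH.sub hZc.locallyIntegrable) fun θ h1 h2 => by
      have hθ' : Continuous (deriv θ) := h1.continuous_deriv (by simp)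
      have i1 : Integrable (fun x => deriv θ x * H x) volume :=
        hH.integrable_smul_left_of_hasCompactSupport hθ' h2.deriv
      have i2 : Integrable (fun x => deriv θ x * Z x) volume :=
        (hθ'.mul hZc).integrable_of_hasCompactSupport (h2.deriv.mul_right)
      simp only [mul_sub]
      rw [integral_sub i1 i2, h θ h1 h2]
      obtain ⟨R, hR⟩ := h2.isCompact.isBounded.subset_closedBall 0
      have hz : ∀ x, R < |x| → x ∉ tsupport θ := fun x hx h => by
        have := hR h
        rw [mem_closedBall_zero_iff, Real.norm_eq_abs] at this
        linarith
      set S := |R| + 1 with hS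
      have hRS : R < S := by linarith [le_abs_self R]
      have hS0 : 0 < S := by positivity
      have hsupp : ∀ F : ℝ → ℝ, (∀ x, x ∉ tsupport θ → F x = 0) →
          ∫ x, F x = ∫ x in (-S)..S, F x := fun F hF => by
        rw [intervalIntegral.integral_of_le (by linarith)]
        refine (setIntegral_eq_integral_of_forall_compl_eq_zero fun x hx => hF x (hz x ?_)).symm
        rw [mem_Ioc, not_and_or, not_lt, not_le] at hx
        rw [lt_abs]
        rcases hx with hx | hx
        · right; linarith
        · left; linarith
      have hθ0 : ∀ x, x ∉ tsupport θ → θ x = 0 := fun x => image_eq_zero_of_notMem_tsupport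
      have hθ0' : ∀ x, x ∉ tsupport θ → deriv θ x = 0 := fun x hx =>
        image_eq_zero_of_notMem_tsupport fun h' => hx (tsupport_deriv_subset (f := θ) h')
      rw [hsupp (fun x => θ x * g x) fun x hx => by simp only [hθ0 x hx, zero_mul],
        hsupp (fun x => deriv θ x * Z x) fun x hx => by simp only [hθ0' x hx, zero_mul]]
      -- The primitive of a locally integrable function is differentiable only almost everywhere, so
      -- integration by parts is used in its form for absolutely continuous functions.
      have ac1 : AbsolutelyContinuousOnInterval θ (-S) S :=
        (h1.of_le (by simp)).contDiffOn.absolutelyContinuousOnInterval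
      have ac2 : AbsolutelyContinuousOnInterval Z (-S) S :=
        (hgi (-S) S).absolutelyContinuousOnInterval_intervalIntegral (by
          rw [mem_uIcc]; left; constructor <;> linarith)
      have ibp := ac1.integral_mul_deriv_eq_deriv_mul ac2
      have e1 : ∫ x in (-S)..S, θ x * deriv Z x = ∫ x in (-S)..S, θ x * g x := by
        refine intervalIntegral.integral_congr_ae ?_
        filter_upwards [(hgi (-S) S).ae_hasDerivAt_integral] with x hx hxm
        rw [(hx (uIoc_subset_uIcc hxm) 0 (by
          rw [mem_uIcc]; left; constructor <;> linarith)).deriv]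
      rw [e1, hθ0 S (hz S (by rwa [abs_of_pos hS0])),
        hθ0 (-S) (hz (-S) (by rwa [abs_neg, abs_of_pos hS0]))] at ibp
      linarith
  exact ⟨c, by filter_upwards [hc] with x hx; linarith⟩

theorem exists_ae_eq_add_integral_pi {z g : ℝ → Fin 4 → ℂ} (hz : LocallyIntegrable z volume)
    (hg : LocallyIntegrable g volume)
    (h : ∀ θ : ℝ → ℂ, ContDiff ℝ (⊤ : ℕ∞) θ → HasCompactSupport θ → ∀ i,
      ∫ x, deriv θ x * z x i = -∫ x, θ x * g x i) :
    ∃ c : Fin 4 → ℂ, ∀ᵐ x, z x = c + ∫ t in (0 : ℝ)..x, g t := by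
  have hgi : ∀ x y, IntervalIntegrable g volume x y := fun x y =>
    intervalIntegrable_iff.2 ((hg.integrableOn_isCompact isCompact_uIcc).mono_set uIoc_subset_uIcc)
  have hL : ∀ L : (Fin 4 → ℂ) →L[ℝ] ℝ, ∀ F : ℝ → Fin 4 → ℂ, LocallyIntegrable F volume →
      LocallyIntegrable (fun x => L (F x)) volume := fun L F hF x => by
    obtain ⟨s, hs, hi⟩ := hF x
    exact ⟨s, hs, L.integrable_comp hi⟩
  have hre : ∀ (i : Fin 4) (L : ℂ →L[ℝ] ℝ), ∃ c : ℝ, ∀ᵐ x, L (z x i) =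
      c + ∫ t in (0 : ℝ)..x, L (g t i) := fun i L => by
    refine exists_ae_eq_add_integral (hL (L.comp (ContinuousLinearMap.proj i)) z hz)
      (hL (L.comp (ContinuousLinearMap.proj i)) g hg) fun θ h1 h2 => ?_
    have hθd : ∀ x, HasDerivAt (fun x => (θ x : ℂ)) ((deriv θ x : ℝ) : ℂ) x := fun x =>
      ((h1.differentiable (by simp)) x).hasDerivAt.ofReal_comp
    have e := h (fun x => (θ x : ℂ)) (Complex.ofRealCLM.contDiff.comp h1)
      (h2.comp_left (g := Complex.ofReal) rfl) i
    have ed : deriv (fun x => (θ x : ℂ)) = fun x => ((deriv θ x : ℝ) : ℂ) :=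
      funext fun x => (hθd x).deriv
    rw [ed] at e
    have hθ' : Continuous (deriv θ) := h1.continuous_deriv (by simp)
    have hcomp : ∀ F : ℝ → Fin 4 → ℂ, LocallyIntegrable F volume →
        LocallyIntegrable (fun x => F x i) volume := fun F hF x => by
      obtain ⟨s, hs, hi⟩ := hF x
      exact ⟨s, hs, (ContinuousLinearMap.proj (R := ℂ) (φ := fun _ : Fin 4 => ℂ) i).integrable_comp hi⟩
    have key : ∀ (η : ℝ → ℝ) (F : ℝ → Fin 4 → ℂ), Continuous η → HasCompactSupport η →
        LocallyIntegrable F volume →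
        ∫ x, η x * L (F x i) = L (∫ x, (η x : ℂ) * F x i) := fun η F k1 k2 k3 => by
      have hi := (hcomp F k3).integrable_smul_left_of_hasCompactSupport k1 k2
      simp only [Complex.real_smul] at hi
      rw [← L.integral_comp_comm hi]
      refine integral_congr_ae (ae_of_all _ fun x => ?_)
      simp only [← Complex.real_smul, map_smul, smul_eq_mul]
    change ∫ x, deriv θ x * L (z x i) = -∫ x, θ x * L (g x i)
    rw [key _ _ hθ' h2.deriv hz, key _ _ h1.continuous h2 hg, e, map_neg]
  choose c hc using fun i => hre i Complex.reCLM
  choose d hd using fun i => hre i Complex.imCLM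
  refine ⟨fun i => ⟨c i, d i⟩, ?_⟩
  have hc' := ae_all_iff.2 hc
  have hd' := ae_all_iff.2 hd
  filter_upwards [hc', hd'] with x h1 h2
  ext1 i
  have e : (∫ t in (0 : ℝ)..x, g t) i = ∫ t in (0 : ℝ)..x, g t i :=
    ((ContinuousLinearMap.proj (R := ℂ) (φ := fun _ : Fin 4 => ℂ) i).intervalIntegral_comp_comm
      (hgi 0 x)).symm
  have hgii : IntervalIntegrable (fun t => g t i) volume 0 x := by
    have := intervalIntegrable_iff.1 (hgi 0 x)
    exact intervalIntegrable_iff.2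
      ((ContinuousLinearMap.proj (R := ℂ) (φ := fun _ : Fin 4 => ℂ) i).integrable_comp this)
  rw [Pi.add_apply, e]
  apply Complex.ext
  · rw [Complex.add_re]
    refine (h1 i).trans (congrArg₂ (· + ·) rfl ?_)
    exact Complex.reCLM.intervalIntegral_comp_comm hgii
  · rw [Complex.add_im]
    refine (h2 i).trans (congrArg₂ (· + ·) rfl ?_)
    exact Complex.imCLM.intervalIntegral_comp_comm hgii

/-- A weak solution of the homogeneous system is a classical one. -/
theorem IsFundamental.exists_ae_eq {b : Op} {Mt Φ Ψ : ℝ → Op} (h : IsFundamental b Mt Φ Ψ)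
    (hM : Continuous Mt) {z : ℝ → Fin 4 → ℂ} (hz : LocallyIntegrable z volume)
    (hw : ∀ θ : ℝ → ℂ, ContDiff ℝ (⊤ : ℕ∞) θ → HasCompactSupport θ → ∀ i,
      ∫ x, _root_.deriv θ x * z x i = -∫ x, θ x * (Mt x (z x)) i) :
    ∃ c : Fin 4 → ℂ, ∀ᵐ x, z x = Φ x c := by
  have hg : LocallyIntegrable (fun x => Mt x (z x)) volume := by
    rw [locallyIntegrable_iff] at hz ⊢
    intro K hK
    obtain ⟨C, hC⟩ := hK.exists_bound_of_continuousOn hM.continuousOn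
    refine Integrable.mono' ((hz K hK).norm.const_mul C) ?_ ?_
    · exact (ContinuousLinearMap.apply ℂ (Fin 4 → ℂ)).flip.aestronglyMeasurable_comp₂
        hM.aestronglyMeasurable (hz K hK).aestronglyMeasurable
    · filter_upwards [ae_restrict_mem hK.measurableSet] with x hx
      exact ((Mt x).le_opNorm _).trans (mul_le_mul_of_nonneg_right (hC x hx) (norm_nonneg _))
  obtain ⟨c, hc⟩ := exists_ae_eq_add_integral_pi hz hg hw
  have hgi : ∀ x y, IntervalIntegrable (fun x => Mt x (z x)) volume x y := fun x y =>
    intervalIntegrable_iff.2 ((hg.integrableOn_isCompact isCompact_uIcc).mono_set uIoc_subset_uIcc)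
  -- The continuous representative satisfies an integral equation with a continuous integrand, hence
  -- it is differentiable and the classical uniqueness applies.
  set zt : ℝ → Fin 4 → ℂ := fun x => c + ∫ t in (0 : ℝ)..x, Mt t (z t) with hzt
  have hztc : Continuous zt := continuous_const.add (intervalIntegral.continuous_primitive hgi 0)
  have hcont : Continuous fun x => Mt x (zt x) := hM.clm_apply hztc
  have e : zt = fun x => c + ∫ t in (0 : ℝ)..x, Mt t (zt t) := by
    funext x
    simp only [hzt]
    congr 1
    refine intervalIntegral.integral_congr_ae ?_
    filter_upwards [hc] with t ht _
    rw [ht]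
  refine ⟨zt 0, ?_⟩
  filter_upwards [hc] with x hx
  rw [hx]
  refine h.eq_of_hasDerivAt (y := zt) (fun x => ?_) x
  conv => enter [1]; rw [e]
  exact ((intervalIntegral.integral_hasDerivAt_right (hcont.intervalIntegrable _ _)
      hcont.aestronglyMeasurable.stronglyMeasurableAtFilter hcont.continuousAt).const_add c)

end GN

namespace GN

/-! ### Integral operators on `L²` -/

theorem integrable_exp_neg_mul_abs {r : ℝ} (hr : 0 < r) :
    Integrable (fun x : ℝ => Real.exp (-(r * |x|))) volume := by
  rw [← integrableOn_univ, ← Iic_union_Ioi (a := (0 : ℝ))]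
  refine IntegrableOn.union ?_ ?_
  · refine (integrableOn_exp_mul_Iic hr 0).congr_fun (fun x hx => ?_) measurableSet_Iic
    have : x ≤ 0 := hx
    simp only [abs_of_nonpos this, mul_neg, neg_neg]
  · refine (exp_neg_integrableOn_Ioi 0 hr).congr_fun (fun x hx => ?_) measurableSet_Ioi
    have : 0 < x := hx
    simp only [abs_of_pos this, neg_mul]

theorem sq_lintegral_mul_le {α : Type*} [MeasurableSpace α] {μ : Measure α} {f g : α → ℝ≥0∞}
    (hf : AEMeasurable f μ) (hg : AEMeasurable g μ) :
    (∫⁻ x, f x * g x ∂μ) ^ 2 ≤ (∫⁻ x, f x ^ 2 ∂μ) * ∫⁻ x, g x ^ 2 ∂μ := by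
  have h := ENNReal.lintegral_mul_le_Lp_mul_Lq μ Real.HolderConjugate.two_two hf hg
  simp only [Pi.mul_apply, ENNReal.rpow_two] at h
  calc (∫⁻ x, f x * g x ∂μ) ^ 2 ≤
        ((∫⁻ x, f x ^ 2 ∂μ) ^ (1 / 2 : ℝ) * (∫⁻ x, g x ^ 2 ∂μ) ^ (1 / 2 : ℝ)) ^ 2 := by gcongr
    _ = _ := by
      rw [mul_pow, ← ENNReal.rpow_mul_natCast, ← ENNReal.rpow_mul_natCast]
      norm_num

/-- The `L²` bound for a convolution with an integrable function, in the form of Schur's test. -/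
theorem lintegral_sq_conv_le {ρ q : ℝ → ℝ≥0∞} (hρ : Measurable ρ) (hq : AEMeasurable q volume) :
    ∫⁻ x, (∫⁻ y, ρ (x - y) ^ 2 * q y) ^ 2 ≤ (∫⁻ t, ρ t ^ 2) ^ 2 * ∫⁻ y, q y ^ 2 := by
  set A := ∫⁻ t, ρ t ^ 2 with hA
  -- Cauchy–Schwarz for the splitting `ρ² q = ρ · (ρ q)`.
  have h1 : ∀ x, (∫⁻ y, ρ (x - y) ^ 2 * q y) ^ 2 ≤ A * ∫⁻ y, ρ (x - y) ^ 2 * q y ^ 2 := fun x => by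
    have hm : Measurable fun y => ρ (x - y) := hρ.comp (measurable_const.sub measurable_id)
    have := sq_lintegral_mul_le (μ := volume) (f := fun y => ρ (x - y))
      (g := fun y => ρ (x - y) * q y) hm.aemeasurable (hm.aemeasurable.mul hq)
    rw [lintegral_sub_left_eq_self (fun t => ρ t ^ 2) x] at this
    refine le_trans (le_of_eq ?_) (this.trans (le_of_eq ?_))
    · simp only [sq, mul_assoc]
    · simp only [mul_pow]; rfl
  have hm2 : AEMeasurable (fun z : ℝ × ℝ => ρ (z.1 - z.2) ^ 2 * q z.2 ^ 2)
      ((volume : Measure ℝ).prod volume) :=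
    ((hρ.comp (measurable_fst.sub measurable_snd)).pow_const 2).aemeasurable.mul
      ((hq.comp_quasiMeasurePreserving Measure.quasiMeasurePreserving_snd).pow_const 2)
  calc _ ≤ ∫⁻ x, A * ∫⁻ y, ρ (x - y) ^ 2 * q y ^ 2 := lintegral_mono h1
    _ = A * ∫⁻ x, ∫⁻ y, ρ (x - y) ^ 2 * q y ^ 2 := lintegral_const_mul'' _ hm2.lintegral_prod_right'
    _ = A * ∫⁻ y, ∫⁻ x, ρ (x - y) ^ 2 * q y ^ 2 := by rw [lintegral_lintegral_swap hm2]
    _ = A * ∫⁻ y, A * q y ^ 2 := by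
        congr 1
        refine lintegral_congr_ae (ae_of_all _ fun y => ?_)
        simp only
        rw [lintegral_mul_const _ (by fun_prop), lintegral_sub_right_eq_self (fun t => ρ t ^ 2) y]
    _ = A ^ 2 * ∫⁻ y, q y ^ 2 := by
        rw [lintegral_const_mul'' _ (hq.pow_const 2), sq, mul_assoc]

theorem eLpNorm_two_eq {α F : Type*} [MeasurableSpace α] [NormedAddCommGroup F] {μ : Measure α}
    (g : α → F) : eLpNorm g 2 μ = (∫⁻ x, ‖g x‖ₑ ^ 2 ∂μ) ^ (1 / 2 : ℝ) := by
  rw [eLpNorm_eq_lintegral_rpow_enorm_toReal (by norm_num) (by norm_num)]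
  simp

section

variable {E F : Type*} [NormedAddCommGroup E] [NormedSpace ℂ E] [NormedAddCommGroup F]
  [NormedSpace ℂ F]

theorem aestronglyMeasurable_kernel_apply {K : ℝ → ℝ → E →L[ℂ] F}
    (hK : StronglyMeasurable fun z : ℝ × ℝ => K z.1 z.2) {h : ℝ → E}
    (hh : AEStronglyMeasurable h volume) :
    AEStronglyMeasurable (fun z : ℝ × ℝ => K z.1 z.2 (h z.2)) ((volume : Measure ℝ).prod volume) :=
  (ContinuousLinearMap.apply ℂ F).flip.aestronglyMeasurable_comp₂ hK.aestronglyMeasurable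
    hh.comp_snd

variable {K : ℝ → ℝ → E →L[ℂ] F} {C r : ℝ}

theorem eLpNorm_integral_kernel_le [CompleteSpace F] (hr : 0 < r)
    (hb : ∀ x y, ‖K x y‖ ≤ C * Real.exp (-(r * |x - y|))) :
    ∃ B : ℝ≥0, ∀ h : ℝ → E, AEStronglyMeasurable h volume →
      eLpNorm (fun x => ∫ y, K x y (h y)) 2 volume ≤ B * eLpNorm h 2 volume := by
  set ρ : ℝ → ℝ≥0∞ := fun t => ENNReal.ofReal (Real.exp (-(r / 2 * |t|))) with hρ
  have hρm : Measurable ρ := by fun_prop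
  have hρ2 : ∀ t, ρ t ^ 2 = ENNReal.ofReal (Real.exp (-(r * |t|))) := fun t => by
    rw [hρ]
    simp only
    rw [← ENNReal.ofReal_pow (Real.exp_nonneg _), ← Real.exp_nat_mul]
    congr 2
    push_cast
    ring
  have hA : ∫⁻ t, ρ t ^ 2 < ∞ := by
    simp only [hρ2]
    rw [← ofReal_integral_eq_lintegral_ofReal (integrable_exp_neg_mul_abs hr)
      (ae_of_all _ fun x => Real.exp_nonneg _)]
    exact ENNReal.ofReal_lt_top
  refine ⟨(ENNReal.ofReal C * ∫⁻ t, ρ t ^ 2).toNNReal, fun h hh => ?_⟩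
  rw [ENNReal.coe_toNNReal (ENNReal.mul_ne_top ENNReal.ofReal_ne_top hA.ne)]
  have hC : 0 ≤ C := by
    have := (norm_nonneg _).trans (hb 0 0)
    simpa using this
  have h1 : ∀ x, ‖∫ y, K x y (h y)‖ₑ ≤ ENNReal.ofReal C * ∫⁻ y, ρ (x - y) ^ 2 * ‖h y‖ₑ := fun x => by
    refine (enorm_integral_le_lintegral_enorm _).trans ?_
    rw [← lintegral_const_mul' _ _ ENNReal.ofReal_ne_top]
    refine lintegral_mono fun y => ?_
    simp only [hρ2]
    rw [← mul_assoc, ← ENNReal.ofReal_mul hC]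
    refine (ContinuousLinearMap.le_opENorm _ _).trans ?_
    gcongr
    rw [← ofReal_norm]
    exact ENNReal.ofReal_le_ofReal (hb x y)
  rw [eLpNorm_two_eq, eLpNorm_two_eq]
  calc _ ≤ (∫⁻ x, (ENNReal.ofReal C * ∫⁻ y, ρ (x - y) ^ 2 * ‖h y‖ₑ) ^ 2) ^ (1 / 2 : ℝ) := by
        gcongr with x; exact h1 x
    _ ≤ ((ENNReal.ofReal C * ∫⁻ t, ρ t ^ 2) ^ 2 * ∫⁻ y, ‖h y‖ₑ ^ 2) ^ (1 / 2 : ℝ) := by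
        gcongr
        simp only [mul_pow]
        rw [lintegral_const_mul' _ _ (by simp), mul_assoc]
        gcongr
        exact lintegral_sq_conv_le hρm hh.enorm
    _ = _ := by
        rw [ENNReal.mul_rpow_of_nonneg _ _ (by norm_num), ← ENNReal.rpow_natCast,
          ← ENNReal.rpow_mul]
        norm_num

theorem exp_neg_mul_abs_sub_le (hr : 0 ≤ r) (x y : ℝ) :
    Real.exp (-(r * |x - y|)) ≤ Real.exp (r * |x|) * Real.exp (-(r * |y|)) := by
  rw [← Real.exp_add]
  refine Real.exp_le_exp.2 ?_
  have := abs_sub_abs_le_abs_sub y x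
  rw [abs_sub_comm] at this
  nlinarith

theorem integrable_exp_mul_norm {G : Type*} [NormedAddCommGroup G] (hr : 0 < r) {h : ℝ → G} (hh : MemLp h 2 volume) :
    Integrable (fun y => Real.exp (-(r * |y|)) * ‖h y‖) volume := by
  refine MemLp.integrable_mul (p := 2) (q := 2) ?_ hh.norm
  refine (memLp_two_iff_integrable_sq (by fun_prop)).2 ?_
  refine (integrable_exp_neg_mul_abs (r := 2 * r) (by linarith)).congr (ae_of_all _ fun x => ?_)
  simp only
  rw [← Real.exp_nat_mul]
  push_cast
  ring_nf

theorem integrable_kernel_apply (hr : 0 < r) (hK : StronglyMeasurable fun z : ℝ × ℝ => K z.1 z.2)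
    (hb : ∀ x y, ‖K x y‖ ≤ C * Real.exp (-(r * |x - y|))) {h : ℝ → E} (hh : MemLp h 2 volume)
    (x : ℝ) : Integrable (fun y => K x y (h y)) volume := by
  have hC : 0 ≤ C := by
    have := (norm_nonneg _).trans (hb 0 0)
    simpa using this
  refine Integrable.mono' ((integrable_exp_mul_norm hr hh).const_mul (C * Real.exp (r * |x|))) ?_
    (ae_of_all _ fun y => ?_)
  · exact (ContinuousLinearMap.apply ℂ F).flip.aestronglyMeasurable_comp₂
      (hK.comp_measurable measurable_prodMk_left).aestronglyMeasurable hh.aestronglyMeasurable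
  · calc ‖K x y (h y)‖ ≤ ‖K x y‖ * ‖h y‖ := (K x y).le_opNorm _
      _ ≤ (C * (Real.exp (r * |x|) * Real.exp (-(r * |y|)))) * ‖h y‖ := by
          gcongr
          exact (hb x y).trans (mul_le_mul_of_nonneg_left (exp_neg_mul_abs_sub_le hr.le x y) hC)
      _ = _ := by ring

theorem integral_kernel_memLp [CompleteSpace F] (hr : 0 < r)
    (hK : StronglyMeasurable fun z : ℝ × ℝ => K z.1 z.2)
    (hb : ∀ x y, ‖K x y‖ ≤ C * Real.exp (-(r * |x - y|))) {h : ℝ → E} (hh : MemLp h 2 volume) :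
    MemLp (fun x => ∫ y, K x y (h y)) 2 volume := by
  obtain ⟨B, hB⟩ := eLpNorm_integral_kernel_le hr hb
  exact ⟨(aestronglyMeasurable_kernel_apply hK hh.aestronglyMeasurable).integral_prod_right',
    (hB h hh.aestronglyMeasurable).trans_lt
      (ENNReal.mul_lt_top ENNReal.coe_lt_top hh.eLpNorm_lt_top)⟩

end

/-! ### The resolvent off the imaginary axis -/

section

variable {b P : Op} {Mt Φ Ψ : ℝ → Op} {C r : ℝ}

/-- Fubini reduces the weak equation for the integral operator to the one for the kernel. Absolute
convergence comes from the compact support of `θ` in `x` and the exponential decay of the kernel in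
`y`. -/
theorem IsFundamental.integral_test_kernel (hF : IsFundamental b Mt Φ Ψ) (hM : Continuous Mt)
    (hr : 0 < r) (hb : ∀ x y, ‖splitKernel Φ Ψ P x y‖ ≤ C * Real.exp (-(r * |x - y|)))
    {h : ℝ → Fin 4 → ℂ} (hh : MemLp h 2 volume) {θ : ℝ → ℂ} (hθ : ContDiff ℝ (⊤ : ℕ∞) θ)
    (hc : HasCompactSupport θ) :
    ∫ x, (_root_.deriv θ x • (∫ y, splitKernel Φ Ψ P x y (h y)) +
        θ x • Mt x (∫ y, splitKernel Φ Ψ P x y (h y))) = ∫ y, θ y • op matα (h y) := by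
  have hK := hF.measurable_splitKernel P
  have hθ' : Continuous (_root_.deriv θ) := hθ.continuous_deriv (by simp)
  have hθc := hθ.continuous
  set T : ℝ → ℝ → Fin 4 → ℂ := fun x y => _root_.deriv θ x • splitKernel Φ Ψ P x y (h y) +
    θ x • Mt x (splitKernel Φ Ψ P x y (h y)) with hT
  have hC : 0 ≤ C := by
    have := (norm_nonneg _).trans (hb 0 0)
    simpa using this
  have hTi : Integrable (Function.uncurry T) ((volume : Measure ℝ).prod volume) := by
    set A : ℝ → ℝ := fun x => (‖_root_.deriv θ x‖ + ‖θ x‖ * ‖Mt x‖) * Real.exp (r * |x|) with hA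
    have hAi : Integrable A volume := by
      refine Continuous.integrable_of_hasCompactSupport (by fun_prop) ?_
      exact (hc.deriv.norm.add (hc.norm.mul_right (f' := fun x => ‖Mt x‖))).mul_right
        (f' := fun x => Real.exp (r * |x|))
    have hm := aestronglyMeasurable_kernel_apply hK hh.aestronglyMeasurable
    refine Integrable.mono' (hAi.mul_prod ((integrable_exp_mul_norm hr hh).const_mul C)) ?_
      (ae_of_all _ fun z => ?_)
    · refine AEStronglyMeasurable.add (AEStronglyMeasurable.smul
        (hθ'.comp continuous_fst).aestronglyMeasurable hm) (AEStronglyMeasurable.smul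
        (hθc.comp continuous_fst).aestronglyMeasurable ?_)
      exact (ContinuousLinearMap.apply ℂ (Fin 4 → ℂ)).flip.aestronglyMeasurable_comp₂
        (hM.comp continuous_fst).aestronglyMeasurable hm
    · obtain ⟨x, y⟩ := z
      have h1 : ‖splitKernel Φ Ψ P x y (h y)‖ ≤
          Real.exp (r * |x|) * (C * (Real.exp (-(r * |y|)) * ‖h y‖)) := by
        calc _ ≤ ‖splitKernel Φ Ψ P x y‖ * ‖h y‖ := ContinuousLinearMap.le_opNorm _ _
          _ ≤ (C * (Real.exp (r * |x|) * Real.exp (-(r * |y|)))) * ‖h y‖ := by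
            gcongr
            exact (hb x y).trans
              (mul_le_mul_of_nonneg_left (exp_neg_mul_abs_sub_le hr.le x y) hC)
          _ = _ := by ring
      calc ‖T x y‖ ≤ ‖_root_.deriv θ x‖ * ‖splitKernel Φ Ψ P x y (h y)‖ +
            ‖θ x‖ * (‖Mt x‖ * ‖splitKernel Φ Ψ P x y (h y)‖) := by
            refine (norm_add_le _ _).trans ?_
            rw [norm_smul, norm_smul]
            gcongr
            exact ContinuousLinearMap.le_opNorm _ _
        _ = (‖_root_.deriv θ x‖ + ‖θ x‖ * ‖Mt x‖) * ‖splitKernel Φ Ψ P x y (h y)‖ := by ring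
        _ ≤ (‖_root_.deriv θ x‖ + ‖θ x‖ * ‖Mt x‖) *
            (Real.exp (r * |x|) * (C * (Real.exp (-(r * |y|)) * ‖h y‖))) := by gcongr
        _ = _ := by simp only [hA]; ring
  have e1 : ∀ x, ∫ y, T x y = _root_.deriv θ x • (∫ y, splitKernel Φ Ψ P x y (h y)) +
      θ x • Mt x (∫ y, splitKernel Φ Ψ P x y (h y)) := fun x => by
    have hi := integrable_kernel_apply hr hK hb hh x
    rw [← (Mt x).integral_comp_comm hi, ← integral_smul, ← integral_smul, ← integral_add]
    · exact hi.smul (_root_.deriv θ x)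
    · exact ((Mt x).integrable_comp hi).smul (θ x)
  have e2 : ∀ y, ∫ x, T x y = θ y • op matα (h y) := fun y => by
    obtain ⟨hi, he⟩ := hF.integral_splitKernel hM P hθ hc y
    have := ContinuousLinearMap.integral_apply hi (h y)
    rw [he] at this
    rw [← _root_.smul_apply, this]
    rfl
  rw [← integral_congr_ae (ae_of_all _ e1), integral_integral_swap hTi,
    integral_congr_ae (ae_of_all _ e2)]

end

end GN

/-! ### The resolvent equation as a first-order system, solved by means of a dichotomy. -/

namespace GN

section

variable {f : ℝ → ℝ} {v u : ℝ → ℝ → ℝ} {ω : ℝ} {μ : ℂ}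

theorem JL_sub_smul (ψ dψ : ℝ → Fin 4 → ℂ) (x : ℝ) : JL f v u ω ψ dψ x - μ • ψ x =
    -op matα (dψ x - op (M f v u ω μ x) (ψ x)) := by
  have h1 : matα * M f v u ω μ x =
      matJ * (matβ - (ω : ℂ) • (1 : Matrix (Fin 4) (Fin 4) ℂ) + W f v u ω x) - μ • 1 := by
    have h2 := matα_mul_matα
    have h3 : matα * (matα * matJ * matβ) = matJ * matβ := by
      rw [mul_assoc, ← mul_assoc matα matα, h2, one_mul]
    have h4 : matα * (matα * matJ * W f v u ω x) = matJ * W f v u ω x := by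
      rw [mul_assoc, ← mul_assoc matα matα, h2, one_mul]
    have h5 : matα * (matα * matJ) = matJ := by rw [← mul_assoc, h2, one_mul]
    simp only [M, mul_add, mul_sub, mul_smul_comm, h2, h3, h4, h5, mul_one]
    abel
  have h2 : matJ * (matJ * matα) = -matα := by rw [← mul_assoc, matJ_mul_matJ, neg_one_mul]
  rw [op_apply, op_apply, JL, Matrix.mulVec_add, Matrix.mulVec_mulVec, Matrix.mulVec_mulVec, h2,
    Matrix.mulVec_sub, Matrix.mulVec_mulVec, h1, Matrix.sub_mulVec, Matrix.smul_mulVec,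
    Matrix.one_mulVec, Matrix.neg_mulVec]
  abel

theorem JL_sub_smul_eq_iff (ψ dψ : ℝ → Fin 4 → ℂ) (x : ℝ) (y : Fin 4 → ℂ) :
    JL f v u ω ψ dψ x - μ • ψ x = y ↔ dψ x = op (M f v u ω μ x) (ψ x) - op matα y := by
  have h2 : ∀ z, op matα (op matα z) = z := fun z => by
    rw [← mul_apply_eq_comp, ← map_mul, matα_mul_matα, map_one, one_apply_eq_self]
  rw [JL_sub_smul]
  constructor
  · rintro rfl
    rw [map_neg, h2]
    abel
  · intro h
    rw [h, sub_sub_cancel_left, map_neg, h2, neg_neg]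

end

/-- A splitting of the solutions of a system into those that decay on the right and on the left. -/
structure IsDichotomy (b : Op) (Mt Φ Ψ : ℝ → Op) (P : Op) (C r : ℝ) : Prop where
  fund : IsFundamental b Mt Φ Ψ
  norm_kernel : ∀ x y, ‖splitKernel Φ Ψ P x y‖ ≤ C * Real.exp (-(r * |x - y|))
  norm_right : ∀ x, 0 ≤ x → ‖(1 - P) * Ψ x‖ ≤ C
  norm_left : ∀ x, 0 ≤ x → ‖P * Ψ (-x)‖ ≤ C

section

variable {b P : Op} {Mt Φ Ψ : ℝ → Op} {C r : ℝ}

theorem eq_zero_of_norm_le_memLp {c : ℝ} {q : ℝ → ℝ} (hq : MemLp q 2 volume) (hc : 0 ≤ c)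
    (h : ∀ᵐ x, 0 ≤ x → c ≤ q x) : c = 0 := by
  by_contra hne
  have h0 : 0 < c := lt_of_le_of_ne hc (Ne.symm hne)
  have h1 : ENNReal.ofReal c ^ 2 * volume (Ici (0 : ℝ)) ≤ ∫⁻ x, ‖q x‖ₑ ^ 2 := by
    rw [← setLIntegral_const]
    refine le_trans (lintegral_mono_ae ?_) (setLIntegral_le_lintegral (Ici 0) _)
    filter_upwards [ae_restrict_of_ae h, ae_restrict_mem measurableSet_Ici] with x hx hx0
    have := hx hx0
    gcongr
    rw [← ofReal_norm]
    exact ENNReal.ofReal_le_ofReal (this.trans (le_abs_self _))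
  have h2 : ∫⁻ x, ‖q x‖ₑ ^ 2 < ∞ := by
    have := hq.eLpNorm_lt_top
    rw [eLpNorm_two_eq] at this
    by_contra hcon
    rw [not_lt, top_le_iff] at hcon
    rw [hcon] at this
    simp at this
  rw [Real.volume_Ici, ENNReal.mul_top (by simp [h0])] at h1
  exact absurd (top_le_iff.1 h1) h2.ne

/-- For `x ≥ 0`, `‖(1 - P)c‖ = ‖(1 - P) Ψ(x) z(x)‖ ≤ C ‖z(x)‖`. A square-integrable `z` allows this
on a half-line only if `(1 - P)c = 0`; the left half-line gives `Pc = 0` likewise. -/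
theorem IsDichotomy.eq_zero (h : IsDichotomy b Mt Φ Ψ P C r) {c : Fin 4 → ℂ} {z : ℝ → Fin 4 → ℂ}
    (hz : MemLp z 2 volume) (hzc : ∀ᵐ x, z x = Φ x c) : c = 0 := by
  have h1 : ∀ x, Ψ x (Φ x c) = c := fun x => by
    rw [← mul_apply_eq_comp, h.fund.inv_mul, one_apply_eq_self]
  have key : ∀ (S : Op) (g : ℝ → ℝ), MeasurePreserving g volume volume →
      (∀ x, 0 ≤ x → ‖S * Ψ (g x)‖ ≤ C) → S c = 0 := fun S g hg hS => by
    have := eq_zero_of_norm_le_memLp (c := ‖S c‖) (q := fun x => C * ‖z (g x)‖)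
      ((hz.comp_measurePreserving hg).norm.const_mul C) (norm_nonneg _) (by
        filter_upwards [hg.quasiMeasurePreserving.ae hzc] with x hx hx0
        rw [hx]
        calc ‖S c‖ = ‖(S * Ψ (g x)) (Φ (g x) c)‖ := by rw [mul_apply_eq_comp, h1]
          _ ≤ ‖S * Ψ (g x)‖ * ‖Φ (g x) c‖ := ContinuousLinearMap.le_opNorm _ _
          _ ≤ _ := by
            gcongr
            exact hS x hx0)
    exact norm_eq_zero.1 this
  have e1 := key (1 - P) id (MeasurePreserving.id _) h.norm_right
  have e2 := key P (fun x => -x) (Measure.measurePreserving_neg volume) h.norm_left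
  rw [_root_.sub_apply, e2, one_apply_eq_self, sub_zero] at e1
  exact e1

theorem IsDichotomy.isH1 (h : IsDichotomy b Mt Φ Ψ P C r) (hM : Continuous Mt) {m : ℝ}
    (hm : ∀ x, ‖Mt x‖ ≤ m) (hr : 0 < r) {g : ℝ → Fin 4 → ℂ} (hg : MemLp g 2 volume) :
    IsH1 (fun x => ∫ y, splitKernel Φ Ψ P x y (g y))
      (fun x => Mt x (∫ y, splitKernel Φ Ψ P x y (g y)) - op matα (g x)) := by
  have hw := integral_kernel_memLp hr (h.fund.measurable_splitKernel P) h.norm_kernel hg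
  set w : ℝ → Fin 4 → ℂ := fun x => ∫ y, splitKernel Φ Ψ P x y (g y) with hwdef
  have hMw : MemLp (fun x => Mt x (w x)) 2 volume := by
    refine hw.of_le_mul (c := m) ?_ (ae_of_all _ fun x => ?_)
    · exact (ContinuousLinearMap.apply ℂ (Fin 4 → ℂ)).flip.aestronglyMeasurable_comp₂
        hM.aestronglyMeasurable hw.aestronglyMeasurable
    · exact ((Mt x).le_opNorm _).trans (mul_le_mul_of_nonneg_right (hm x) (norm_nonneg _))
  have hag : MemLp (fun x => op matα (g x)) 2 volume := (op matα).comp_memLp' hg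
  refine ⟨hw, hMw.sub hag, fun θ hθ hc i => ?_⟩
  have hθ' : Continuous (_root_.deriv θ) := hθ.continuous_deriv (by simp)
  have loc : ∀ F : ℝ → Fin 4 → ℂ, MemLp F 2 volume → ∀ η : ℝ → ℂ, Continuous η →
      HasCompactSupport η → Integrable (fun x => η x • F x) volume := fun F hF η h1 h2 =>
    (hF.locallyIntegrable (by norm_num)).integrable_smul_left_of_hasCompactSupport h1 h2
  have i1 := loc w hw _ hθ' hc.deriv
  have i2 := loc _ hMw _ hθ.continuous hc
  have i3 := loc _ hag _ hθ.continuous hc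
  have key := h.fund.integral_test_kernel hM hr h.norm_kernel hg hθ hc
  have pr : ∀ F : ℝ → Fin 4 → ℂ, Integrable F volume → (∫ x, F x) i = ∫ x, F x i := fun F hF =>
    ((ContinuousLinearMap.proj (R := ℂ) (φ := fun _ : Fin 4 => ℂ) i).integral_comp_comm hF).symm
  have key2 : ∫ x, _root_.deriv θ x • w x = -∫ x, θ x • (Mt x (w x) - op matα (g x)) := by
    simp only [smul_sub]
    rw [integral_sub i2 i3, ← key, integral_add i1 i2]
    abel
  have := congrFun key2 i
  rw [Pi.neg_apply, pr _ i1, pr] at this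
  · exact this
  · simp only [smul_sub]
    exact i2.sub i3

variable {f : ℝ → ℝ} {v u : ℝ → ℝ → ℝ} {ω : ℝ} {μ : ℂ}

theorem IsDichotomy.solvesResolvent (h : IsDichotomy b (fun x => op (M f v u ω μ x)) Φ Ψ P C r)
    (hM : Continuous fun x => op (M f v u ω μ x)) {m : ℝ} (hm : ∀ x, ‖op (M f v u ω μ x)‖ ≤ m)
    (hr : 0 < r) {g : ℝ → Fin 4 → ℂ} (hg : MemLp g 2 volume) :
    SolvesResolvent f v u ω μ g (fun x => ∫ y, splitKernel Φ Ψ P x y (g y)) :=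
  ⟨_, h.isH1 hM hm hr hg, ae_of_all _ fun _ => (JL_sub_smul_eq_iff _ _ _ _).2 rfl⟩

theorem IsDichotomy.ae_eq_of_solvesResolvent
    (h : IsDichotomy b (fun x => op (M f v u ω μ x)) Φ Ψ P C r)
    (hM : Continuous fun x => op (M f v u ω μ x)) {g w w' : ℝ → Fin 4 → ℂ}
    (hw : SolvesResolvent f v u ω μ g w) (hw' : SolvesResolvent f v u ω μ g w') :
    w' =ᵐ[volume] w := by
  obtain ⟨d, ⟨h1, h2, h3⟩, h4⟩ := hw
  obtain ⟨d', ⟨h1', h2', h3'⟩, h4'⟩ := hw'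
  have hz : MemLp (fun x => w' x - w x) 2 volume := h1'.sub h1
  obtain ⟨c, hc⟩ := h.fund.exists_ae_eq hM (hz.locallyIntegrable (by norm_num))
    fun θ hθ hs i => by
      have hθ' : Continuous (_root_.deriv θ) := hθ.continuous_deriv (by simp)
      have loc : ∀ F : ℝ → Fin 4 → ℂ, MemLp F 2 volume → ∀ η : ℝ → ℂ, Continuous η →
          HasCompactSupport η → Integrable (fun x => η x * F x i) volume := fun F hF η k1 k2 =>
        (ContinuousLinearMap.proj (R := ℂ) (φ := fun _ : Fin 4 => ℂ) i).integrable_comp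
          ((hF.locallyIntegrable (by norm_num)).integrable_smul_left_of_hasCompactSupport k1 k2)
      have e : ∫ x, θ x * (op (M f v u ω μ x) (w' x - w x)) i = ∫ x, θ x * (d' x i - d x i) := by
        refine integral_congr_ae ?_
        filter_upwards [h4, h4'] with x k1 k2
        rw [(JL_sub_smul_eq_iff _ _ _ _).1 k1, (JL_sub_smul_eq_iff _ _ _ _).1 k2, map_sub]
        simp only [Pi.sub_apply]
        ring
      rw [e]
      simp only [Pi.sub_apply, mul_sub]
      rw [integral_sub (loc _ h1' _ hθ' hs.deriv) (loc _ h1 _ hθ' hs.deriv),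
        integral_sub (loc _ h2' _ hθ.continuous hs) (loc _ h2 _ hθ.continuous hs),
        h3 θ hθ hs i, h3' θ hθ hs i]
      ring
  have h0 := h.eq_zero hz hc
  filter_upwards [hc] with x hx
  rw [h0, map_zero] at hx
  exact sub_eq_zero.1 hx

theorem IsDichotomy.isResolventPoint (h : IsDichotomy b (fun x => op (M f v u ω μ x)) Φ Ψ P C r)
    (hM : Continuous fun x => op (M f v u ω μ x)) {m : ℝ} (hm : ∀ x, ‖op (M f v u ω μ x)‖ ≤ m)
    (hr : 0 < r) : IsResolventPoint f v u ω μ := by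
  obtain ⟨B, hB⟩ := eLpNorm_integral_kernel_le hr h.norm_kernel
  refine ⟨B, fun g hg => ⟨fun x => ∫ y, splitKernel Φ Ψ P x y (g y), ?_⟩⟩
  have hw := h.solvesResolvent hM hm hr hg
  exact ⟨hw, fun w' hw' => h.ae_eq_of_solvesResolvent hM hw hw', hB g hg.aestronglyMeasurable⟩

end

end GN

namespace GN

/-! ### Bounds on the kernel -/

/-- The data defining the kernel at the parameter `p`, with a common bound `N`. -/
structure IsSysData (f : ℝ → ℝ) (k : ℕ) (v u : ℝ → ℝ → ℝ) (σ : Side) (p : ℂ × ℝ) (Z Y : ℝ → Op)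
    (Q P : Op) (N D : ℝ) : Prop where
  mem : p ∈ halfSpace σ
  abs_re_le : |p.1.re| ≤ 1 / 2
  profile : IsProfile f p.2 (v p.2) (u p.2)
  conj : IsSysConj f k v u p Z Y N D
  proj : IsStableProj (op (freeM p.1 p.2)) (fun j => op (chan j)) (kap σ p.1 p.2) Q
  split : IsSplitting (op matβ) (Z 0 * Q * Y 0) P
  bounded : IsBoundedBy N (fun j => op (chan j)) (kap σ p.1 p.2) Q 0
  norm_P : ‖P‖ ≤ N
  norm_matβ : ‖op matβ‖ ≤ N
  norm_matα : ‖op matα‖ ≤ N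

section

variable {f : ℝ → ℝ} {k : ℕ} {v u : ℝ → ℝ → ℝ} {σ : Side} {p : ℂ × ℝ} {Z Y : ℝ → Op}
  {Q P : Op} {N D : ℝ}

theorem IsSysData.isFundamental (h : IsSysData f k v u σ p Z Y Q P N D) :
    IsFundamental (op matβ) (fun x => op (M f v u p.2 p.1 x)) (sysFund σ p Z Y) (sysInv σ p Z Y) := by
  simp only [op_M]
  exact h.conj.isFundamental h.abs_re_le h.profile

theorem IsSysData.isBoundedBy (h : IsSysData f k v u σ p Z Y Q P N D) {r : ℝ} (hr : 0 ≤ r)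
    (hrκ : ∀ j, r ≤ (kap σ p.1 p.2 j).re) :
    IsBoundedBy N (fun j => op (chan j)) (kap σ p.1 p.2) Q r :=
  ⟨h.bounded.one_le, h.bounded.norm_pr, h.bounded.norm_Q, h.bounded.norm_one_sub_Q, hr, hrκ⟩

/-- The loss `B` is left open: it bounds `‖m‖ sinh(κt)/κ` relative to the exponential, at `t =
min(|x|, |y|)`. It is linear in `t` in general and constant away from the thresholds. -/
theorem IsSysData.norm_kernel_le (h : IsSysData f k v u σ p Z Y Q P N D) {r : ℝ} (hr : 0 ≤ r)
    (hrκ : ∀ j, r ≤ (kap σ p.1 p.2 j).re) {x y B : ℝ} (hB0 : 0 ≤ B)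
    (hB : ∀ j, ‖sn (kap σ p.1 p.2 j) (min |x| |y|)‖ * ‖op (freeM p.1 p.2)‖ ≤
      B * Real.exp ((kap σ p.1 p.2 j).re * min |x| |y|)) :
    ‖kernel σ p Z Y P x y‖ ≤ 6 * N ^ 17 * (1 + B) * Real.exp (-(r * |x - y|)) := by
  have hbd := h.isBoundedBy hr hrκ
  have hN1 := hbd.one_le
  have hN : 0 ≤ N := by linarith
  have hF := h.isFundamental
  have hα : ‖op (-matα)‖ ≤ N := by rw [map_neg, norm_neg]; exact h.norm_matα
  have main : ∀ {x y : ℝ}, y ≤ x → (∀ j, ‖sn (kap σ p.1 p.2 j) (min |x| |y|)‖ *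
      ‖op (freeM p.1 p.2)‖ ≤ B * Real.exp ((kap σ p.1 p.2 j).re * min |x| |y|)) →
      ‖sysFund σ p Z Y x * P * sysInv σ p Z Y y‖ ≤
        6 * N ^ 14 * (1 + B) * Real.exp (-(r * (x - y))) := fun hyx hB =>
    hbd.norm_stable_le (freeM_isChanneled_kap σ p) h.proj h.conj h.split h.norm_P
      op_matβ_mul_self h.norm_matβ hF hB0 hyx hB
  rcases lt_or_ge y x with hyx | hxy
  · rw [kernel, splitKernel_of_lt P hyx, abs_of_pos (sub_pos.2 hyx)]
    calc _ ≤ ‖sysFund σ p Z Y x * P * sysInv σ p Z Y y‖ * ‖op (-matα)‖ := norm_mul_le _ _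
      _ ≤ (6 * N ^ 14 * (1 + B) * Real.exp (-(r * (x - y)))) * N := by
          gcongr
          exact main hyx.le hB
      _ = 6 * N ^ 15 * (1 + B) * Real.exp (-(r * (x - y))) := by ring
      _ ≤ _ := by
          gcongr
          norm_num
  · rw [kernel, splitKernel_of_le P hxy, abs_sub_comm, abs_of_nonneg (sub_nonneg.2 hxy)]
    -- Below the diagonal, reflection turns `1 - P` into `P` and `(x, y)` into `(-x, -y)`, which
    -- lies above it.
    have e : -(sysFund σ p Z Y x * (1 - P) * sysInv σ p Z Y y) =
        -(op matβ * (sysFund σ p Z Y (-x) * P * sysInv σ p Z Y (-y)) * op matβ) := by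
      have e2 := hF.inv_neg (-y)
      have e3 := hF.neg (-x)
      rw [neg_neg] at e2 e3
      congr 1
      rw [e2, e3]
      have : ∀ s t : Op, op matβ * s * op matβ * (1 - P) * (op matβ * t * op matβ) =
          op matβ * (s * (op matβ * (1 - P) * op matβ) * t) * op matβ := fun s t => by
        noncomm_ring
      rw [this, h.split.refl_one_sub op_matβ_mul_self]
    have h1 := main (x := -x) (y := -y) (by linarith) (by simpa only [abs_neg] using hB)
    rw [e]
    calc _ ≤ (‖op matβ‖ * ‖sysFund σ p Z Y (-x) * P * sysInv σ p Z Y (-y)‖ * ‖op matβ‖) *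
          ‖op (-matα)‖ := by
          refine (norm_mul_le _ _).trans ?_
          rw [norm_neg]
          gcongr
          exact norm_mul₃_le
      _ ≤ (N * (6 * N ^ 14 * (1 + B) * Real.exp (-(r * (-x - -y)))) * N) * N := by
          have := h.norm_matβ
          gcongr
      _ = _ := by
          rw [show -x - -y = y - x by ring]
          ring

theorem IsSysData.norm_kernel_le_min (h : IsSysData f k v u σ p Z Y Q P N D) {m : ℝ}
    (hm : ‖op (freeM p.1 p.2)‖ ≤ m) (x y : ℝ) :
    ‖kernel σ p Z Y P x y‖ ≤ 6 * N ^ 17 * (1 + min |x| |y| * m) := by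
  have hmin : 0 ≤ min |x| |y| := le_min (abs_nonneg _) (abs_nonneg _)
  have hm0 : 0 ≤ m := (norm_nonneg _).trans hm
  have := h.norm_kernel_le le_rfl h.bounded.rate_le (x := x) (y := y) (B := min |x| |y| * m)
    (by positivity) fun j => by
      have h1 := norm_sn_le (kap σ p.1 p.2 j) (min |x| |y|)
      have hk := h.bounded.rate_le j
      rw [abs_of_nonneg hmin, abs_of_nonneg (mul_nonneg hk hmin)] at h1
      calc _ ≤ (min |x| |y| * Real.exp ((kap σ p.1 p.2 j).re * min |x| |y|)) * m := by gcongr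
        _ = _ := by ring
  simpa using this

theorem IsSysData.norm_kernel_le_const (h : IsSysData f k v u σ p Z Y Q P N D) {r B : ℝ} (hr : 0 ≤ r)
    (hrκ : ∀ j, r ≤ (kap σ p.1 p.2 j).re) (hκ : ∀ j, kap σ p.1 p.2 j ≠ 0)
    (hm : ∀ j, ‖op (freeM p.1 p.2)‖ ≤ B * ‖kap σ p.1 p.2 j‖) (x y : ℝ) :
    ‖kernel σ p Z Y P x y‖ ≤ 6 * N ^ 17 * (1 + B) * Real.exp (-(r * |x - y|)) := by
  have hB0 : 0 ≤ B := by
    have h1 : 0 < ‖kap σ p.1 p.2 0‖ := norm_pos_iff.2 (hκ 0)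
    exact nonneg_of_mul_nonneg_left ((norm_nonneg _).trans (hm 0)) h1
  have hmin : 0 ≤ min |x| |y| := le_min (abs_nonneg _) (abs_nonneg _)
  refine h.norm_kernel_le hr hrκ hB0 fun j => ?_
  have h1 := norm_sn_le_div (hκ j) (min |x| |y|)
  have h2 : 0 < ‖kap σ p.1 p.2 j‖ := norm_pos_iff.2 (hκ j)
  have hk := h.bounded.rate_le j
  rw [abs_of_nonneg (mul_nonneg hk hmin)] at h1
  calc _ ≤ (1 / ‖kap σ p.1 p.2 j‖ * Real.exp ((kap σ p.1 p.2 j).re * min |x| |y|)) *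
        (B * ‖kap σ p.1 p.2 j‖) := by
        gcongr
        exact hm j
    _ = _ := by field_simp

/-- Strictly off the axis both `Re κ_j` are positive, and the smaller one serves as the rate. The
constant degenerates at the axis, but this dichotomy is used only at a fixed parameter, to identify
the kernel with the resolvent. -/
theorem IsSysData.isDichotomy (h : IsSysData f k v u σ p Z Y Q P N D) (hp : 0 < σ.sgn * p.1.re) :
    ∃ C r, 0 < r ∧ IsDichotomy (op matβ) (fun x => op (M f v u p.2 p.1 x)) (sysFund σ p Z Y)
      (sysInv σ p Z Y) P C r := by
  have hκ := fun j => re_kap_pos hp p.2 j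
  set r := min (kap σ p.1 p.2 0).re (kap σ p.1 p.2 1).re with hr
  have hr0 : 0 < r := lt_min (hκ 0) (hκ 1)
  have hrκ : ∀ j, r ≤ (kap σ p.1 p.2 j).re := fun j => by
    fin_cases j
    · exact min_le_left _ _
    · exact min_le_right _ _
  have hbd := h.isBoundedBy hr0.le hrκ
  have hN1 := hbd.one_le
  have hF := h.isFundamental
  set B := ‖op (freeM p.1 p.2)‖ / r with hB
  have hB0 : 0 ≤ B := by positivity
  have hrn : ∀ j, r ≤ ‖kap σ p.1 p.2 j‖ := fun j =>
    (hrκ j).trans ((le_abs_self _).trans (Complex.abs_re_le_norm _))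
  have hright : ∀ x, 0 ≤ x → ‖(1 - P) * sysInv σ p Z Y x‖ ≤ 2 * N ^ 7 := fun x hx => by
    refine (hbd.norm_mul_fundInv_le h.proj h.conj h.split h.norm_P h.norm_matβ hx).trans ?_
    have : Real.exp (-(r * x)) ≤ 1 := Real.exp_le_one_iff.2 (by nlinarith)
    have h0 : 0 ≤ 2 * N ^ 7 := by positivity
    nlinarith
  refine ⟨max (6 * N ^ 17 * (1 + B)) (N * (2 * N ^ 7) * N), r, hr0, hF, fun x y => ?_,
    fun x hx => ?_, fun x hx => ?_⟩
  · refine (h.norm_kernel_le_const hr0.le hrκ (fun j h0 => ?_) (B := B) (fun j => ?_) x y).trans ?_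
    · have := hκ j
      rw [h0] at this
      simp at this
    · calc ‖op (freeM p.1 p.2)‖ = B * r := by rw [hB]; field_simp
        _ ≤ _ := by gcongr; exact hrn j
    · gcongr
      exact le_max_left _ _
  · refine (hright x hx).trans (le_max_of_le_right ?_)
    have h0 : 0 ≤ 2 * N ^ 7 := by positivity
    have h2 : 1 ≤ N * N := by nlinarith
    nlinarith
  · refine le_max_of_le_right ?_
    have e : P * sysInv σ p Z Y (-x) = op matβ * ((1 - P) * sysInv σ p Z Y x) * op matβ := by
      rw [hF.inv_neg]
      calc _ = P * op matβ * sysInv σ p Z Y x * op matβ := by noncomm_ring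
        _ = _ := by rw [h.split.mul_refl op_matβ_mul_self]; noncomm_ring
    rw [e]
    refine norm_mul₃_le.trans ?_
    have := h.norm_matβ
    have h1 := hright x hx
    gcongr

end

end GN

namespace GN

/-! ### The kernels near a regular point of the boundary -/

theorem continuousWithinAt_reflect {T A : Type*} [TopologicalSpace T] [NormedRing A] {b : A} {S : Set T}
    {t : T} {F : T → ℝ → A} (h : ∀ x, 0 ≤ x → ContinuousWithinAt (fun p => F p x) S t) (x : ℝ) :
    ContinuousWithinAt (fun p => reflect b (F p) x) S t := by
  unfold reflect
  split_ifs with hx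
  · exact h x hx
  · exact (continuousWithinAt_const.mul (h (-x) (by linarith))).mul continuousWithinAt_const

theorem continuousWithinAt_flow {σ : Side} {p₀ : ℂ × ℝ} (hp₀ : p₀ ∈ halfSpace σ) (x : ℝ) :
    ContinuousWithinAt (fun p => flow σ p x) (halfSpace σ) p₀ :=
  continuousWithinAt_extend (S := halfSpace σ) self_mem_nhdsWithin hp₀
    ((continuous_flow (σ := σ) (S := halfSpace σ) subset_rfl).comp
      (g := fun q : halfSpace σ × ℝ => flow σ q.1 q.2) (f := fun q => (q, x)) (by fun_prop))
    fun _ => rfl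

theorem continuousAt_kap_of_mem {σ : Side} {p₀ : ℂ × ℝ} (hp₀ : p₀ ∈ halfSpace σ) (j : Fin 2) :
    ContinuousAt (fun p : ℂ × ℝ => kap σ p.1 p.2 j) p₀ :=
  (continuous_apply j).continuousAt.comp
    (f := fun p : ℂ × ℝ => kap σ p.1 p.2) (g := fun q : Fin 2 → ℂ => q j) (continuousAt_kap hp₀)

theorem continuousAt_freeStab {σ : Side} {p₀ : ℂ × ℝ} (hp₀ : p₀ ∈ halfSpace σ) :
    ContinuousAt (fun p => freeStab σ p) p₀ := by
  have hz : ∀ j, Continuous fun p : ℂ × ℝ => zc j p.1 p.2 := fun j => by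
    unfold zc; split_ifs <;> fun_prop
  refine (op : Matrix (Fin 4) (Fin 4) ℂ →ₐ[ℂ] Op).toLinearMap.continuous_of_finiteDimensional.continuousAt.comp
    (f := fun p : ℂ × ℝ => stab p.1 p.2 (kap σ p.1 p.2)) ?_
  unfold stab chanQ
  refine tendsto_finsetSum _ fun j _ => ?_
  have h1 := (hz j).continuousAt (x := p₀)
  have h2 := continuousAt_kap_of_mem hp₀ j
  have h3 : ContinuousAt (fun p : ℂ × ℝ => chan j * (1 / 2 : ℂ) •
    (1 + zc j p.1 p.2 • matβ + kap σ p.1 p.2 j • matX)) p₀ := by fun_prop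
  exact h3

section

variable {f : ℝ → ℝ} {a b : ℝ} {v u : ℝ → ℝ → ℝ} {k : ℕ}

theorem IsConjugation.mono {A : Type*} [NormedRing A] [NormedAlgebra ℝ A] {m : A} {P Z Y : ℝ → A}
    {B B' D γ : ℝ} (h : IsConjugation m P Z Y B D γ) (hB : B ≤ B') : IsConjugation m P Z Y B' D γ :=
  ⟨h.deriv_Z, h.deriv_Y, h.mul_YZ, h.mul_ZY, fun x hx => (h.norm_Z x hx).trans hB,
    fun x hx => (h.norm_Y x hx).trans hB, h.norm_Z_sub⟩

/-- A splitting at the boundary point, given by the Jost frame, persists nearby in the closed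
half-space, where all ingredients are continuous. `N` collects their norms there, so that one bound
serves the boundary points and the points off the axis alike. -/
theorem IsSolitaryFamily.exists_kernels (hφ : IsSolitaryFamily f (Ioo a b) v u)
    (ha : -(1 / 3) ≤ a) (hb : b ≤ 1 / 3) (hf : ContDiff ℝ (⊤ : ℕ∞) f) (hk : 2 ≤ k)
    (hfk : ∃ c : ℝ, ∀ s ∈ Icc (0 : ℝ) 1, |f s| ≤ c * s ^ k) {σ : Side} {Λ ω₀ : ℝ}
    (hω₀ : ω₀ ∈ Ioo a b) (hJ : IsJostFrame f k v u ω₀ σ Λ) :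
    ∃ (N D : ℝ) (Z Y : ℂ × ℝ → ℝ → Op) (P : ℂ × ℝ → Op),
      (∀ᶠ p in 𝓝[halfSpace σ] (Complex.I * Λ, ω₀), p.2 ∈ Ioo a b ∧ ‖op (freeM p.1 p.2)‖ ≤ N ∧
        IsSysData f k v u σ p (Z p) (Y p) (freeStab σ p) (P p) N D) ∧
      ∀ x y, ContinuousWithinAt (fun p => kernel σ p (Z p) (Y p) (P p) x y) (halfSpace σ)
        (Complex.I * Λ, ω₀) := by
  obtain ⟨B, D, Z, Y, hZ, hY, hev⟩ := hφ.exists_isConjugation ha hb hf hk hfk σ Λ hω₀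
  set p₀ : ℂ × ℝ := (Complex.I * Λ, ω₀) with hp₀
  have hmem : p₀ ∈ halfSpace σ := boundary_mem_halfSpace σ Λ ω₀
  have hS : ContinuousWithinAt (fun p => freeStab σ p) (halfSpace σ) p₀ :=
    (continuousAt_freeStab hmem).continuousWithinAt
  have hQ : ContinuousWithinAt (fun p => sysStab σ p (Z p) (Y p)) (halfSpace σ) p₀ :=
    ((hZ 0 le_rfl).mul hS).mul (hY 0 le_rfl)
  have hconj₀ : IsSysConj f k v u p₀ (Z p₀) (Y p₀) B D :=
    (mem_of_mem_nhdsWithin hmem hev).2.2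
  obtain ⟨P₀, hP₀⟩ := hconj₀.exists_isSplitting hk (abs_lt_of_mem_Ioo ha hb hω₀)
    (hφ.isProfile hω₀) hJ
  have hidem : ∀ᶠ p in 𝓝[halfSpace σ] p₀, sysStab σ p (Z p) (Y p) * sysStab σ p (Z p) (Y p) =
      sysStab σ p (Z p) (Y p) := by
    filter_upwards [hev] with p hp
    have h1 := hp.2.2.mul_YZ 0 le_rfl
    have h2 := (freeStab_isStableProj σ p).idem
    rw [sysStab]
    calc _ = Z p 0 * freeStab σ p * (Y p 0 * Z p 0) * freeStab σ p * Y p 0 := by noncomm_ring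
      _ = Z p 0 * (freeStab σ p * freeStab σ p) * Y p 0 := by rw [h1]; noncomm_ring
      _ = _ := by rw [h2]
  obtain ⟨P, hPlim, hPs⟩ := exists_isSplitting_eventually op_matβ_mul_self hQ hidem hP₀
  -- The filter contains the base point itself, so the limit `P₀` is also the value of `P` there.
  have hPc : ContinuousWithinAt P (halfSpace σ) p₀ := by
    have : P p₀ = P₀ := tendsto_nhds_unique (tendsto_pure_nhds P p₀)
      (hPlim.mono_left (pure_le_nhdsWithin hmem))
    rw [ContinuousWithinAt, this]
    exact hPlim
  have bound : ∀ F : ℂ × ℝ → Op, ContinuousWithinAt F (halfSpace σ) p₀ →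
      ∀ᶠ p in 𝓝[halfSpace σ] p₀, ‖F p‖ ≤ ‖F p₀‖ + 1 := fun F hF =>
    hF.norm.eventually (ge_mem_nhds (by linarith))
  have b1 := bound _ hPc
  have b2 := bound _ hS
  have b3 := bound (fun p => 1 - freeStab σ p) (continuousWithinAt_const.sub hS)
  have b4 := bound _ (continuous_freeM.continuousWithinAt (s := halfSpace σ) (x := p₀))
  set N : ℝ := 1 + |B| + (‖op (chan 0)‖ + ‖op (chan 1)‖) + (‖freeStab σ p₀‖ + 1) +
    (‖1 - freeStab σ p₀‖ + 1) + (‖P p₀‖ + 1) + (‖op (freeM p₀.1 p₀.2)‖ + 1) + ‖op matβ‖ +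
    ‖op matα‖ with hN
  have n0 := abs_nonneg B
  have n1 := norm_nonneg (op (chan 0))
  have n2 := norm_nonneg (op (chan 1))
  have n3 := norm_nonneg (freeStab σ p₀)
  have n4 := norm_nonneg (1 - freeStab σ p₀)
  have n5 := norm_nonneg (P p₀)
  have n6 := norm_nonneg (op (freeM p₀.1 p₀.2))
  have n7 := norm_nonneg (op matβ)
  have n8 := norm_nonneg (op matα)
  refine ⟨N, D, Z, Y, P, ?_, fun x y => ?_⟩
  · filter_upwards [hev, hPs, b1, b2, b3, b4, self_mem_nhdsWithin] with p hp hs c1 c2 c3 c4 c5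
    refine ⟨hp.1, by linarith, c5, hp.2.1, hφ.isProfile hp.1,
      hp.2.2.mono (by linarith [le_abs_self B]), freeStab_isStableProj σ p, hs,
      ⟨by linarith, fun j => ?_, by linarith, by linarith, le_rfl, fun j => re_kap_nonneg c5 p.2 j⟩,
      by linarith, by linarith, by linarith⟩
    fin_cases j
    · change ‖op (chan 0)‖ ≤ N
      linarith
    · change ‖op (chan 1)‖ ≤ N
      linarith
  · have hΦ : ContinuousWithinAt (fun p => sysFund σ p (Z p) (Y p) x) (halfSpace σ) p₀ :=
      continuousWithinAt_reflect (F := fun p x => Z p x * flow σ p x * Y p 0)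
        (fun x hx => ((hZ x hx).mul (continuousWithinAt_flow hmem x)).mul (hY 0 le_rfl)) x
    have hΨ : ContinuousWithinAt (fun p => sysInv σ p (Z p) (Y p) y) (halfSpace σ) p₀ :=
      continuousWithinAt_reflect (F := fun p x => Z p 0 * flow σ p (-x) * Y p x)
        (fun x hx => ((hZ 0 le_rfl).mul (continuousWithinAt_flow hmem (-x))).mul (hY x hx)) y
    unfold kernel splitKernel
    split_ifs
    · exact ((hΦ.mul hPc).mul hΨ).mul continuousWithinAt_const
    · exact ((hΦ.mul (continuousWithinAt_const.sub hPc)).mul hΨ).neg.mul continuousWithinAt_const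

end

end GN

namespace GN

/-! ### Weighted Hilbert–Schmidt bounds -/

/-- The weight `⟨x⟩^{2s}`. -/
noncomputable def wt (s x : ℝ) : ℝ≥0∞ := ENNReal.ofReal ((1 + x ^ 2) ^ s)

theorem one_add_sq_pos (x : ℝ) : 0 < 1 + x ^ 2 := by positivity

theorem measurable_wt (s : ℝ) : Measurable (wt s) := by unfold wt; fun_prop

theorem wt_half_sq (s x : ℝ) : wt (s / 2) x ^ 2 = wt s x := by
  have := one_add_sq_pos x
  rw [wt, wt, ← ENNReal.ofReal_pow (by positivity), ← Real.rpow_natCast, ← Real.rpow_mul this.le]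
  congr 2
  push_cast
  ring

theorem wt_neg_mul (s x : ℝ) : wt (-s) x * wt s x = 1 := by
  have := one_add_sq_pos x
  rw [wt, wt, ← ENNReal.ofReal_mul (by positivity), ← Real.rpow_add this]
  simp

theorem lintegral_wt_neg_lt_top {s : ℝ} (hs : 1 ≤ s) : ∫⁻ x, wt (-s) x < ∞ := by
  have h1 : ∀ x : ℝ, wt (-s) x ≤ ENNReal.ofReal ((1 + x ^ 2)⁻¹) := fun x => by
    refine ENNReal.ofReal_le_ofReal ?_
    rw [← Real.rpow_neg_one]
    exact Real.rpow_le_rpow_of_exponent_le (by nlinarith [sq_nonneg x]) (by linarith)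
  refine (lintegral_mono h1).trans_lt ?_
  exact (integrable_inv_one_add_sq).lintegral_lt_top

theorem ofReal_sum_sq_le (y : Fin 4 → ℂ) : ENNReal.ofReal (∑ i, ‖y i‖ ^ 2) ≤ 4 * ‖y‖ₑ ^ 2 := by
  rw [← ofReal_norm, ← ENNReal.ofReal_pow (norm_nonneg _)]
  rw [show (4 : ℝ≥0∞) = ENNReal.ofReal 4 by simp, ← ENNReal.ofReal_mul (by norm_num)]
  refine ENNReal.ofReal_le_ofReal ?_
  calc ∑ i, ‖y i‖ ^ 2 ≤ ∑ _i : Fin 4, ‖y‖ ^ 2 := Finset.sum_le_sum fun i _ => by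
        gcongr; exact norm_le_pi_norm y i
    _ = 4 * ‖y‖ ^ 2 := by simp

theorem enorm_sq_le_ofReal_sum (y : Fin 4 → ℂ) : ‖y‖ₑ ^ 2 ≤ ENNReal.ofReal (∑ i, ‖y i‖ ^ 2) := by
  rw [← ofReal_norm, ← ENNReal.ofReal_pow (norm_nonneg _)]
  refine ENNReal.ofReal_le_ofReal ?_
  have h0 : 0 ≤ ∑ i, ‖y i‖ ^ 2 := by positivity
  have : ‖y‖ ≤ √(∑ i, ‖y i‖ ^ 2) := (pi_norm_le_iff_of_nonneg (Real.sqrt_nonneg _)).2 fun i =>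
    Real.le_sqrt_of_sq_le (Finset.single_le_sum (f := fun i => ‖y i‖ ^ 2)
      (fun j _ => by positivity) (Finset.mem_univ i))
  calc ‖y‖ ^ 2 ≤ √(∑ i, ‖y i‖ ^ 2) ^ 2 := by gcongr
    _ = _ := Real.sq_sqrt h0

theorem wnorm_eq (s : ℝ) (h : ℝ → Fin 4 → ℂ) :
    wnorm s h = (∫⁻ x, wt s x * ENNReal.ofReal (∑ i, ‖h x i‖ ^ 2)) ^ (1 / 2 : ℝ) := by
  rw [wnorm]
  congr 1
  refine lintegral_congr fun x => ?_
  have := one_add_sq_pos x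
  rw [wt, ← ENNReal.ofReal_mul (by positivity)]

theorem lintegral_wt_mul_le_wnorm_sq (s : ℝ) (h : ℝ → Fin 4 → ℂ) :
    ∫⁻ x, wt s x * ‖h x‖ₑ ^ 2 ≤ wnorm s h ^ 2 := by
  rw [wnorm_eq, ← ENNReal.rpow_mul_natCast]
  norm_num
  gcongr with x
  simpa using enorm_sq_le_ofReal_sum (h x)

theorem sq_lintegral_le_wnorm {s : ℝ} {κ : ℝ → ℝ≥0∞} (hκ : AEMeasurable κ volume)
    {h : ℝ → Fin 4 → ℂ} (hh : AEStronglyMeasurable h volume) :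
    (∫⁻ y, κ y * ‖h y‖ₑ) ^ 2 ≤ (∫⁻ y, wt (-s) y * κ y ^ 2) * wnorm s h ^ 2 := by
  have h1 := sq_lintegral_mul_le (μ := volume) (f := fun y => wt (-s / 2) y * κ y)
    (g := fun y => wt (s / 2) y * ‖h y‖ₑ) ((measurable_wt _).aemeasurable.mul hκ)
    ((measurable_wt _).aemeasurable.mul hh.enorm)
  simp only [mul_pow, wt_half_sq] at h1
  refine le_trans (le_of_eq ?_) (h1.trans (mul_le_mul_right (lintegral_wt_mul_le_wnorm_sq s h) _))
  congr 1
  refine lintegral_congr fun y => ?_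
  have := wt_neg_mul (s / 2) y
  rw [← neg_div] at this
  calc κ y * ‖h y‖ₑ = (wt (-s / 2) y * wt (s / 2) y) * (κ y * ‖h y‖ₑ) := by rw [this, one_mul]
    _ = _ := by ring

/-- Cauchy–Schwarz in `y` bounds the operator by its Hilbert–Schmidt norm with weights; the factor
`2` compares the maximum norm on `ℂ⁴` with the Euclidean one. -/
theorem wnorm_neg_le {s : ℝ} {κ : ℝ → ℝ → ℝ≥0∞} (hκ : ∀ x, AEMeasurable (κ x) volume)
    {h g : ℝ → Fin 4 → ℂ} (hh : AEStronglyMeasurable h volume) (hfin : wnorm s h < ∞)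
    (hg : ∀ᵐ x, ‖g x‖ₑ ≤ ∫⁻ y, κ x y * ‖h y‖ₑ) :
    wnorm (-s) g ≤
      2 * (∫⁻ x, ∫⁻ y, wt (-s) x * (wt (-s) y * κ x y ^ 2)) ^ (1 / 2 : ℝ) * wnorm s h := by
  have key : ∫⁻ x, wt (-s) x * ENNReal.ofReal (∑ i, ‖g x i‖ ^ 2) ≤
      4 * (∫⁻ x, ∫⁻ y, wt (-s) x * (wt (-s) y * κ x y ^ 2)) * wnorm s h ^ 2 := by
    have h4 : (4 : ℝ≥0∞) * wnorm s h ^ 2 ≠ ∞ :=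
      ENNReal.mul_ne_top (by simp) (ENNReal.pow_ne_top hfin.ne)
    rw [mul_right_comm, ← lintegral_const_mul' _ _ h4]
    refine lintegral_mono_ae ?_
    filter_upwards [hg] with x hx
    calc wt (-s) x * ENNReal.ofReal (∑ i, ‖g x i‖ ^ 2)
        ≤ wt (-s) x * (4 * (∫⁻ y, κ x y * ‖h y‖ₑ) ^ 2) := by
          gcongr
          refine (ofReal_sum_sq_le _).trans ?_
          gcongr
      _ ≤ wt (-s) x * (4 * ((∫⁻ y, wt (-s) y * κ x y ^ 2) * wnorm s h ^ 2)) := by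
          gcongr
          exact sq_lintegral_le_wnorm (hκ x) hh
      _ = _ := by
          rw [lintegral_const_mul' _ _ (show wt (-s) x ≠ ∞ from ENNReal.ofReal_ne_top)]
          ring
  rw [wnorm_eq]
  calc _ ≤ (4 * (∫⁻ x, ∫⁻ y, wt (-s) x * (wt (-s) y * κ x y ^ 2)) * wnorm s h ^ 2) ^ (1 / 2 : ℝ) := by
        gcongr
    _ = _ := by
        rw [ENNReal.mul_rpow_of_nonneg _ _ (by norm_num), ENNReal.mul_rpow_of_nonneg _ _ (by norm_num),
          show (4 : ℝ≥0∞) = 2 ^ 2 by norm_num, ← ENNReal.rpow_natCast, ← ENNReal.rpow_natCast,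
          ← ENNReal.rpow_mul, ← ENNReal.rpow_mul]
        norm_num

theorem memLp_of_wnorm {s : ℝ} (hs : 0 ≤ s) {h : ℝ → Fin 4 → ℂ} (hh : AEStronglyMeasurable h volume)
    (hfin : wnorm s h < ∞) : MemLp h 2 volume := by
  refine ⟨hh, ?_⟩
  rw [eLpNorm_two_eq]
  refine ENNReal.rpow_lt_top_of_nonneg (by norm_num) (ne_of_lt ?_)
  refine lt_of_le_of_lt (lintegral_mono fun x => ?_)
    ((lintegral_wt_mul_le_wnorm_sq s h).trans_lt (ENNReal.pow_lt_top hfin))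
  refine le_mul_of_one_le_left' ?_
  rw [wt, ← ENNReal.ofReal_one]
  exact ENNReal.ofReal_le_ofReal (Real.one_le_rpow (by nlinarith [sq_nonneg x]) hs)

theorem integrable_of_wnorm {s : ℝ} (hs : 1 ≤ s) {h : ℝ → Fin 4 → ℂ} (hh : AEStronglyMeasurable h volume)
    (hfin : wnorm s h < ∞) : Integrable h volume := by
  refine ⟨hh, ?_⟩
  have h1 := sq_lintegral_le_wnorm (s := s) (κ := fun _ => 1) aemeasurable_const hh
  simp only [one_mul, one_pow, mul_one] at h1
  have h2 := h1.trans_lt (ENNReal.mul_lt_top (lintegral_wt_neg_lt_top hs) (ENNReal.pow_lt_top hfin))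
  rw [hasFiniteIntegral_iff_enorm]
  by_contra hcon
  rw [not_lt, top_le_iff] at hcon
  rw [hcon] at h2
  simp at h2

/-- `g` is a bound of a kernel in its first variable which is admissible for the weight `s`. -/
structure IsWeightBound (s c : ℝ) (g : ℝ → ℝ) : Prop where
  one_le : 1 ≤ s
  nonneg : ∀ x, 0 ≤ g x
  le : ∀ x, (1 + x ^ 2) ^ (-s) * g x ^ 2 ≤ c * (1 + x ^ 2)⁻¹

/-- The bound of the Hilbert–Schmidt integral. -/
noncomputable def weightConst (s c : ℝ) : ℝ≥0∞ :=
  (∫⁻ x : ℝ, ENNReal.ofReal (c * (1 + x ^ 2)⁻¹)) * ∫⁻ y, wt (-s) y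

theorem weightConst_lt_top {s : ℝ} (hs : 1 ≤ s) (c : ℝ) : weightConst s c < ∞ :=
  ENNReal.mul_lt_top (integrable_inv_one_add_sq.const_mul c).lintegral_lt_top
    (lintegral_wt_neg_lt_top hs)

theorem IsWeightBound.wt_mul_le {s c : ℝ} {g : ℝ → ℝ} (hg : IsWeightBound s c g) (x : ℝ) :
    wt (-s) x * ENNReal.ofReal (g x) ^ 2 ≤ ENNReal.ofReal (c * (1 + x ^ 2)⁻¹) := by
  have := one_add_sq_pos x
  rw [wt, ← ENNReal.ofReal_pow (hg.nonneg x), ← ENNReal.ofReal_mul (by positivity)]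
  exact ENNReal.ofReal_le_ofReal (hg.le x)

theorem IsWeightBound.wnorm_le {s c : ℝ} {g : ℝ → ℝ} (hg : IsWeightBound s c g)
    {G : ℝ → ℝ → Matrix (Fin 4) (Fin 4) ℂ} (hG : ∀ x y z, ‖G x y *ᵥ z‖ ≤ g x * ‖z‖)
    {h : ℝ → Fin 4 → ℂ} (hh : AEStronglyMeasurable h volume) (hfin : wnorm s h < ∞) :
    wnorm (-s) (integralOp G h) ≤ 2 * weightConst s c ^ (1 / 2 : ℝ) * wnorm s h := by
  refine (wnorm_neg_le (κ := fun x _ => ENNReal.ofReal (g x)) (fun x => aemeasurable_const) hh hfin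
    (ae_of_all _ fun x => ?_)).trans ?_
  · refine (enorm_integral_le_lintegral_enorm _).trans (lintegral_mono fun y => ?_)
    rw [← ofReal_norm, ← ofReal_norm, ← ENNReal.ofReal_mul (hg.nonneg x)]
    exact ENNReal.ofReal_le_ofReal (hG x y (h y))
  · gcongr
    rw [weightConst, ← lintegral_mul_const _ (by fun_prop)]
    refine lintegral_mono fun x => ?_
    rw [← lintegral_const_mul _ (measurable_wt _)]
    refine lintegral_mono fun y => ?_
    calc _ = wt (-s) x * ENNReal.ofReal (g x) ^ 2 * wt (-s) y := by ring
      _ ≤ _ := by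
        gcongr
        exact hg.wt_mul_le x

/-- The kernels converge pointwise under the common bound `g`, and `⟨x⟩^{-2s} ⟨y⟩^{-2s} g(x)²` is
integrable. Dominated convergence gives convergence in the weighted Hilbert–Schmidt norm. -/
theorem IsWeightBound.tendsto {s c : ℝ} {g : ℝ → ℝ} (hg : IsWeightBound s c g) {K : ℝ → ℝ → ℝ → Op}
    {K₀ : ℝ → ℝ → Op} {ε₀ : ℝ} (hε₀ : 0 < ε₀)
    (hKm : ∀ ε ∈ Ioo 0 ε₀, StronglyMeasurable fun z : ℝ × ℝ => K ε z.1 z.2)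
    (hK₀m : StronglyMeasurable fun z : ℝ × ℝ => K₀ z.1 z.2)
    (hKb : ∀ ε ∈ Ioo 0 ε₀, ∀ x y, ‖K ε x y‖ ≤ g x) (hK₀b : ∀ x y, ‖K₀ x y‖ ≤ g x)
    (hlim : ∀ x y, Tendsto (fun ε => K ε x y) (𝓝[>] 0) (𝓝 (K₀ x y)))
    {h : ℝ → Fin 4 → ℂ} (hh : AEStronglyMeasurable h volume) (hfin : wnorm s h < ∞)
    {w : ℝ → ℝ → Fin 4 → ℂ}
    (hw : ∀ ε ∈ Ioo 0 ε₀, w ε =ᵐ[volume] fun x => ∫ y, K ε x y (h y)) :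
    Tendsto (fun ε => wnorm (-s) (fun x => w ε x - integralOp (fun x y => mat (K₀ x y)) h x))
      (𝓝[>] 0) (𝓝 0) := by
  have hhi := integrable_of_wnorm hg.one_le hh hfin
  have hmem : Ioo 0 ε₀ ∈ 𝓝[>] (0 : ℝ) := Ioo_mem_nhdsGT hε₀
  have hint : ∀ L : ℝ → ℝ → Op, StronglyMeasurable (fun z : ℝ × ℝ => L z.1 z.2) →
      (∀ x y, ‖L x y‖ ≤ g x) → ∀ x, Integrable (fun y => L x y (h y)) volume := fun L hLm hL x => by
    refine (hhi.norm.const_mul (g x)).mono' ?_ (ae_of_all _ fun y => ?_)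
    · exact (ContinuousLinearMap.apply ℂ (Fin 4 → ℂ)).flip.aestronglyMeasurable_comp₂
        (hLm.comp_measurable measurable_prodMk_left).aestronglyMeasurable hh
    · exact ((L x y).le_opNorm _).trans (mul_le_mul_of_nonneg_right (hL x y) (norm_nonneg _))
  set F : ℝ → ℝ × ℝ → ℝ≥0∞ := fun ε z =>
    wt (-s) z.1 * (wt (-s) z.2 * ‖K ε z.1 z.2 - K₀ z.1 z.2‖ₑ ^ 2) with hF
  have hFm : ∀ ε ∈ Ioo 0 ε₀, Measurable (F ε) := fun ε hε =>
    ((measurable_wt _).comp measurable_fst).mul (((measurable_wt _).comp measurable_snd).mul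
      (((hKm ε hε).sub hK₀m).enorm.pow_const 2))
  have hbound : ∀ ε ∈ Ioo 0 ε₀, wnorm (-s)
      (fun x => w ε x - integralOp (fun x y => mat (K₀ x y)) h x) ≤
      2 * (∫⁻ z, F ε z ∂((volume : Measure ℝ).prod volume)) ^ (1 / 2 : ℝ) * wnorm s h := fun ε hε => by
    have hDm := (hKm ε hε).sub hK₀m
    refine (wnorm_neg_le (κ := fun x y => ‖K ε x y - K₀ x y‖ₑ) (fun x => ?_) hh hfin ?_).trans ?_
    · exact ((hDm.comp_measurable measurable_prodMk_left).enorm).aemeasurable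
    · filter_upwards [hw ε hε] with x hx
      have e : w ε x - integralOp (fun x y => mat (K₀ x y)) h x =
          ∫ y, (K ε x y - K₀ x y) (h y) := by
        simp only [integralOp, mat_mulVec, _root_.sub_apply]
        rw [hx, integral_sub (hint _ (hKm ε hε) (hKb ε hε) x) (hint _ hK₀m hK₀b x)]
      rw [e]
      refine (enorm_integral_le_lintegral_enorm _).trans (lintegral_mono fun y => ?_)
      exact ContinuousLinearMap.le_opENorm _ _
    · rw [lintegral_prod _ (hFm ε hε).aemeasurable]
  have hF0 : Tendsto (fun ε => ∫⁻ z, F ε z ∂((volume : Measure ℝ).prod volume)) (𝓝[>] 0) (𝓝 0) := by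
    have := tendsto_lintegral_filter_of_dominated_convergence
      (μ := (volume : Measure ℝ).prod volume) (l := 𝓝[>] (0 : ℝ)) (F := F) (f := fun _ => 0)
      (fun z : ℝ × ℝ => 4 * (ENNReal.ofReal (c * (1 + z.1 ^ 2)⁻¹) * wt (-s) z.2))
      (by filter_upwards [hmem] with ε hε using hFm ε hε) ?_ ?_ ?_
    · simpa using this
    · filter_upwards [hmem] with ε hε
      refine ae_of_all _ fun z => ?_
      have h1 : ‖K ε z.1 z.2 - K₀ z.1 z.2‖ₑ ≤ 2 * ENNReal.ofReal (g z.1) := by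
        rw [← ofReal_norm, two_mul, ← ENNReal.ofReal_add (hg.nonneg _) (hg.nonneg _)]
        exact ENNReal.ofReal_le_ofReal ((norm_sub_le _ _).trans
          (add_le_add (hKb ε hε _ _) (hK₀b _ _)))
      calc F ε z ≤ wt (-s) z.1 * (wt (-s) z.2 * (2 * ENNReal.ofReal (g z.1)) ^ 2) := by
            simp only [hF]; gcongr
        _ = 4 * ((wt (-s) z.1 * ENNReal.ofReal (g z.1) ^ 2) * wt (-s) z.2) := by ring
        _ ≤ _ := by
            gcongr
            exact hg.wt_mul_le _
    · have hm : Measurable fun z : ℝ × ℝ => ENNReal.ofReal (c * (1 + z.1 ^ 2)⁻¹) * wt (-s) z.2 :=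
        Measurable.mul (by fun_prop) ((measurable_wt _).comp measurable_snd)
      have hp := lintegral_prod_mul (μ := (volume : Measure ℝ)) (ν := (volume : Measure ℝ))
        (f := fun x => ENNReal.ofReal (c * (1 + x ^ 2)⁻¹)) (g := wt (-s)) (by fun_prop)
        (measurable_wt _).aemeasurable
      rw [lintegral_const_mul _ hm, hp]
      exact ENNReal.mul_ne_top (by simp) (weightConst_lt_top hg.one_le c).ne
    · refine ae_of_all _ fun z => ?_
      have h1 : Tendsto (fun ε => ‖K ε z.1 z.2 - K₀ z.1 z.2‖ₑ) (𝓝[>] 0) (𝓝 0) := by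
        have := ENNReal.tendsto_ofReal (tendsto_iff_norm_sub_tendsto_zero.1 (hlim z.1 z.2))
        simpa only [ofReal_norm, ENNReal.ofReal_zero] using this
      have h2 := ENNReal.Tendsto.const_mul (a := wt (-s) z.1 * wt (-s) z.2)
        (ENNReal.Tendsto.pow (n := 2) h1)
        (Or.inr (ENNReal.mul_ne_top ENNReal.ofReal_ne_top ENNReal.ofReal_ne_top))
      simpa [hF, mul_assoc] using h2
  have h3 : Tendsto (fun ε => 2 * (∫⁻ z, F ε z ∂((volume : Measure ℝ).prod volume)) ^ (1 / 2 : ℝ) *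
      wnorm s h) (𝓝[>] 0) (𝓝 0) := by
    have h4 := (ENNReal.continuous_rpow_const (y := 1 / 2)).continuousAt.tendsto.comp hF0
    have h5 := ENNReal.Tendsto.mul_const (b := wnorm s h)
      (ENNReal.Tendsto.const_mul (a := 2) h4 (Or.inr (by simp))) (Or.inr hfin.ne)
    simpa using h5
  refine tendsto_of_tendsto_of_tendsto_of_le_of_le' tendsto_const_nhds h3
    (Eventually.of_forall fun _ => zero_le) ?_
  filter_upwards [hmem] with ε hε using hbound ε hε

theorem IsWeightBound.isBoundaryResolvent {f : ℝ → ℝ} {v u : ℝ → ℝ → ℝ} {ω Λ : ℝ} {σ : Side}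
    {s c : ℝ} {g : ℝ → ℝ} (hg : IsWeightBound s c g) {Φ Ψ : ℝ → ℝ → Op} {P : ℝ → Op}
    {Φ₀ Ψ₀ : ℝ → Op} {P₀ b : Op} {M₀ : ℝ → Op} {ε₀ : ℝ} (hε₀ : 0 < ε₀)
    (hM : ∀ μ : ℂ, Continuous fun x => op (M f v u ω μ x))
    (hMb : ∀ μ : ℂ, ∃ m : ℝ, ∀ x, ‖op (M f v u ω μ x)‖ ≤ m)
    (hD : ∀ ε ∈ Ioo 0 ε₀, ∃ C r, 0 < r ∧ IsDichotomy b
      (fun x => op (M f v u ω (Complex.I * Λ + (σ.sgn * ε : ℝ)) x)) (Φ ε) (Ψ ε) (P ε) C r)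
    (hF₀ : IsFundamental b M₀ Φ₀ Ψ₀)
    (hKb : ∀ ε ∈ Ioo 0 ε₀, ∀ x y, ‖splitKernel (Φ ε) (Ψ ε) (P ε) x y‖ ≤ g x)
    (hK₀b : ∀ x y, ‖splitKernel Φ₀ Ψ₀ P₀ x y‖ ≤ g x)
    (hlim : ∀ x y, Tendsto (fun ε => splitKernel (Φ ε) (Ψ ε) (P ε) x y) (𝓝[>] 0)
      (𝓝 (splitKernel Φ₀ Ψ₀ P₀ x y))) :
    IsBoundaryResolvent f v u ω σ Λ s (integralOp fun x y => mat (splitKernel Φ₀ Ψ₀ P₀ x y)) := by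
  refine ⟨ε₀, hε₀, fun ε hε => ?_, fun h hh hfin w hw => ?_⟩
  · obtain ⟨C, r, hr, h⟩ := hD ε hε
    obtain ⟨m, hm⟩ := hMb (Complex.I * Λ + (σ.sgn * ε : ℝ))
    exact h.isResolventPoint (hM _) hm hr
  · refine hg.tendsto (K := fun ε => splitKernel (Φ ε) (Ψ ε) (P ε)) hε₀ (fun ε hε => ?_)
      (hF₀.measurable_splitKernel P₀) hKb hK₀b hlim hh hfin (fun ε hε => ?_)
    · obtain ⟨C, r, -, h⟩ := hD ε hε
      exact h.fund.measurable_splitKernel (P ε)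
    · obtain ⟨C, r, hr, h⟩ := hD ε hε
      obtain ⟨m, hm⟩ := hMb (Complex.I * Λ + (σ.sgn * ε : ℝ))
      have hL2 := memLp_of_wnorm (by linarith [hg.one_le]) hh hfin
      exact h.ae_eq_of_solvesResolvent (hM _) (h.solvesResolvent (hM _) hm hr hL2) (hw ε hε)

end GN

namespace GN

/-! ### The boundary values of the resolvent -/

section

variable {f : ℝ → ℝ} {a b : ℝ} {v u : ℝ → ℝ → ℝ} {k : ℕ} {σ : Side} {Λ ω : ℝ}

/-- The standing assumptions. -/
structure IsSetting (f : ℝ → ℝ) (k : ℕ) (a b : ℝ) (v u : ℝ → ℝ → ℝ) : Prop where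
  smooth : ContDiff ℝ (⊤ : ℕ∞) f
  two_le : 2 ≤ k
  flat : ∃ c : ℝ, ∀ s ∈ Icc (0 : ℝ) 1, |f s| ≤ c * s ^ k
  left : -(1 / 3) ≤ a
  right : b ≤ 1 / 3
  family : IsSolitaryFamily f (Ioo a b) v u

theorem IsSetting.abs_lt (h : IsSetting f k a b v u) (hω : ω ∈ Ioo a b) : |ω| < 1 / 3 :=
  abs_lt_of_mem_Ioo h.left h.right hω

theorem IsSetting.exists_isSysConj (h : IsSetting f k a b v u) (hω : ω ∈ Ioo a b) (σ : Side) (Λ : ℝ) :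
    ∃ B D Z Y, IsSysConj f k v u (Complex.I * Λ, ω) Z Y B D := by
  obtain ⟨B, D, Z, Y, -, -, hev⟩ := h.family.exists_isConjugation h.left h.right h.smooth h.two_le
    h.flat σ Λ hω
  exact ⟨B, D, _, _, (mem_of_mem_nhdsWithin (boundary_mem_halfSpace σ Λ ω) hev).2.2⟩

theorem IsSetting.existsUnique_jost (h : IsSetting f k a b v u) (hω : ω ∈ Ioo a b) (σ : Side) (Λ : ℝ)
    (j : Fin 2) : ∃! g, IsJost f k v u ω σ Λ j g := by
  obtain ⟨B, D, Z, Y, hZ⟩ := h.exists_isSysConj hω σ Λ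
  have h3 := h.abs_lt hω
  have hJ := hZ.isJost (σ := σ) (by linarith) (h.family.isProfile hω) j
  exact ⟨_, hJ, fun g hg => hZ.isJost_unique h.two_le h3 (h.family.isProfile hω) hg hJ⟩

theorem IsSetting.isJostFrame (h : IsSetting f k a b v u) (hω : ω ∈ Ioo a b)
    (hE : evans f k v u ω Λ ≠ 0) (σ : Side) : IsJostFrame f k v u ω σ Λ := by
  have hm := evans_ne_zero_iff.1 hE
  cases σ
  · exact hm.plus (h.existsUnique_jost hω _ Λ) (h.existsUnique_jost hω _ Λ)
  · exact hm

theorem IsSetting.continuous_M (h : IsSetting f k a b v u) (hω : ω ∈ Ioo a b) (μ : ℂ) :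
    Continuous fun x => op (M f v u ω μ x) := by
  simp only [op_M]
  refine continuous_const.add (continuous_iff_continuousAt.2 fun x => ?_)
  exact ContinuousAt.comp (f := fun x : ℝ => (ω, x)) (g := fun q : ℝ × ℝ => potOp f v u q.1 q.2)
    (h.family.continuousAt_potOp h.smooth hω x) (by fun_prop)

theorem IsSetting.exists_norm_M_le (h : IsSetting f k a b v u) (hω : ω ∈ Ioo a b) (μ : ℂ) :
    ∃ m : ℝ, ∀ x, ‖op (M f v u ω μ x)‖ ≤ m := by
  obtain ⟨C, hC0, hC⟩ := h.family.eventually_norm_potOp_le h.left h.right h.smooth h.two_le h.flat hω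
  refine ⟨‖op (freeM μ ω)‖ + C, fun x => ?_⟩
  rw [op_M]
  refine (norm_add_le _ _).trans (add_le_add le_rfl ((hC.self_of_nhds.2 x).trans ?_))
  have h1 : Real.exp (-(2 * k * dl ω * |x|)) ≤ 1 := by
    rw [Real.exp_le_one_iff, neg_nonpos]
    have := dl_nonneg ω
    positivity
  nlinarith

theorem tendsto_side (σ : Side) (Λ ω : ℝ) :
    Tendsto (fun ε : ℝ => ((Complex.I * Λ + (σ.sgn * ε : ℝ), ω) : ℂ × ℝ)) (𝓝[>] 0)
      (𝓝[halfSpace σ] (Complex.I * Λ, ω)) := by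
  refine tendsto_nhdsWithin_iff.2 ⟨?_, ?_⟩
  · have : Continuous fun ε : ℝ => ((Complex.I * Λ + (σ.sgn * ε : ℝ), ω) : ℂ × ℝ) := by fun_prop
    have h := this.tendsto 0
    simp only [mul_zero, Complex.ofReal_zero, add_zero] at h
    exact h.mono_left nhdsWithin_le_nhds
  · filter_upwards [self_mem_nhdsWithin] with ε hε
    have h0 : 0 < ε := hε
    simp only [halfSpace, mem_ofPred_eq, Complex.add_re, Complex.mul_re, Complex.I_re, zero_mul,
      Complex.I_im, Complex.ofReal_im, mul_zero, sub_zero, Complex.ofReal_re, zero_add]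
    rw [← mul_assoc, σ.sgn_sq, one_mul]
    exact h0.le

/-- The kernel of the boundary value of the resolvent. -/
noncomputable def bKernel (f : ℝ → ℝ) (k : ℕ) (v u : ℝ → ℝ → ℝ) (σ : Side) (ω Λ : ℝ) :
    ℝ → ℝ → Matrix (Fin 4) (Fin 4) ℂ :=
  green f k v u ω σ Λ 1

theorem IsSysData.bKernel_eq {Z Y : ℝ → Op} {P : Op} {N D : ℝ}
    (h : IsSysData f k v u σ (Complex.I * Λ, ω) Z Y (freeStab σ (Complex.I * Λ, ω)) P N D)
    (hk : 2 ≤ k) (hω : |ω| < 1 / 3) (hJ : IsJostFrame f k v u ω σ Λ) (x y : ℝ) :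
    bKernel f k v u σ ω Λ x y = mat (kernel σ (Complex.I * Λ, ω) Z Y P x y) :=
  h.conj.green_eq hk hω h.profile hJ h.split (by simp) x y

theorem IsSetting.isBoundaryResolvent (h : IsSetting f k a b v u) (hω : ω ∈ Ioo a b)
    (hJ : IsJostFrame f k v u ω σ Λ) {N D : ℝ} {Z Y : ℂ × ℝ → ℝ → Op} {P : ℂ × ℝ → Op}
    (hev : ∀ᶠ p in 𝓝[halfSpace σ] (Complex.I * Λ, ω),
      IsSysData f k v u σ p (Z p) (Y p) (freeStab σ p) (P p) N D)
    (hc : ∀ x y, ContinuousWithinAt (fun p => kernel σ p (Z p) (Y p) (P p) x y) (halfSpace σ)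
      (Complex.I * Λ, ω)) {s c : ℝ} {g : ℝ → ℝ} (hg : IsWeightBound s c g)
    (hb : ∀ᶠ p in 𝓝[halfSpace σ] (Complex.I * Λ, ω),
      ∀ x y, ‖kernel σ p (Z p) (Y p) (P p) x y‖ ≤ g x) :
    IsBoundaryResolvent f v u ω σ Λ s (integralOp (bKernel f k v u σ ω Λ)) := by
  have hmem := boundary_mem_halfSpace σ Λ ω
  have d₀ := mem_of_mem_nhdsWithin hmem hev
  have b₀ := mem_of_mem_nhdsWithin hmem hb
  have e : bKernel f k v u σ ω Λ = fun x y => mat (splitKernel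
      (sysFund σ (Complex.I * Λ, ω) (Z (Complex.I * Λ, ω)) (Y (Complex.I * Λ, ω)))
      (sysInv σ (Complex.I * Λ, ω) (Z (Complex.I * Λ, ω)) (Y (Complex.I * Λ, ω)))
      (P (Complex.I * Λ, ω)) x y) := by
    funext x y
    exact d₀.bKernel_eq h.two_le (h.abs_lt hω) hJ x y
  rw [e]
  have ht := tendsto_side σ Λ ω
  obtain ⟨ε₀, hε₀, hsub⟩ := mem_nhdsGT_iff_exists_Ioo_subset.1 (ht.eventually (hev.and hb))
  have hε : ∀ ε ∈ Ioo 0 ε₀, _ := fun ε hε => hsub hε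
  refine hg.isBoundaryResolvent (b := op matβ) (f := f) (v := v) (u := u) (ε₀ := ε₀)
    (Φ := fun ε => sysFund σ (Complex.I * Λ + (σ.sgn * ε : ℝ), ω)
      (Z (Complex.I * Λ + (σ.sgn * ε : ℝ), ω)) (Y (Complex.I * Λ + (σ.sgn * ε : ℝ), ω)))
    (Ψ := fun ε => sysInv σ (Complex.I * Λ + (σ.sgn * ε : ℝ), ω)
      (Z (Complex.I * Λ + (σ.sgn * ε : ℝ), ω)) (Y (Complex.I * Λ + (σ.sgn * ε : ℝ), ω)))
    (P := fun ε => P (Complex.I * Λ + (σ.sgn * ε : ℝ), ω))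
    hε₀ (h.continuous_M hω) (h.exists_norm_M_le hω)
    (fun ε hε' => ?_) d₀.isFundamental (fun ε hε' => (hε ε hε').2) b₀ (fun x y => ?_)
  · refine (hε ε hε').1.isDichotomy ?_
    have h0 : 0 < ε := hε'.1
    simp only [Complex.add_re, Complex.mul_re, Complex.I_re, zero_mul,
      Complex.I_im, Complex.ofReal_im, mul_zero, sub_zero, Complex.ofReal_re, zero_add]
    rw [← mul_assoc, σ.sgn_sq, one_mul]
    exact h0
  · exact Tendsto.comp (hc x y) ht

theorem isWeightBound_const {s : ℝ} (hs : 1 ≤ s) {C : ℝ} (hC : 0 ≤ C) :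
    IsWeightBound s (C ^ 2) fun _ => C := by
  refine ⟨hs, fun _ => hC, fun x => ?_⟩
  have h1 : (1 + x ^ 2) ^ (-s) ≤ (1 + x ^ 2)⁻¹ := by
    rw [← Real.rpow_neg_one]
    exact Real.rpow_le_rpow_of_exponent_le (by nlinarith [sq_nonneg x]) (by linarith)
  rw [mul_comm]
  gcongr

/-- A bound by `min(|x|, |y|)` may be charged to `x` alone, and `(1 + x²)^{-2} (1 + |x|)²` is
dominated by a multiple of `(1 + x²)⁻¹`. -/
theorem isWeightBound_linear {s : ℝ} (hs : 2 ≤ s) {C : ℝ} (hC : 0 ≤ C) :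
    IsWeightBound s (2 * C ^ 2) fun x => C * (1 + |x|) := by
  refine ⟨by linarith, fun x => by positivity, fun x => ?_⟩
  have h0 := one_add_sq_pos x
  have h1 : (1 + x ^ 2) ^ (-s) ≤ (1 + x ^ 2)⁻¹ * (1 + x ^ 2)⁻¹ := by
    rw [← Real.rpow_neg_one, ← Real.rpow_add h0]
    exact Real.rpow_le_rpow_of_exponent_le (by nlinarith [sq_nonneg x]) (by linarith)
  have h2 : (C * (1 + |x|)) ^ 2 ≤ 2 * C ^ 2 * (1 + x ^ 2) := by
    rw [mul_pow]
    have : (1 + |x|) ^ 2 ≤ 2 * (1 + x ^ 2) := by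
      nlinarith [sq_nonneg (1 - |x|), sq_abs x]
    nlinarith [sq_nonneg C]
  calc _ ≤ ((1 + x ^ 2)⁻¹ * (1 + x ^ 2)⁻¹) * (2 * C ^ 2 * (1 + x ^ 2)) := by gcongr
    _ = _ := by field_simp

/-- The boundary value of the resolvent at a regular point, with the local bounds. -/
theorem IsSetting.regular (h : IsSetting f k a b v u) (hω : ω ∈ Ioo a b)
    (hJ : IsJostFrame f k v u ω σ Λ) :
    IsGreen f v u ω Λ (bKernel f k v u σ ω Λ) ∧
    (∀ Γ : Matrix (Fin 2) (Fin 2) ℂ, Γ.det ≠ 0 → ∀ x y,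
      bKernel f k v u σ ω Λ x y = green f k v u ω σ Λ Γ x y) ∧
    (∀ s, 3 < s → IsBoundaryResolvent f v u ω σ Λ s (integralOp (bKernel f k v u σ ω Λ))) ∧
    ((∀ j, kap σ (Complex.I * Λ) ω j ≠ 0) →
      IsBoundaryResolvent f v u ω σ Λ 1 (integralOp (bKernel f k v u σ ω Λ))) ∧
    ∃ C : ℝ, 0 ≤ C ∧ ∀ᶠ q : ℝ × ℝ in 𝓝 (Λ, ω), IsJostFrame f k v u q.2 σ q.1 →
      ∀ x y, ∀ i j, ‖bKernel f k v u σ q.2 q.1 x y i j‖ ≤ C * (1 + min |x| |y|) := by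
  obtain ⟨N, D, Z, Y, P, hev, hc⟩ := h.family.exists_kernels h.left h.right h.smooth h.two_le h.flat
    hω hJ
  have hmem := boundary_mem_halfSpace σ Λ ω
  obtain ⟨-, hm₀, d₀⟩ := mem_of_mem_nhdsWithin hmem hev
  have hN1 := d₀.bounded.one_le
  have hev' := hev.mono fun p hp => hp.2.2
  have hmin : ∀ x y : ℝ, 0 ≤ min |x| |y| := fun x y => le_min (abs_nonneg _) (abs_nonneg _)
  have hlin : ∀ {p : ℂ × ℝ}, ‖op (freeM p.1 p.2)‖ ≤ N →
      IsSysData f k v u σ p (Z p) (Y p) (freeStab σ p) (P p) N D →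
      ∀ x y, ‖kernel σ p (Z p) (Y p) (P p) x y‖ ≤ 6 * N ^ 18 * (1 + min |x| |y|) :=
    fun {p} h1 h2 x y => by
      refine (h2.norm_kernel_le_min h1 x y).trans ?_
      have h3 : 1 + min |x| |y| * N ≤ N * (1 + min |x| |y|) := by nlinarith [hmin x y]
      calc _ ≤ 6 * N ^ 17 * (N * (1 + min |x| |y|)) := by gcongr
        _ = _ := by ring
  have hω3 := h.abs_lt hω
  refine ⟨?_, fun Γ hΓ x y => ?_, fun s hs => ?_, fun hκ => ?_, 6 * N ^ 18, by positivity, ?_⟩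
  · have e : bKernel f k v u σ ω Λ = fun x y => mat (kernel σ (Complex.I * Λ, ω)
        (Z (Complex.I * Λ, ω)) (Y (Complex.I * Λ, ω)) (P (Complex.I * Λ, ω)) x y) :=
      funext fun x => funext fun y => d₀.bKernel_eq h.two_le hω3 hJ x y
    rw [e]
    exact d₀.isFundamental.isGreen (h.continuous_M hω _) _
  · rw [d₀.bKernel_eq h.two_le hω3 hJ,
      d₀.conj.green_eq h.two_le hω3 d₀.profile hJ d₀.split hΓ]
  · refine h.isBoundaryResolvent hω hJ hev' hc
      (isWeightBound_linear (s := s) (by linarith) (C := 6 * N ^ 18) (by positivity)) ?_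
    filter_upwards [hev] with p hp x y
    refine (hlin hp.2.1 hp.2.2 x y).trans ?_
    gcongr
    exact min_le_left _ _
  -- Away from thresholds the rates are bounded below near the point, hence so is the denominator of
  -- `sinh(κx)/κ`. The kernels are then uniformly bounded, and the weight `s = 1` suffices.
  · set q := min ‖kap σ (Complex.I * Λ) ω 0‖ ‖kap σ (Complex.I * Λ) ω 1‖ with hq
    have hq0 : 0 < q := lt_min (norm_pos_iff.2 (hκ 0)) (norm_pos_iff.2 (hκ 1))
    have hnear : ∀ j, ∀ᶠ p : ℂ × ℝ in 𝓝[halfSpace σ] (Complex.I * Λ, ω),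
        q / 2 ≤ ‖kap σ p.1 p.2 j‖ := fun j => by
      have h1 := (continuousAt_kap_of_mem hmem j).norm
      have h2 : q / 2 < ‖kap σ (Complex.I * Λ) ω j‖ := by
        have : q ≤ ‖kap σ (Complex.I * Λ) ω j‖ := by
          fin_cases j
          · exact min_le_left _ _
          · exact min_le_right _ _
        linarith
      exact nhdsWithin_le_nhds (h1.eventually (le_mem_nhds h2))
    refine h.isBoundaryResolvent hω hJ hev' hc
      (isWeightBound_const le_rfl (C := 6 * N ^ 17 * (1 + N * (2 / q))) (by positivity)) ?_
    filter_upwards [hev, hnear 0, hnear 1] with p hp k0 k1 x y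
    have hk : ∀ j, q / 2 ≤ ‖kap σ p.1 p.2 j‖ := fun j => by
      fin_cases j
      · exact k0
      · exact k1
    have := hp.2.2.norm_kernel_le_const (B := N * (2 / q)) le_rfl hp.2.2.bounded.rate_le
      (fun j => norm_pos_iff.1 (lt_of_lt_of_le (by positivity) (hk j))) (fun j => ?_) x y
    · simpa using this
    · calc ‖op (freeM p.1 p.2)‖ ≤ N := hp.2.1
        _ = N * (2 / q) * (q / 2) := by field_simp
        _ ≤ _ := by gcongr; exact hk j
  -- Nearby boundary points lie in the same half-space, so the constant `N` serves them too; their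
  -- kernels are identified with Green's function through their own Jost frames.
  · have ht : Tendsto (fun q : ℝ × ℝ => ((Complex.I * q.1, q.2) : ℂ × ℝ)) (𝓝 (Λ, ω))
        (𝓝[halfSpace σ] (Complex.I * Λ, ω)) := by
      have hcont : Continuous fun q : ℝ × ℝ => ((Complex.I * q.1, q.2) : ℂ × ℝ) := by fun_prop
      have hcont' := hcont.tendsto (Λ, ω)
      exact tendsto_nhdsWithin_iff.2 ⟨hcont', Eventually.of_forall fun q =>
        boundary_mem_halfSpace σ q.1 q.2⟩
    filter_upwards [ht.eventually hev] with q hq hJq x y i j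
    rw [hq.2.2.bKernel_eq h.two_le (h.abs_lt hq.1) hJq]
    have hle := hlin (p := ((Complex.I * q.1, q.2) : ℂ × ℝ)) hq.2.1 hq.2.2 x y
    exact le_trans (norm_mat_le _ _ _) hle

end

end GN

namespace GN

/-! ### The spectral projection of the free system, and splittings close to it -/

section

set_option linter.unusedSectionVars false

variable {A : Type*} [NormedRing A] [NormedAlgebra ℂ A] [NormOneClass A] [CompleteSpace A]
  {m b Q : A} {pr : Fin 2 → A} {κ : Fin 2 → ℂ}

/-- The spectral projection of `m` for the eigenvalues `-κ_j`. -/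
noncomputable def specStab (m : A) (pr : Fin 2 → A) (κ : Fin 2 → ℂ) : A :=
  ∑ j, ((1 / 2 : ℂ) • pr j - ((1 / 2 : ℂ) * (κ j)⁻¹) • (pr j * m))

theorem IsChanneled.mul_sum_mul (h : IsChanneled m pr κ) (c d : Fin 2 → ℂ) (j : Fin 2) :
    pr j * ∑ i, (c i • pr i - d i • (pr i * m)) = c j • pr j - d j • (pr j * m) := by
  rw [Finset.mul_sum, Finset.sum_eq_single j]
  · rw [mul_sub, mul_smul_comm, mul_smul_comm, ← mul_assoc, h.idem]
  · intro i _ hi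
    rw [mul_sub, mul_smul_comm, mul_smul_comm, ← mul_assoc, h.orth j i hi.symm]
    simp
  · simp

theorem IsChanneled.eq_of_mul (h : IsChanneled m pr κ) {s t : A} (hst : ∀ j, pr j * s = pr j * t) :
    s = t := by
  rw [← one_mul s, ← one_mul t, ← h.sum, add_mul, add_mul, hst 0, hst 1]

theorem IsChanneled.mul_specStab (h : IsChanneled m pr κ) (j : Fin 2) : pr j * specStab m pr κ =
    (1 / 2 : ℂ) • pr j - ((1 / 2 : ℂ) * (κ j)⁻¹) • (pr j * m) :=
  h.mul_sum_mul (fun _ => 1 / 2) (fun j => (1 / 2) * (κ j)⁻¹) j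

theorem IsChanneled.specStab_comm (h : IsChanneled m pr κ) :
    specStab m pr κ * m = m * specStab m pr κ := by
  rw [specStab, Finset.sum_mul, Finset.mul_sum]
  refine Finset.sum_congr rfl fun j _ => ?_
  simp only [sub_mul, mul_sub, smul_mul_assoc, mul_smul_comm, ← mul_assoc, h.comm]

theorem IsChanneled.specStab_comm_pr (h : IsChanneled m pr κ) (j : Fin 2) :
    specStab m pr κ * pr j = pr j * specStab m pr κ := by
  rw [specStab, Finset.sum_mul, Finset.mul_sum]
  refine Finset.sum_congr rfl fun i _ => ?_
  have h1 : pr i * pr j = pr j * pr i := by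
    by_cases hij : i = j
    · rw [hij]
    · rw [h.orth i j hij, h.orth j i (Ne.symm hij)]
  simp only [sub_mul, mul_sub, smul_mul_assoc, mul_smul_comm, mul_assoc, h.comm]
  rw [← mul_assoc (pr i), ← mul_assoc (pr j), h1]

theorem IsChanneled.specStab_isStableProj (h : IsChanneled m pr κ) (hκ : ∀ j, κ j ≠ 0) :
    IsStableProj m pr κ (specStab m pr κ) := by
  have hleft : ∀ j, pr j * (m * specStab m pr κ) = -(κ j • (pr j * specStab m pr κ)) := fun j => by
    have ht : (κ j)⁻¹ * κ j = 1 := inv_mul_cancel₀ (hκ j)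
    rw [← h.specStab_comm, ← mul_assoc, h.mul_specStab, sub_mul, smul_mul_assoc, smul_mul_assoc,
      mul_assoc, h.sq]
    linear_combination (norm := module) (-(1 / 2 : ℂ) * ht) • (pr j * m) - (1 / 2 * κ j * ht) • pr j
  refine ⟨h.eq_of_mul fun j => ?_, h.specStab_comm_pr, hleft, fun j => ?_⟩
  · have ht : (κ j)⁻¹ * κ j = 1 := inv_mul_cancel₀ (hκ j)
    rw [← mul_assoc]
    nth_rw 1 [h.mul_specStab]
    rw [sub_mul, smul_mul_assoc, smul_mul_assoc, mul_assoc, hleft]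
    linear_combination (norm := module) (1 / 2 * ht) • (pr j * specStab m pr κ)
  · have ht : (κ j)⁻¹ * κ j = 1 := inv_mul_cancel₀ (hκ j)
    have h1 : pr j * (specStab m pr κ * m) = -(κ j • (pr j * specStab m pr κ)) := by
      rw [h.specStab_comm, hleft]
    rw [sub_mul, one_mul, mul_sub, h1, mul_sub, mul_one, h.mul_specStab]
    linear_combination (norm := module) (-ht) • (pr j * m)

theorem IsChanneled.one_sub_specStab (h : IsChanneled m pr κ) : 1 - specStab m pr κ =
    ∑ j, ((1 / 2 : ℂ) • pr j - (-((1 / 2 : ℂ) * (κ j)⁻¹)) • (pr j * m)) := by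
  refine h.eq_of_mul fun j => ?_
  rw [h.mul_sum_mul (fun _ => 1 / 2) (fun j => -((1 / 2) * (κ j)⁻¹)), mul_sub, mul_one, h.mul_specStab]
  module

/-- Since `b m b = -m`, reflection exchanges the eigenvalues `κ_j` and `-κ_j`. The spectral
projection is therefore already a splitting of the free system, which the polynomial projection
`stab` is not in general. -/
theorem IsChanneled.refl_specStab (h : IsChanneled m pr κ) (hb : b * b = 1) (hm : b * m * b = -m)
    (hpr : ∀ j, b * pr j * b = pr j) : b * specStab m pr κ * b = 1 - specStab m pr κ := by
  rw [h.one_sub_specStab, specStab, Finset.mul_sum, Finset.sum_mul]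
  refine Finset.sum_congr rfl fun j _ => ?_
  have : b * (pr j * m) * b = -(pr j * m) := by
    calc b * (pr j * m) * b = b * pr j * (b * b) * m * b := by rw [hb]; noncomm_ring
      _ = (b * pr j * b) * (b * m * b) := by noncomm_ring
      _ = _ := by rw [hpr, hm, mul_neg]
  rw [mul_sub, sub_mul, mul_smul_comm, smul_mul_assoc, mul_smul_comm, smul_mul_assoc, hpr, this]
  module

/-- The factor `κ_j⁻¹` is harmless when `‖m‖` and `|κ_j|` are comparable, as they are for large
`|Λ|`. -/
theorem norm_sum_smul_sub_le {n B : ℝ} (hn : ∀ j, ‖pr j‖ ≤ n) (hB : ∀ j, ‖m‖ ≤ B * ‖κ j‖)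
    (hκ : ∀ j, κ j ≠ 0) {d : Fin 2 → ℂ} (hd : ∀ j, ‖d j‖ = 1 / 2 * ‖κ j‖⁻¹) :
    ‖∑ j, ((1 / 2 : ℂ) • pr j - d j • (pr j * m))‖ ≤ n * (1 + B) := by
  have key : ∀ j, ‖(1 / 2 : ℂ) • pr j - d j • (pr j * m)‖ ≤ 1 / 2 * (n * (1 + B)) := fun j => by
    have h0 : 0 < ‖κ j‖ := norm_pos_iff.2 (hκ j)
    have hn0 : 0 ≤ n := (norm_nonneg _).trans (hn j)
    refine (norm_sub_le _ _).trans ?_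
    rw [norm_smul, norm_smul, hd]
    calc _ ≤ 1 / 2 * n + 1 / 2 * ‖κ j‖⁻¹ * (n * (B * ‖κ j‖)) := by
          gcongr
          · norm_num
          · exact hn j
          · exact (norm_mul_le _ _).trans (mul_le_mul (hn j) (hB j) (norm_nonneg _) hn0)
      _ = _ := by field_simp
  refine (norm_sum_le _ _).trans ?_
  rw [Fin.sum_univ_two]
  linarith [key 0, key 1]

/-- `(m + θ) Q` and `(m - θ) (1 - Q)` are of the size of `κ_j - θ`. -/
theorem IsStableProj.norm_add_smul_mul_le (h : IsStableProj m pr κ Q) (hc : IsChanneled m pr κ)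
    {θ : ℂ} {c n : ℝ} (hθ : ∀ j, ‖κ j - θ‖ ≤ c) (hn : ∀ j, ‖pr j‖ ≤ n) :
    ‖m * Q + θ • Q‖ ≤ 2 * (n * ‖Q‖) * c ∧ ‖(1 - Q) * m - θ • (1 - Q)‖ ≤ 2 * (n * ‖1 - Q‖) * c := by
  have hs : ∀ s : A, s = pr 0 * s + pr 1 * s := fun s => by rw [← add_mul, hc.sum, one_mul]
  have e1 : m * Q + θ • Q = ∑ j, (-(κ j - θ)) • (pr j * Q) := by
    rw [hs (m * Q + θ • Q), Fin.sum_univ_two, mul_add, mul_add, h.left,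
      h.left, mul_smul_comm, mul_smul_comm]
    module
  have e2 : (1 - Q) * m - θ • (1 - Q) = ∑ j, (κ j - θ) • (pr j * (1 - Q)) := by
    rw [hs ((1 - Q) * m - θ • (1 - Q)), Fin.sum_univ_two, mul_sub, mul_sub,
      h.right, h.right, mul_smul_comm, mul_smul_comm]
    module
  rw [e1, e2]
  exact ⟨norm_sum_exp_smul_le (fun j => by rw [norm_neg]; exact hθ j) fun j => (norm_mul_le _ _).trans
      (mul_le_mul_of_nonneg_right (hn j) (norm_nonneg _)),
    norm_sum_exp_smul_le hθ fun j => (norm_mul_le _ _).trans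
      (mul_le_mul_of_nonneg_right (hn j) (norm_nonneg _))⟩

/-- Stable projections have the same range. -/
theorem IsStableProj.mul_eq (h : IsStableProj m pr κ Q) {Q' : A} (h' : IsStableProj m pr κ Q')
    (hc : IsChanneled m pr κ) (hκ : ∀ j, κ j ≠ 0) : Q * Q' = Q' := by
  -- In the channel `j`, `m` acts as `κ_j` to the right of `1 - Q` and as `-κ_j` on the range of
  -- `Q'`. The two agree on `(1 - Q)Q'` only if it is zero.
  have key : ∀ j, pr j * ((1 - Q) * Q') = 0 := fun j => by
    have hQ : (1 - Q) * pr j = pr j * (1 - Q) := by rw [sub_mul, mul_sub, h.comm, one_mul, mul_one]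
    have e1 : pr j * ((1 - Q) * m * Q') = κ j • (pr j * ((1 - Q) * Q')) := by
      rw [← mul_assoc, h.right, smul_mul_assoc, mul_assoc]
    have e2 : pr j * ((1 - Q) * m * Q') = -(κ j • (pr j * ((1 - Q) * Q'))) := by
      calc pr j * ((1 - Q) * m * Q') = (1 - Q) * (pr j * (m * Q')) := by
            rw [mul_assoc, ← mul_assoc, ← hQ, mul_assoc]
        _ = -(κ j • ((1 - Q) * pr j * Q')) := by
            rw [h'.left, mul_neg, mul_smul_comm, mul_assoc]
        _ = _ := by rw [hQ, mul_assoc]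
    have e3 : (2 * κ j) • (pr j * ((1 - Q) * Q')) = 0 := by
      linear_combination (norm := module) e2 - e1
    exact (smul_eq_zero.1 e3).resolve_left (mul_ne_zero two_ne_zero (hκ j))
  have : (1 - Q) * Q' = 0 := hc.eq_of_mul fun j => by rw [key, mul_zero]
  rw [sub_mul, one_mul, sub_eq_zero] at this
  exact this.symm

theorem IsSplitting.congr {Q' P z y : A} (h : IsSplitting b (z * Q * y) P) (hyz : y * z = 1)
    (h1 : Q * Q' = Q') (h2 : Q' * Q = Q) : IsSplitting b (z * Q' * y) P := by
  have e1 : (z * Q' * y) * (z * Q * y) = z * Q * y := by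
    calc _ = z * Q' * (y * z) * Q * y := by noncomm_ring
      _ = z * (Q' * Q) * y := by rw [hyz]; noncomm_ring
      _ = _ := by rw [h2]
  have e2 : (z * Q * y) * (z * Q' * y) = z * Q' * y := by
    calc _ = z * Q * (y * z) * Q' * y := by noncomm_ring
      _ = z * (Q * Q') * y := by rw [hyz]; noncomm_ring
      _ = _ := by rw [h1]
  refine ⟨?_, ?_, h.refl⟩
  · calc _ = (z * Q' * y) * ((z * Q * y) * P) := by rw [h.left]
      _ = P := by rw [← mul_assoc, e1, h.left]
  · calc _ = P * ((z * Q * y) * (z * Q' * y)) := by rw [e2]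
      _ = _ := by rw [← mul_assoc, h.right, e2]

/-- The operator `S = zQ + b(zQ)b` commutes with `b` and satisfies `SQ = zQ`, so `S Q S⁻¹` is a
splitting as soon as `S` is invertible. The only obstruction is the off-diagonal block `(1 - Q)zQ`:
the candidate inverse `T` obeys `TS = 1 - E`, where `E` consists of four terms of norm at most `N⁴
e`, so `‖E‖ ≤ 1/2`. -/
theorem exists_isSplitting_of_norm_le (hA : ∀ s t : A, s * t = 1 → t * s = 1) {z y : A} {N e : ℝ}
    (hb : b * b = 1) (hQ : Q * Q = Q) (hbQ : b * Q * b = 1 - Q) (hyz : y * z = 1) (hN : 1 ≤ N)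
    (hbN : ‖b‖ ≤ N) (hQN : ‖Q‖ ≤ N) (hzN : ‖z‖ ≤ N) (hyN : ‖y‖ ≤ N) (he : ‖(1 - Q) * z * Q‖ ≤ e)
    (hsmall : 8 * N ^ 4 * e ≤ 1) : ∃ P, IsSplitting b (z * Q * y) P ∧ ‖P‖ ≤ 4 * N ^ 7 := by
  have he0 : 0 ≤ e := (norm_nonneg _).trans he
  have hQb : Q * b = b * (1 - Q) := by
    rw [← hbQ]
    calc Q * b = (b * b) * Q * b := by rw [hb, one_mul]
      _ = _ := by noncomm_ring
  have hbQ' : b * Q = (1 - Q) * b := by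
    rw [← hbQ]
    calc b * Q = b * Q * (b * b) := by rw [hb, mul_one]
      _ = _ := by noncomm_ring
  set S := z * Q + b * (z * Q) * b with hS
  set T := Q * y * Q + b * (Q * y * Q) * b with hT
  set e₁ := (1 - Q) * z * Q with he₁
  set E := Q * y * e₁ + b * (Q * y * e₁) * b - Q * y * (b * e₁ * b) - b * (Q * y * (b * e₁ * b)) * b
    with hE
  have f1 : Q * y * Q * (z * Q) = Q - Q * y * e₁ := by
    have : Q * y * Q * (z * Q) = Q * (y * z) * Q - Q * y * e₁ := by rw [he₁]; noncomm_ring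
    rw [this, hyz, mul_one, hQ]
  have f2 : Q * y * Q * (b * (z * Q) * b) = Q * y * (b * e₁ * b) := by
    calc _ = Q * y * (Q * b) * (z * Q) * b := by noncomm_ring
      _ = _ := by rw [hQb, he₁]; noncomm_ring
  have hTS : T * S = 1 - E := by
    calc T * S = Q * y * Q * (z * Q) + Q * y * Q * (b * (z * Q) * b) +
          b * (Q * y * Q * (b * (z * Q) * b)) * b + b * (Q * y * Q * (z * Q)) * b := by
          have g1 : ∀ s t : A, b * s * b * t = b * (s * (b * t * b)) * b := fun s t => by
            calc b * s * b * t = b * s * b * t * (b * b) := by rw [hb, mul_one]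
              _ = _ := by noncomm_ring
          have g2 : ∀ s t : A, b * s * b * (b * t * b) = b * (s * t) * b := fun s t => by
            calc _ = b * s * (b * b) * t * b := by noncomm_ring
              _ = _ := by rw [hb]; noncomm_ring
          rw [hT, hS, add_mul, mul_add, mul_add, g1, g2]
          abel
      _ = Q + b * Q * b - E := by
          rw [f1, f2, hE]
          noncomm_ring
      _ = 1 - E := by rw [hbQ]; noncomm_ring
  have hN0 : 0 ≤ N := by linarith
  have hbb : ∀ s : A, ‖b * s * b‖ ≤ N ^ 2 * ‖s‖ := fun s => by
    calc _ ≤ ‖b‖ * ‖s‖ * ‖b‖ := norm_mul₃_le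
      _ ≤ N * ‖s‖ * N := by gcongr
      _ = _ := by ring
  have hQy : ∀ s : A, ‖Q * y * s‖ ≤ N ^ 2 * ‖s‖ := fun s => by
    calc _ ≤ ‖Q‖ * ‖y‖ * ‖s‖ := norm_mul₃_le
      _ ≤ N * N * ‖s‖ := by gcongr
      _ = _ := by ring
  have hN2 : 1 ≤ N ^ 2 := one_le_pow₀ hN
  have n1 : ‖Q * y * e₁‖ ≤ N ^ 2 * e := (hQy e₁).trans (by gcongr)
  have n2 : ‖Q * y * (b * e₁ * b)‖ ≤ N ^ 2 * (N ^ 2 * e) :=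
    (hQy _).trans (by gcongr; exact (hbb e₁).trans (by gcongr))
  have hEn : ‖E‖ ≤ 1 / 2 := by
    have hz : e₁ * Q = e₁ := by rw [he₁, mul_assoc, hQ]
    have n3 := (hbb (Q * y * e₁)).trans (mul_le_mul_of_nonneg_left n1 (sq_nonneg N))
    have n4 : ‖b * (Q * y * (b * e₁ * b)) * b‖ ≤ N ^ 4 * e := by
      have : b * (Q * y * (b * e₁ * b)) * b = b * Q * y * b * e₁ := by
        calc _ = b * Q * y * b * e₁ * (b * b) := by noncomm_ring
          _ = _ := by rw [hb, mul_one]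
      rw [this]
      calc _ ≤ ‖b * Q‖ * ‖y * b‖ * ‖e₁‖ := by
            rw [show b * Q * y * b * e₁ = (b * Q) * (y * b) * e₁ by noncomm_ring]
            exact norm_mul₃_le
        _ ≤ (N * N) * (N * N) * e := by
            gcongr
            · exact (norm_mul_le _ _).trans (by gcongr)
            · exact (norm_mul_le _ _).trans (by gcongr)
        _ = _ := by ring
    have n5 : ‖E‖ ≤ ‖Q * y * e₁‖ + ‖b * (Q * y * e₁) * b‖ + ‖Q * y * (b * e₁ * b)‖ +
        ‖b * (Q * y * (b * e₁ * b)) * b‖ := by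
      rw [hE]
      exact (norm_sub_le _ _).trans (add_le_add ((norm_sub_le _ _).trans
        (add_le_add (norm_add_le _ _) le_rfl)) le_rfl)
    have n6 : N ^ 2 * e ≤ N ^ 4 * e := by
      exact mul_le_mul_of_nonneg_right (pow_le_pow_right₀ hN (by norm_num)) he0
    nlinarith
  have hu : IsUnit (1 - E) := isUnit_one_sub_of_norm_lt_one (by linarith)
  obtain ⟨I, hIS⟩ : ∃ I, I * S = 1 := by
    obtain ⟨w, hw⟩ := hu
    exact ⟨↑w⁻¹ * T, by rw [mul_assoc, hTS, ← hw, w.inv_mul]⟩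
  have hSI := hA _ _ hIS
  -- From `I = T + E I` and `‖E‖ ≤ 1/2`.
  have hIn : ‖I‖ ≤ 2 * ‖T‖ := by
    have h1 : I = T + E * I := by
      calc I = (1 - E) * I + E * I := by noncomm_ring
        _ = T + E * I := by rw [← hTS, mul_assoc, hSI, mul_one]
    have h2 : ‖I‖ ≤ ‖T‖ + ‖E‖ * ‖I‖ := by
      calc ‖I‖ = ‖T + E * I‖ := by rw [← h1]
        _ ≤ _ := (norm_add_le _ _).trans (add_le_add le_rfl (norm_mul_le _ _))
    nlinarith [norm_nonneg I]
  have hTn : ‖T‖ ≤ 2 * N ^ 5 := by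
    have h1 : ‖Q * y * Q‖ ≤ N ^ 3 := (hQy Q).trans (by nlinarith)
    have h2 := (hbb (Q * y * Q)).trans (mul_le_mul_of_nonneg_left h1 (sq_nonneg N))
    have h3 : N ^ 3 ≤ N ^ 5 := pow_le_pow_right₀ hN (by norm_num)
    have h4 := norm_add_le (Q * y * Q) (b * (Q * y * Q) * b)
    rw [hT]
    nlinarith
  have hSQ : S * Q = z * Q := by
    calc S * Q = z * (Q * Q) + b * z * (Q * b) * Q := by rw [hS]; noncomm_ring
      _ = z * (Q * Q) + b * z * b * (Q - Q * Q) := by rw [hQb]; noncomm_ring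
      _ = _ := by rw [hQ]; noncomm_ring
  have hbS : b * S = S * b := by
    calc b * S = b * (z * Q) + (b * b) * (z * Q) * b := by rw [hS]; noncomm_ring
      _ = b * (z * Q) * (b * b) + z * Q * b := by rw [hb]; noncomm_ring
      _ = _ := by rw [hS]; noncomm_ring
  have hIb : I * b = b * I := by
    calc I * b = I * (b * S) * I := by rw [mul_assoc, mul_assoc, hSI, mul_one]
      _ = (I * S) * b * I := by rw [hbS]; noncomm_ring
      _ = _ := by rw [hIS, one_mul]
  refine ⟨z * Q * I, ⟨?_, ?_, ?_⟩, ?_⟩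
  · calc _ = z * Q * (y * z) * Q * I := by noncomm_ring
      _ = z * (Q * Q) * I := by rw [hyz]; noncomm_ring
      _ = _ := by rw [hQ]
  · calc _ = z * Q * I * (S * Q) * y := by rw [hSQ]; noncomm_ring
      _ = z * Q * (I * S) * Q * y := by noncomm_ring
      _ = z * (Q * Q) * y := by rw [hIS]; noncomm_ring
      _ = _ := by rw [hQ]
  · calc _ = (b * S) * Q * (I * b) := by rw [← hSQ]; noncomm_ring
      _ = S * (b * Q * b) * I := by rw [hbS, hIb]; noncomm_ring
      _ = S * I - S * Q * I := by rw [hbQ]; noncomm_ring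
      _ = _ := by rw [hSI, hSQ]
  · calc ‖z * Q * I‖ ≤ ‖z‖ * ‖Q‖ * ‖I‖ := norm_mul₃_le
      _ ≤ N * N * (2 * (2 * N ^ 5)) := by
          gcongr
          exact hIn.trans (by gcongr)
      _ = _ := by ring

end

end GN

namespace GN

/-! ### The off-diagonal part of a conjugation for large frequencies -/

/-- Grönwall's inequality run backwards from a point `T` where `‖w‖ ≤ ε`. The comparison function
has a strictly larger derivative than allowed, which is what the boundary form of the inequality
requires. -/
theorem norm_le_of_norm_deriv_le {E : Type*} [NormedAddCommGroup E] [NormedSpace ℝ E]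
    {w w' : ℝ → E} {a c ε : ℝ} (ha : 0 < a) (hc : 0 < c) (hε : 0 < ε)
    (hw : ∀ x, 0 ≤ x → HasDerivAt w (w' x) x)
    (hb : ∀ x, 0 ≤ x → ‖w' x‖ ≤ c * Real.exp (-a * x) * (ε + ‖w x‖))
    (hlim : Tendsto w atTop (𝓝 0)) : ‖w 0‖ ≤ 2 * ε * Real.exp (2 * c / a) := by
  obtain ⟨T, hT0, hT⟩ : ∃ T, 0 ≤ T ∧ ‖w T‖ ≤ ε := by
    have h := (tendsto_zero_iff_norm_tendsto_zero.1 hlim).eventually (Iio_mem_nhds hε)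
    obtain ⟨T, hT, hT'⟩ := (h.and (eventually_ge_atTop 0)).exists
    exact ⟨T, hT', le_of_lt hT⟩
  have hd : ∀ t, HasDerivAt (fun t => 2 * ε * Real.exp (2 * c / a * Real.exp (-a * (T - t))) - ε)
      (2 * c * Real.exp (-a * (T - t)) *
        (2 * ε * Real.exp (2 * c / a * Real.exp (-a * (T - t))))) t := by
    intro t
    have h1 : HasDerivAt (fun t => -a * (T - t)) a t := by
      simpa using ((hasDerivAt_id t).const_sub T).const_mul (-a)
    refine (((h1.exp.const_mul (2 * c / a)).exp.const_mul (2 * ε)).sub_const ε).congr_deriv ?_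
    field_simp
  have key := image_norm_le_of_norm_deriv_right_lt_deriv_boundary (f := fun t => w (T - t))
    (f' := fun t => -w' (T - t)) (a := 0) (b := T)
    (fun t ht => ((hw (T - t) (by linarith [ht.2])).comp_const_sub T t).continuousAt.continuousWithinAt)
    (fun t ht => ((hw (T - t) (by linarith [ht.2])).comp_const_sub T t).hasDerivWithinAt)
    (by
      have := Real.one_le_exp (x := 2 * c / a * Real.exp (-a * (T - 0))) (by positivity)
      have h2 := mul_le_mul_of_nonneg_left this (by positivity : 0 ≤ 2 * ε)
      simp only [sub_zero] at h2 ⊢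
      linarith)
    hd
    (by
      intro t ht heq
      rw [norm_neg]
      refine (hb _ (by linarith [ht.2])).trans_lt ?_
      rw [heq, add_sub_cancel, mul_assoc c, mul_assoc (2 * c), mul_assoc 2 c]
      have : 0 < c * (Real.exp (-a * (T - t)) *
        (2 * ε * Real.exp (2 * c / a * Real.exp (-a * (T - t))))) := by positivity
      linarith) (right_mem_Icc.2 hT0)
  simp only [sub_self, mul_zero, Real.exp_zero, mul_one] at key
  linarith

section

set_option linter.unusedSectionVars false

/-- A normal-form identity. The off-diagonal block `X = (1 - Q)ZQ` is driven by `F = (1 - Q)P(QZQ)`.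
Up to the errors `α₁`, `α₂` one has `mF - Fm = 2θF`, so adding `(2θ)⁻¹ F` to `X` absorbs the source;
what remains is linear in `X` or carries the factor `(2θ)⁻¹`. -/
theorem twisted_deriv_eq {A : Type*} [Ring A] [Algebra ℂ A] {m Q P P' Z α₁ α₂ : A} {θ : ℂ}
    (hθ : θ ≠ 0) (hQm : Q * m = m * Q) (h₁ : m * Q + θ • Q = α₁)
    (h₂ : (1 - Q) * m - θ • (1 - Q) = α₂) :
    (1 - Q) * ((m + P) * Z - Z * m) * Q + (2 * θ)⁻¹ • ((1 - Q) * P' * (Q * Z * Q) +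
        (1 - Q) * P * (Q * ((m + P) * Z - Z * m) * Q)) =
      (m * ((1 - Q) * Z * Q + (2 * θ)⁻¹ • ((1 - Q) * P * (Q * Z * Q))) -
        ((1 - Q) * Z * Q + (2 * θ)⁻¹ • ((1 - Q) * P * (Q * Z * Q))) * m) +
      ((1 - Q) * P * ((1 - Q) * Z * Q) + (2 * θ)⁻¹ • ((1 - Q) * P' * (Q * Z * Q) -
        α₂ * P * (Q * Z * Q) + (1 - Q) * P * (Q * Z * α₁) +
        (1 - Q) * P * (α₁ * (Z * Q) - Q * Z * α₁ + Q * P * (Z * Q)))) := by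
  have hR : m * (1 - Q) = (1 - Q) * m := by rw [mul_sub, sub_mul, hQm]; simp
  have hmQ : m * Q = α₁ - θ • Q := by rw [← h₁]; abel
  have hRm : (1 - Q) * m = α₂ + θ • (1 - Q) := by rw [← h₂]; abel
  have hX : (1 - Q) * ((m + P) * Z - Z * m) * Q = m * ((1 - Q) * Z * Q) - (1 - Q) * Z * Q * m +
      ((1 - Q) * P * (Q * Z * Q) + (1 - Q) * P * ((1 - Q) * Z * Q)) := by
    have e1 : (1 - Q) * ((m + P) * Z - Z * m) * Q = ((1 - Q) * m) * Z * Q + (1 - Q) * P * Z * Q -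
      (1 - Q) * Z * (m * Q) := by noncomm_ring
    rw [e1, ← hR, ← hQm]
    noncomm_ring
  have hT : Q * ((m + P) * Z - Z * m) * Q = α₁ * (Z * Q) - Q * Z * α₁ + Q * P * (Z * Q) := by
    have e1 : Q * ((m + P) * Z - Z * m) * Q = (Q * m) * (Z * Q) + Q * P * (Z * Q) -
      Q * Z * (m * Q) := by noncomm_ring
    rw [e1, hQm, hmQ, sub_mul, mul_sub, smul_mul_assoc, mul_smul_comm]
    simp only [mul_assoc]
    abel
  have hmG : m * ((1 - Q) * P * (Q * Z * Q)) = α₂ * P * (Q * Z * Q) +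
      θ • ((1 - Q) * P * (Q * Z * Q)) := by
    have e1 : m * ((1 - Q) * P * (Q * Z * Q)) = (m * (1 - Q)) * P * (Q * Z * Q) := by noncomm_ring
    rw [e1, hR, hRm, add_mul, add_mul, smul_mul_assoc, smul_mul_assoc]
  have hGm : (1 - Q) * P * (Q * Z * Q) * m = (1 - Q) * P * (Q * Z * α₁) -
      θ • ((1 - Q) * P * (Q * Z * Q)) := by
    have e1 : (1 - Q) * P * (Q * Z * Q) * m = (1 - Q) * P * (Q * Z * (Q * m)) := by noncomm_ring
    rw [e1, hQm, hmQ, mul_sub, mul_sub, mul_smul_comm, mul_smul_comm]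
  have hτ : (2 * θ)⁻¹ * (2 * θ) = 1 := inv_mul_cancel₀ (by simpa using hθ)
  rw [hX, hT, mul_add m ((1 - Q) * Z * Q), add_mul ((1 - Q) * Z * Q), mul_smul_comm,
    smul_mul_assoc, hmG, hGm]
  generalize (1 - Q) * P * (Q * Z * Q) = G at *
  linear_combination (norm := module) (-hτ) • G

/-- The off-diagonal part of the conjugation is small when the two parts of the free system
oscillate against each other with the large frequency `2θ`. -/
theorem IsConjugation.norm_offDiag_le {A : Type*} [NormedRing A] [NormedAlgebra ℂ A]
    [CompleteSpace A] [NormOneClass A] {m Q : A} {P P' Z Y U : ℝ → A} {K N C D c a γ : ℝ} {θ : ℂ}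
    (hZ : IsConjugation m P Z Y N D γ) (hU : IsFlowGroup m U K 0) (ha : 0 < a) (hγ : 0 < γ)
    (hC : 0 < C) (hN : 1 ≤ N) (hc : 0 ≤ c) (hθ : θ ≠ 0) (hQ : Q * Q = Q) (hQm : Q * m = m * Q)
    (hQN : ‖Q‖ ≤ N) (hRN : ‖1 - Q‖ ≤ N) (h₁ : ‖m * Q + θ • Q‖ ≤ c)
    (h₂ : ‖(1 - Q) * m - θ • (1 - Q)‖ ≤ c) (hP : ∀ x, HasDerivAt P (P' x) x)
    (hPC : ∀ x, 0 ≤ x → ‖P x‖ ≤ C * Real.exp (-a * x))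
    (hPC' : ∀ x, 0 ≤ x → ‖P' x‖ ≤ C * Real.exp (-a * x)) :
    ‖(1 - Q) * Z 0 * Q‖ ≤
      3 * (N ^ 4 * (2 * N * C + 1 + 4 * c)) * Real.exp (2 * (K ^ 4 * C * N) / a) * ‖(2 * θ)⁻¹‖ := by
  set τ := (2 * θ)⁻¹ with hτ
  have hτ0 : 0 < ‖τ‖ := norm_pos_iff.2 (inv_ne_zero (by simpa using hθ))
  have hK : 1 ≤ K := by simpa [hU.zero] using hU.bound 0
  have hUK : ∀ x, ‖U x‖ ≤ K := fun x => by simpa using hU.bound x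
  have hN0 : 0 ≤ N := by linarith
  have h3 : ∀ x y z : A, ‖x * y * z‖ ≤ ‖x‖ * ‖y‖ * ‖z‖ := fun x y z =>
    (norm_mul_le _ _).trans (by gcongr; exact norm_mul_le _ _)
  have he1 : ∀ x, 0 ≤ x → Real.exp (-a * x) ≤ 1 := fun x hx => by
    rw [Real.exp_le_one_iff]; nlinarith
  set X : ℝ → A := fun x => (1 - Q) * Z x * Q with hX
  set F : ℝ → A := fun x => (1 - Q) * P x * (Q * Z x * Q) with hF
  set H : ℝ → A := fun x => (1 - Q) * P x * X x + τ • ((1 - Q) * P' x * (Q * Z x * Q) -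
        (((1 - Q) * m - θ • (1 - Q))) * P x * (Q * Z x * Q) +
        (1 - Q) * P x * (Q * Z x * (m * Q + θ • Q)) +
        (1 - Q) * P x * ((m * Q + θ • Q) * (Z x * Q) - Q * Z x * (m * Q + θ • Q) +
          Q * P x * (Z x * Q))) with hH
  have hV : ∀ x, 0 ≤ x → HasDerivAt (fun x => X x + τ • F x)
      ((m * (X x + τ • F x) - (X x + τ • F x) * m) + H x) x := by
    intro x hx
    have hz := hZ.deriv_Z x hx
    have hT := (hz.const_mul Q).mul_const Q
    have h := ((hz.const_mul (1 - Q)).mul_const Q).add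
      ((((hP x).const_mul (1 - Q)).mul hT).const_smul τ)
    refine h.congr_deriv ?_
    exact twisted_deriv_eq hθ hQm rfl rfl
  have hFb : ∀ x, 0 ≤ x → ‖F x‖ ≤ N ^ 4 * C * Real.exp (-a * x) := by
    intro x hx
    calc ‖F x‖ ≤ ‖1 - Q‖ * ‖P x‖ * (‖Q‖ * ‖Z x‖ * ‖Q‖) :=
          (h3 _ _ _).trans (by gcongr; exact h3 _ _ _)
      _ ≤ N * (C * Real.exp (-a * x)) * (N * N * N) := by
          gcongr
          exacts [hPC x hx, hZ.norm_Z x hx]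
      _ = _ := by ring
  have hHb : ∀ x, 0 ≤ x → ‖H x‖ ≤ C * N * Real.exp (-a * x) *
      (‖X x‖ + ‖τ‖ * (N ^ 3 * (1 + 4 * c + N * C))) := by
    intro x hx
    have hZx := hZ.norm_Z x hx
    have hPx := hPC x hx
    have hPx' := hPC' x hx
    set e := Real.exp (-a * x) with he
    have hP1 : ‖P x‖ ≤ C := hPx.trans (mul_le_of_le_one_right hC.le (he1 x hx))
    have b0 : ‖(1 - Q) * P x * X x‖ ≤ N * (C * e) * ‖X x‖ :=
      (h3 _ _ _).trans (by gcongr)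
    have b1 : ‖(1 - Q) * P' x * (Q * Z x * Q)‖ ≤ N * (C * e) * (N * N * N) :=
      (h3 _ _ _).trans (by gcongr; exact (h3 _ _ _).trans (by gcongr))
    have b2 : ‖((1 - Q) * m - θ • (1 - Q)) * P x * (Q * Z x * Q)‖ ≤ c * (C * e) * (N * N * N) :=
      (h3 _ _ _).trans (by gcongr; exact (h3 _ _ _).trans (by gcongr))
    have b3 : ‖Q * Z x * (m * Q + θ • Q)‖ ≤ N * N * c := (h3 _ _ _).trans (by gcongr)
    have b4 : ‖(1 - Q) * P x * (Q * Z x * (m * Q + θ • Q))‖ ≤ N * (C * e) * (N * N * c) :=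
      (h3 _ _ _).trans (by gcongr)
    have b5 : ‖(m * Q + θ • Q) * (Z x * Q)‖ ≤ c * (N * N) :=
      (norm_mul_le _ _).trans (by gcongr; exact (norm_mul_le _ _).trans (by gcongr))
    have b6 : ‖Q * P x * (Z x * Q)‖ ≤ N * C * (N * N) :=
      (h3 _ _ _).trans (by gcongr; exact (norm_mul_le _ _).trans (by gcongr))
    have b7 : ‖(1 - Q) * P x * ((m * Q + θ • Q) * (Z x * Q) - Q * Z x * (m * Q + θ • Q) +
          Q * P x * (Z x * Q))‖ ≤ N * (C * e) * (c * (N * N) + N * N * c + N * C * (N * N)) := by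
      refine (h3 _ _ _).trans ?_
      gcongr
      exact (norm_add_le _ _).trans (add_le_add ((norm_sub_le _ _).trans (add_le_add b5 b3)) b6)
    have hb := (norm_add_le _ _).trans (add_le_add ((norm_add_le _ _).trans (add_le_add
      ((norm_sub_le _ _).trans (add_le_add b1 b2)) b4)) b7)
    have hb' := (norm_add_le _ _).trans (add_le_add b0 ((norm_smul_le τ _).trans
      (mul_le_mul_of_nonneg_left hb (norm_nonneg τ))))
    refine hb'.trans ?_
    have hce : 0 ≤ ‖τ‖ * C * e * (4 * c * N ^ 3 + C * N ^ 4) * (N - 1) :=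
      mul_nonneg (by positivity) (by linarith)
    linarith
  set ε := ‖τ‖ * (N ^ 4 * (2 * N * C + 1 + 4 * c)) with hε
  have hε0 : 0 < ε := by positivity
  have hsum : N ^ 4 * C + N ^ 3 * (1 + 4 * c + N * C) ≤ N ^ 4 * (2 * N * C + 1 + 4 * c) := by
    have e1 : 0 ≤ N ^ 3 * (1 + 4 * c) * (N - 1) := mul_nonneg (by positivity) (by linarith)
    have e2 : 0 ≤ 2 * (N ^ 4 * C) * (N - 1) := mul_nonneg (by positivity) (by linarith)
    linarith
  have hVX : ∀ x, 0 ≤ x → ‖X x‖ ≤ ‖X x + τ • F x‖ + ‖τ‖ * (N ^ 4 * C) := by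
    intro x hx
    calc ‖X x‖ = ‖(X x + τ • F x) - τ • F x‖ := by simp
      _ ≤ _ := (norm_sub_le _ _).trans (by
          rw [norm_smul τ]
          gcongr
          exact (hFb x hx).trans (mul_le_of_le_one_right (by positivity) (he1 x hx)))
  -- Conjugation by the flow, which is bounded since `ρ = 0`, removes the commutator with `m` and
  -- leaves a quantity to which the backward Grönwall bound applies.
  have hWd : ∀ x, 0 ≤ x → HasDerivAt (fun x => U (-x) * (X x + τ • F x) * U x)
      (U (-x) * H x * U x) x := by
    intro x hx
    refine (((hU.deriv_neg x).mul (hV x hx)).mul (hU.deriv x)).congr_deriv ?_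
    simp only [Pi.mul_apply]
    generalize X x + τ • F x = V
    noncomm_ring
  have hVW : ∀ x, ‖X x + τ • F x‖ ≤ K ^ 2 * ‖U (-x) * (X x + τ • F x) * U x‖ := by
    intro x
    have e : X x + τ • F x = U x * (U (-x) * (X x + τ • F x) * U x) * U (-x) := by
      generalize X x + τ • F x = V
      calc V = (U x * U (-x)) * V * (U x * U (-x)) := by rw [hU.mul_neg]; simp
        _ = _ := by noncomm_ring
    calc ‖X x + τ • F x‖ ≤ ‖U x‖ * ‖U (-x) * (X x + τ • F x) * U x‖ * ‖U (-x)‖ := by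
          conv_lhs => rw [e]
          exact h3 _ _ _
      _ ≤ K * ‖U (-x) * (X x + τ • F x) * U x‖ * K := by gcongr <;> exact hUK _
      _ = _ := by ring
  have hW := norm_le_of_norm_deriv_le (a := a) (c := K ^ 4 * C * N) (ε := ε) ha (by positivity)
    hε0 hWd ?_ ?_
  · rw [neg_zero, hU.zero, one_mul, mul_one] at hW
    have h1 := hVX 0 le_rfl
    have h2 : ‖τ‖ * (N ^ 4 * C) ≤ ε := by
      have : 0 ≤ N ^ 3 * (1 + 4 * c + N * C) := by positivity
      exact mul_le_mul_of_nonneg_left (by linarith) (norm_nonneg τ)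
    have h4 : 1 ≤ Real.exp (2 * (K ^ 4 * C * N) / a) := Real.one_le_exp (by positivity)
    have h5 : ε * 1 ≤ ε * Real.exp (2 * (K ^ 4 * C * N) / a) := by gcongr
    refine h1.trans ?_
    calc _ ≤ 3 * (ε * Real.exp (2 * (K ^ 4 * C * N) / a)) := by linarith
      _ = _ := by rw [hε]; ring
  · intro x hx
    calc ‖U (-x) * H x * U x‖ ≤ ‖U (-x)‖ * ‖H x‖ * ‖U x‖ := h3 _ _ _
      _ ≤ K * (C * N * Real.exp (-a * x) *
          (‖X x‖ + ‖τ‖ * (N ^ 3 * (1 + 4 * c + N * C)))) * K := by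
          gcongr
          exacts [hUK _, hHb x hx, hUK _]
      _ ≤ K * (C * N * Real.exp (-a * x) *
          (K ^ 2 * (ε + ‖U (-x) * (X x + τ • F x) * U x‖))) * K := by
          have e1 := (hVX x hx).trans (add_le_add_left (hVW x) _)
          have e2 : ‖τ‖ * (N ^ 4 * C) + ‖τ‖ * (N ^ 3 * (1 + 4 * c + N * C)) ≤ ε := by
            rw [hε, ← mul_add]; gcongr
          have e3 : ε ≤ K ^ 2 * ε := le_mul_of_one_le_left hε0.le (one_le_pow₀ hK)
          gcongr
          linarith
      _ = _ := by ring
  -- `X` tends to zero because `(1 - Q) · 1 · Q = 0` and `Z → 1`; `F` does because the potential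
  -- decays.
  · have hXl : Tendsto (fun x => X x + τ • F x) atTop (𝓝 0) := by
      have hexp : ∀ g : ℝ, 0 < g → Tendsto (fun x : ℝ => Real.exp (-g * x)) atTop (𝓝 0) :=
        fun g hg => Real.tendsto_exp_atBot.comp
          (tendsto_id.const_mul_atTop_of_neg (by linarith))
      have t1 : Tendsto X atTop (𝓝 0) := by
        refine squeeze_zero_norm' (a := fun x => N * (D * Real.exp (-γ * x)) * N) ?_ (by
          simpa using (((hexp γ hγ).const_mul D).const_mul N).mul_const N)
        filter_upwards [eventually_ge_atTop 0] with x hx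
        have e : X x = (1 - Q) * (Z x - 1) * Q := by
          have : (1 - Q) * Q = 0 := by rw [sub_mul, hQ]; simp
          rw [mul_sub, sub_mul, mul_one, this, sub_zero]
        rw [e]
        have hD : 0 ≤ D * Real.exp (-γ * x) := (norm_nonneg _).trans (hZ.norm_Z_sub x hx)
        exact (h3 _ _ _).trans (mul_le_mul (mul_le_mul hRN (hZ.norm_Z_sub x hx) (norm_nonneg _)
          hN0) hQN (norm_nonneg _) (mul_nonneg hN0 hD))
      have t2 : Tendsto F atTop (𝓝 0) := by
        refine squeeze_zero_norm' ((eventually_ge_atTop 0).mono hFb) ?_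
        simpa using (hexp a ha).const_mul (N ^ 4 * C)
      simpa using t1.add (t2.const_smul τ)
    refine squeeze_zero_norm (a := fun x => K * ‖X x + τ • F x‖ * K) (fun x => ?_) (by
      simpa using (hXl.norm.const_mul K).mul_const K)
    exact (h3 _ _ _).trans (by gcongr <;> exact hUK _)

end

end GN

namespace GN

/-! ### The derivative of the potential -/

variable {f : ℝ → ℝ} {k : ℕ} {a b ω : ℝ} {v u : ℝ → ℝ → ℝ}

theorem contDiff_op_pot (hf : ContDiff ℝ (⊤ : ℕ∞) f) :
    ContDiff ℝ 1 fun q : ℝ × ℝ => op (matα * matJ * pot f q.1 q.2) := by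
  have hs : ContDiff ℝ 1 fun q : ℝ × ℝ => q.1 ^ 2 - q.2 ^ 2 := by fun_prop
  have h1 : ContDiff ℝ 1 fun q : ℝ × ℝ => f (q.1 ^ 2 - q.2 ^ 2) :=
    (hf.of_le (by exact_mod_cast le_top)).comp hs
  have h2 : ContDiff ℝ 1 fun q : ℝ × ℝ => deriv f (q.1 ^ 2 - q.2 ^ 2) :=
    ((contDiff_infty_iff_deriv.1 hf).2.of_le (by exact_mod_cast le_top)).comp hs
  have key : ∀ g : ℝ × ℝ → ℝ, ContDiff ℝ 1 g → ContDiff ℝ 1 fun q => (g q : ℂ) := fun g hg =>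
    Complex.ofRealCLM.contDiff.comp hg
  have hent : ∀ i j, ContDiff ℝ 1 fun q : ℝ × ℝ => pot f q.1 q.2 i j := by
    intro i j
    have c1 := key _ (h1.neg.sub (((contDiff_const (c := (2 : ℝ))).mul h2).mul (contDiff_fst.pow 2)))
    have c2 := key _ (((contDiff_const (c := (2 : ℝ))).mul h2).mul (contDiff_fst.mul contDiff_snd))
    have c3 := key _ (h1.sub (((contDiff_const (c := (2 : ℝ))).mul h2).mul (contDiff_snd.pow 2)))
    simp only [pot_eq]
    fin_cases i <;> fin_cases j <;>
      first
      | exact contDiff_const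
      | exact c1
      | exact c2
      | exact c3
      | exact key _ h1.neg
      | exact key _ h1
  have e : (fun q : ℝ × ℝ => op (matα * matJ * pot f q.1 q.2)) = fun q =>
      op (matα * matJ) * ∑ i, ∑ j, pot f q.1 q.2 i j • op (Matrix.single i j 1) := by
    funext q
    rw [map_mul]
    congr 1
    conv_lhs => rw [Matrix.matrix_eq_sum_single (pot f q.1 q.2)]
    simp only [map_sum, ← map_smul, Matrix.smul_single, smul_eq_mul, mul_one]
  rw [e]
  exact contDiff_const.mul (ContDiff.sum fun i _ => ContDiff.sum fun j _ =>
    (hent i j).smul contDiff_const)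

/-- By the equations, `v'` and `u'` are bounded multiples of `u` and `v`. The chain rule thus gives
decay at the rate `δ` of the profile itself, less than that of the potential but enough for the
normal form. -/
theorem exists_hasDerivAt_comp {E : Type*} [NormedAddCommGroup E] [NormedSpace ℝ E] {Ψ : ℝ × ℝ → E}
    (hΨ : ContDiff ℝ 1 Ψ) {c₁ c₂ : ℝ × ℝ → ℝ} (hc₁ : Continuous c₁) (hc₂ : Continuous c₂)
    {v u : ℝ → ℝ} (hv : ∀ x, HasDerivAt v (c₁ (v x, u x) * u x) x)
    (hu : ∀ x, HasDerivAt u (c₂ (v x, u x) * v x) x) {C δ : ℝ} (hC : 0 ≤ C) (hδ : 0 ≤ δ)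
    (hn : ∀ x, v x ^ 2 + u x ^ 2 ≤ C * Real.exp (-(2 * δ * |x|))) :
    ∃ (B : ℝ) (P' : ℝ → E), 0 ≤ B ∧ (∀ x, HasDerivAt (fun x => Ψ (v x, u x)) (P' x) x) ∧
      ∀ x, ‖P' x‖ ≤ B * Real.exp (-(δ * |x|)) := by
  have hcont : Continuous fun q => ‖fderiv ℝ Ψ q‖ * (|c₁ q| + |c₂ q|) :=
    (hΨ.continuous_fderiv one_ne_zero).norm.mul (hc₁.abs.add hc₂.abs)
  obtain ⟨B, hB⟩ := (isCompact_closedBall (0 : ℝ × ℝ) (Real.sqrt C)).exists_bound_of_continuousOn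
    hcont.continuousOn
  have hB0 : 0 ≤ B := (norm_nonneg _).trans (hB 0 (by simp))
  refine ⟨B * Real.sqrt C, fun x => fderiv ℝ Ψ (v x, u x)
      (c₁ (v x, u x) * u x, c₂ (v x, u x) * v x), by positivity, fun x => ?_, fun x => ?_⟩
  · exact ((hΨ.differentiable one_ne_zero).differentiableAt.hasFDerivAt).comp_hasDerivAt x
      ((hv x).prodMk (hu x))
  · have hs : Real.sqrt (v x ^ 2 + u x ^ 2) ≤ Real.sqrt C * Real.exp (-(δ * |x|)) := by
      refine (Real.sqrt_le_sqrt (hn x)).trans (le_of_eq ?_)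
      rw [Real.sqrt_mul hC, show -(2 * δ * |x|) = -(δ * |x|) + -(δ * |x|) by ring,
        Real.exp_add, Real.sqrt_mul_self (Real.exp_pos _).le]
    have hv' : |v x| ≤ Real.sqrt C * Real.exp (-(δ * |x|)) :=
      (Real.abs_le_sqrt (by linarith [sq_nonneg (u x)])).trans hs
    have hu' : |u x| ≤ Real.sqrt C * Real.exp (-(δ * |x|)) :=
      (Real.abs_le_sqrt (by linarith [sq_nonneg (v x)])).trans hs
    have he : Real.sqrt C * Real.exp (-(δ * |x|)) ≤ Real.sqrt C :=
      mul_le_of_le_one_right (Real.sqrt_nonneg _) (Real.exp_le_one_iff.2 (by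
        rw [neg_nonpos]; positivity))
    have hb := hB (v x, u x) (by
      rw [mem_closedBall_zero_iff, Prod.norm_def]
      exact max_le (hv'.trans he) (hu'.trans he))
    rw [Real.norm_of_nonneg (by positivity)] at hb
    have hm : ‖(c₁ (v x, u x) * u x, c₂ (v x, u x) * v x)‖ ≤
        (|c₁ (v x, u x)| + |c₂ (v x, u x)|) * (Real.sqrt C * Real.exp (-(δ * |x|))) := by
      rw [Prod.norm_def]
      simp only [Real.norm_eq_abs, abs_mul]
      exact max_le (mul_le_mul (le_add_of_nonneg_right (abs_nonneg _)) hu' (abs_nonneg _)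
        (by positivity)) (mul_le_mul (le_add_of_nonneg_left (abs_nonneg _)) hv' (abs_nonneg _)
        (by positivity))
    refine (ContinuousLinearMap.le_opNorm _ _).trans
      ((mul_le_mul_of_nonneg_left hm (norm_nonneg _)).trans ?_)
    rw [← mul_assoc, mul_assoc B]
    exact mul_le_mul_of_nonneg_right hb (by positivity)

/-- The potential has an exponentially decaying derivative. -/
theorem IsSetting.exists_hasDerivAt_potOp (h : IsSetting f k a b v u) (hω : ω ∈ Ioo a b) :
    ∃ (C : ℝ) (P' : ℝ → Op), 0 < C ∧ (∀ x, HasDerivAt (potOp f v u ω) (P' x) x) ∧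
      (∀ x, ‖potOp f v u ω x‖ ≤ C * Real.exp (-(2 * k * dl ω * |x|))) ∧
      ∀ x, ‖P' x‖ ≤ C * Real.exp (-(dl ω * |x|)) := by
  have hP := h.family.isProfile hω
  have hfc := h.smooth.continuous
  obtain ⟨C₁, hC₁, h1⟩ := h.family.eventually_sq_add_sq_le h.left h.right h.smooth h.two_le h.flat hω
  obtain ⟨C₂, hC₂, h2⟩ := h.family.eventually_norm_potOp_le h.left h.right h.smooth h.two_le h.flat hω
  obtain ⟨B, P', hB, hd, hb⟩ := exists_hasDerivAt_comp (contDiff_op_pot h.smooth)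
    (c₁ := fun q => -(1 + ω) + f (q.1 ^ 2 - q.2 ^ 2)) (c₂ := fun q => ω - 1 + f (q.1 ^ 2 - q.2 ^ 2))
    (by fun_prop) (by fun_prop) hP.deriv_v hP.deriv_u hC₁ (dl_nonneg ω) h1.self_of_nhds.2
  exact ⟨C₂ + B, P', by positivity, hd,
    fun x => (h2.self_of_nhds.2 x).trans (by gcongr; linarith),
    fun x => (hb x).trans (by gcongr; linarith)⟩

end GN

namespace GN

/-! ### Large spectral parameters -/

section

variable {f : ℝ → ℝ} {k : ℕ} {a b ω Λ N D : ℝ} {v u : ℝ → ℝ → ℝ} {σ : Side} {Z Y : ℝ → Op} {P Q : Op}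

/-- With purely imaginary rates the free flow is bounded uniformly in `Λ`; the growth rate `ρ = 0`
replaces the rate `3/2` of the local argument. -/
theorem IsChanneled.norm_chanFlow_le_of_re_eq_zero {A : Type*} [NormedRing A] [NormedAlgebra ℂ A]
    {m : A} {pr : Fin 2 → A} {κ : Fin 2 → ℂ} {n B : ℝ} (hn : ∀ j, ‖pr j‖ ≤ n)
    (hB : ∀ j, ‖m‖ ≤ B * ‖κ j‖) (hκ : ∀ j, κ j ≠ 0) (hre : ∀ j, (κ j).re = 0) (x : ℝ) :
    ‖chanFlow m pr κ x‖ ≤ 2 * (n * (1 + B)) := by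
  have key : ∀ j, ‖Complex.cosh (κ j * x) • pr j + sn (κ j) x • (pr j * m)‖ ≤ n * (1 + B) := by
    intro j
    have h0 : 0 < ‖κ j‖ := norm_pos_iff.2 (hκ j)
    have hn0 : 0 ≤ n := (norm_nonneg _).trans (hn j)
    have h1 : ‖Complex.cosh (κ j * x)‖ ≤ 1 := (norm_cosh_le _).trans (by simp [hre])
    have h2 : ‖sn (κ j) x‖ ≤ ‖κ j‖⁻¹ := (norm_sn_le_div (hκ j) x).trans (by simp [hre])
    refine (norm_add_le _ _).trans ?_
    rw [norm_smul, norm_smul]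
    calc _ ≤ 1 * n + ‖κ j‖⁻¹ * (n * (B * ‖κ j‖)) := by
          gcongr
          · exact hn j
          · exact (norm_mul_le _ _).trans (mul_le_mul (hn j) (hB j) (norm_nonneg _) hn0)
      _ = _ := by field_simp
  refine (norm_sum_le _ _).trans ?_
  rw [Fin.sum_univ_two]
  linarith [key 0, key 1]

theorem sub_one_le_sqrt {z : ℝ} (hz : 1 ≤ z) : z - 1 ≤ Real.sqrt (z ^ 2 - 1) :=
  Real.le_sqrt_of_sq_le (by nlinarith)

/-- For `|Λ| ≥ 4` both rates are imaginary and lie within `2` of the common value `θ = iσΛ`. Up to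
bounded errors `m` therefore acts as `-θ` on the stable part and as `θ` on its complement. -/
theorem kap_large (σ : Side) (hω : |ω| < 1 / 3) (hΛ : 4 ≤ |Λ|) (j : Fin 2) :
    (kap σ (Complex.I * Λ) ω j).re = 0 ∧ ‖kap σ (Complex.I * Λ) ω j - Complex.I * (σ.sgn * Λ)‖ ≤ 2 ∧
      |Λ| / 2 ≤ ‖kap σ (Complex.I * Λ) ω j‖ := by
  have hζ : |Λ| - 1 / 3 ≤ |zeta j ω Λ| ∧ |zeta j ω Λ| ≤ |Λ| + 1 / 3 := by
    have h1 : |zeta j ω Λ| ≤ |Λ| + |ω| ∧ |Λ| ≤ |zeta j ω Λ| + |ω| := by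
      rw [zeta]
      split_ifs
      · exact ⟨by linarith [abs_add_le ω Λ], by
          have := abs_sub (ω + Λ) ω; rwa [add_sub_cancel_left] at this⟩
      · exact ⟨by linarith [abs_sub ω Λ], by
          have := abs_sub ω (ω - Λ); rw [sub_sub_cancel] at this; linarith⟩
    constructor <;> linarith [h1.1, h1.2]
  have hκ : kap σ (Complex.I * Λ) ω j = Complex.I *
      ((σ.sgn * (Real.sign Λ * Real.sqrt (zeta j ω Λ ^ 2 - 1)) : ℝ) : ℂ) := by
    rw [kap_boundary σ (by linarith), xi, if_pos (by linarith [hζ.1])]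
    push_cast
    ring
  have h1 : |zeta j ω Λ| - 1 ≤ Real.sqrt (zeta j ω Λ ^ 2 - 1) := by
    rw [← sq_abs]; exact sub_one_le_sqrt (by linarith [hζ.1])
  have h2 : Real.sqrt (zeta j ω Λ ^ 2 - 1) ≤ |zeta j ω Λ| :=
    Real.sqrt_le_iff.2 ⟨abs_nonneg _, by rw [sq_abs]; linarith⟩
  have hne : Λ ≠ 0 := fun h0 => by rw [h0, abs_zero] at hΛ; linarith
  have hs : |Real.sign Λ| = 1 := by
    rcases Real.sign_apply_eq_of_ne_zero Λ hne with h | h <;> simp [h]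
  have hΛs : Λ = Real.sign Λ * |Λ| := by
    rcases lt_or_gt_of_ne hne with h | h
    · rw [Real.sign_of_neg h, abs_of_neg h]; ring
    · rw [Real.sign_of_pos h, abs_of_pos h]; ring
  refine ⟨by rw [hκ, Complex.mul_re]; simp only [Complex.I_re, Complex.ofReal_im]; ring, ?_, ?_⟩
  · have e : kap σ (Complex.I * Λ) ω j - Complex.I * (σ.sgn * Λ) = Complex.I *
        ((σ.sgn * (Real.sign Λ * (Real.sqrt (zeta j ω Λ ^ 2 - 1) - |Λ|)) : ℝ) : ℂ) := by
      rw [hκ, ← Complex.ofReal_mul, ← mul_sub, ← Complex.ofReal_sub]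
      congr 2
      rw [mul_sub (Real.sign Λ), ← hΛs]
      ring
    rw [e, norm_mul, Complex.norm_I, one_mul, Complex.norm_real, Real.norm_eq_abs, abs_mul, abs_mul,
      σ.abs_sgn, hs, one_mul, one_mul]
    exact abs_le.2 ⟨by linarith [hζ.1], by linarith [hζ.2]⟩
  · rw [hκ, norm_mul, Complex.norm_I, one_mul, Complex.norm_real, Real.norm_eq_abs, abs_mul, abs_mul,
      σ.abs_sgn, hs, one_mul, one_mul, abs_of_nonneg (Real.sqrt_nonneg _)]
    linarith [hζ.1]

theorem op_matβ_mul_chan_mul (j : Fin 2) : op matβ * op (chan j) * op matβ = op (chan j) := by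
  rw [← map_mul, ← map_mul, comm_chan matβ_mul_matJ, mul_assoc, matβ_mul_matβ, mul_one]

theorem op_matβ_mul_freeM_mul (μ : ℂ) (ω : ℝ) :
    op matβ * op (freeM μ ω) * op matβ = -op (freeM μ ω) := by
  rw [← map_mul, ← map_mul, ← map_neg]
  congr 1
  ext i j
  fin_cases i <;> fin_cases j <;>
    simp [freeM, matα, matJ, matβ, Matrix.mul_apply, Fin.sum_univ_four]

theorem IsSysConj.eq_zero_of_jostR_mulVec (h : IsSysConj f k v u (Complex.I * Λ, ω) Z Y N D)
    (hk : 2 ≤ k) (hω : |ω| < 1 / 3) (hP : IsProfile f ω (v ω) (u ω)) {c : Fin 2 → ℂ}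
    (hc : jostR f k v u ω σ Λ 0 *ᵥ c = 0) : c = 0 := by
  have hF := h.isFundamental (σ := σ) (by simp) hP
  have h1 : Z 0 (∑ j, c j • Xi σ j ω Λ) = 0 := by
    rw [← hc, jostR_mulVec, map_sum]
    refine Finset.sum_congr rfl fun j _ => ?_
    rw [map_smul, h.jost_eq hk hω hP]
    simp only [hF.zero, one_apply_eq_self]
  have h2 : ∑ j, c j • Xi σ j ω Λ = 0 := by
    have := congrArg (Y 0) h1
    rwa [← mul_apply_eq_comp, h.mul_YZ 0 le_rfl, one_apply_eq_self, map_zero] at this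
  ext i
  have h3 := congrArg (chan i *ᵥ ·) h2
  simp only [Matrix.mulVec_sum, Matrix.mulVec_smul, Matrix.mulVec_zero] at h3
  rw [Finset.sum_eq_single i (fun j _ hj => by
    rw [← chan_mulVec_Xi σ j, Matrix.mulVec_mulVec, chan_orth i j hj.symm, Matrix.zero_mulVec,
      smul_zero]) (by simp), chan_mulVec_Xi] at h3
  exact (smul_eq_zero.1 h3).resolve_right (Xi_ne_zero σ i ω Λ)

/-- A splitting of the solutions makes the Jost solutions a frame. -/
theorem IsSysConj.isJostFrame (h : IsSysConj f k v u (Complex.I * Λ, ω) Z Y N D) (hk : 2 ≤ k)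
    (hω : |ω| < 1 / 3) (hP : IsProfile f ω (v ω) (u ω))
    (hs : IsSplitting (op matβ) (sysStab σ (Complex.I * Λ, ω) Z Y) P) :
    IsJostFrame f k v u ω σ Λ := by
  have hPa : mat P * jostR f k v u ω σ Λ 0 = jostR f k v u ω σ Λ 0 := by
    rw [← h.sysStab_mul_jostR (σ := σ) hk hω hP, ← Matrix.mul_assoc, ← mat_mul, hs.right]
  have hPβ : mat P * matβ = matβ * (1 - mat P) := by
    have := congrArg mat (hs.mul_refl op_matβ_mul_self)
    rwa [mat_mul, mat_mul, mat_op, mat_sub, mat_one] at this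
  have hPb : mat P * (matβ * jostR f k v u ω σ Λ 0) = 0 := by
    rw [← Matrix.mul_assoc, hPβ, Matrix.mul_assoc, Matrix.sub_mul, hPa, Matrix.one_mul, sub_self,
      Matrix.mul_zero]
  refine exists_isFrameInv fun c d hcd => ?_
  have h1 : jostR f k v u ω σ Λ 0 *ᵥ c = 0 := by
    have := congrArg (mat P *ᵥ ·) hcd
    simpa only [Matrix.mulVec_add, Matrix.mulVec_mulVec, hPa, hPb, Matrix.zero_mulVec, add_zero,
      Matrix.mulVec_zero] using this
  rw [h1, zero_add] at hcd
  have h2 := congrArg (matβ *ᵥ ·) hcd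
  simp only [Matrix.mulVec_mulVec, ← Matrix.mul_assoc, matβ_mul_matβ, Matrix.one_mul,
    Matrix.mulVec_zero] at h2
  exact ⟨h.eq_zero_of_jostR_mulVec hk hω hP h1, h.eq_zero_of_jostR_mulVec hk hω hP h2⟩

/-- Away from thresholds all stable projections have the same range, and a splitting depends on the
projection only through its range. This passes from the spectral projection back to `freeStab`, to
which the Jost solutions are tied. -/
theorem IsSysData.isSplitting_sysStab {p : ℂ × ℝ} (h : IsSysData f k v u σ p Z Y Q P N D)
    (hκ : ∀ j, kap σ p.1 p.2 j ≠ 0) : IsSplitting (op matβ) (sysStab σ p Z Y) P :=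
  h.split.congr (h.conj.mul_YZ 0 le_rfl)
    (h.proj.mul_eq (freeStab_isStableProj σ p) (freeM_isChanneled_kap σ p) hκ)
    ((freeStab_isStableProj σ p).mul_eq h.proj (freeM_isChanneled_kap σ p) hκ)

theorem exists_norm_freeM_le_mul_kap (hω : |ω| < 1 / 3) : ∃ B : ℝ, 0 ≤ B ∧ ∀ (σ : Side) (Λ : ℝ), 4 ≤ |Λ| →
    ∀ j, ‖op (freeM (Complex.I * Λ) ω)‖ ≤ B * ‖kap σ (Complex.I * Λ) ω j‖ := by
  refine ⟨2 * (‖op (matα * matJ * matβ)‖ + ‖op (matα * matJ)‖ + ‖op matα‖), by positivity,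
    fun σ Λ hΛ j => ?_⟩
  have h1 := (kap_large σ hω hΛ j).2.2
  have h2 := norm_freeM_le (Complex.I * Λ) ω
  rw [norm_mul, Complex.norm_I, one_mul, Complex.norm_real, Real.norm_eq_abs] at h2
  refine h2.trans ?_
  calc _ ≤ |Λ| * ‖op (matα * matJ * matβ)‖ + |Λ| * ‖op (matα * matJ)‖ + |Λ| * ‖op matα‖ := by
        have h3 : |ω| ≤ |Λ| := by linarith
        gcongr
        exact le_mul_of_one_le_left (norm_nonneg _) (by linarith)
    _ = 2 * (‖op (matα * matJ * matβ)‖ + ‖op (matα * matJ)‖ + ‖op matα‖) * (|Λ| / 2) := by ring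
    _ ≤ _ := by gcongr

/-- The constant in the smallness of the off-diagonal part of a conjugation. -/
noncomputable def offDiagBound (K N C c a : ℝ) : ℝ :=
  3 * (N ^ 4 * (2 * N * C + 1 + 4 * c)) * Real.exp (2 * (K ^ 4 * C * N) / a)

theorem IsChanneled.norm_specStab_le {A : Type*} [NormedRing A] [NormedAlgebra ℂ A]
    [CompleteSpace A] [NormOneClass A] {m : A} {pr : Fin 2 → A} {κ : Fin 2 → ℂ} {n B : ℝ}
    (h : IsChanneled m pr κ) (hn : ∀ j, ‖pr j‖ ≤ n) (hB : ∀ j, ‖m‖ ≤ B * ‖κ j‖) (hκ : ∀ j, κ j ≠ 0) :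
    ‖specStab m pr κ‖ ≤ n * (1 + B) ∧ ‖1 - specStab m pr κ‖ ≤ n * (1 + B) :=
  ⟨norm_sum_smul_sub_le hn hB hκ fun j => by simp,
    h.one_sub_specStab ▸ norm_sum_smul_sub_le hn hB hκ fun j => by simp⟩

theorem norm_inv_frequency (σ : Side) (Λ : ℝ) :
    ‖(2 * (Complex.I * (σ.sgn * Λ)) : ℂ)⁻¹‖ = (2 * |Λ|)⁻¹ := by
  simp [σ.abs_sgn]

/-- The spectral projection is a splitting of the free system. The conjugation has an off-diagonal
block of size `|θ|⁻¹` at the origin, so the splitting survives once `hlarge` makes this block small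
enough. -/
theorem IsChanneled.exists_conjugation_splitting {A : Type*} [NormedRing A] [NormedAlgebra ℂ A]
    [CompleteSpace A] [NormOneClass A] (hA : ∀ s t : A, s * t = 1 → t * s = 1) {m b : A}
    {pr : Fin 2 → A} {κ : Fin 2 → ℂ} {V V' : ℝ → A} {K N C c a γ : ℝ} {θ : ℂ}
    (h : IsChanneled m pr κ) (hκ : ∀ j, κ j ≠ 0) (hU : IsFlowGroup m (chanFlow m pr κ) K 0)
    (hK : 0 < K) (hC : 0 < C) (ha : 0 < a) (hγ : a ≤ γ) (hb : b * b = 1) (hbm : b * m * b = -m)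
    (hbpr : ∀ j, b * pr j * b = pr j) (hN : 1 ≤ N) (hcN : conjBound K C a ≤ N) (hbN : ‖b‖ ≤ N)
    (hQN : ‖specStab m pr κ‖ ≤ N) (hRN : ‖1 - specStab m pr κ‖ ≤ N) (hc : 0 ≤ c) (hθ : θ ≠ 0)
    (h₁ : ‖m * specStab m pr κ + θ • specStab m pr κ‖ ≤ c)
    (h₂ : ‖(1 - specStab m pr κ) * m - θ • (1 - specStab m pr κ)‖ ≤ c)
    (hV : ∀ x, HasDerivAt V (V' x) x) (hVC : ∀ x, 0 ≤ x → ‖V x‖ ≤ C * Real.exp (-γ * x))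
    (hVC' : ∀ x, 0 ≤ x → ‖V' x‖ ≤ C * Real.exp (-a * x))
    (hlarge : 8 * N ^ 4 * (offDiagBound K N C c a * ‖(2 * θ)⁻¹‖) ≤ 1) :
    ∃ Z Y P, IsConjugation m V Z Y N (K ^ 2 * C / a * conjBound K C a) γ ∧
      IsSplitting b (Z 0 * specStab m pr κ * Y 0) P ∧ ‖P‖ ≤ 4 * N ^ 7 := by
  obtain ⟨Z, Y, -, -, hZ⟩ := exists_isConjugation (Par := Unit) hA hK hC
    le_rfl ha (m := fun _ => m) (U := fun _ => chanFlow m pr κ)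
    (P := fun _ => V) (γ := fun _ => γ) (fun _ => hU)
    (hU.continuous.comp continuous_snd)
    ((continuous_iff_continuousAt.2 fun x => (hV x).continuousAt).comp continuous_snd)
    (fun _ => by linarith) (fun _ => hVC)
  replace hZ := (hZ ()).mono hcN
  have hQ := h.specStab_isStableProj hκ
  have hoff := hZ.norm_offDiag_le hU ha (by linarith) hC hN hc hθ hQ.idem h.specStab_comm hQN hRN
    h₁ h₂ hV (fun x hx => (hVC x hx).trans (by gcongr)) hVC'
  obtain ⟨P, hP, hPn⟩ := exists_isSplitting_of_norm_le hA hb hQ.idem (h.refl_specStab hb hbm hbpr)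
    (hZ.mul_YZ 0 le_rfl) hN hbN hQN (hZ.norm_Z 0 le_rfl) (hZ.norm_Y 0 le_rfl) hoff hlarge
  exact ⟨Z (), Y (), P, hZ, hP, hPn⟩

/-- Uniform bounds for the system and its splitting for large spectral parameters. -/
theorem IsSetting.exists_isSysData (h : IsSetting f k a b v u) (hω : ω ∈ Ioo a b) :
    ∃ N B D Λ₀ : ℝ, 0 ≤ B ∧ 4 ≤ Λ₀ ∧ ∀ (σ : Side) (Λ : ℝ), Λ₀ ≤ |Λ| →
      (∀ j, kap σ (Complex.I * Λ) ω j ≠ 0) ∧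
      (∀ j, ‖op (freeM (Complex.I * Λ) ω)‖ ≤ B * ‖kap σ (Complex.I * Λ) ω j‖) ∧
      ∃ Z Y Q P, IsSysData f k v u σ (Complex.I * Λ, ω) Z Y Q P N D := by
  have hω3 := h.abs_lt hω
  obtain ⟨B, hB0, hB⟩ := exists_norm_freeM_le_mul_kap hω3
  obtain ⟨C, P', hC, hPd, hPb, hPb'⟩ := h.exists_hasDerivAt_potOp hω
  set n : ℝ := ‖op (chan 0)‖ + ‖op (chan 1)‖ with hn
  have hchan : ∀ j, ‖op (chan j)‖ ≤ n := fun j => by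
    fin_cases j
    · exact le_add_of_nonneg_right (norm_nonneg _)
    · exact le_add_of_nonneg_left (norm_nonneg _)
  have hn0 : 0 ≤ n := (norm_nonneg _).trans (hchan 0)
  set δ := dl ω with hδ
  have hδ0 : 0 < δ := by have := lt_dl hω3; linarith
  set K : ℝ := 2 * (n * (1 + B)) + 1 with hK
  have hK0 : 0 < K := by positivity
  have hcb : 0 < conjBound K C δ := by unfold conjBound; positivity
  set N₀ : ℝ := conjBound K C δ + n * (1 + B) + n + ‖op matβ‖ + ‖op matα‖ + 1 with hN₀
  have hnB : 0 ≤ n * (1 + B) := by positivity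
  have hN1 : 1 ≤ N₀ := by
    have := norm_nonneg (op matβ); have := norm_nonneg (op matα); linarith
  have hβN : ‖op matβ‖ ≤ N₀ := by have := norm_nonneg (op matα); linarith
  have hαN : ‖op matα‖ ≤ N₀ := by have := norm_nonneg (op matβ); linarith
  have hcN : conjBound K C δ ≤ N₀ := by
    have := norm_nonneg (op matβ); have := norm_nonneg (op matα); linarith
  have hnN : n ≤ N₀ := by
    have := norm_nonneg (op matβ); have := norm_nonneg (op matα); linarith
  have hQN : n * (1 + B) ≤ N₀ := by
    have := norm_nonneg (op matβ); have := norm_nonneg (op matα); linarith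
  have hc0 : 0 ≤ 2 * (n * N₀) * 2 := by positivity
  set C₁ : ℝ := offDiagBound K N₀ C (2 * (n * N₀) * 2) δ with hC₁
  have hC₁0 : 0 ≤ 4 * N₀ ^ 4 * C₁ := by rw [hC₁, offDiagBound]; positivity
  have hk1 : (2 : ℝ) ≤ k := by exact_mod_cast h.two_le
  have hγ : δ ≤ 2 * k * δ := le_mul_of_one_le_left hδ0.le (by linarith)
  clear_value C₁ N₀ K n
  have hNN : N₀ ≤ 4 * N₀ ^ 7 := by
    have : N₀ ^ 1 ≤ N₀ ^ 7 := pow_le_pow_right₀ hN1 (by norm_num)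
    linarith
  -- The first constant bounds the perturbed splitting and, as `N₀ ≥ 1`, everything else. With
  -- `‖(2θ)⁻¹‖ = 1/(2|Λ|)`, the smallness condition reads `4 N₀⁴ C₁ ≤ |Λ|`.
  refine ⟨4 * N₀ ^ 7, B, K ^ 2 * C / δ * conjBound K C δ, 4 + 4 * N₀ ^ 4 * C₁, hB0,
    by linarith, fun σ Λ hΛ => ?_⟩
  have hΛ4 : 4 ≤ |Λ| := by linarith
  have hΛ0 : 0 < |Λ| := by linarith
  have hκ : ∀ j, kap σ (Complex.I * Λ) ω j ≠ 0 := fun j =>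
    norm_pos_iff.1 (by linarith [(kap_large σ hω3 hΛ4 j).2.2])
  have hBj := hB σ Λ hΛ4
  refine ⟨hκ, hBj, ?_⟩
  have hchn : IsChanneled (op (freeM (Complex.I * Λ) ω)) (fun j => op (chan j))
    (kap σ (Complex.I * Λ) ω) := freeM_isChanneled fun j => kap_sq σ _ ω j
  have hU := hchn.isFlowGroup (K := K) (ρ := 0) fun x => by
    rw [zero_mul, Real.exp_zero, mul_one]
    exact (IsChanneled.norm_chanFlow_le_of_re_eq_zero hchan hBj hκ
      (fun j => (kap_large σ hω3 hΛ4 j).1) x).trans (by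
        rw [hK]; exact le_add_of_nonneg_right zero_le_one)
  have hQ := hchn.specStab_isStableProj hκ
  obtain ⟨hQn, hRn⟩ := hchn.norm_specStab_le hchan hBj hκ
  replace hQn := hQn.trans hQN
  replace hRn := hRn.trans hQN
  obtain ⟨o1, o2⟩ := hQ.norm_add_smul_mul_le hchn (fun j => (kap_large σ hω3 hΛ4 j).2.1) hchan
  have hθ : (Complex.I * (σ.sgn * Λ) : ℂ) ≠ 0 := fun h0 => by
    have := norm_inv_frequency σ Λ
    rw [h0, mul_zero, _root_.inv_zero, norm_zero] at this
    have : 0 < (2 * |Λ|)⁻¹ := by positivity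
    linarith
  obtain ⟨Z, Y, P, hZ, hP, hPn⟩ := hchn.exists_conjugation_splitting (fun s t => op_mul_eq_one)
    hκ hU hK0 hC hδ0 hγ op_matβ_mul_self (op_matβ_mul_freeM_mul _ _) op_matβ_mul_chan_mul hN1 hcN hβN
    hQn hRn hc0 hθ (o1.trans (by gcongr)) (o2.trans (by gcongr)) hPd
    (fun x hx => by
      have := hPb x
      rwa [abs_of_nonneg hx, ← neg_mul] at this)
    (fun x hx => by
      have := hPb' x
      rwa [abs_of_nonneg hx, ← neg_mul] at this)
    (by
      rw [norm_inv_frequency, ← hC₁, ← div_eq_mul_inv, ← mul_div_assoc, div_le_one (by positivity)]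
      linarith)
  exact ⟨Z, Y, _, P, boundary_mem_halfSpace σ Λ ω, by simp, h.family.isProfile hω, hZ.mono hNN, hQ, hP,
    ⟨hN1.trans hNN, fun j => (hchan j).trans (hnN.trans hNN), LE.le.trans hQn hNN, hRn.trans hNN, le_rfl,
      fun j => (kap_large σ hω3 hΛ4 j).1.ge⟩, hPn, hβN.trans hNN, hαN.trans hNN⟩

/-- For large spectral parameters the Jost solutions form a frame, there are no thresholds, and
Green's function is uniformly bounded. -/
theorem IsSetting.large (h : IsSetting f k a b v u) (hω : ω ∈ Ioo a b) :
    ∃ C Λ₀ : ℝ, 0 ≤ C ∧ 4 ≤ Λ₀ ∧ ∀ (σ : Side) (Λ : ℝ), Λ₀ ≤ |Λ| → IsJostFrame f k v u ω σ Λ ∧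
      (∀ j, kap σ (Complex.I * Λ) ω j ≠ 0) ∧
      ∀ x y i j, ‖bKernel f k v u σ ω Λ x y i j‖ ≤ C := by
  obtain ⟨N, B, D, Λ₀, hB0, hΛ₀, H⟩ := h.exists_isSysData hω
  have hω3 := h.abs_lt hω
  obtain ⟨_, _, _, _, _, _, d⟩ := H .plus Λ₀ (le_abs_self _)
  have hN := d.bounded.one_le
  refine ⟨6 * N ^ 17 * (1 + B), Λ₀, by positivity, hΛ₀, fun σ Λ hΛ => ?_⟩
  obtain ⟨hκ, hB, Z, Y, Q, P, d⟩ := H σ Λ hΛ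
  have hs := d.isSplitting_sysStab hκ
  have hJ := d.conj.isJostFrame h.two_le hω3 d.profile hs
  refine ⟨hJ, hκ, fun x y i j => ?_⟩
  rw [bKernel, d.conj.green_eq h.two_le hω3 d.profile hJ hs (by simp)]
  refine (norm_mat_le _ _ _).trans ?_
  simpa using d.norm_kernel_le_const le_rfl d.bounded.rate_le hκ hB x y

end

end GN

namespace GN

/-! ### Locally uniform bounds and the main theorem -/

section

variable {f : ℝ → ℝ} {k : ℕ} {a b ω Λ : ℝ} {v u : ℝ → ℝ → ℝ} {σ : Side}

theorem norm_mulVec_le {m : Matrix (Fin 4) (Fin 4) ℂ} {c : ℝ} (h : ∀ i j, ‖m i j‖ ≤ c)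
    (z : Fin 4 → ℂ) : ‖m *ᵥ z‖ ≤ 16 * c * ‖z‖ := by
  rw [← op_apply]
  refine (ContinuousLinearMap.le_opNorm _ _).trans (mul_le_mul_of_nonneg_right ?_ (norm_nonneg z))
  refine (norm_op_le m).trans ((Finset.sum_le_sum fun i _ => Finset.sum_le_sum fun j _ => h i j).trans ?_)
  simp only [Finset.sum_const, Finset.card_univ, Fintype.card_fin, nsmul_eq_mul, Nat.cast_ofNat]
  linarith

theorem one_add_min_abs_le (x y : ℝ) : 1 + min |x| |y| ≤
    2 * (min (Real.sqrt (1 + x ^ 2)) (Real.sqrt (1 + y ^ 2)) * Real.sqrt (1 + y ^ 2)) := by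
  have h1 : ∀ x : ℝ, 1 ≤ Real.sqrt (1 + x ^ 2) := fun x => Real.one_le_sqrt.2 (by nlinarith)
  have h2 : ∀ x : ℝ, |x| ≤ Real.sqrt (1 + x ^ 2) := fun x => Real.abs_le_sqrt (by linarith)
  have h3 : 1 ≤ min (Real.sqrt (1 + x ^ 2)) (Real.sqrt (1 + y ^ 2)) := le_min (h1 x) (h1 y)
  have h4 : min |x| |y| ≤ min (Real.sqrt (1 + x ^ 2)) (Real.sqrt (1 + y ^ 2)) :=
    min_le_min (h2 x) (h2 y)
  have h5 := le_mul_of_one_le_right (zero_le_one.trans h3) (h1 y)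
  linarith

/-- The bounds for the kernels on both sides by `c (1 + min(|x|, |y|))`. -/
def kernelBounds (f : ℝ → ℝ) (k : ℕ) (v u : ℝ → ℝ → ℝ) (p : ℝ × ℝ) : Set ℝ :=
  {c | 0 ≤ c ∧ ∀ σ x y i j, ‖bKernel f k v u σ p.2 p.1 x y i j‖ ≤ c * (1 + min |x| |y|)}

theorem bddBelow_kernelBounds (p : ℝ × ℝ) : BddBelow (kernelBounds f k v u p) :=
  ⟨0, fun _ hc => hc.1⟩

/-- The conditions on the constant are closed, so the best constant is itself admissible. -/
theorem sInf_mem_kernelBounds {p : ℝ × ℝ} (h : (kernelBounds f k v u p).Nonempty) :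
    sInf (kernelBounds f k v u p) ∈ kernelBounds f k v u p := by
  refine ⟨le_csInf h fun _ hc => hc.1, fun σ x y i j => ?_⟩
  have hpos : 0 < 1 + min |x| |y| := by
    have : 0 ≤ min |x| |y| := le_min (abs_nonneg x) (abs_nonneg y)
    linarith
  rw [← div_le_iff₀ hpos]
  exact le_csInf h fun c hc => (div_le_iff₀ hpos).2 (hc.2 σ x y i j)

theorem IsSetting.eventually_mem_kernelBounds (h : IsSetting f k a b v u) (hω : ω ∈ Ioo a b)
    (hE : evans f k v u ω Λ ≠ 0) : ∃ C : ℝ, ∀ᶠ q : ℝ × ℝ in 𝓝 (Λ, ω), q.2 ∈ Ioo a b →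
      evans f k v u q.2 q.1 ≠ 0 → C ∈ kernelBounds f k v u q := by
  obtain ⟨-, -, -, -, C₁, hC₁, h₁⟩ := h.regular hω (h.isJostFrame hω hE .plus)
  obtain ⟨-, -, -, -, C₂, hC₂, h₂⟩ := h.regular hω (h.isJostFrame hω hE .minus)
  refine ⟨max C₁ C₂, ?_⟩
  filter_upwards [h₁, h₂] with q hq₁ hq₂ hqω hqE
  refine ⟨hC₁.trans (le_max_left _ _), fun σ x y i j => ?_⟩
  have hpos : 0 ≤ 1 + min |x| |y| := by
    have : 0 ≤ min |x| |y| := le_min (abs_nonneg x) (abs_nonneg y)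
    linarith
  cases σ
  · exact (hq₁ (h.isJostFrame hqω hqE _) x y i j).trans
      (mul_le_mul_of_nonneg_right (le_max_left _ _) hpos)
  · exact (hq₂ (h.isJostFrame hqω hqE _) x y i j).trans
      (mul_le_mul_of_nonneg_right (le_max_right _ _) hpos)

/-- The kernels are bounded uniformly for `Λ` in a bounded set. -/
theorem IsSetting.exists_mem_kernelBounds (h : IsSetting f k a b v u) (hω : ω ∈ Ioo a b) {K : ℝ}
    (hE : ∀ Λ : ℝ, 1 - |ω| ≤ |Λ| → |Λ| ≤ K → evans f k v u ω Λ ≠ 0) :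
    ∃ C, 0 ≤ C ∧ ∀ Λ : ℝ, 1 - |ω| ≤ |Λ| → |Λ| ≤ K → C ∈ kernelBounds f k v u (Λ, ω) := by
  have hcl : IsClosed {Λ : ℝ | 1 - |ω| ≤ |Λ|} := isClosed_le continuous_const continuous_abs
  have hcomp : IsCompact ({Λ : ℝ | 1 - |ω| ≤ |Λ|} ∩ Icc (-K) K) := isCompact_Icc.inter_left hcl
  -- The local bounds are patched over the compact set of admissible `Λ`, on which the Evans
  -- function does not vanish by assumption.
  have key := hcomp.induction_on
    (p := fun s => ∃ C, 0 ≤ C ∧ ∀ Λ ∈ s, 1 - |ω| ≤ |Λ| → |Λ| ≤ K → C ∈ kernelBounds f k v u (Λ, ω))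
    ⟨0, le_rfl, fun Λ hΛ => absurd hΛ (notMem_empty Λ)⟩
    (fun s t hst ⟨C, hC, H⟩ => ⟨C, hC, fun Λ hΛ => H Λ (hst hΛ)⟩)
    (by
      rintro s t ⟨C, hC, H⟩ ⟨C', hC', H'⟩
      have mono : ∀ {c c' : ℝ} {p : ℝ × ℝ}, c ≤ c' → c ∈ kernelBounds f k v u p →
          c' ∈ kernelBounds f k v u p := fun hcc hc => ⟨hc.1.trans hcc, fun σ x y i j =>
        (hc.2 σ x y i j).trans (mul_le_mul_of_nonneg_right hcc (by
          have : 0 ≤ min |x| |y| := le_min (abs_nonneg x) (abs_nonneg y)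
          linarith))⟩
      refine ⟨max C C', hC.trans (le_max_left _ _), ?_⟩
      rintro Λ (hΛ | hΛ) h1 h2
      · exact mono (le_max_left _ _) (H Λ hΛ h1 h2)
      · exact mono (le_max_right _ _) (H' Λ hΛ h1 h2))
    (by
      rintro Λ ⟨hΛ1, hΛ2⟩
      have hEΛ := hE Λ hΛ1 (abs_le.2 hΛ2)
      obtain ⟨C, hC⟩ := h.eventually_mem_kernelBounds hω hEΛ
      have ht : Tendsto (fun Λ' : ℝ => (Λ', ω)) (𝓝 Λ) (𝓝 (Λ, ω)) :=
        (continuous_id.prodMk continuous_const).tendsto Λ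
      have hev := ht.eventually hC
      refine ⟨_, mem_nhdsWithin_of_mem_nhds hev, C, (hev.self_of_nhds hω hEΛ).1,
        fun Λ' hΛ' h1 h2 => hΛ' hω (hE Λ' h1 h2)⟩)
  obtain ⟨C, hC, H⟩ := key
  exact ⟨C, hC, fun Λ h1 h2 => H Λ ⟨h1, abs_le.1 h2⟩ h1 h2⟩

theorem exists_wnorm_le {s c : ℝ} {g : ℝ → ℝ} (hg : IsWeightBound s c g) : ∃ C : ℝ≥0,
    ∀ G : ℝ → ℝ → Matrix (Fin 4) (Fin 4) ℂ, (∀ x y z, ‖G x y *ᵥ z‖ ≤ g x * ‖z‖) →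
      ∀ h : ℝ → Fin 4 → ℂ, AEStronglyMeasurable h volume → wnorm s h < ∞ →
        wnorm (-s) (integralOp G h) ≤ C * wnorm s h := by
  have ht : 2 * weightConst s c ^ (1 / 2 : ℝ) ≠ ∞ := ENNReal.mul_ne_top ENNReal.ofNat_ne_top
    (ENNReal.rpow_ne_top_of_nonneg (by norm_num) (weightConst_lt_top hg.one_le c).ne)
  refine ⟨(2 * weightConst s c ^ (1 / 2 : ℝ)).toNNReal, fun G hG h hh hfin => ?_⟩
  rw [ENNReal.coe_toNNReal ht]
  exact hg.wnorm_le hG hh hfin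

end

end GN

theorem mainTheorem2
    (f : ℝ → ℝ) (hf : ContDiff ℝ (⊤ : ℕ∞) f)
    (k : ℕ) (hk : 2 ≤ k) (hfk : ∃ c : ℝ, ∀ s ∈ Icc (0 : ℝ) 1, |f s| ≤ c * s ^ k)
    (a b : ℝ) (ha : -(1 / 3) ≤ a) (hb : b ≤ 1 / 3)
    (v u : ℝ → ℝ → ℝ) (hφ : IsSolitaryFamily f (Ioo a b) v u) :
    -- the Jost solutions are well defined
    (∀ ω ∈ Ioo a b, ∀ (σ : Side) (Λ : ℝ) (j : Fin 2), ∃! h, IsJost f k v u ω σ Λ j h) ∧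
    ∃ G : Side → ℝ → ℝ → ℝ → ℝ → Matrix (Fin 4) (Fin 4) ℂ,
      -- the boundary-value resolvent kernels `G σ ω Λ x y`, built from the Jost solutions
      (∀ ω Λ : ℝ, (Λ, ω) ∈ regularSet f k v u (Ioo a b) → ∀ σ : Side,
        (∀ Γ : Matrix (Fin 2) (Fin 2) ℂ, Γ.det ≠ 0 → ∀ x y, x ≠ y →
          G σ ω Λ x y = green f k v u ω σ Λ Γ x y) ∧
        IsGreen f v u ω Λ (G σ ω Λ) ∧
        ∀ s : ℝ, 3 < s → IsBoundaryResolvent f v u ω σ Λ s (integralOp (G σ ω Λ))) ∧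
      -- the pointwise bound, with a constant locally bounded in `(Λ, ω)`
      (∃ C : ℝ × ℝ → ℝ,
        (∀ p ∈ regularSet f k v u (Ioo a b), ∃ N ∈ 𝓝 p,
          BddAbove (C '' (N ∩ regularSet f k v u (Ioo a b)))) ∧
        ∀ ω Λ : ℝ, (Λ, ω) ∈ regularSet f k v u (Ioo a b) → ∀ (σ : Side) (x y : ℝ) (i j : Fin 4),
          ‖G σ ω Λ x y i j‖ ≤
            C (Λ, ω) * (min (Real.sqrt (1 + x ^ 2)) (Real.sqrt (1 + y ^ 2)) *
              Real.sqrt (1 + y ^ 2))) ∧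
      -- the uniform bound for large `|Λ|`
      (∀ ω ∈ Ioo a b, ∃ C Λ₀ : ℝ, ∀ Λ : ℝ, Λ₀ ≤ |Λ| →
        (Λ, ω) ∈ regularSet f k v u (Ioo a b) ∧
        ∀ (σ : Side) (x y : ℝ) (i j : Fin 4), ‖G σ ω Λ x y i j‖ ≤ C) ∧
      -- the uniform bound from `L²_s` to `L²_{-s}` for bounded `Λ`
      (∀ ω ∈ Ioo a b, ∀ s : ℝ, 3 < s → ∀ K : ℝ, 0 < K →
        (∀ Λ : ℝ, 1 - |ω| ≤ |Λ| → |Λ| ≤ K → evans f k v u ω Λ ≠ 0) →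
        ∃ C : ℝ≥0, ∀ Λ : ℝ, 1 - |ω| ≤ |Λ| → |Λ| ≤ K → ∀ (σ : Side) (h : ℝ → Fin 4 → ℂ),
          AEStronglyMeasurable h volume → wnorm s h < ∞ →
          wnorm (-s) (integralOp (G σ ω Λ) h) ≤ C * wnorm s h) ∧
      -- the uniform bound from `L²_1` to `L²_{-1}` for large `|Λ|`
      (∀ ω ∈ Ioo a b, ∃ (C : ℝ≥0) (Λ₀ : ℝ), ∀ Λ : ℝ, Λ₀ ≤ |Λ| → ∀ σ : Side,
        IsBoundaryResolvent f v u ω σ Λ 1 (integralOp (G σ ω Λ)) ∧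
        ∀ h : ℝ → Fin 4 → ℂ, AEStronglyMeasurable h volume → wnorm 1 h < ∞ →
          wnorm (-1) (integralOp (G σ ω Λ) h) ≤ C * wnorm 1 h) := by
  have h : IsSetting f k a b v u := ⟨hf, hk, hfk, ha, hb, hφ⟩
  refine ⟨fun ω hω σ Λ j => h.existsUnique_jost hω σ Λ j, bKernel f k v u, ?_, ?_, ?_, ?_, ?_⟩
  · rintro ω Λ ⟨hω, -, hE⟩ σ
    obtain ⟨hg, hΓ, hs, -, -⟩ := h.regular hω (h.isJostFrame hω hE σ)
    exact ⟨fun Γ hdet x y _ => hΓ Γ hdet x y, hg, hs⟩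
  -- The best constant lies below every admissible one, so it inherits local boundedness from the
  -- local bounds. The factor `2` comes from `one_add_min_abs_le`.
  · refine ⟨fun p => 2 * sInf (kernelBounds f k v u p), ?_, ?_⟩
    · rintro ⟨Λ, ω⟩ ⟨hω, -, hE⟩
      obtain ⟨C, hC⟩ := h.eventually_mem_kernelBounds hω hE
      refine ⟨_, hC, 2 * C, ?_⟩
      rintro _ ⟨q, ⟨hq, hqω, -, hqE⟩, rfl⟩
      exact mul_le_mul_of_nonneg_left (csInf_le (bddBelow_kernelBounds q) (hq hqω hqE)) zero_le_two
    · rintro ω Λ ⟨hω, -, hE⟩ σ x y i j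
      obtain ⟨C, hC⟩ := h.eventually_mem_kernelBounds hω hE
      have hm := sInf_mem_kernelBounds ⟨C, hC.self_of_nhds hω hE⟩
      refine (hm.2 σ x y i j).trans ((mul_le_mul_of_nonneg_left (one_add_min_abs_le x y) hm.1).trans
        (le_of_eq ?_))
      ring
  · intro ω hω
    obtain ⟨C, Λ₀, -, hΛ₀, H⟩ := h.large hω
    -- Non-vanishing of the Evans function is read off from the frame on the minus side, which the
    -- perturbed splitting provides.
    exact ⟨C, Λ₀, fun Λ hΛ => ⟨⟨hω, by simp only; linarith [abs_nonneg ω],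
      evans_ne_zero_iff.2 (H .minus Λ hΛ).1⟩, fun σ => (H σ Λ hΛ).2.2⟩⟩
  · intro ω hω s hs K _ hE
    obtain ⟨c, hc, H⟩ := h.exists_mem_kernelBounds hω hE
    obtain ⟨C, hC⟩ := exists_wnorm_le (isWeightBound_linear (s := s) (by linarith)
      (C := 16 * c) (by positivity))
    refine ⟨C, fun Λ h1 h2 σ g hg hfin => hC _ (fun x y z => ?_) g hg hfin⟩
    refine (norm_mulVec_le (fun i j => (H Λ h1 h2).2 σ x y i j) z).trans ?_
    rw [← mul_assoc 16 c]
    gcongr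
    exact min_le_left _ _
  · intro ω hω
    obtain ⟨c, Λ₀, hc, -, H⟩ := h.large hω
    obtain ⟨C, hC⟩ := exists_wnorm_le (isWeightBound_const (s := 1) le_rfl
      (C := 16 * c) (by positivity))
    refine ⟨C, Λ₀, fun Λ hΛ σ => ?_⟩
    obtain ⟨hJ, hκ, hb⟩ := H σ Λ hΛ
    exact ⟨(h.regular hω hJ).2.2.2.1 hκ, fun g hg hfin =>
      hC _ (fun x y z => norm_mulVec_le (hb x y) z) g hg hfin⟩
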